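/- **Setting.** Let $X$ be a topological space with a complete measure $\mu$ such that the compactly supported continuous functions form a dense subspace of $L^1(X,\mu)$, and let $d:X\times X\to[0,\infty)$ be a quasimetric: $d(x,y)=0$ iff $x=y$, $d(x,y)\le C_t[d(x,z)+d(z,y)]$ and $d(x,y)\le C_s\,d(y,x)$. Write $B(x,r)=\{y: d(x,y)<r\}$ and $d_X=\sup_{x,y}d(x,y)$, and assume $d_X<\infty$. Balls are measurable and of finite measure, every neighbourhood of a point $x$ contains some ball $B(x,r)$, $r>0$, and $\mu$ is doubling: $\mu B(x,2r)\le C_d\,\mu B(x,r)$ for $x\in X$, $0<r<d_X$. Moreover $\mu(B(x,R)\setminus B(x,r))>0$ for all $x\in X$, $0<r<R<d_X$, and $\mu$ is upper Ahlfors regular: for some $c,\gamma>0$, $\mu B(x,r)\le c\,r^{\gamma}$ for all $x\in X$, $r>0$. **Spaces.** For $1\le q<\infty$ and $0\le\kappa<1$ put $$\|f\|_{L^{q,\kappa}(X,\mu)}=\sup_{x\in X,\ 0<r<d_X}\Big(\frac1{\mu B(x,r)^{\kappa}}\int_{B(x,r)}|f|^q\,d\mu\Big)^{1/q}.$$ Let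 $1<p<\infty$, $\theta>0$, $0<\lambda<1$, and let $A:(0,p-1)\to[0,\infty)$ be non-decreasing with $\lim_{x\to0+}A(x)=0$. Put $s_{\max}=\min\{p-1,a\}$ with $a=\sup\{x>0:A(x)\le\lambda\}$. The generalized grand Morrey space $L^{p),\lambda)}_{\theta,A}(X,\mu)$ consists of the measurable functions $f:X\to\mathbb R$ with $$\|f\|_{L^{p),\lambda)}_{\theta,A}}=\sup_{0<\varepsilon<s_{\max}}\varepsilon^{\frac{\theta}{p-\varepsilon}}\,\|f\|_{L^{p-\varepsilon,\lambda-A(\varepsilon)}(X,\mu)}<\infty .$$ $BMO$ is the space of real-valued $b$ that are integrable on balls and satisfy $\sup_{x\in X,\,0<r<d_X}\frac1{\mu B(x,r)}\int_{B(x,r)}|b-b_{B(x,r)}|\,d\mu<\infty$, where $b_B$ is the average of $b$ over $B$. **Calderón–Zygmund operators.** Let $K:\{(x,y)\in X\times X: x\ne y\}\to\mathbb R$ be a measurable kernel for which there are a constant $C>0$ and a positive non-decreasing function $w$ on $(0,\infty)$, with $w(2t)\le c\,w(t)$ for $t>0$ and $\int_0^1 w(t)\,\frac{dt}{t}<\infty$,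 such that $|K(x,y)|\le \frac{C}{\mu B(x,d(x,y))}$ for $x\neq y$, and $$|K(x_1,y)-K(x_2,y)|+|K(y,x_1)-K(y,x_2)|\le C\,w\Big(\frac{d(x_2,x_1)}{d(x_2,y)}\Big)\frac1{\mu B(x_2,d(x_2,y))}$$ for all pairwise distinct $x_1,x_2,y$ with $d(x_2,y)\ge C\,d(x_1,x_2)$. Put $$Tf(x)=\mathrm{p.v.}\int_X K(x,y)f(y)\,d\mu(y)=\lim_{\eta\to0+}\int_{X\setminus B(x,\eta)}K(x,y)f(y)\,d\mu(y),$$ and assume that for every $f\in L^2(X,\mu)$ this limit exists for almost every $x$, and that $T$ is bounded on $L^2(X,\mu)$. **Theorem.** Under these assumptions let $b\in BMO$. Then the commutator $[b,T]f=b\,Tf-T(bf)$ is well defined and bounded on $L^{p),\lambda)}_{\theta,A}(X,\mu)$: there is a constant $C_0<\infty$ such that for every $f\in L^{p),\lambda)}_{\theta,A}(X,\mu)$ the principal values $Tf$ and $T(bf)$ exist almost everywhere, $[b,T]f$ belongs to $L^{p),\lambda)}_{\theta,A}(X,\mu)$, and $$\|[b,T]f\|_{L^{p),\lambda)}_{\theta,A}}\le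 C_0\,\|f\|_{L^{p),\lambda)}_{\theta,A}} .$$ -/

import Mathlib

open MeasureTheory Filter Topology Set
open scoped ENNReal NNReal

noncomputable section

namespace GrandMorrey

/-- The ball `B(x,r) = {y : d(x,y) < r}`. -/
def qball {X : Type*} (d : X → X → ℝ) (x : X) (r : ℝ) : Set X := {y | d x y < r}

/-- The diameter `d_X` of the whole space, as an extended nonnegative number. -/
def qdiam {X : Type*} (d : X → X → ℝ) : ℝ≥0∞ := ⨆ x, ⨆ y, ENNReal.ofReal (d x y)

/-- `d` is a quasimetric (symmetric only up to a multiplicative constant). -/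
structure IsQuasimetric {X : Type*} (d : X → X → ℝ) : Prop where
  nonneg : ∀ x y, 0 ≤ d x y
  eq_zero_iff : ∀ x y, d x y = 0 ↔ x = y
  quasi_triangle : ∃ Ct : ℝ, 0 < Ct ∧ ∀ x y z, d x y ≤ Ct * (d x z + d z y)
  quasi_symm : ∃ Cs : ℝ, 0 < Cs ∧ ∀ x y, d x y ≤ Cs * d y x

/-- `(X,d,μ)` is a space of homogeneous type in which annuli have positive measure.  The measure
is complete, its σ-algebra contains the balls, compactly supported continuous functions form a
dense subspace of `L¹`, every neighbourhood of a point contains a ball centred at the point,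
balls have finite measure, and `μ` is doubling. -/
structure IsHomogeneousType {X : Type*} [TopologicalSpace X] [MeasurableSpace X]
    (d : X → X → ℝ) (μ : Measure X) : Prop where
  quasimetric : IsQuasimetric d
  complete : μ.IsComplete
  cc_integrable : ∀ g : X → ℝ, Continuous g → HasCompactSupport g → Integrable g μ
  cc_dense : ∀ f : X → ℝ, Integrable f μ → ∀ δ : ℝ, 0 < δ →
    ∃ g : X → ℝ, Continuous g ∧ HasCompactSupport g ∧ ∫ x, |f x - g x| ∂μ ≤ δ
  measurableSet_ball : ∀ x r, MeasurableSet (qball d x r)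
  ball_subset_nhds : ∀ x, ∀ V ∈ 𝓝 x, ∃ r : ℝ, 0 < r ∧ qball d x r ⊆ V
  measure_ball_lt_top : ∀ x (r : ℝ), 0 < r → μ (qball d x r) < ∞
  doubling : ∃ Cd : ℝ≥0, 1 < Cd ∧ ∀ x (r : ℝ), 0 < r → ENNReal.ofReal r < qdiam d →
    μ (qball d x (2 * r)) ≤ Cd * μ (qball d x r)
  annulus_pos : ∀ x (r R : ℝ), 0 < r → r < R → ENNReal.ofReal R < qdiam d →
    0 < μ (qball d x R \ qball d x r)

/-- Upper Ahlfors regularity of degree `γ`. -/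
def IsUpperAhlforsRegular {X : Type*} [MeasurableSpace X]
    (d : X → X → ℝ) (μ : Measure X) (γ : ℝ) : Prop :=
  ∃ c : ℝ, 0 < c ∧ ∀ x (r : ℝ), 0 < r → μ (qball d x r) ≤ ENNReal.ofReal (c * r ^ γ)

/-- The Morrey norm
`‖f‖_{L^{q,κ}} = sup_{x, 0 < r < d_X} (μ(B(x,r))^{-κ} ∫_{B(x,r)} |f|^q dμ)^{1/q}`. -/
def morreyNorm {X : Type*} [MeasurableSpace X] (d : X → X → ℝ) (μ : Measure X)
    (q κ : ℝ) (f : X → ℝ) : ℝ≥0∞ :=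
  ⨆ (x : X) (r : ℝ) (_ : 0 < r) (_ : ENNReal.ofReal r < qdiam d),
    ((μ (qball d x r) ^ κ)⁻¹ * ∫⁻ y in qball d x r, ‖f y‖ₑ ^ q ∂μ) ^ (1 / q)

/-- Admissible functions `A` on `(0, p - 1)`: nonnegative, nondecreasing, with limit `0` at `0`. -/
structure IsAdmissible (p : ℝ) (A : ℝ → ℝ) : Prop where
  nonneg : ∀ ε ∈ Ioo (0 : ℝ) (p - 1), 0 ≤ A ε
  mono : MonotoneOn A (Ioo 0 (p - 1))
  tendsto_zero : Tendsto A (𝓝[>] 0) (𝓝 0)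

/-- `s_max = min {p - 1, sup {ε > 0 : A ε ≤ lam}}`, where `A` is only regarded on `(0, p - 1)`. -/
def sMax (p lam : ℝ) (A : ℝ → ℝ) : ℝ := sSup {ε | ε ∈ Ioo 0 (p - 1) ∧ A ε ≤ lam}

/-- The generalized grand Morrey norm
`sup_{0 < ε < s_max} φ(ε)^{1/(p-ε)} ‖f‖_{L^{p-ε, lam-A(ε)}}`. -/
def grandMorreyNorm {X : Type*} [MeasurableSpace X] (d : X → X → ℝ) (μ : Measure X)
    (p lam : ℝ) (φ A : ℝ → ℝ) (f : X → ℝ) : ℝ≥0∞ :=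
  ⨆ (ε : ℝ) (_ : 0 < ε) (_ : ε < sMax p lam A),
    ENNReal.ofReal (φ ε ^ (1 / (p - ε))) * morreyNorm d μ (p - ε) (lam - A ε) f

/-- Membership in the generalized grand Morrey space. -/
def MemGrandMorrey {X : Type*} [MeasurableSpace X] (d : X → X → ℝ) (μ : Measure X)
    (p lam : ℝ) (φ A : ℝ → ℝ) (f : X → ℝ) : Prop :=
  AEStronglyMeasurable f μ ∧ grandMorreyNorm d μ p lam φ A f < ∞

/-- The BMO seminorm. -/
def bmoNorm {X : Type*} [MeasurableSpace X] (d : X → X → ℝ) (μ : Measure X)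
    (b : X → ℝ) : ℝ≥0∞ :=
  ⨆ (x : X) (r : ℝ) (_ : 0 < r) (_ : ENNReal.ofReal r < qdiam d),
    (μ (qball d x r))⁻¹ * ∫⁻ y in qball d x r, ‖b y - ⨍ z in qball d x r, b z ∂μ‖ₑ ∂μ

/-- Bounded mean oscillation; locally integrable means integrable on balls. -/
def MemBMO {X : Type*} [MeasurableSpace X] (d : X → X → ℝ) (μ : Measure X)
    (b : X → ℝ) : Prop :=
  (∀ x (r : ℝ), 0 < r → IntegrableOn b (qball d x r) μ) ∧ bmoNorm d μ b < ∞

/-- The truncated integral `∫_{X \ B(x,η)} K(x,y) f(y) dμ(y)`. -/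
def truncated {X : Type*} [MeasurableSpace X] (d : X → X → ℝ) (μ : Measure X)
    (K : X → X → ℝ) (f : X → ℝ) (η : ℝ) (x : X) : ℝ :=
  ∫ y in (qball d x η)ᶜ, K x y * f y ∂μ

/-- `p.v. ∫ K(x,y) f(y) dμ(y)` exists at `x`: the truncated integrals converge absolutely, and
they have a finite limit as the truncation radius tends to `0`. -/
def PVExistsAt {X : Type*} [MeasurableSpace X] (d : X → X → ℝ) (μ : Measure X)
    (K : X → X → ℝ) (f : X → ℝ) (x : X) : Prop :=
  (∀ η : ℝ, 0 < η → IntegrableOn (fun y => K x y * f y) (qball d x η)ᶜ μ) ∧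
    ∃ l : ℝ, Tendsto (fun η => truncated d μ K f η x) (𝓝[>] 0) (𝓝 l)

/-- `T f(x) = p.v. ∫ K(x,y) f(y) dμ(y)` (only meaningful where the principal value exists). -/
def pvOperator {X : Type*} [MeasurableSpace X] (d : X → X → ℝ) (μ : Measure X)
    (K : X → X → ℝ) (f : X → ℝ) (x : X) : ℝ :=
  limUnder (𝓝[>] (0 : ℝ)) (fun η => truncated d μ K f η x)

/-- Moduli of continuity of Dini type: positive nondecreasing functions on `(0,∞)` satisfying the
`Δ₂` condition and the Dini condition. -/
structure IsDiniModulus (w : ℝ → ℝ) : Prop where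
  pos : ∀ t, 0 < t → 0 < w t
  mono : MonotoneOn w (Ioi 0)
  delta_two : ∃ c : ℝ, ∀ t, 0 < t → w (2 * t) ≤ c * w t
  dini : IntegrableOn (fun t => w t / t) (Ioc 0 1)

/-- Calderón–Zygmund kernels of Dini type.  Only the values of `K` off the diagonal matter. -/
structure IsCZKernel {X : Type*} [MeasurableSpace X] (d : X → X → ℝ) (μ : Measure X)
    (K : X → X → ℝ) : Prop where
  measurable : AEStronglyMeasurable (Function.uncurry K) (μ.prod μ)
  bounds : ∃ (C : ℝ) (w : ℝ → ℝ), 0 < C ∧ IsDiniModulus w ∧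
    (∀ x y, x ≠ y → |K x y| ≤ C / μ.real (qball d x (d x y))) ∧
    ∀ x₁ x₂ y, x₁ ≠ x₂ → x₁ ≠ y → x₂ ≠ y → C * d x₁ x₂ ≤ d x₂ y →
      |K x₁ y - K x₂ y| + |K y x₁ - K y x₂| ≤
        C * w (d x₂ x₁ / d x₂ y) * (1 / μ.real (qball d x₂ (d x₂ y)))

/-- The kernel `K` defines a Calderón–Zygmund operator: on `L²` the principal values exist almost
everywhere and the resulting operator is bounded. -/
structure IsCZOperator {X : Type*} [MeasurableSpace X] (d : X → X → ℝ) (μ : Measure X)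
    (K : X → X → ℝ) : Prop where
  kernel : IsCZKernel d μ K
  pv_exists : ∀ f : X → ℝ, MemLp f 2 μ → ∀ᵐ x ∂μ, PVExistsAt d μ K f x
  bounded : ∃ C : ℝ≥0, ∀ f : X → ℝ, MemLp f 2 μ →
    MemLp (pvOperator d μ K f) 2 μ ∧ eLpNorm (pvOperator d μ K f) 2 μ ≤ C * eLpNorm f 2 μ

/-- The commutator `[b,U]f = b U(f) - U(b f)`. -/
def commutator {X : Type*} (b : X → ℝ) (U : (X → ℝ) → X → ℝ) (f : X → ℝ) (x : X) : ℝ :=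
  b x * U f x - U (fun y => b y * f y) x

end GrandMorrey

end

/-!
The commutator is estimated on `L^q` first, uniformly for `q` in compact subintervals of `(1, ∞)`,
then on Morrey spaces, and finally on the grand Morrey space.

*From `L²` to weak type.* The space has finite diameter and finite measure, and its doubling
condition extends to all radii (`DoublingBalls`). A Calderón–Zygmund decomposition of an integrable
`f` over disjoint balls and their engulfing dilates gives the weak type `(1,1)` of `T` together with
the almost everywhere existence of `T f` (`IsCZOperator.exists_weakType`): outside the dilates of
the selected balls the truncations of the bad part converge, since at density points of the
complement the balls that are cut by `B(x, η)` carry a vanishing proportion of mass.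

*Weights.* A local good-`λ` inequality compares `T f` with the maximal function of `f`, and with a
supremum over a countable family of balls of truncated integrals; the family is countable because
neither `x ↦ d x y` nor the uncentred maximal function over all balls need be measurable. It yields
`∫ |T f|^q dν ≤ C ∫ |f|^q dν` for measures `ν` that satisfy a quantitative `A_∞` and an `A_r`
condition, with `C` uniform over all such measures with given constants
(`IsWeakType.exists_weighted_bound`).

*From `T` to the commutator.* By the John–Nirenberg inequality
(`HasBoundedOscillation.exists_expBound`) the functions `e^{s b}` with small `|s|` are such weights.
Following Coifman, Rochberg and Weiss, `[b, T] f` is the derivative at `z = 0` of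
`e^{z b} T (e^{-z b} f)`, so Cauchy's formula on a small circle bounds it on `L^q` by the
weighted bounds. This requires no more than the Dini condition on the kernel, whereas sharp maximal
function estimates for commutators ask for a logarithmic factor. The formula is applied to quantized truncations of `b`,
which take finitely many values, and Fatou's lemma removes the truncation
(`IsWeakType.exists_commutator_bound`).

*Morrey and grand Morrey spaces.* On a ball `B`, `f` is split at a dilate of `B`. The distant part
is controlled by the size of the kernel, the moments of `b - b_B`, and the geometric growth of the
measures of dilates, which holds because annuli have positive measure
(`IsHomogeneousType.exists_reverseDoubling`). This gives Morrey bounds uniform in both exponents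
(`IsWeakType.exists_morrey_bound`) as long as `q` stays away from `1` and `κ` from `1`. In the grand
Morrey norm `q = p - ε` may approach `1` as `ε` increases, but by Hölder's inequality on the finite
measure space the terms with `ε > s_max / 2` are dominated by the one with `ε = s_max / 2`
(`DoublingBalls.grandMorreyNorm_le`).
-/

namespace GrandMorrey

/-! ### Geometry of bounded doubling quasimetric spaces -/

/-- A quasimetric of diameter less than `D`, with both structural constants bounded by `c`, whose
balls are measurable, have positive measure, and satisfy the doubling condition for *all* radii. -/
structure DoublingBalls {X : Type*} [MeasurableSpace X] (d : X → X → ℝ) (μ : Measure X)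
    (c D : ℝ) (Cd : ℝ≥0) : Prop where
  one_le : 1 ≤ c
  one_le_doubling : 1 ≤ Cd
  nonneg : ∀ x y, 0 ≤ d x y
  eq_zero_iff : ∀ x y, d x y = 0 ↔ x = y
  triangle : ∀ x y z, d x y ≤ c * (d x z + d z y)
  symm : ∀ x y, d x y ≤ c * d y x
  lt_diam : ∀ x y, d x y < D
  measurableSet_ball : ∀ x r, MeasurableSet (qball d x r)
  measure_ball_pos : ∀ x r, 0 < r → 0 < μ (qball d x r)
  doubling : ∀ x r, 0 < r → μ (qball d x (2 * r)) ≤ Cd * μ (qball d x r)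

/-- If `B(y, s)` meets `B(x, r)` and `s ≤ t * r`, then `B(y, s) ⊆ B(x, engulfConst c t * r)`. -/
noncomputable def engulfConst (c t : ℝ) : ℝ := c * (1 + 2 * c ^ 2 * t)

/-- The measures of intersecting balls whose radii satisfy `s ≤ t * r` differ by at most this
factor. -/
noncomputable def compConst (c : ℝ) (Cd : ℝ≥0) (t : ℝ) : ℝ≥0 := Cd ^ ⌈engulfConst c t⌉₊

/-- A countable family of balls (given by centre and radius) such that every ball lies in a member
of comparable radius. Suprema over such a family are measurable, unlike suprema over all balls. -/
structure IsBallBasis {X : Type*} (d : X → X → ℝ) (𝒢 : Set (X × ℝ)) (Λ : ℝ) : Prop where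
  countable : 𝒢.Countable
  pos : ∀ B ∈ 𝒢, 0 < B.2
  exists_superset : ∀ x r, 0 < r →
    ∃ B ∈ 𝒢, qball d x r ⊆ qball d B.1 B.2 ∧ r ≤ B.2 ∧ B.2 ≤ Λ * r

theorem qball_mono {X : Type*} (d : X → X → ℝ) (x : X) {r s : ℝ} (h : r ≤ s) :
    qball d x r ⊆ qball d x s := fun _ hy => lt_of_lt_of_le hy h

namespace DoublingBalls

variable {X : Type*} [MeasurableSpace X] {d : X → X → ℝ} {μ : Measure X} {c D : ℝ} {Cd : ℝ≥0}

theorem self_eq (h : DoublingBalls d μ c D Cd) (x : X) : d x x = 0 := (h.eq_zero_iff x x).2 rfl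

theorem pos_of_ne (h : DoublingBalls d μ c D Cd) {x y : X} (hxy : x ≠ y) : 0 < d x y :=
  lt_of_le_of_ne (h.nonneg x y) fun e => hxy ((h.eq_zero_iff x y).1 e.symm)

theorem mem_ball_self (h : DoublingBalls d μ c D Cd) (x : X) {r : ℝ} (hr : 0 < r) :
    x ∈ qball d x r := by simpa [qball, h.self_eq] using hr

theorem ball_eq_univ (h : DoublingBalls d μ c D Cd) (x : X) {r : ℝ} (hr : D ≤ r) :
    qball d x r = univ := eq_univ_of_forall fun y => (h.lt_diam x y).trans_le hr

theorem pos_diam (h : DoublingBalls d μ c D Cd) (x : X) : 0 < D := by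
  simpa [h.self_eq] using h.lt_diam x x

theorem cpos (h : DoublingBalls d μ c D Cd) : 0 < c := lt_of_lt_of_le one_pos h.one_le

theorem one_le_engulfConst (h : DoublingBalls d μ c D Cd) {t : ℝ} (ht : 0 ≤ t) :
    1 ≤ engulfConst c t := by
  have h1 : 0 ≤ 2 * c ^ 2 * t := by positivity
  have := h.one_le
  unfold engulfConst
  nlinarith

theorem le_engulfConst (h : DoublingBalls d μ c D Cd) {t : ℝ} (ht : 0 ≤ t) :
    2 * t ≤ engulfConst c t := by
  have h1 := h.one_le
  have h3 : 1 ≤ c ^ 2 := one_le_pow₀ h1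
  have h2 : 2 * t ≤ 2 * c ^ 2 * t := by nlinarith
  have h4 : 0 ≤ 2 * c ^ 2 * t := by positivity
  unfold engulfConst
  nlinarith

theorem pos_of_mem (h : DoublingBalls d μ c D Cd) {x y : X} {r : ℝ} (hy : y ∈ qball d x r) :
    0 < r := (h.nonneg x y).trans_lt hy

theorem ball_subset_of_inter (h : DoublingBalls d μ c D Cd) {x y : X} {r s t : ℝ}
    (hst : s ≤ t * r) (hne : (qball d x r ∩ qball d y s).Nonempty) :
    qball d y s ⊆ qball d x (engulfConst c t * r) := by
  obtain ⟨u, hux, huy⟩ := hne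
  intro v hv
  have hc := h.one_le
  have h1 := h.triangle x v u
  have h2 := h.triangle u v y
  have h3 := h.symm u y
  simp only [qball, mem_ofPred_eq] at hux huy hv ⊢
  have hs : 0 < s := (h.nonneg y u).trans_lt huy
  have h4 : d u y ≤ c * s := h3.trans (by gcongr)
  have h5 : d u v ≤ 2 * c ^ 2 * s := by
    refine h2.trans ?_
    have : d u y + d y v ≤ c * s + c * s := by nlinarith
    nlinarith
  have h7 : 2 * c ^ 2 * s ≤ 2 * c ^ 2 * (t * r) := by gcongr
  have h8 : d x u + d u v < r + 2 * c ^ 2 * (t * r) := by linarith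
  calc d x v ≤ c * (d x u + d u v) := h1
    _ < c * (r + 2 * c ^ 2 * (t * r)) := mul_lt_mul_of_pos_left h8 h.cpos
    _ = engulfConst c t * r := by unfold engulfConst; ring

theorem measure_dilate_le (h : DoublingBalls d μ c D Cd) (t : ℝ) (x : X) {r : ℝ} (hr : 0 < r) :
    μ (qball d x (t * r)) ≤ (Cd ^ ⌈t⌉₊ : ℝ≥0) * μ (qball d x r) := by
  have key : ∀ n : ℕ, μ (qball d x (2 ^ n * r)) ≤ (Cd ^ n : ℝ≥0) * μ (qball d x r) := by
    intro n
    induction n with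
    | zero => simp
    | succ n ih =>
      calc μ (qball d x (2 ^ (n + 1) * r)) = μ (qball d x (2 * (2 ^ n * r))) := by ring_nf
        _ ≤ Cd * μ (qball d x (2 ^ n * r)) := h.doubling _ _ (by positivity)
        _ ≤ Cd * ((Cd ^ n : ℝ≥0) * μ (qball d x r)) := by gcongr
        _ = _ := by rw [← mul_assoc, pow_succ']; push_cast; rfl
  refine (measure_mono (qball_mono d x ?_)).trans (key _)
  have h1 : t ≤ (⌈t⌉₊ : ℝ) := Nat.le_ceil t
  have h2 : (⌈t⌉₊ : ℝ) ≤ 2 ^ ⌈t⌉₊ := by exact_mod_cast Nat.lt_two_pow_self.le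
  gcongr
  exact h1.trans h2

theorem measure_le_of_inter (h : DoublingBalls d μ c D Cd) {x y : X} {r s t : ℝ}
    (hst : s ≤ t * r) (hr : 0 < r) (hne : (qball d x r ∩ qball d y s).Nonempty) :
    μ (qball d y s) ≤ compConst c Cd t * μ (qball d x r) :=
  (measure_mono (h.ball_subset_of_inter hst hne)).trans (h.measure_dilate_le _ x hr)

theorem measure_engulf_le (h : DoublingBalls d μ c D Cd) (t : ℝ) (x : X) {r : ℝ} (hr : 0 < r) :
    μ (qball d x (engulfConst c t * r)) ≤ compConst c Cd t * μ (qball d x r) :=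
  h.measure_dilate_le _ x hr

theorem exists_net (h : DoublingBalls d μ c D Cd) [IsFiniteMeasure μ] {r : ℝ} (hr : 0 < r) :
    ∃ u : Set X, u.Countable ∧ u.PairwiseDisjoint (fun x => qball d x r) ∧
      ∀ x, ∃ z ∈ u, qball d x r ⊆ qball d z (engulfConst c 1 * r) := by
  obtain ⟨u, -, hu, hcov⟩ := Vitali.exists_disjoint_subfamily_covering_enlargement
    (fun x => qball d x r) univ (fun _ => r) 2 one_lt_two (fun _ _ => hr.le) r (fun _ _ => le_rfl)
    (fun x _ => ⟨x, h.mem_ball_self x hr⟩)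
  refine ⟨u, ?_, hu, fun x => ?_⟩
  · have := Measure.countable_meas_pos_of_disjoint_iUnion (μ := μ)
      (As := fun x : u => qball d (x : X) r) (fun x => h.measurableSet_ball _ _)
      (fun a b hab => hu a.2 b.2 (fun e => hab (Subtype.ext e)))
    have h2 : {i : u | 0 < μ (qball d (i : X) r)} = univ :=
      eq_univ_of_forall fun i => h.measure_ball_pos _ _ hr
    rw [h2, countable_univ_iff] at this
    exact this
  · obtain ⟨z, hz, hne, -⟩ := hcov x (mem_univ x)
    refine ⟨z, hz, h.ball_subset_of_inter (by simp) ?_⟩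
    rwa [inter_comm] at hne

/-- Nets at all dyadic scales form a ball basis. -/
theorem exists_ballBasis (h : DoublingBalls d μ c D Cd) [IsFiniteMeasure μ] :
    ∃ 𝒢 Λ, 1 ≤ Λ ∧ IsBallBasis d 𝒢 Λ := by
  choose u huc _ hu using fun k : ℤ => h.exists_net (r := (2 : ℝ) ^ k) (by positivity)
  have hκ : 1 ≤ engulfConst c 1 := h.one_le_engulfConst zero_le_one
  refine ⟨⋃ k : ℤ, (fun z => (z, engulfConst c 1 * 2 ^ k)) '' u k, 2 * engulfConst c 1,
    by linarith, countable_iUnion fun k => (huc k).image _, ?_, ?_⟩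
  · rintro B hB
    obtain ⟨k, z, -, rfl⟩ := mem_iUnion.1 hB
    positivity
  · intro x r hr
    obtain ⟨k, hk1, hk2⟩ := exists_mem_Ioc_zpow hr one_lt_two
    obtain ⟨z, hz, hsub⟩ := hu (k + 1) x
    refine ⟨(z, engulfConst c 1 * 2 ^ (k + 1)), mem_iUnion.2 ⟨k + 1, z, hz, rfl⟩,
      (qball_mono d x hk2).trans hsub, ?_, ?_⟩
    · exact hk2.trans (le_mul_of_one_le_left (by positivity) hκ)
    · rw [zpow_add_one₀ two_ne_zero]
      simp only
      nlinarith

end DoublingBalls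

variable {X : Type*} [MeasurableSpace X] {d : X → X → ℝ} {μ : Measure X} {c D : ℝ} {Cd : ℝ≥0}

/-- Vitali covering. Each selected ball contains a point at which its radius is maximal, up to
a factor `2`, among all the balls of the family that contain the point. -/
theorem DoublingBalls.exists_covering (h : DoublingBalls d μ c D Cd) (t : Set (X × ℝ))
    (htpos : ∀ B ∈ t, 0 < B.2) (R : ℝ) (hR : ∀ B ∈ t, B.2 ≤ R) :
    ∃ u ⊆ t, u.PairwiseDisjoint (fun B => qball d B.1 B.2) ∧
      (⋃ B ∈ t, qball d B.1 B.2) ⊆ ⋃ B ∈ u, qball d B.1 (engulfConst c 2 * B.2) ∧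
      ∀ B ∈ u, ∃ x ∈ qball d B.1 B.2, ∀ B' ∈ t, x ∈ qball d B'.1 B'.2 → B'.2 ≤ 2 * B.2 := by
  have key : ∀ x ∈ ⋃ B ∈ t, qball d B.1 B.2, ∃ B ∈ t, x ∈ qball d B.1 B.2 ∧
      ∀ B' ∈ t, x ∈ qball d B'.1 B'.2 → B'.2 ≤ 2 * B.2 := by
    intro x hx
    simp only [mem_iUnion, exists_prop] at hx
    obtain ⟨B0, hB0, hxB0⟩ := hx
    set S : Set ℝ := Prod.snd '' {B | B ∈ t ∧ x ∈ qball d B.1 B.2} with hS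
    have hne : S.Nonempty := ⟨_, B0, ⟨hB0, hxB0⟩, rfl⟩
    have hbdd : BddAbove S := ⟨R, by rintro _ ⟨B, hB, rfl⟩; exact hR B hB.1⟩
    have hpos : 0 < sSup S := lt_of_lt_of_le (htpos B0 hB0) (le_csSup hbdd ⟨B0, ⟨hB0, hxB0⟩, rfl⟩)
    obtain ⟨_, ⟨B, hB, rfl⟩, hlt⟩ := exists_lt_of_lt_csSup hne (half_lt_self hpos)
    refine ⟨B, hB.1, hB.2, fun B' hB' hx' => ?_⟩
    have := le_csSup hbdd (⟨B', ⟨hB', hx'⟩, rfl⟩ : B'.2 ∈ S)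
    linarith
  choose! F hFt hFx hFmax using key
  set Ω := ⋃ B ∈ t, qball d B.1 B.2 with hΩ
  obtain ⟨u, hut, hdisj, hcov⟩ := Vitali.exists_disjoint_subfamily_covering_enlargement
    (fun B : X × ℝ => qball d B.1 B.2) (F '' Ω) (fun B => B.2) 2 one_lt_two
    (by rintro _ ⟨x, hx, rfl⟩; exact (htpos _ (hFt x hx)).le) R
    (by rintro _ ⟨x, hx, rfl⟩; exact hR _ (hFt x hx))
    (by rintro _ ⟨x, hx, rfl⟩; exact ⟨x, hFx x hx⟩)
  refine ⟨u, ?_, hdisj, ?_, ?_⟩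
  · intro B hB
    obtain ⟨x, hx, rfl⟩ := hut hB
    exact hFt x hx
  · intro x hx
    obtain ⟨B, hB, hne, hle⟩ := hcov (F x) ⟨x, hx, rfl⟩
    rw [inter_comm] at hne
    exact mem_biUnion hB (h.ball_subset_of_inter hle hne (hFx x hx))
  · intro B hB
    obtain ⟨x, hx, rfl⟩ := hut hB
    exact ⟨x, hFx x hx, hFmax x hx⟩

end GrandMorrey

namespace GrandMorrey

/-! ### Maximal functions over a countable family of balls -/

/-- The uncentred maximal function over the balls of the family `𝒢`, with respect to `ν`. -/
noncomputable def maxFn {X : Type*} [MeasurableSpace X] (d : X → X → ℝ) (𝒢 : Set (X × ℝ))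
    (ν : Measure X) (φ : X → ℝ≥0∞) (x : X) : ℝ≥0∞ :=
  ⨆ B ∈ 𝒢, (qball d B.1 B.2).indicator
    (fun _ => (ν (qball d B.1 B.2))⁻¹ * ∫⁻ y in qball d B.1 B.2, φ y ∂ν) x

variable {X : Type*} [MeasurableSpace X] {d : X → X → ℝ} {μ ν : Measure X} {c D : ℝ} {Cd : ℝ≥0}
  {𝒢 : Set (X × ℝ)} {Λ : ℝ}

theorem lt_maxFn_iff {φ : X → ℝ≥0∞} {x : X} {a : ℝ≥0∞} : a < maxFn d 𝒢 ν φ x ↔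
    ∃ B ∈ 𝒢, x ∈ qball d B.1 B.2 ∧
      a < (ν (qball d B.1 B.2))⁻¹ * ∫⁻ y in qball d B.1 B.2, φ y ∂ν := by
  simp only [maxFn, lt_iSup_iff, exists_prop]
  refine exists_congr fun B => and_congr_right fun _ => ?_
  by_cases hx : x ∈ qball d B.1 B.2 <;> simp [hx]

theorem measurable_maxFn (h : DoublingBalls d μ c D Cd) (h𝒢 : IsBallBasis d 𝒢 Λ)
    (φ : X → ℝ≥0∞) : Measurable (maxFn d 𝒢 ν φ) :=
  Measurable.biSup _ h𝒢.countable fun _ _ =>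
    measurable_const.indicator (h.measurableSet_ball _ _)

theorem average_le_maxFn {φ : X → ℝ≥0∞} {x : X} {B : X × ℝ} (hB : B ∈ 𝒢)
    (hx : x ∈ qball d B.1 B.2) :
    (ν (qball d B.1 B.2))⁻¹ * ∫⁻ y in qball d B.1 B.2, φ y ∂ν ≤ maxFn d 𝒢 ν φ x := by
  refine le_trans ?_ (le_biSup _ hB)
  simp [hx]

theorem maxFn_congr_ae {φ ψ : X → ℝ≥0∞} (hφ : φ =ᵐ[ν] ψ) :
    maxFn d 𝒢 ν φ = maxFn d 𝒢 ν ψ := by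
  funext x
  simp only [maxFn]
  congr! 6 with B hB y
  exact lintegral_congr_ae (ae_restrict_of_ae hφ)

theorem DoublingBalls.lintegral_ball_le (h : DoublingBalls d μ c D Cd) [IsFiniteMeasure μ]
    (h𝒢 : IsBallBasis d 𝒢 Λ) (φ : X → ℝ≥0∞) {x u : X} {r : ℝ} (hu : u ∈ qball d x r) :
    ∫⁻ y in qball d x r, φ y ∂μ ≤
      compConst c Cd Λ * maxFn d 𝒢 μ φ u * μ (qball d x r) := by
  have hr := h.pos_of_mem hu
  obtain ⟨B, hB, hsub, h1, h2⟩ := h𝒢.exists_superset x r hr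
  have hpos := h.measure_ball_pos B.1 B.2 (h𝒢.pos B hB)
  have hm : μ (qball d B.1 B.2) ≤ compConst c Cd Λ * μ (qball d x r) :=
    h.measure_le_of_inter h2 hr ⟨u, hu, hsub hu⟩
  calc ∫⁻ y in qball d x r, φ y ∂μ ≤ ∫⁻ y in qball d B.1 B.2, φ y ∂μ :=
        lintegral_mono_set hsub
    _ = ((μ (qball d B.1 B.2))⁻¹ * ∫⁻ y in qball d B.1 B.2, φ y ∂μ) * μ (qball d B.1 B.2) := by
        rw [mul_right_comm, ENNReal.inv_mul_cancel hpos.ne' (measure_ne_top _ _), one_mul]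
    _ ≤ maxFn d 𝒢 μ φ u * (compConst c Cd Λ * μ (qball d x r)) := by
        gcongr
        exact average_le_maxFn hB (hsub hu)
    _ = _ := by ring

theorem sum_lintegral_le_of_disjoint (h : DoublingBalls d μ c D Cd) {u : Set (X × ℝ)}
    (hu : u.Countable) (hd : u.PairwiseDisjoint (fun B => qball d B.1 B.2)) (φ : X → ℝ≥0∞) :
    ∑' B : u, ∫⁻ y in qball d B.1.1 B.1.2, φ y ∂ν ≤ ∫⁻ y, φ y ∂ν := by
  rw [← lintegral_biUnion hu (fun B _ => h.measurableSet_ball _ _) hd]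
  exact setLIntegral_le_lintegral _ _

/-- The weak type `(1,1)` inequality for the maximal function of a doubling measure. -/
theorem DoublingBalls.mul_measure_lt_maxFn_le (h : DoublingBalls d μ c D Cd) [IsFiniteMeasure ν]
    (h𝒢 : IsBallBasis d 𝒢 Λ) {Cν : ℝ≥0} (hCν : 1 ≤ Cν)
    (hν : ∀ x r, 0 < r → ν (qball d x (engulfConst c 2 * r)) ≤ Cν * ν (qball d x r))
    (φ : X → ℝ≥0∞) (α : ℝ≥0∞) :
    α * ν {x | α < maxFn d 𝒢 ν φ x} ≤ Cν * ∫⁻ y, φ y ∂ν := by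
  set t : Set (X × ℝ) := {B | B ∈ 𝒢 ∧
    α < (ν (qball d B.1 B.2))⁻¹ * ∫⁻ y in qball d B.1 B.2, φ y ∂ν} with ht
  have hball : ∀ B ∈ t, α * ν (qball d B.1 B.2) ≤ ∫⁻ y in qball d B.1 B.2, φ y ∂ν := by
    rintro B ⟨-, hB⟩
    rcases eq_or_ne (ν (qball d B.1 B.2)) 0 with h0 | h0
    · simp [h0]
    · calc α * ν (qball d B.1 B.2)
          ≤ ((ν (qball d B.1 B.2))⁻¹ * ∫⁻ y in qball d B.1 B.2, φ y ∂ν) * ν (qball d B.1 B.2) := by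
            gcongr
        _ = _ := by rw [mul_right_comm, ENNReal.inv_mul_cancel h0 (measure_ne_top _ _), one_mul]
  have hset : {x | α < maxFn d 𝒢 ν φ x} = ⋃ B ∈ t, qball d B.1 B.2 := by
    ext x
    simp only [mem_ofPred_eq, lt_maxFn_iff, mem_iUnion, exists_prop, ht]
    exact exists_congr fun B => by tauto
  by_cases hbig : ∃ B ∈ t, D ≤ B.2
  · -- a ball of the family is the whole space
    obtain ⟨B, hB, hDB⟩ := hbig
    have h1 := hball B hB
    rw [h.ball_eq_univ _ hDB, Measure.restrict_univ] at h1
    calc α * ν {x | α < maxFn d 𝒢 ν φ x} ≤ α * ν univ := by gcongr; exact subset_univ _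
      _ ≤ ∫⁻ y, φ y ∂ν := h1
      _ ≤ Cν * ∫⁻ y, φ y ∂ν := le_mul_of_one_le_left (by simp) (by exact_mod_cast hCν)
  push Not at hbig
  obtain ⟨u, hut, hdisj, hcov, -⟩ := h.exists_covering t (fun B hB => h𝒢.pos B hB.1) D
    (fun B hB => (hbig B hB).le)
  have huc : u.Countable := h𝒢.countable.mono fun B hB => (hut hB).1
  have := huc.to_subtype
  calc α * ν {x | α < maxFn d 𝒢 ν φ x}
      ≤ α * ν (⋃ B : u, qball d B.1.1 (engulfConst c 2 * B.1.2)) := by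
        rw [hset]
        gcongr
        rwa [← biUnion_eq_iUnion u (fun B _ => qball d B.1 (engulfConst c 2 * B.2))]
    _ ≤ α * ∑' B : u, ν (qball d B.1.1 (engulfConst c 2 * B.1.2)) := by
        gcongr; exact measure_iUnion_le _
    _ ≤ α * ∑' B : u, Cν * ν (qball d B.1.1 B.1.2) := by
        gcongr with B
        exact hν _ _ (h𝒢.pos _ (hut B.2).1)
    _ = Cν * ∑' B : u, α * ν (qball d B.1.1 B.1.2) := by
        rw [ENNReal.tsum_mul_left, ENNReal.tsum_mul_left]; ring
    _ ≤ Cν * ∑' B : u, ∫⁻ y in qball d B.1.1 B.1.2, φ y ∂ν := by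
        gcongr with B
        exact hball _ (hut B.2)
    _ ≤ Cν * ∫⁻ y, φ y ∂ν := by
        gcongr
        exact sum_lintegral_le_of_disjoint h huc hdisj φ

theorem DoublingBalls.mul_measure_lt_maxFn_le' (h : DoublingBalls d μ c D Cd) [IsFiniteMeasure μ]
    (h𝒢 : IsBallBasis d 𝒢 Λ) (φ : X → ℝ≥0∞) (α : ℝ≥0∞) :
    α * μ {x | α < maxFn d 𝒢 μ φ x} ≤ compConst c Cd 2 * ∫⁻ y, φ y ∂μ :=
  h.mul_measure_lt_maxFn_le h𝒢 (one_le_pow₀ h.one_le_doubling)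
    (fun x _ hr => h.measure_engulf_le 2 x hr) φ α

theorem lintegral_ofReal_toReal_rpow {φ : X → ℝ≥0∞} (hφ : ∀ᵐ x ∂ν, φ x ≠ ∞) {s : ℝ} (hs : 0 ≤ s) :
    ∫⁻ x, ENNReal.ofReal ((φ x).toReal ^ s) ∂ν = ∫⁻ x, φ x ^ s ∂ν := by
  refine lintegral_congr_ae ?_
  filter_upwards [hφ] with x hx
  rw [← ENNReal.ofReal_rpow_of_nonneg ENNReal.toReal_nonneg hs, ENNReal.ofReal_toReal hx]

theorem maxFn_le_add (φ : X → ℝ≥0∞)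
    (a : ℝ≥0∞) (x : X) :
    maxFn d 𝒢 ν φ x ≤ maxFn d 𝒢 ν ({y | a < φ y}.indicator φ) x + a := by
  refine iSup₂_le fun B hB => ?_
  by_cases hx : x ∈ qball d B.1 B.2
  · simp only [hx, indicator_of_mem]
    calc (ν (qball d B.1 B.2))⁻¹ * ∫⁻ y in qball d B.1 B.2, φ y ∂ν
        ≤ (ν (qball d B.1 B.2))⁻¹ *
          ∫⁻ y in qball d B.1 B.2, ({y | a < φ y}.indicator φ y + a) ∂ν := by
          gcongr with y
          by_cases hy : a < φ y
          · simp [hy]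
          · rw [indicator_of_notMem (show y ∉ {y | a < φ y} from hy), zero_add]
            exact not_lt.1 hy
      _ ≤ _ := by
          rw [lintegral_add_right _ measurable_const, mul_add]
          gcongr
          · exact average_le_maxFn hB hx
          · rw [setLIntegral_const, mul_comm a, ← mul_assoc]
            exact mul_le_of_le_one_left (by simp) (ENNReal.inv_mul_le_one _)
  · simp [hx]

/-- The strong type inequality for the maximal function of a doubling measure. -/
theorem DoublingBalls.lintegral_maxFn_rpow_le (h : DoublingBalls d μ c D Cd) [IsFiniteMeasure ν]
    (h𝒢 : IsBallBasis d 𝒢 Λ) {Cν : ℝ≥0} (hCν : 1 ≤ Cν)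
    (hν : ∀ x r, 0 < r → ν (qball d x (engulfConst c 2 * r)) ≤ Cν * ν (qball d x r))
    {φ : X → ℝ≥0∞} (hφ' : AEMeasurable φ ν) {s : ℝ} (hs : 1 < s) :
    ∫⁻ x, maxFn d 𝒢 ν φ x ^ s ∂ν ≤
      ENNReal.ofReal (s / (s - 1) * 2 ^ s) * Cν * ∫⁻ x, φ x ^ s ∂ν := by
  wlog hφ : Measurable φ generalizing φ
  · have := this hφ'.measurable_mk.aemeasurable hφ'.measurable_mk
    rw [maxFn_congr_ae hφ'.ae_eq_mk]
    refine this.trans_eq ?_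
    congr 1
    exact lintegral_congr_ae (hφ'.ae_eq_mk.mono fun x hx => by simp [hx])
  have hs0 : 0 < s - 1 := by linarith
  have hconst : 0 < s / (s - 1) * (2:ℝ) ^ s := by positivity
  by_cases hfin : ∫⁻ x, φ x ^ s ∂ν = ∞
  · rw [hfin, ENNReal.mul_top]
    · exact le_top
    · simp only [ne_eq, mul_eq_zero, ENNReal.ofReal_eq_zero, not_or, not_le, ENNReal.coe_eq_zero]
      exact ⟨hconst, (one_pos.trans_le hCν).ne'⟩
  have hφ1 : ∫⁻ x, φ x ∂ν ≠ ∞ := by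
    refine ne_top_of_le_ne_top (b := ∫⁻ x, (1 + φ x ^ s) ∂ν) ?_ (lintegral_mono fun x => ?_)
    · rw [lintegral_add_left measurable_const]
      simp [hfin]
    · rcases le_total (φ x) 1 with h1 | h1
      · exact h1.trans le_self_add
      · exact (ENNReal.le_rpow_self_of_one_le h1 hs.le).trans le_add_self
  have hφfin : ∀ᵐ x ∂ν, φ x ≠ ∞ := (ae_lt_top hφ hφ1).mono fun x hx => hx.ne
  have hM := measurable_maxFn (ν := ν) h h𝒢 φ
  have hMfin : ∀ᵐ x ∂ν, maxFn d 𝒢 ν φ x ≠ ∞ := by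
    rw [ae_iff]
    by_contra hne
    have h1 : ∀ n : ℕ, (n : ℝ≥0∞) * ν {x | ¬ maxFn d 𝒢 ν φ x ≠ ∞} ≤ Cν * ∫⁻ y, φ y ∂ν :=
      fun n => le_trans (by gcongr with x; intro hx; simp at hx; simp [hx])
        (h.mul_measure_lt_maxFn_le h𝒢 hCν hν φ n)
    obtain ⟨n, hn⟩ := ENNReal.exists_nat_mul_gt hne
      (ENNReal.mul_ne_top ENNReal.coe_ne_top hφ1 : (Cν : ℝ≥0∞) * ∫⁻ y, φ y ∂ν ≠ ∞)
    exact absurd (h1 n) (not_le.2 hn)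
  set ρ := ν.withDensity φ with hρ
  have key : ∀ t ∈ Ioi (0:ℝ), ν {x | t < (maxFn d 𝒢 ν φ x).toReal} * ENNReal.ofReal (t ^ (s - 1)) ≤
      2 * Cν * (ρ {x | t < 2 * (φ x).toReal} * ENNReal.ofReal (t ^ (s - 1 - 1))) := by
    intro t ht
    have ht' : (0:ℝ) < t := ht
    have h1 : ν {x | t < (maxFn d 𝒢 ν φ x).toReal} ≤
        ν {x | ENNReal.ofReal (t / 2) < maxFn d 𝒢 ν
          ({y | ENNReal.ofReal (t / 2) < φ y}.indicator φ) x} := by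
      refine measure_mono fun x hx => ?_
      have h2 := maxFn_le_add (d := d) (𝒢 := 𝒢) (ν := ν) φ (ENNReal.ofReal (t / 2)) x
      by_contra hcon
      simp only [mem_ofPred_eq, not_lt] at hcon hx
      have h3 : maxFn d 𝒢 ν φ x ≤ ENNReal.ofReal t := by
        refine h2.trans ((add_le_add_left hcon _).trans ?_)
        rw [← ENNReal.ofReal_add (by positivity) (by positivity)]
        simp
      exact absurd (ENNReal.toReal_le_of_le_ofReal ht'.le h3) (not_le.2 hx)
    have h4 := h.mul_measure_lt_maxFn_le h𝒢 hCν hν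
      ({y | ENNReal.ofReal (t / 2) < φ y}.indicator φ) (ENNReal.ofReal (t / 2))
    have hms : MeasurableSet {y | ENNReal.ofReal (t / 2) < φ y} := measurableSet_lt measurable_const hφ
    rw [lintegral_indicator hms, ← withDensity_apply _ hms, ← hρ] at h4
    have h5 : ρ {y | ENNReal.ofReal (t / 2) < φ y} ≤ ρ {x | t < 2 * (φ x).toReal} := by
      refine measure_mono_ae ?_
      filter_upwards [(withDensity_absolutelyContinuous ν φ).ae_le hφfin] with x hx hx2
      have hx2' : ENNReal.ofReal (t / 2) < φ x := hx2
      have := (ENNReal.ofReal_lt_iff_lt_toReal (by positivity) hx).1 hx2'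
      change t < 2 * (φ x).toReal
      linarith
    have h6 : ENNReal.ofReal (t ^ (s - 1)) =
        2 * ENNReal.ofReal (t / 2) * ENNReal.ofReal (t ^ (s - 1 - 1)) := by
      rw [show (2 : ℝ≥0∞) = ENNReal.ofReal 2 by simp, ← ENNReal.ofReal_mul (by norm_num),
        ← ENNReal.ofReal_mul (by positivity), Real.rpow_sub_one ht'.ne' (s - 1)]
      congr 1; field_simp
    calc ν {x | t < (maxFn d 𝒢 ν φ x).toReal} * ENNReal.ofReal (t ^ (s - 1))
        ≤ ν {x | ENNReal.ofReal (t / 2) < maxFn d 𝒢 ν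
          ({y | ENNReal.ofReal (t / 2) < φ y}.indicator φ) x} *
            (2 * ENNReal.ofReal (t / 2) * ENNReal.ofReal (t ^ (s - 1 - 1))) := by
          rw [h6]; gcongr
      _ = 2 * (ENNReal.ofReal (t / 2) * ν {x | ENNReal.ofReal (t / 2) < maxFn d 𝒢 ν
          ({y | ENNReal.ofReal (t / 2) < φ y}.indicator φ) x}) *
            ENNReal.ofReal (t ^ (s - 1 - 1)) := by ring
      _ ≤ 2 * (Cν * ρ {x | t < 2 * (φ x).toReal}) * ENNReal.ofReal (t ^ (s - 1 - 1)) := by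
          exact mul_le_mul' (mul_le_mul' le_rfl (h4.trans (by gcongr))) le_rfl
      _ = _ := by ring
  calc ∫⁻ x, maxFn d 𝒢 ν φ x ^ s ∂ν
      = ∫⁻ x, ENNReal.ofReal ((maxFn d 𝒢 ν φ x).toReal ^ s) ∂ν :=
        (lintegral_ofReal_toReal_rpow hMfin (by linarith)).symm
    _ = ENNReal.ofReal s * ∫⁻ t in Ioi 0,
          ν {x | t < (maxFn d 𝒢 ν φ x).toReal} * ENNReal.ofReal (t ^ (s - 1)) :=
        lintegral_rpow_eq_lintegral_meas_lt_mul ν (ae_of_all _ fun x => ENNReal.toReal_nonneg)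
          hM.ennreal_toReal.aemeasurable (by linarith)
    _ ≤ ENNReal.ofReal s * ∫⁻ t in Ioi 0,
          2 * Cν * (ρ {x | t < 2 * (φ x).toReal} * ENNReal.ofReal (t ^ (s - 1 - 1))) := by
        gcongr 1
        exact setLIntegral_mono' measurableSet_Ioi key
    _ = ENNReal.ofReal (s / (s - 1)) * 2 * Cν * (ENNReal.ofReal (s - 1) * ∫⁻ t in Ioi 0,
          (ρ {x | t < 2 * (φ x).toReal} * ENNReal.ofReal (t ^ (s - 1 - 1)))) := by
        rw [lintegral_const_mul' _ _ (by finiteness)]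
        have : ENNReal.ofReal s = ENNReal.ofReal (s / (s - 1)) * ENNReal.ofReal (s - 1) := by
          rw [← ENNReal.ofReal_mul (by positivity)]; congr 1; field_simp
        rw [this]; ring
    _ = ENNReal.ofReal (s / (s - 1)) * 2 * Cν *
          ∫⁻ x, ENNReal.ofReal ((2 * (φ x).toReal) ^ (s - 1)) ∂ρ := by
        rw [lintegral_rpow_eq_lintegral_meas_lt_mul ρ (ae_of_all _ fun x => by positivity)
          (by fun_prop) hs0]
    _ = ENNReal.ofReal (s / (s - 1)) * 2 * Cν *
          ∫⁻ x, ENNReal.ofReal (2 ^ (s - 1)) * φ x ^ s ∂ν := by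
        congr 1
        rw [hρ, lintegral_withDensity_eq_lintegral_mul _ hφ (by fun_prop)]
        refine lintegral_congr_ae ?_
        filter_upwards [hφfin] with x hx
        simp only [Pi.mul_apply]
        rw [Real.mul_rpow zero_le_two ENNReal.toReal_nonneg, ENNReal.ofReal_mul (by positivity),
          ← ENNReal.ofReal_rpow_of_nonneg ENNReal.toReal_nonneg hs0.le, ENNReal.ofReal_toReal hx,
          mul_left_comm]
        congr 1
        nth_rewrite 1 [← ENNReal.rpow_one (φ x)]
        rw [← ENNReal.rpow_add_of_nonneg _ _ zero_le_one hs0.le]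
        congr 1; ring
    _ = _ := by
        rw [lintegral_const_mul' _ _ ENNReal.ofReal_ne_top, ENNReal.ofReal_mul (by positivity)]
        have : ENNReal.ofReal ((2:ℝ) ^ s) = 2 * ENNReal.ofReal (2 ^ (s - 1)) := by
          rw [show (2 : ℝ≥0∞) = ENNReal.ofReal 2 by simp, ← ENNReal.ofReal_mul (by norm_num),
            Real.rpow_sub_one two_ne_zero]
          congr 1; field_simp
        rw [this]; ring

/-- From a good-`λ` inequality to `L^q`; nothing needs to be assumed about the finiteness of
`∫ G ^ q`, because the inequality passes to the truncations `min G N`. -/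
theorem lintegral_rpow_le_of_goodLambda [IsFiniteMeasure ν] {G F : X → ℝ≥0∞} (hG : Measurable G)
    (hF : Measurable F) {γ : ℝ} (hγ : 0 < γ) {ε : ℝ≥0∞} {q : ℝ} (hq : 0 < q)
    (hε : ENNReal.ofReal (3 ^ q) * ε ≤ 2⁻¹)
    (H : ∀ t : ℝ, 0 < t → ν {x | ENNReal.ofReal (3 * t) < G x ∧ F x ≤ ENNReal.ofReal (γ * t)} ≤
      ε * ν {x | ENNReal.ofReal t < G x}) :
    ∫⁻ x, G x ^ q ∂ν ≤ 2 * ENNReal.ofReal ((3 / γ) ^ q) * ∫⁻ x, F x ^ q ∂ν := by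
  by_cases hfin : ∫⁻ x, F x ^ q ∂ν = ∞
  · rw [hfin, ENNReal.mul_top]
    · exact le_top
    · simp only [ne_eq, mul_eq_zero, ENNReal.ofReal_eq_zero, not_or, not_le]
      exact ⟨by simp, by positivity⟩
  have hFfin : ∀ᵐ x ∂ν, F x ≠ ∞ := by
    filter_upwards [ae_lt_top (hF.pow_const q) hfin] with x hx hx2
    simp [hx2, hq] at hx
  set J := ∫⁻ x, ENNReal.ofReal (((F x).toReal / γ) ^ q) ∂ν with hJ
  have hJeq : ENNReal.ofReal (3 ^ q) * J = ENNReal.ofReal ((3 / γ) ^ q) * ∫⁻ x, F x ^ q ∂ν := by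
    rw [← lintegral_ofReal_toReal_rpow hFfin hq.le, hJ,
      ← lintegral_const_mul' _ _ ENNReal.ofReal_ne_top,
      ← lintegral_const_mul' _ _ ENNReal.ofReal_ne_top]
    refine lintegral_congr fun x => ?_
    rw [← ENNReal.ofReal_mul (by positivity), ← ENNReal.ofReal_mul (by positivity),
      ← Real.mul_rpow (by positivity) (by positivity),
      ← Real.mul_rpow (by positivity) ENNReal.toReal_nonneg]
    congr 2; ring
  have main : ∀ N : ℕ, ∫⁻ x, (min (G x) N) ^ q ∂ν ≤
      2 * ENNReal.ofReal ((3 / γ) ^ q) * ∫⁻ x, F x ^ q ∂ν := by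
    intro N
    have hNfin : ∀ x, min (G x) (N : ℝ≥0∞) ≠ ∞ := fun x =>
      ne_top_of_le_ne_top (ENNReal.natCast_ne_top N) (min_le_right _ _)
    have hgm : Measurable fun x => (min (G x) (N : ℝ≥0∞)).toReal :=
      (hG.min measurable_const).ennreal_toReal
    set I := ∫⁻ x, ENNReal.ofReal ((min (G x) (N : ℝ≥0∞)).toReal ^ q) ∂ν with hI
    have hIfin : I ≠ ∞ := by
      refine ne_top_of_le_ne_top (b := ∫⁻ _, ENNReal.ofReal ((N:ℝ) ^ q) ∂ν) ?_
        (lintegral_mono fun x => ?_)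
      · rw [lintegral_const]; finiteness
      · refine ENNReal.ofReal_le_ofReal (Real.rpow_le_rpow ENNReal.toReal_nonneg ?_ hq.le)
        exact ENNReal.toReal_le_of_le_ofReal (Nat.cast_nonneg N) (by simp)
    have hlt : ∀ x (t : ℝ), 0 < t → (t < (min (G x) (N : ℝ≥0∞)).toReal ↔
        ENNReal.ofReal t < G x ∧ t < N) := by
      intro x t ht
      rw [← ENNReal.ofReal_lt_iff_lt_toReal ht.le (hNfin x), lt_min_iff]
      refine and_congr_right fun _ => ?_
      rw [ENNReal.ofReal_lt_iff_lt_toReal ht.le (ENNReal.natCast_ne_top N)]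
      simp
    have key : ∀ t ∈ Ioi (0:ℝ), ν {x | t < (min (G x) (N : ℝ≥0∞)).toReal / 3} ≤
        ν {x | t < (F x).toReal / γ} + ε * ν {x | t < (min (G x) (N : ℝ≥0∞)).toReal} := by
      intro t ht
      have ht : (0:ℝ) < t := ht
      by_cases hN : 3 * t < N
      · have h1 : {x | t < (min (G x) (N : ℝ≥0∞)).toReal / 3} ≤ᵐ[ν]
            ({x | t < (F x).toReal / γ} ∪
            {x | ENNReal.ofReal (3 * t) < G x ∧ F x ≤ ENNReal.ofReal (γ * t)} : Set X) := by
          filter_upwards [hFfin] with x hFx hx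
          have hx : t < (min (G x) (N : ℝ≥0∞)).toReal / 3 := hx
          have hx2 := ((hlt x (3 * t) (by positivity)).1 (by linarith)).1
          by_cases hx3 : t < (F x).toReal / γ
          · exact Or.inl hx3
          · refine Or.inr ⟨hx2, ?_⟩
            rw [not_lt, div_le_iff₀ hγ] at hx3
            rw [← ENNReal.ofReal_toReal hFx]
            exact ENNReal.ofReal_le_ofReal (by linarith)
        refine (measure_mono_ae h1).trans ((measure_union_le _ _).trans ?_)
        gcongr
        refine (H t ht).trans ?_
        gcongr with x
        intro hx
        exact (hlt x t ht).2 ⟨hx, by linarith⟩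
      · have : {x | t < (min (G x) (N : ℝ≥0∞)).toReal / 3} = ∅ := by
          refine eq_empty_of_forall_notMem fun x hx => hN ?_
          have hx : t < (min (G x) (N : ℝ≥0∞)).toReal / 3 := hx
          exact ((hlt x (3 * t) (by positivity)).1 (by linarith)).2
        simp [this]
    have h3 : ∫⁻ x, ENNReal.ofReal (((min (G x) (N : ℝ≥0∞)).toReal / 3) ^ q) ∂ν ≤ J + ε * I := by
      rw [hJ, hI, lintegral_rpow_eq_lintegral_meas_lt_mul ν
          (ae_of_all _ fun x => by positivity) (by fun_prop) hq,
        lintegral_rpow_eq_lintegral_meas_lt_mul ν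
          (ae_of_all _ fun x => by positivity) (by fun_prop) hq,
        lintegral_rpow_eq_lintegral_meas_lt_mul ν
          (ae_of_all _ fun x => by positivity) (by fun_prop) hq]
      have hεtop : ε ≠ ∞ := by
        rintro rfl
        rw [ENNReal.mul_top (by simp; positivity)] at hε
        simp at hε
      rw [mul_left_comm, ← mul_add, ← lintegral_const_mul' _ _ hεtop, ← lintegral_add_left]
      · gcongr 1
        refine setLIntegral_mono' measurableSet_Ioi fun t ht => ?_
        rw [← mul_assoc, ← add_mul]
        gcongr
        exact key t ht
      · refine Measurable.mul (Antitone.measurable fun a b hab => measure_mono fun x hx => ?_)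
          (by fun_prop)
        exact lt_of_le_of_lt hab hx
    have h4 : I = ENNReal.ofReal (3 ^ q) *
        ∫⁻ x, ENNReal.ofReal (((min (G x) (N : ℝ≥0∞)).toReal / 3) ^ q) ∂ν := by
      rw [hI, ← lintegral_const_mul' _ _ ENNReal.ofReal_ne_top]
      refine lintegral_congr fun x => ?_
      rw [← ENNReal.ofReal_mul (by positivity), ← Real.mul_rpow (by positivity) (by positivity)]
      congr 2; ring
    -- the second term is absorbed, as `I` is finite
    have h5 : I ≤ ENNReal.ofReal (3 ^ q) * J + 2⁻¹ * I := by
      calc I = ENNReal.ofReal (3 ^ q) * _ := h4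
        _ ≤ ENNReal.ofReal (3 ^ q) * (J + ε * I) := by gcongr
        _ = ENNReal.ofReal (3 ^ q) * J + ENNReal.ofReal (3 ^ q) * ε * I := by ring
        _ ≤ _ := by gcongr
    have h6 : I = 2⁻¹ * I + 2⁻¹ * I := by
      rw [← add_mul, ENNReal.inv_two_add_inv_two, one_mul]
    have h7 : 2⁻¹ * I ≤ ENNReal.ofReal (3 ^ q) * J := by
      refine ENNReal.le_of_add_le_add_right ?_ (h6.symm.trans_le h5)
      exact ENNReal.mul_ne_top (by simp) hIfin
    calc ∫⁻ x, (min (G x) N) ^ q ∂ν = I :=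
          (lintegral_ofReal_toReal_rpow (ae_of_all _ hNfin) hq.le).symm
      _ = 2 * (2⁻¹ * I) := by
          rw [← mul_assoc, ENNReal.mul_inv_cancel (by simp) (by simp), one_mul]
      _ ≤ 2 * (ENNReal.ofReal (3 ^ q) * J) := by gcongr
      _ = _ := by rw [hJeq, mul_assoc]
  have hlim : Tendsto (fun N : ℕ => ∫⁻ x, (min (G x) N) ^ q ∂ν) atTop (𝓝 (∫⁻ x, G x ^ q ∂ν)) := by
    refine lintegral_tendsto_of_tendsto_of_monotone
      (fun N => ((hG.min measurable_const).pow_const q).aemeasurable)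
      (ae_of_all _ fun x M N hMN => ?_) (ae_of_all _ fun x => ?_)
    · dsimp only
      gcongr
    · have h1 : Tendsto (fun N : ℕ => min (G x) (N : ℝ≥0∞)) atTop (𝓝 (min (G x) ∞)) :=
        tendsto_const_nhds.min ENNReal.tendsto_nat_nhds_top
      rw [min_top_right] at h1
      exact (ENNReal.continuous_rpow_const.tendsto _).comp h1
  exact le_of_tendsto' hlim main

end GrandMorrey

namespace GrandMorrey

/-! ### Lebesgue differentiation -/

variable {X : Type*} [MeasurableSpace X] {d : X → X → ℝ} {μ ν : Measure X} {c D : ℝ} {Cd : ℝ≥0}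
  {𝒢 : Set (X × ℝ)} {Λ : ℝ}

theorem eventually_small_radius {a : ℝ} (ha : 0 < a) : ∀ᶠ r in 𝓝[>] (0:ℝ), 0 < r ∧ r < a := by
  filter_upwards [Ioo_mem_nhdsGT ha] with r hr using hr

/-- Almost every point is a Lebesgue point of a given integrable function. -/
theorem IsHomogeneousType.ae_lebesgue_point [TopologicalSpace X] (hX : IsHomogeneousType d μ)
    (h : DoublingBalls d μ c D Cd) [IsFiniteMeasure μ]
    {f : X → ℝ} (hf : Integrable f μ) :
    ∀ᵐ x ∂μ, ∀ ε : ℝ≥0∞, 0 < ε → ∀ᶠ r in 𝓝[>] (0:ℝ),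
      ∫⁻ y in qball d x r, ‖f y - f x‖ₑ ∂μ ≤ ε * μ (qball d x r) := by
  obtain ⟨𝒢, Λ, -, h𝒢⟩ := h.exists_ballBasis
  set C : ℝ≥0∞ := ((compConst c Cd Λ : ℝ≥0) : ℝ≥0∞) with hC
  have key : ∀ ε : ℝ≥0, 0 < ε → ∀ᵐ x ∂μ, ∀ᶠ r in 𝓝[>] (0:ℝ),
      ∫⁻ y in qball d x r, ‖f y - f x‖ₑ ∂μ ≤ (3 * ε) * μ (qball d x r) := by
    intro ε hε
    rw [ae_iff]
    set E := {x | ¬ ∀ᶠ r in 𝓝[>] (0:ℝ),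
      ∫⁻ y in qball d x r, ‖f y - f x‖ₑ ∂μ ≤ (3 * ε) * μ (qball d x r)} with hE
    have hεne : (ε : ℝ≥0∞) ≠ 0 := by simpa using hε.ne'
    have bound : ∀ δ : ℝ≥0, 0 < δ →
        ε * μ E ≤ (C * compConst c Cd 2 + 1) * δ := by
      intro δ hδ
      obtain ⟨g, hgc, hgs, hfg⟩ := hX.cc_dense f hf δ hδ
      have hgi := hX.cc_integrable g hgc hgs
      have hdi : Integrable (fun x => f x - g x) μ := hf.sub hgi
      have hfg' : ∫⁻ x, ‖f x - g x‖ₑ ∂μ ≤ δ := by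
        rw [← ofReal_integral_norm_eq_lintegral_enorm hdi]
        exact ENNReal.ofReal_le_of_le_toReal (by simpa using hfg)
      set φ : X → ℝ≥0∞ := fun x => ‖f x - g x‖ₑ with hφ
      have hsub : E ⊆ {x | ε < C * maxFn d 𝒢 μ φ x} ∪ {x | ε ≤ φ x} := by
        intro x hx
        by_contra hcon
        simp only [mem_union, mem_ofPred_eq, not_or, not_lt, not_le] at hcon
        refine hx ?_
        obtain ⟨ρ, hρ, hρV⟩ := hX.ball_subset_nhds x
          {y | dist (g y) (g x) < ε} (hgc.continuousAt.eventually (Metric.ball_mem_nhds _ hε))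
        filter_upwards [eventually_small_radius hρ] with r hr
        have h1 : ∀ y ∈ qball d x r, ‖f y - f x‖ₑ ≤ φ y + (ε + ε) := by
          intro y hy
          have h2 : ‖g y - g x‖ₑ ≤ ε := by
            have : dist (g y) (g x) < ε := hρV (qball_mono d x hr.2.le hy)
            rw [← edist_eq_enorm_sub, edist_dist]
            exact ENNReal.ofReal_le_of_le_toReal (by simpa using this.le)
          have h3 : ‖g x - f x‖ₑ ≤ ε := by
            rw [← enorm_neg, neg_sub]; exact hcon.2.le
          calc ‖f y - f x‖ₑ = ‖(f y - g y) + ((g y - g x) + (g x - f x))‖ₑ := by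
                congr 1; ring
            _ ≤ ‖f y - g y‖ₑ + (‖g y - g x‖ₑ + ‖g x - f x‖ₑ) :=
                (enorm_add_le _ _).trans (by gcongr; exact enorm_add_le _ _)
            _ ≤ _ := by gcongr
        calc ∫⁻ y in qball d x r, ‖f y - f x‖ₑ ∂μ
            ≤ ∫⁻ y in qball d x r, (φ y + (ε + ε)) ∂μ :=
              setLIntegral_mono' (h.measurableSet_ball _ _) h1
          _ = ∫⁻ y in qball d x r, φ y ∂μ + (ε + ε) * μ (qball d x r) := by
              rw [lintegral_add_right _ measurable_const, setLIntegral_const]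
          _ ≤ C * maxFn d 𝒢 μ φ x * μ (qball d x r) + (ε + ε) * μ (qball d x r) := by
              gcongr
              exact h.lintegral_ball_le h𝒢 φ (h.mem_ball_self x hr.1)
          _ ≤ ε * μ (qball d x r) + (ε + ε) * μ (qball d x r) := by gcongr; exact hcon.1
          _ = _ := by ring
      have h4 : ε * μ {x | ε < C * maxFn d 𝒢 μ φ x} ≤ C * (compConst c Cd 2 * δ) := by
        have hC0 : C ≠ 0 := by
          rw [hC]
          simpa [compConst] using fun h0 => absurd h0 (one_pos.trans_le h.one_le_doubling).ne'
        have hCt : C ≠ ∞ := ENNReal.coe_ne_top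
        have h5 : {x | ε < C * maxFn d 𝒢 μ φ x} = {x | ε / C < maxFn d 𝒢 μ φ x} := by
          ext x
          simp only [mem_ofPred_eq]
          rw [ENNReal.div_lt_iff (Or.inl hC0) (Or.inl hCt), mul_comm]
        calc ε * μ {x | ε < C * maxFn d 𝒢 μ φ x}
            = C * (ε / C * μ {x | ε / C < maxFn d 𝒢 μ φ x}) := by
              rw [h5, ← mul_assoc, ENNReal.mul_div_cancel hC0 hCt]
          _ ≤ C * (compConst c Cd 2 * ∫⁻ y, φ y ∂μ) := by
              gcongr 1; exact h.mul_measure_lt_maxFn_le' h𝒢 φ _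
          _ ≤ _ := by gcongr
      have h6 : ε * μ {x | ε ≤ φ x} ≤ δ :=
        (mul_meas_ge_le_lintegral₀ hdi.1.enorm _).trans hfg'
      calc ε * μ E ≤ ε * (μ {x | ε < C * maxFn d 𝒢 μ φ x} + μ {x | ε ≤ φ x}) := by
            gcongr 1; exact (measure_mono hsub).trans (measure_union_le _ _)
        _ ≤ C * (compConst c Cd 2 * δ) + δ := by rw [mul_add]; gcongr
        _ = _ := by ring
    have hlim : Tendsto (fun n : ℕ => (C * compConst c Cd 2 + 1) * ((1 / ((n:ℝ≥0) + 1) : ℝ≥0) : ℝ≥0∞))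
        atTop (𝓝 ((C * compConst c Cd 2 + 1) * ((0 : ℝ≥0) : ℝ≥0∞))) := by
      refine ENNReal.Tendsto.const_mul ?_ (Or.inr (by finiteness))
      exact ENNReal.tendsto_coe.2 tendsto_one_div_add_atTop_nhds_zero_nat
    have h0 : ε * μ E ≤ 0 := by
      refine (ge_of_tendsto' hlim fun n => bound _ (by positivity)).trans (by simp)
    exact (mul_eq_zero.1 (le_antisymm h0 zero_le)).resolve_left hεne
  have key2 : ∀ n : ℕ, ∀ᵐ x ∂μ, ∀ᶠ r in 𝓝[>] (0:ℝ), ∫⁻ y in qball d x r, ‖f y - f x‖ₑ ∂μ ≤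
      (3 * ((1 / ((n:ℝ≥0) + 1) : ℝ≥0) : ℝ≥0∞)) * μ (qball d x r) := fun n => key _ (by positivity)
  have hlim2 : Tendsto (fun n : ℕ => 3 * ((1 / ((n:ℝ≥0) + 1) : ℝ≥0) : ℝ≥0∞))
      atTop (𝓝 (3 * ((0 : ℝ≥0) : ℝ≥0∞))) :=
    ENNReal.Tendsto.const_mul
      (ENNReal.tendsto_coe.2 tendsto_one_div_add_atTop_nhds_zero_nat) (Or.inr (by simp))
  filter_upwards [ae_all_iff.2 key2] with x hx ε hε
  obtain ⟨n, hn⟩ := (hlim2.eventually (gt_mem_nhds (by simpa using hε))).exists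
  filter_upwards [hx n] with r hr
  exact hr.trans (by gcongr)

/-- At almost every point `x`, `|f x|` is at most any number which bounds the averages of `|f|`
over all small balls centred at `x`. -/
theorem IsHomogeneousType.ae_enorm_le_of_average_le [TopologicalSpace X]
    (hX : IsHomogeneousType d μ) (h : DoublingBalls d μ c D Cd) [IsFiniteMeasure μ]
    {f : X → ℝ} (hf : Integrable f μ) :
    ∀ᵐ x ∂μ, ∀ m : ℝ≥0∞, (∃ ρ > (0:ℝ), ∀ r : ℝ, 0 < r → r < ρ →
      ∫⁻ y in qball d x r, ‖f y‖ₑ ∂μ ≤ m * μ (qball d x r)) → ‖f x‖ₑ ≤ m := by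
  filter_upwards [hX.ae_lebesgue_point h hf] with x hx m ⟨ρ, hρ, hm⟩
  refine ENNReal.le_of_forall_pos_le_add fun ε hε _ => ?_
  obtain ⟨r, hr1, hr2⟩ := ((hx ε (by simpa using hε)).and (eventually_small_radius hρ)).exists
  have hpos := h.measure_ball_pos x r hr2.1
  refine (ENNReal.mul_le_mul_iff_left hpos.ne' (measure_ne_top μ (qball d x r))).1 ?_
  calc ‖f x‖ₑ * μ (qball d x r) = ∫⁻ _ in qball d x r, ‖f x‖ₑ ∂μ := by rw [setLIntegral_const]
    _ ≤ ∫⁻ y in qball d x r, (‖f y‖ₑ + ‖f y - f x‖ₑ) ∂μ := by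
        gcongr with y
        rw [← enorm_neg (f y - f x), neg_sub]
        calc ‖f x‖ₑ = ‖f y + (f x - f y)‖ₑ := by congr 1; ring
          _ ≤ _ := enorm_add_le _ _
    _ = ∫⁻ y in qball d x r, ‖f y‖ₑ ∂μ + ∫⁻ y in qball d x r, ‖f y - f x‖ₑ ∂μ :=
        lintegral_add_left' hf.1.enorm.restrict _
    _ ≤ m * μ (qball d x r) + ε * μ (qball d x r) := add_le_add (hm r hr2.1 hr2.2) hr1
    _ = _ := by ring

/-- Almost every point of a measurable set is a density point. -/
theorem IsHomogeneousType.ae_density_point [TopologicalSpace X]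
    (hX : IsHomogeneousType d μ) (h : DoublingBalls d μ c D Cd) [IsFiniteMeasure μ]
    {s : Set X} (hs : MeasurableSet s) :
    ∀ᵐ x ∂μ, x ∉ s → ∀ ε : ℝ≥0∞, 0 < ε → ∀ᶠ r in 𝓝[>] (0:ℝ),
      μ (s ∩ qball d x r) ≤ ε * μ (qball d x r) := by
  have hi : Integrable (s.indicator fun _ => (1:ℝ)) μ := (integrable_const _).indicator hs
  filter_upwards [hX.ae_lebesgue_point h hi] with x hx hxs ε hε
  filter_upwards [hx ε hε] with r hr
  refine le_trans (le_of_eq ?_) hr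
  rw [← Measure.restrict_apply hs, ← lintegral_indicator_one hs]
  refine lintegral_congr fun y => ?_
  by_cases hy : y ∈ s <;> simp [hy, hxs]

end GrandMorrey

namespace GrandMorrey

/-! ### Calderón–Zygmund kernels and their truncations -/

/-- A Calderón–Zygmund kernel with given size and smoothness constant `C` and modulus `w`. -/
structure IsCZKernelWith {X : Type*} [MeasurableSpace X] (d : X → X → ℝ) (μ : Measure X)
    (K : X → X → ℝ) (C : ℝ) (w : ℝ → ℝ) : Prop where
  measurable : AEStronglyMeasurable (Function.uncurry K) (μ.prod μ)
  pos : 0 < C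
  dini : IsDiniModulus w
  size : ∀ x y, x ≠ y → |K x y| ≤ C / μ.real (qball d x (d x y))
  smooth : ∀ x₁ x₂ y, x₁ ≠ x₂ → x₁ ≠ y → x₂ ≠ y → C * d x₁ x₂ ≤ d x₂ y →
    |K x₁ y - K x₂ y| + |K y x₁ - K y x₂| ≤
      C * w (d x₂ x₁ / d x₂ y) * (1 / μ.real (qball d x₂ (d x₂ y)))

/-- The smoothness of the kernel with respect to a point of `B(x, r)` is available outside
`B(x, farConst c C * r)`. -/
noncomputable def farConst (c C : ℝ) : ℝ := 2 * c + C * c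

/-- The sum `∑ w(2^{-k-1})`, which is finite by the Dini condition. -/
noncomputable def diniSum (w : ℝ → ℝ) : ℝ≥0∞ := ∑' k : ℕ, ENNReal.ofReal (w ((1 / 2) ^ (k + 1)))

theorem IsDiniModulus.diniSum_lt_top {w : ℝ → ℝ} (hw : IsDiniModulus w) : diniSum w < ∞ := by
  have key : ∀ k : ℕ, ENNReal.ofReal (w ((1 / 2) ^ (k + 1))) ≤
      2 * ∫⁻ t in Ioc ((1 / 2 : ℝ) ^ (k + 1)) ((1 / 2) ^ k), ENNReal.ofReal (w t / t) := by
    intro k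
    set a : ℝ := (1 / 2) ^ (k + 1) with ha
    have hapos : 0 < a := by positivity
    have ha2 : (1 / 2 : ℝ) ^ k = 2 * a := by rw [ha, pow_succ]; ring
    rw [ha2]
    calc ENNReal.ofReal (w a) = 2 * ∫⁻ _ in Ioc a (2 * a), ENNReal.ofReal (w a / (2 * a)) := by
          rw [setLIntegral_const, Real.volume_Ioc, ← ENNReal.ofReal_mul
            (div_nonneg (hw.pos a hapos).le (by positivity)),
            show (2 : ℝ≥0∞) = ENNReal.ofReal 2 by simp, ← ENNReal.ofReal_mul zero_le_two]
          congr 1; field_simp; ring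
      _ ≤ _ := by
          gcongr 1
          refine setLIntegral_mono' measurableSet_Ioc fun t ht => ENNReal.ofReal_le_ofReal ?_
          have htpos : 0 < t := hapos.trans ht.1
          exact div_le_div₀ (hw.pos t htpos).le (hw.mono hapos htpos ht.1.le) htpos ht.2
  have hdisj : Pairwise (Function.onFun Disjoint
      fun k : ℕ => Ioc ((1 / 2 : ℝ) ^ (k + 1)) ((1 / 2) ^ k)) := by
    have hanti : Antitone fun k : ℕ => (1 / 2 : ℝ) ^ k :=
      fun a b hab => pow_le_pow_of_le_one (by norm_num) (by norm_num) hab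
    simpa using hanti.pairwise_disjoint_on_Ioc_succ
  calc diniSum w ≤ ∑' k : ℕ, 2 * ∫⁻ t in Ioc ((1 / 2 : ℝ) ^ (k + 1)) ((1 / 2) ^ k),
        ENNReal.ofReal (w t / t) := ENNReal.tsum_le_tsum key
    _ = 2 * ∫⁻ t in ⋃ k : ℕ, Ioc ((1 / 2 : ℝ) ^ (k + 1)) ((1 / 2) ^ k),
        ENNReal.ofReal (w t / t) := by
        rw [ENNReal.tsum_mul_left, lintegral_iUnion (fun _ => measurableSet_Ioc) hdisj]
    _ ≤ 2 * ∫⁻ t in Ioc 0 1, ENNReal.ofReal (w t / t) := by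
        gcongr 1
        refine lintegral_mono_set (iUnion_subset fun k t ht => ⟨?_, ht.2.trans ?_⟩)
        · exact lt_trans (by positivity) ht.1
        · exact pow_le_one₀ (by norm_num) (by norm_num)
    _ < ∞ := by
        refine ENNReal.mul_lt_top (by simp) ?_
        refine lt_of_le_of_lt (lintegral_mono fun t => ?_) hw.dini.2
        exact Real.ofReal_le_enorm _

theorem IsDiniModulus.tendsto_zero {w : ℝ → ℝ} (hw : IsDiniModulus w) :
    Tendsto (fun t => ENNReal.ofReal (w t)) (𝓝[>] 0) (𝓝 0) := by
  have h1 := ENNReal.tendsto_atTop_zero_of_tsum_ne_top hw.diniSum_lt_top.ne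
  refine ENNReal.tendsto_nhds_zero.2 fun ε hε => ?_
  obtain ⟨k, hk⟩ := (h1.eventually (gt_mem_nhds hε)).exists
  filter_upwards [eventually_small_radius (a := (1 / 2 : ℝ) ^ (k + 1)) (by positivity)] with t ht
  refine le_trans (ENNReal.ofReal_le_ofReal ?_) hk.le
  exact hw.mono ht.1 (mem_Ioi.2 (ht.1.trans ht.2)) ht.2.le

variable {X : Type*} [MeasurableSpace X] {d : X → X → ℝ} {μ ν : Measure X} {c D : ℝ} {Cd : ℝ≥0}
  {𝒢 : Set (X × ℝ)} {Λ : ℝ} {K : X → X → ℝ} {C : ℝ} {w : ℝ → ℝ}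

/-- Integration over the complement of a ball by summation over dyadic annuli. -/
theorem DoublingBalls.lintegral_annuli_le (h : DoublingBalls d μ c D Cd) {z : X} {r : ℝ}
    (hr : 0 < r) [IsFiniteMeasure μ] {u φ : X → ℝ≥0∞} (hφ : AEMeasurable φ μ) {a m : ℕ → ℝ≥0∞}
    (hu : ∀ k y, 2 ^ (k + 1) * r ≤ d z y → u y ≤ a k * (μ (qball d z (2 ^ (k + 1) * r)))⁻¹)
    (hm : ∀ k, ∫⁻ y in qball d z (2 ^ (k + 2) * r), φ y ∂μ ≤
      m k * μ (qball d z (2 ^ (k + 1) * r))) :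
    ∫⁻ y in (qball d z (2 * r))ᶜ, u y * φ y ∂μ ≤ ∑' k, a k * m k := by
  calc ∫⁻ y in (qball d z (2 * r))ᶜ, u y * φ y ∂μ
      ≤ ∫⁻ y in (qball d z (2 * r))ᶜ, ∑' k, (qball d z (2 ^ (k + 2) * r)).indicator
          (fun y => a k * (μ (qball d z (2 ^ (k + 1) * r)))⁻¹ * φ y) y ∂μ := by
        refine setLIntegral_mono' (h.measurableSet_ball _ _).compl fun y hy => ?_
        have hy : 2 * r ≤ d z y := not_lt.1 hy
        obtain ⟨k, hk1, hk2⟩ := exists_nat_pow_near (x := d z y / (2 * r)) (y := 2)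
          ((one_le_div (by positivity)).2 hy) one_lt_two
        rw [le_div_iff₀ (by positivity)] at hk1
        rw [div_lt_iff₀ (by positivity)] at hk2
        have hk1' : 2 ^ (k + 1) * r ≤ d z y := by
          rw [pow_succ]; linarith
        have hk2' : y ∈ qball d z (2 ^ (k + 2) * r) := by
          change d z y < _
          rw [pow_succ]; linarith
        refine le_trans ?_ (ENNReal.le_tsum k)
        rw [indicator_of_mem hk2']
        gcongr
        exact hu k y hk1'
    _ ≤ ∫⁻ y, ∑' k, (qball d z (2 ^ (k + 2) * r)).indicator
          (fun y => a k * (μ (qball d z (2 ^ (k + 1) * r)))⁻¹ * φ y) y ∂μ :=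
        setLIntegral_le_lintegral _ _
    _ = ∑' k, ∫⁻ y in qball d z (2 ^ (k + 2) * r),
          a k * (μ (qball d z (2 ^ (k + 1) * r)))⁻¹ * φ y ∂μ := by
        rw [lintegral_tsum fun k => (hφ.const_mul _).indicator (h.measurableSet_ball _ _)]
        simp_rw [lintegral_indicator (h.measurableSet_ball _ _)]
    _ ≤ ∑' k, a k * m k := by
        refine ENNReal.tsum_le_tsum fun k => ?_
        have hpos := h.measure_ball_pos z (2 ^ (k + 1) * r) (by positivity)
        rw [lintegral_const_mul'' _ hφ.restrict]
        calc a k * (μ (qball d z (2 ^ (k + 1) * r)))⁻¹ *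
              ∫⁻ y in qball d z (2 ^ (k + 2) * r), φ y ∂μ
            ≤ a k * (μ (qball d z (2 ^ (k + 1) * r)))⁻¹ *
              (m k * μ (qball d z (2 ^ (k + 1) * r))) := by gcongr; exact hm k
          _ = a k * m k * ((μ (qball d z (2 ^ (k + 1) * r)))⁻¹ *
              μ (qball d z (2 ^ (k + 1) * r))) := by ring
          _ = a k * m k := by
              rw [ENNReal.inv_mul_cancel hpos.ne' (measure_ne_top _ _), mul_one]

theorem ofReal_div_measureReal (h : DoublingBalls d μ c D Cd) [IsFiniteMeasure μ] (a : ℝ) {x : X}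
    {r : ℝ} (hr : 0 < r) :
    ENNReal.ofReal (a / μ.real (qball d x r)) = ENNReal.ofReal a * (μ (qball d x r))⁻¹ := by
  have hpos := h.measure_ball_pos x r hr
  have hpos' : 0 < μ.real (qball d x r) := ENNReal.toReal_pos hpos.ne' (measure_ne_top _ _)
  rw [ENNReal.ofReal_div_of_pos hpos', ofReal_measureReal, div_eq_mul_inv]

namespace IsCZKernelWith

theorem enorm_le (hK : IsCZKernelWith d μ K C w) (h : DoublingBalls d μ c D Cd)
    [IsFiniteMeasure μ] {x y : X} {η : ℝ} (hη : 0 < η) (hxy : η ≤ d x y) :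
    ‖K x y‖ₑ ≤ ENNReal.ofReal C * (μ (qball d x η))⁻¹ := by
  have hne : x ≠ y := by
    rintro rfl
    rw [h.self_eq] at hxy
    linarith
  calc ‖K x y‖ₑ = ENNReal.ofReal |K x y| := Real.enorm_eq_ofReal_abs _
    _ ≤ ENNReal.ofReal (C / μ.real (qball d x (d x y))) :=
        ENNReal.ofReal_le_ofReal (hK.size x y hne)
    _ = ENNReal.ofReal C * (μ (qball d x (d x y)))⁻¹ :=
        ofReal_div_measureReal h C (hη.trans_le hxy)
    _ ≤ _ := by gcongr; exact qball_mono d x hxy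

theorem two_le_farConst (hK : IsCZKernelWith d μ K C w) (h : DoublingBalls d μ c D Cd) :
    2 * c ≤ farConst c C ∧ C * c ≤ farConst c C ∧ 2 ≤ farConst c C := by
  have h1 := h.one_le
  have h2 := mul_pos hK.pos h.cpos
  unfold farConst
  exact ⟨by linarith, by linarith, by linarith⟩

/-- Smoothness of the kernel in either variable, in terms of balls. -/
theorem enorm_sub_add_le (hK : IsCZKernelWith d μ K C w) (h : DoublingBalls d μ c D Cd)
    [IsFiniteMeasure μ] {x x' y : X} {r : ℝ} (hx' : x' ∈ qball d x r)
    (hy : farConst c C * r ≤ d x y) :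
    ‖K x' y - K x y‖ₑ + ‖K y x' - K y x‖ₑ ≤
      ENNReal.ofReal (C * w (r / d x y)) * (μ (qball d x (d x y)))⁻¹ := by
  have hr := h.pos_of_mem hx'
  obtain ⟨hL1, hL2, hL3⟩ := hK.two_le_farConst h
  rcases eq_or_ne x' x with rfl | hne
  · simp
  have hx'r : d x x' < r := hx'
  have hry : 2 * r ≤ d x y := le_trans (by gcongr) hy
  have hdpos : 0 < d x y := by linarith
  have hxy : x ≠ y := by
    rintro rfl
    rw [h.self_eq] at hdpos
    exact lt_irrefl _ hdpos
  have hx'y : x' ≠ y := by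
    rintro rfl
    linarith
  have hcond : C * d x' x ≤ d x y := by
    have h1 := h.symm x' x
    have hCc := hK.pos
    calc C * d x' x ≤ C * (c * r) := by
          gcongr
          exact h1.trans (by have := h.cpos; gcongr)
      _ = C * c * r := by ring
      _ ≤ farConst c C * r := by gcongr
      _ ≤ _ := hy
  have hd' : 0 < d x x' := h.pos_of_ne hne.symm
  have hs := hK.smooth x' x y hne hx'y hxy hcond
  rw [Real.enorm_eq_ofReal_abs, Real.enorm_eq_ofReal_abs,
    ← ENNReal.ofReal_add (abs_nonneg _) (abs_nonneg _), ← ofReal_div_measureReal h _ hdpos]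
  refine ENNReal.ofReal_le_ofReal (hs.trans ?_)
  rw [mul_one_div]
  have hCc := hK.pos
  gcongr
  exact hK.dini.mono (mem_Ioi.2 (by positivity)) (mem_Ioi.2 (by positivity)) (by gcongr)

/-- Smoothness of the kernel on the dyadic annuli around `x`, where it decays like `w (2^{-k-1})`.
-/
theorem enorm_sub_add_le_annulus (hK : IsCZKernelWith d μ K C w) (h : DoublingBalls d μ c D Cd)
    [IsFiniteMeasure μ] {x x' y : X} {r : ℝ} (hx' : x' ∈ qball d x r)
    (hy : farConst c C * r ≤ d x y) (k : ℕ) (hk : 2 ^ (k + 1) * r ≤ d x y) :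
    ‖K x' y - K x y‖ₑ + ‖K y x' - K y x‖ₑ ≤
      ENNReal.ofReal C * ENNReal.ofReal (w ((1 / 2) ^ (k + 1))) *
        (μ (qball d x (2 ^ (k + 1) * r)))⁻¹ := by
  have hr := h.pos_of_mem hx'
  have hpos : 0 < d x y := lt_of_lt_of_le (by positivity) hk
  refine (hK.enorm_sub_add_le h hx' hy).trans ?_
  have hw : w (r / d x y) ≤ w ((1 / 2) ^ (k + 1)) := by
    refine hK.dini.mono (mem_Ioi.2 (by positivity)) (mem_Ioi.2 (by positivity)) ?_
    rw [div_le_iff₀ hpos, one_div, inv_pow, ← div_eq_inv_mul, le_div_iff₀ (by positivity)]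
    linarith
  rw [← ENNReal.ofReal_mul hK.pos.le]
  have hCc := hK.pos
  gcongr
  exact qball_mono d x hk

/-- Smoothness integrated against a function whose averages over balls are bounded. -/
theorem lintegral_smooth_le (hK : IsCZKernelWith d μ K C w) (h : DoublingBalls d μ c D Cd)
    [IsFiniteMeasure μ] {x : X} {r : ℝ} (hr : 0 < r) {u φ : X → ℝ≥0∞}
    (hφ : AEMeasurable φ μ) {m : ℝ≥0∞}
    (hu : ∀ (k : ℕ) y, farConst c C * r ≤ d x y → 2 ^ (k + 1) * r ≤ d x y → u y ≤
      ENNReal.ofReal C * ENNReal.ofReal (w ((1 / 2) ^ (k + 1))) *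
        (μ (qball d x (2 ^ (k + 1) * r)))⁻¹)
    (hm : ∀ ρ, r ≤ ρ → ∫⁻ y in qball d x ρ, φ y ∂μ ≤ m * μ (qball d x ρ)) :
    ∫⁻ y in (qball d x (farConst c C * r))ᶜ, u y * φ y ∂μ ≤
      ENNReal.ofReal C * diniSum w * Cd * m := by
  obtain ⟨-, -, hL3⟩ := hK.two_le_farConst h
  have hsub : (qball d x (farConst c C * r))ᶜ ⊆ (qball d x (2 * r))ᶜ :=
    compl_subset_compl.2 (qball_mono d x (by gcongr))
  have hms := (h.measurableSet_ball x (farConst c C * r)).compl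
  have h1 := h.lintegral_annuli_le (z := x) hr
    (u := (qball d x (farConst c C * r))ᶜ.indicator u) hφ
    (a := fun k => ENNReal.ofReal C * ENNReal.ofReal (w ((1 / 2) ^ (k + 1))))
    (m := fun _ => Cd * m) (fun k y hy => ?_) (fun k => ?_)
  · calc ∫⁻ y in (qball d x (farConst c C * r))ᶜ, u y * φ y ∂μ
        = ∫⁻ y in (qball d x (farConst c C * r))ᶜ,
            (qball d x (farConst c C * r))ᶜ.indicator u y * φ y ∂μ :=
          setLIntegral_congr_fun hms fun y hy => by simp only [indicator_of_mem hy]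
      _ ≤ _ := (lintegral_mono_set hsub).trans h1
      _ = _ := by
          rw [ENNReal.tsum_mul_right, ENNReal.tsum_mul_left, diniSum]; ring
  · by_cases hyy : y ∈ (qball d x (farConst c C * r))ᶜ
    · rw [indicator_of_mem hyy]
      exact hu k y (not_lt.1 hyy) hy
    · rw [indicator_of_notMem hyy]; exact zero_le
  · have h2 : (r : ℝ) ≤ 2 ^ (k + 2) * r :=
      le_mul_of_one_le_left hr.le (one_le_pow₀ one_le_two)
    calc _ ≤ m * μ (qball d x (2 ^ (k + 2) * r)) := hm _ h2
      _ = m * μ (qball d x (2 * (2 ^ (k + 1) * r))) := by ring_nf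
      _ ≤ m * (Cd * μ (qball d x (2 ^ (k + 1) * r))) := by
          gcongr; exact h.doubling _ _ (by positivity)
      _ = _ := by ring

theorem aestronglyMeasurable (hK : IsCZKernelWith d μ K C w) (h : DoublingBalls d μ c D Cd)
    [IsFiniteMeasure μ] [NullSingletonClass μ] (x : X) : AEStronglyMeasurable (K x) μ := by
  -- the smoothness of the kernel propagates measurability from almost every `x` to every `x`
  have hae : ∀ᵐ x ∂μ, AEStronglyMeasurable (K x) μ := hK.measurable.prodMk_left
  have hex : ∀ n : ℕ, ∃ x', x' ∈ qball d x (1 / ((n:ℝ) + 1)) ∧ AEStronglyMeasurable (K x') μ := by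
    intro n
    by_contra hcon
    push Not at hcon
    have hpos := h.measure_ball_pos x (1 / ((n:ℝ) + 1)) (by positivity)
    exact hpos.ne' (measure_mono_null (fun x' hx' => hcon x' hx') (ae_iff.1 hae))
  choose xs hxs hxm using hex
  have hnull : ∀ᵐ y ∂μ, y ≠ x := by simp [ae_iff]
  refine aestronglyMeasurable_of_tendsto_ae atTop hxm ?_
  filter_upwards [hnull] with y hy
  have hpos : 0 < d x y := h.pos_of_ne hy.symm
  rw [tendsto_iff_edist_tendsto_0]
  have hr0 : Tendsto (fun n : ℕ => 1 / ((n:ℝ) + 1)) atTop (𝓝 0) :=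
    tendsto_one_div_add_atTop_nhds_zero_nat
  have h1 : Tendsto (fun n : ℕ => (1 / ((n:ℝ) + 1)) / d x y) atTop (𝓝[>] 0) := by
    refine tendsto_nhdsWithin_iff.2 ⟨?_, Eventually.of_forall fun n => ?_⟩
    · simpa using hr0.div_const (d x y)
    · exact mem_Ioi.2 (by positivity)
  have h2 : Tendsto (fun n : ℕ => ENNReal.ofReal (C * w ((1 / ((n:ℝ) + 1)) / d x y)) *
      (μ (qball d x (d x y)))⁻¹) atTop (𝓝 0) := by
    have h3 := hK.dini.tendsto_zero.comp h1
    have h4 : Tendsto (fun n : ℕ => ENNReal.ofReal C * ENNReal.ofReal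
        (w ((1 / ((n:ℝ) + 1)) / d x y)) * (μ (qball d x (d x y)))⁻¹) atTop
        (𝓝 (ENNReal.ofReal C * 0 * (μ (qball d x (d x y)))⁻¹)) := by
      refine ENNReal.Tendsto.mul_const (ENNReal.Tendsto.const_mul h3 (Or.inr ?_)) (Or.inr ?_)
      · simp
      · simpa using (h.measure_ball_pos x _ hpos).ne'
    simpa [ENNReal.ofReal_mul hK.pos.le] using h4
  refine tendsto_of_tendsto_of_tendsto_of_le_of_le' tendsto_const_nhds h2
    (Eventually.of_forall fun n => zero_le) ?_
  have h5 : Tendsto (fun n : ℕ => farConst c C * (1 / ((n:ℝ) + 1))) atTop (𝓝 0) := by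
    simpa using hr0.const_mul (farConst c C)
  filter_upwards [h5.eventually (gt_mem_nhds hpos)] with n hn
  rw [edist_eq_enorm_sub]
  exact le_self_add.trans (hK.enorm_sub_add_le h (hxs n) hn.le)

theorem integrableOn (hK : IsCZKernelWith d μ K C w) (h : DoublingBalls d μ c D Cd)
    [IsFiniteMeasure μ] [NullSingletonClass μ] {f : X → ℝ} (hf : Integrable f μ) {x : X} {η : ℝ} (hη : 0 < η)
    {s : Set X} (hs : MeasurableSet s) (hsη : ∀ y ∈ s, η ≤ d x y) :
    IntegrableOn (fun y => K x y * f y) s μ := by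
  refine ⟨((hK.aestronglyMeasurable h x).mul hf.1).restrict, ?_⟩
  have hpos := h.measure_ball_pos x η hη
  calc ∫⁻ y in s, ‖K x y * f y‖ₑ ∂μ
      ≤ ∫⁻ y in s, (ENNReal.ofReal C * (μ (qball d x η))⁻¹) * ‖f y‖ₑ ∂μ := by
        refine setLIntegral_mono' hs fun y hy => ?_
        rw [enorm_mul]
        gcongr
        exact hK.enorm_le h hη (hsη y hy)
    _ = (ENNReal.ofReal C * (μ (qball d x η))⁻¹) * ∫⁻ y in s, ‖f y‖ₑ ∂μ :=
        lintegral_const_mul'' _ hf.1.enorm.restrict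
    _ < ∞ := by
        refine ENNReal.mul_lt_top (ENNReal.mul_lt_top (by simp) (by simpa using hpos))
          (lt_of_le_of_lt (setLIntegral_le_lintegral _ _) hf.2)

theorem integrableOn_compl (hK : IsCZKernelWith d μ K C w) (h : DoublingBalls d μ c D Cd)
    [IsFiniteMeasure μ] [NullSingletonClass μ] {f : X → ℝ} (hf : Integrable f μ) (x : X) {η : ℝ}
    (hη : 0 < η) : IntegrableOn (fun y => K x y * f y) (qball d x η)ᶜ μ :=
  hK.integrableOn h hf hη (h.measurableSet_ball _ _).compl fun _ hy => not_lt.1 hy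

theorem enorm_setIntegral_le (hK : IsCZKernelWith d μ K C w) (h : DoublingBalls d μ c D Cd)
    [IsFiniteMeasure μ] {f : X → ℝ} (hf : AEStronglyMeasurable f μ) {x : X} {η : ℝ} (hη : 0 < η)
    {s : Set X} (hs : MeasurableSet s) (hsη : ∀ y ∈ s, η ≤ d x y) :
    ‖∫ y in s, K x y * f y ∂μ‖ₑ ≤
      ENNReal.ofReal C * (μ (qball d x η))⁻¹ * ∫⁻ y in s, ‖f y‖ₑ ∂μ := by
  refine (enorm_integral_le_lintegral_enorm _).trans ?_
  rw [← lintegral_const_mul'' _ hf.enorm.restrict]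
  refine setLIntegral_mono' hs fun y hy => ?_
  rw [enorm_mul]
  gcongr
  exact hK.enorm_le h hη (hsη y hy)

theorem ball_subset_far (hK : IsCZKernelWith d μ K C w) (h : DoublingBalls d μ c D Cd)
    {x x' : X} {r : ℝ} (hx' : x' ∈ qball d x r) :
    qball d x' r ⊆ qball d x (farConst c C * r) := by
  obtain ⟨hL1, -, -⟩ := hK.two_le_farConst h
  intro u hu
  have hr := h.pos_of_mem hx'
  have h1 := h.triangle x u x'
  have h2 : d x x' < r := hx'
  have h3 : d x' u < r := hu
  change d x u < _
  calc d x u ≤ c * (d x x' + d x' u) := h1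
    _ < c * (2 * r) := by have := h.cpos; gcongr; linarith
    _ = 2 * c * r := by ring
    _ ≤ _ := by gcongr

/-- The far part of `T f` varies little over a ball. -/
theorem enorm_far_sub_le (hK : IsCZKernelWith d μ K C w) (h : DoublingBalls d μ c D Cd)
    [IsFiniteMeasure μ] [NullSingletonClass μ] {f : X → ℝ} (hf : Integrable f μ) {x x' : X} {r : ℝ}
    (hx' : x' ∈ qball d x r) {m : ℝ≥0∞}
    (hm : ∀ ρ, r ≤ ρ → ∫⁻ y in qball d x ρ, ‖f y‖ₑ ∂μ ≤ m * μ (qball d x ρ)) :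
    ‖∫ y in (qball d x (farConst c C * r))ᶜ, K x' y * f y ∂μ -
        truncated d μ K f (farConst c C * r) x‖ₑ ≤
      ENNReal.ofReal C * diniSum w * Cd * m := by
  have hr := h.pos_of_mem hx'
  obtain ⟨-, -, hL3⟩ := hK.two_le_farConst h
  have hms := (h.measurableSet_ball x (farConst c C * r)).compl
  have hi' : IntegrableOn (fun y => K x' y * f y) (qball d x (farConst c C * r))ᶜ μ :=
    hK.integrableOn h hf hr hms fun y hy =>
      not_lt.1 fun hlt => hy (hK.ball_subset_far h hx' hlt)
  have hi : IntegrableOn (fun y => K x y * f y) (qball d x (farConst c C * r))ᶜ μ :=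
    hK.integrableOn_compl h hf x (by positivity)
  rw [truncated, ← integral_sub hi' hi]
  refine (enorm_integral_le_lintegral_enorm _).trans ?_
  have h1 := hK.lintegral_smooth_le h hr (u := fun y => ‖K x' y - K x y‖ₑ) hf.1.enorm
    (fun k y hy hk => le_self_add.trans (hK.enorm_sub_add_le_annulus h hx' hy k hk)) hm
  refine le_trans (le_of_eq ?_) h1
  refine lintegral_congr fun y => ?_
  rw [← enorm_mul, sub_mul]

/-- Comparison of truncated integrals at nearby points and scales. -/
theorem enorm_truncated_sub_le (hK : IsCZKernelWith d μ K C w) (h : DoublingBalls d μ c D Cd)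
    [IsFiniteMeasure μ] [NullSingletonClass μ] {f : X → ℝ} (hf : Integrable f μ) {x x' : X} {r η : ℝ}
    (hx' : x' ∈ qball d x r) (hη : 0 < η) (hsub : qball d x' η ⊆ qball d x (farConst c C * r))
    {m : ℝ≥0∞} (hm : ∀ ρ, r ≤ ρ → ∫⁻ y in qball d x ρ, ‖f y‖ₑ ∂μ ≤ m * μ (qball d x ρ)) :
    ‖truncated d μ K f η x' - truncated d μ K f (farConst c C * r) x‖ₑ ≤
      ENNReal.ofReal C * (μ (qball d x' η))⁻¹ * (m * μ (qball d x (farConst c C * r))) +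
      ENNReal.ofReal C * diniSum w * Cd * m := by
  obtain ⟨-, -, hL3⟩ := hK.two_le_farConst h
  have hr := h.pos_of_mem hx'
  set S := qball d x (farConst c C * r) \ qball d x' η with hS
  have hSm : MeasurableSet S := (h.measurableSet_ball _ _).diff (h.measurableSet_ball _ _)
  have hBm := (h.measurableSet_ball x (farConst c C * r)).compl
  have hunion : (qball d x' η)ᶜ = S ∪ (qball d x (farConst c C * r))ᶜ := by
    ext y
    have := @hsub y
    simp only [hS, mem_compl_iff, mem_union, Set.mem_sdiff]
    tauto
  have hdisj : Disjoint S (qball d x (farConst c C * r))ᶜ :=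
    disjoint_compl_right.mono_left sdiff_subset
  have hi := hK.integrableOn_compl h hf x' hη
  have heq : truncated d μ K f η x' = ∫ y in S, K x' y * f y ∂μ +
      ∫ y in (qball d x (farConst c C * r))ᶜ, K x' y * f y ∂μ := by
    rw [truncated, hunion]
    rw [hunion] at hi
    exact setIntegral_union hdisj hBm (hi.mono_set subset_union_left)
      (hi.mono_set subset_union_right)
  rw [heq, add_sub_assoc]
  refine (enorm_add_le _ _).trans (add_le_add ?_ (hK.enorm_far_sub_le h hf hx' hm))
  refine (hK.enorm_setIntegral_le h hf.1 hη hSm fun y hy => not_lt.1 hy.2).trans ?_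
  gcongr
  refine (lintegral_mono_set sdiff_subset).trans (hm _ ?_)
  exact le_mul_of_one_le_left hr.le (by linarith)

end IsCZKernelWith

/-! ### Principal values -/

theorem PVExistsAt.tendsto {f : X → ℝ} {x : X} (hf : PVExistsAt d μ K f x) :
    Tendsto (fun η => truncated d μ K f η x) (𝓝[>] 0) (𝓝 (pvOperator d μ K f x)) := by
  obtain ⟨l, hl⟩ := hf.2
  rwa [pvOperator, hl.limUnder_eq]

theorem pvExistsAt_of_tendsto {f : X → ℝ} {x : X} {l : ℝ}
    (hi : ∀ η : ℝ, 0 < η → IntegrableOn (fun y => K x y * f y) (qball d x η)ᶜ μ)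
    (hl : Tendsto (fun η => truncated d μ K f η x) (𝓝[>] 0) (𝓝 l)) :
    PVExistsAt d μ K f x ∧ pvOperator d μ K f x = l :=
  ⟨⟨hi, l, hl⟩, hl.limUnder_eq⟩

theorem PVExistsAt.add {f g : X → ℝ} {x : X} (hf : PVExistsAt d μ K f x)
    (hg : PVExistsAt d μ K g x) : PVExistsAt d μ K (fun y => f y + g y) x ∧
      pvOperator d μ K (fun y => f y + g y) x = pvOperator d μ K f x + pvOperator d μ K g x := by
  refine pvExistsAt_of_tendsto (fun η hη => ?_) ((hf.tendsto.add hg.tendsto).congr' ?_)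
  · simp only [mul_add]
    exact Integrable.add (hf.1 η hη) (hg.1 η hη)
  · filter_upwards [self_mem_nhdsWithin] with η hη
    simp only [truncated, mul_add]
    exact (integral_add (hf.1 η hη) (hg.1 η hη)).symm

theorem PVExistsAt.const_mul {f : X → ℝ} {x : X} (a : ℝ) (hf : PVExistsAt d μ K f x) :
    PVExistsAt d μ K (fun y => a * f y) x ∧
      pvOperator d μ K (fun y => a * f y) x = a * pvOperator d μ K f x := by
  refine pvExistsAt_of_tendsto (fun η hη => ?_) ((hf.tendsto.const_mul a).congr fun η => ?_)
  · simp only [mul_left_comm _ a]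
    exact Integrable.const_mul (hf.1 η hη) a
  · simp only [truncated, mul_left_comm _ a, integral_const_mul]

theorem PVExistsAt.sub {f g : X → ℝ} {x : X} (hf : PVExistsAt d μ K f x)
    (hg : PVExistsAt d μ K g x) : PVExistsAt d μ K (fun y => f y - g y) x ∧
      pvOperator d μ K (fun y => f y - g y) x = pvOperator d μ K f x - pvOperator d μ K g x := by
  have h1 := hg.const_mul (-1)
  have h2 := hf.add h1.1
  rw [h1.2] at h2
  simp only [neg_one_mul, ← sub_eq_add_neg] at h2
  exact h2

theorem PVExistsAt.congr_ae {f g : X → ℝ} {x : X} (hf : PVExistsAt d μ K f x) (hfg : f =ᵐ[μ] g) :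
    PVExistsAt d μ K g x ∧ pvOperator d μ K g x = pvOperator d μ K f x := by
  have hc : (fun y => K x y * f y) =ᵐ[μ] fun y => K x y * g y :=
    hfg.mono fun y hy => by simp only [hy]
  refine pvExistsAt_of_tendsto (fun η hη => (hf.1 η hη).congr (ae_restrict_of_ae hc))
    (hf.tendsto.congr fun η => integral_congr_ae (ae_restrict_of_ae hc))

/-- If `f` vanishes near `x`, the principal value is an ordinary integral. -/
theorem IsCZKernelWith.pv_of_far (hK : IsCZKernelWith d μ K C w) (h : DoublingBalls d μ c D Cd)
    [IsFiniteMeasure μ] [NullSingletonClass μ] {f : X → ℝ} (hf : Integrable f μ) {x : X} {η : ℝ} (hη : 0 < η)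
    {s : Set X} (hs : MeasurableSet s) (hsη : ∀ y ∈ s, η ≤ d x y) :
    PVExistsAt d μ K (s.indicator f) x ∧
      pvOperator d μ K (s.indicator f) x = ∫ y in s, K x y * f y ∂μ := by
  have hind : ∀ y, K x y * s.indicator f y = s.indicator (fun y => K x y * f y) y := fun y => by
    by_cases hy : y ∈ s <;> simp [hy]
  refine pvExistsAt_of_tendsto (fun ρ hρ => ?_) (tendsto_const_nhds.congr' ?_)
  · exact hK.integrableOn_compl h (hf.indicator hs) x hρ
  · filter_upwards [eventually_small_radius hη] with ρ hρ
    simp only [truncated, hind]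
    rw [setIntegral_indicator hs]
    congr 2
    ext y
    simp only [mem_inter_iff, mem_compl_iff]
    refine ⟨fun hy => ⟨fun hlt => ?_, hy⟩, fun hy => hy.2⟩
    have h1 : d x y < ρ := hlt
    linarith [hsη y hy, hρ.2]

/-- Splitting a principal value at a point of `B(x, r)` into a local part and a far part. -/
theorem IsCZKernelWith.pv_split (hK : IsCZKernelWith d μ K C w) (h : DoublingBalls d μ c D Cd)
    [IsFiniteMeasure μ] [NullSingletonClass μ] {f : X → ℝ} (hf : Integrable f μ) {x x' : X} {r : ℝ}
    (hx' : x' ∈ qball d x r) (hpv : PVExistsAt d μ K f x') :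
    PVExistsAt d μ K ((qball d x (farConst c C * r)).indicator f) x' ∧
      pvOperator d μ K f x' = pvOperator d μ K ((qball d x (farConst c C * r)).indicator f) x' +
        ∫ y in (qball d x (farConst c C * r))ᶜ, K x' y * f y ∂μ := by
  have h1 := hK.pv_of_far h hf (h.pos_of_mem hx') (h.measurableSet_ball x (farConst c C * r)).compl
    (fun y hy => not_lt.1 fun hlt => hy (hK.ball_subset_far h hx' hlt))
  have h2 := hpv.sub h1.1
  have h3 : (fun y => f y - (qball d x (farConst c C * r))ᶜ.indicator f y) =
      (qball d x (farConst c C * r)).indicator f := by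
    funext y
    by_cases hy : y ∈ qball d x (farConst c C * r) <;> simp [hy]
  rw [h3, h1.2] at h2
  exact ⟨h2.1, by rw [h2.2]; ring⟩

end GrandMorrey

namespace GrandMorrey

/-! ### Calderón–Zygmund decomposition -/

variable {X : Type*} [MeasurableSpace X] {d : X → X → ℝ} {μ ν : Measure X} {c D : ℝ} {Cd : ℝ≥0}
  {𝒢 : Set (X × ℝ)} {Λ : ℝ} {K : X → X → ℝ} {C : ℝ} {w : ℝ → ℝ}

/-- A Whitney-type decomposition of the set `{M φ > α}`: disjoint measurable sets `Q B` which
partition it, each squeezed between a ball `B` and its dilate, over which the average of `φ` is at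
most a multiple of `α`. The balls themselves are indexed by `u`. -/
structure IsCZCover (d : X → X → ℝ) (μ : Measure X) (c : ℝ) (φ : X → ℝ≥0∞) (α C₂ : ℝ≥0∞)
    (Ω : Set X) (u : Set (X × ℝ)) (Q : X × ℝ → Set X) : Prop where
  countable : u.Countable
  pos : ∀ B ∈ u, 0 < B.2
  measurableSet : ∀ B ∈ u, MeasurableSet (Q B)
  ball_subset : ∀ B ∈ u, qball d B.1 B.2 ⊆ Q B
  subset_ball : ∀ B ∈ u, Q B ⊆ qball d B.1 (engulfConst c 2 * B.2)
  disjoint : u.PairwiseDisjoint Q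
  iUnion_eq : ⋃ B ∈ u, Q B = Ω
  lintegral_le : ∀ B ∈ u, ∫⁻ y in qball d B.1 (engulfConst c 2 * B.2), φ y ∂μ ≤
    C₂ * α * μ (qball d B.1 B.2)

theorem DoublingBalls.two_lt_engulfConst (h : DoublingBalls d μ c D Cd) : 2 < engulfConst c 2 := by
  have := h.le_engulfConst (t := 2) zero_le_two
  linarith

/-- The balls are selected from those of the basis on which the average of `φ` exceeds `α`. The
hypothesis on `α` excludes the whole space, so that their radii are bounded. -/
theorem DoublingBalls.exists_czCover (h : DoublingBalls d μ c D Cd) [IsFiniteMeasure μ]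
    (h𝒢 : IsBallBasis d 𝒢 Λ) {φ : X → ℝ≥0∞} {α : ℝ≥0∞} (hα : ∫⁻ y, φ y ∂μ < α * μ univ) :
    ∃ u Q, IsCZCover d μ c φ α (compConst c Cd Λ * compConst c Cd 2)
      {x | α < maxFn d 𝒢 μ φ x} u Q := by
  set Ω := {x | α < maxFn d 𝒢 μ φ x} with hΩdef
  have hΩm : MeasurableSet Ω := measurableSet_lt measurable_const (measurable_maxFn h h𝒢 φ)
  set t : Set (X × ℝ) := {B | B ∈ 𝒢 ∧
    α < (μ (qball d B.1 B.2))⁻¹ * ∫⁻ y in qball d B.1 B.2, φ y ∂μ} with ht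
  have hΩ : Ω = ⋃ B ∈ t, qball d B.1 B.2 := by
    ext x
    simp only [hΩdef, mem_ofPred_eq, lt_maxFn_iff, mem_iUnion, exists_prop, ht]
    exact exists_congr fun B => by tauto
  have hnott : ∀ B ∈ 𝒢, B ∉ t → ∫⁻ y in qball d B.1 B.2, φ y ∂μ ≤ α * μ (qball d B.1 B.2) := by
    intro B hB hBt
    have h1 : (μ (qball d B.1 B.2))⁻¹ * ∫⁻ y in qball d B.1 B.2, φ y ∂μ ≤ α :=
      not_lt.1 fun hlt => hBt ⟨hB, hlt⟩
    have hpos := h.measure_ball_pos B.1 B.2 (h𝒢.pos B hB)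
    rwa [mul_comm, ← div_eq_mul_inv, ENNReal.div_le_iff hpos.ne' (measure_ne_top _ _)] at h1
  have hsmall : ∀ B ∈ t, B.2 ≤ D := by
    intro B hB
    by_contra hcon
    push Not at hcon
    have h1 := hB.2
    rw [h.ball_eq_univ _ hcon.le, Measure.restrict_univ] at h1
    refine absurd h1 (not_lt.2 ?_)
    have hpos : 0 < μ univ :=
      (h.measure_ball_pos B.1 B.2 (h𝒢.pos B hB.1)).trans_le (measure_mono (subset_univ _))
    rw [mul_comm, ← div_eq_mul_inv, ENNReal.div_le_iff hpos.ne' (measure_ne_top _ _)]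
    exact hα.le
  obtain ⟨u, hut, hdisj, hcov, hmax⟩ := h.exists_covering t (fun B hB => h𝒢.pos B hB.1) D hsmall
  have huc : u.Countable := h𝒢.countable.mono fun B hB => (hut hB).1
  obtain ⟨e, he⟩ := countable_iff_exists_injOn.1 huc
  set κ := engulfConst c 2 with hκ
  -- a point of `Ω` outside all the selected balls goes to the first dilate that contains it
  set Q : X × ℝ → Set X := fun B => qball d B.1 B.2 ∪
    ((Ω ∩ qball d B.1 (κ * B.2)) \ ((⋃ B' ∈ u, qball d B'.1 B'.2) ∪
      ⋃ B' ∈ {B' ∈ u | e B' < e B}, qball d B'.1 (κ * B'.2))) with hQ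
  have hκ2 : 2 < κ := h.two_lt_engulfConst
  have hsubκ : ∀ B ∈ u, qball d B.1 B.2 ⊆ qball d B.1 (κ * B.2) := fun B hB => by
    have := h𝒢.pos B (hut hB).1
    exact qball_mono d _ (by nlinarith)
  have hballΩ : ∀ B ∈ u, qball d B.1 B.2 ⊆ Ω := fun B hB => by
    rw [hΩ]; exact subset_biUnion_of_mem (u := fun B : X × ℝ => qball d B.1 B.2) (hut hB)
  refine ⟨u, Q, huc, fun B hB => h𝒢.pos B (hut hB).1, fun B hB => ?_, fun B hB =>
    subset_union_left, fun B hB => ?_, ?_, ?_, fun B hB => ?_⟩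
  · refine (h.measurableSet_ball _ _).union ((hΩm.inter (h.measurableSet_ball _ _)).diff
      ((MeasurableSet.biUnion huc fun _ _ => h.measurableSet_ball _ _).union
      (MeasurableSet.biUnion (huc.mono fun B' hB' => hB'.1) fun _ _ => h.measurableSet_ball _ _)))
  · exact union_subset (hsubκ B hB) (sdiff_subset.trans inter_subset_right)
  · intro B hB B' hB' hne
    have hsymm : ∀ B ∈ u, ∀ B' ∈ u, e B < e B' → Disjoint (Q B) (Q B') := by
      intro B hB B' hB' hlt
      rw [Set.disjoint_left]
      rintro x (hx | hx) (hx' | hx')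
      · have hne' : B ≠ B' := by rintro rfl; exact lt_irrefl _ hlt
        exact Set.disjoint_left.1 (hdisj hB hB' hne') hx hx'
      · exact hx'.2 (Or.inl (mem_biUnion hB hx))
      · exact hx.2 (Or.inl (mem_biUnion hB' hx'))
      · exact hx'.2 (Or.inr (mem_biUnion (show B ∈ {B'' ∈ u | e B'' < e B'} from ⟨hB, hlt⟩)
          hx.1.2))
    rcases lt_trichotomy (e B) (e B') with hlt | heq | hgt
    · exact hsymm B hB B' hB' hlt
    · exact absurd (he hB hB' heq) hne
    · exact (hsymm B' hB' B hB hgt).symm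
  · refine Subset.antisymm (iUnion₂_subset fun B hB => union_subset (hballΩ B hB)
      (sdiff_subset.trans inter_subset_left)) fun x hx => ?_
    by_cases hx1 : x ∈ ⋃ B' ∈ u, qball d B'.1 B'.2
    · simp only [mem_iUnion, exists_prop] at hx1
      obtain ⟨B, hB, hxB⟩ := hx1
      exact mem_biUnion hB (Or.inl hxB)
    · have hx2 : ∃ n, ∃ B ∈ u, e B = n ∧ x ∈ qball d B.1 (κ * B.2) := by
        have := hcov (hΩ ▸ hx)
        simp only [mem_iUnion, exists_prop] at this
        obtain ⟨B, hB, hxB⟩ := this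
        exact ⟨e B, B, hB, rfl, hxB⟩
      classical
      obtain ⟨B, hB, heB, hxB⟩ := Nat.find_spec hx2
      refine mem_biUnion hB (Or.inr ⟨⟨hx, hxB⟩, ?_⟩)
      rintro (hx3 | hx3)
      · exact hx1 hx3
      · simp only [mem_iUnion, exists_prop] at hx3
        obtain ⟨B', ⟨hB', hlt⟩, hxB'⟩ := hx3
        exact Nat.find_min hx2 (heB ▸ hlt) ⟨B', hB', rfl, hxB'⟩
  · -- a ball of twice the near-maximal radius has a small average
    obtain ⟨x, hxB, hxmax⟩ := hmax B hB
    have hr := h𝒢.pos B (hut hB).1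
    have hκr : 0 < κ * B.2 := by positivity
    obtain ⟨B', hB', hsub, h1, h2⟩ := h𝒢.exists_superset B.1 (κ * B.2) hκr
    have hxκ := hsubκ B hB hxB
    have hB't : B' ∉ t := fun hcon => by
      have := hxmax B' hcon (hsub hxκ)
      nlinarith
    calc ∫⁻ y in qball d B.1 (κ * B.2), φ y ∂μ ≤ ∫⁻ y in qball d B'.1 B'.2, φ y ∂μ :=
          lintegral_mono_set hsub
      _ ≤ α * μ (qball d B'.1 B'.2) := hnott B' hB' hB't
      _ ≤ α * (compConst c Cd Λ * (compConst c Cd 2 * μ (qball d B.1 B.2))) := by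
          gcongr
          refine (h.measure_le_of_inter h2 hκr ⟨x, hxκ, hsub hxκ⟩).trans ?_
          gcongr
          exact h.measure_engulf_le 2 _ hr
      _ = _ := by ring

section

variable {φ : X → ℝ≥0∞} {α C₂ : ℝ≥0∞} {Ω : Set X} {u : Set (X × ℝ)} {Q : X × ℝ → Set X}

theorem IsCZCover.measurableSet_union (hQ : IsCZCover d μ c φ α C₂ Ω u Q) : MeasurableSet Ω := by
  rw [← hQ.iUnion_eq]
  exact MeasurableSet.biUnion hQ.countable hQ.measurableSet

theorem IsCZCover.tsum_lintegral (hQ : IsCZCover d μ c φ α C₂ Ω u Q) (ψ : X → ℝ≥0∞) :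
    ∑' B : u, ∫⁻ y in Q B, ψ y ∂μ = ∫⁻ y in Ω, ψ y ∂μ := by
  rw [← hQ.iUnion_eq, lintegral_biUnion hQ.countable hQ.measurableSet hQ.disjoint]

theorem IsCZCover.tsum_measure_le (hQ : IsCZCover d μ c φ α C₂ Ω u Q) :
    ∑' B : u, μ (qball d B.1.1 B.1.2) ≤ μ Ω := by
  calc ∑' B : u, μ (qball d B.1.1 B.1.2) ≤ ∑' B : u, ∫⁻ _ in Q B, 1 ∂μ := by
        refine ENNReal.tsum_le_tsum fun B => ?_
        rw [setLIntegral_one]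
        exact measure_mono (hQ.ball_subset B B.2)
    _ = μ Ω := by rw [hQ.tsum_lintegral, setLIntegral_one]

/-- The good part of the Calderón–Zygmund decomposition: it agrees with `f` off `Ω`, and is
the average of `f` on each piece. -/
theorem IsCZCover.exists_good [TopologicalSpace X] (hX : IsHomogeneousType d μ)
    (h : DoublingBalls d μ c D Cd) [IsFiniteMeasure μ] (h𝒢 : IsBallBasis d 𝒢 Λ)
    {f : X → ℝ} (hf : Integrable f μ)
    (hQ : IsCZCover d μ c (fun y => ‖f y‖ₑ) α (compConst c Cd Λ * compConst c Cd 2)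
      {x | α < maxFn d 𝒢 μ (fun y => ‖f y‖ₑ) x} u Q) :
    ∃ g : X → ℝ, Integrable g μ ∧ (∀ x, maxFn d 𝒢 μ (fun y => ‖f y‖ₑ) x ≤ α → g x = f x) ∧
      (∀ B ∈ u, ∫ y in Q B, g y ∂μ = ∫ y in Q B, f y ∂μ) ∧
      (∀ B ∈ u, ∫⁻ y in Q B, ‖g y‖ₑ ∂μ ≤ ∫⁻ y in Q B, ‖f y‖ₑ ∂μ) ∧
      (∀ᵐ x ∂μ, ‖g x‖ₑ ≤ compConst c Cd Λ * compConst c Cd 2 * α) ∧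
      ∫⁻ x, ‖g x‖ₑ ∂μ ≤ ∫⁻ x, ‖f x‖ₑ ∂μ := by
  classical
  set Ω := {x | α < maxFn d 𝒢 μ (fun y => ‖f y‖ₑ) x} with hΩ
  have hΩm := hQ.measurableSet_union
  have huniq : ∀ x ∈ Ω, ∃ B ∈ u, x ∈ Q B := fun x hx => by
    rw [← hQ.iUnion_eq] at hx
    simpa using hx
  choose! P hPu hPQ using huniq
  set g : X → ℝ := fun x => if x ∈ Ω then ⨍ y in Q (P x), f y ∂μ else f x with hg
  have hgQ : ∀ B ∈ u, ∀ x ∈ Q B, g x = ⨍ y in Q B, f y ∂μ := by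
    intro B hB x hx
    have hxΩ : x ∈ Ω := by rw [← hQ.iUnion_eq]; exact mem_biUnion hB hx
    have : P x = B := by
      by_contra hne
      exact Set.disjoint_left.1 (hQ.disjoint (hPu x hxΩ) hB hne) (hPQ x hxΩ) hx
    simp only [hg, hxΩ, if_true, this]
  have hgf : ∀ x ∉ Ω, g x = f x := fun x hx => by simp [hg, hx]
  have hQpos : ∀ B ∈ u, μ (Q B) ≠ 0 := fun B hB =>
    ((h.measure_ball_pos _ _ (hQ.pos B hB)).trans_le (measure_mono (hQ.ball_subset B hB))).ne'
  have hmean : ∀ B ∈ u, ‖⨍ y in Q B, f y ∂μ‖ₑ * μ (Q B) ≤ ∫⁻ y in Q B, ‖f y‖ₑ ∂μ := by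
    intro B hB
    have h1 : μ.real (Q B) ≠ 0 := (ENNReal.toReal_pos (hQpos B hB) (measure_ne_top _ _)).ne'
    have h2 : ‖⨍ y in Q B, f y ∂μ‖ₑ * μ (Q B) = ‖∫ y in Q B, f y ∂μ‖ₑ := by
      rw [setAverage_eq, smul_eq_mul, enorm_mul, enorm_inv h1, Real.enorm_eq_ofReal
        measureReal_nonneg, ofReal_measureReal, mul_right_comm,
        ENNReal.inv_mul_cancel (hQpos B hB) (measure_ne_top _ _), one_mul]
    rw [h2]
    exact enorm_integral_le_lintegral_enorm _
  have hgle : ∀ B ∈ u, ∫⁻ y in Q B, ‖g y‖ₑ ∂μ ≤ ∫⁻ y in Q B, ‖f y‖ₑ ∂μ := by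
    intro B hB
    rw [setLIntegral_congr_fun (hQ.measurableSet B hB)
      (g := fun _ => ‖⨍ y in Q B, f y ∂μ‖ₑ) fun x hx => by simp only [hgQ B hB x hx],
      setLIntegral_const]
    exact hmean B hB
  have hgm : AEStronglyMeasurable g μ := by
    rw [← Measure.restrict_univ (μ := μ), ← union_compl_self Ω, aestronglyMeasurable_union_iff]
    constructor
    · have := hQ.countable.to_subtype
      rw [← hQ.iUnion_eq, biUnion_eq_iUnion, aestronglyMeasurable_iUnion_iff]
      intro B
      refine aestronglyMeasurable_const.congr (f := fun _ => ⨍ y in Q B, f y ∂μ) ?_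
      exact (ae_restrict_iff' (hQ.measurableSet B B.2)).2
        (ae_of_all _ fun x hx => (hgQ B B.2 x hx).symm)
    · refine hf.1.restrict.congr ?_
      exact (ae_restrict_iff' hΩm.compl).2 (ae_of_all _ fun x hx => (hgf x hx).symm)
  have hgint : ∫⁻ x, ‖g x‖ₑ ∂μ ≤ ∫⁻ x, ‖f x‖ₑ ∂μ := by
    rw [← lintegral_add_compl _ hΩm, ← lintegral_add_compl (fun x => ‖f x‖ₑ) hΩm]
    refine add_le_add ?_ (le_of_eq ?_)
    · rw [← hQ.tsum_lintegral, ← hQ.tsum_lintegral]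
      exact ENNReal.tsum_le_tsum fun B => hgle B B.2
    · exact setLIntegral_congr_fun hΩm.compl fun x hx => by simp only [hgf x hx]
  have hC1 : (1 : ℝ≥0∞) ≤ compConst c Cd 2 := by
    exact_mod_cast one_le_pow₀ h.one_le_doubling
  refine ⟨g, ⟨hgm, hgint.trans_lt hf.2⟩, fun x hx => hgf x (not_lt.2 hx), fun B hB => ?_, hgle,
    ?_, hgint⟩
  · rw [setIntegral_congr_fun (hQ.measurableSet B hB) (fun x hx => hgQ B hB x hx),
      setIntegral_const]
    exact measure_smul_setAverage _ (measure_ne_top _ _)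
  · filter_upwards [hX.ae_enorm_le_of_average_le h hf] with x hx
    by_cases hxΩ : x ∈ Ω
    · rw [hgQ (P x) (hPu x hxΩ) x (hPQ x hxΩ)]
      have hB := hPu x hxΩ
      have hpos := h.measure_ball_pos (P x).1 (P x).2 (hQ.pos _ hB)
      refine (ENNReal.mul_le_mul_iff_left hpos.ne' (measure_ne_top μ _)).1 ?_
      calc ‖⨍ y in Q (P x), f y ∂μ‖ₑ * μ (qball d (P x).1 (P x).2)
          ≤ ‖⨍ y in Q (P x), f y ∂μ‖ₑ * μ (Q (P x)) := by gcongr; exact hQ.ball_subset _ hB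
        _ ≤ ∫⁻ y in Q (P x), ‖f y‖ₑ ∂μ := hmean _ hB
        _ ≤ _ := (lintegral_mono_set (hQ.subset_ball _ hB)).trans (hQ.lintegral_le _ hB)
    · rw [hgf x hxΩ]
      refine (hx (compConst c Cd Λ * α) ⟨1, one_pos, fun r hr _ => ?_⟩).trans ?_
      · refine (h.lintegral_ball_le h𝒢 _ (h.mem_ball_self x hr)).trans ?_
        gcongr
        exact not_lt.1 hxΩ
      · gcongr
        exact le_mul_of_one_le_right zero_le hC1

end

end GrandMorrey

namespace GrandMorrey

variable {X : Type*} [MeasurableSpace X] {d : X → X → ℝ} {μ ν : Measure X} {c D : ℝ} {Cd : ℝ≥0}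
  {𝒢 : Set (X × ℝ)} {Λ : ℝ} {K : X → X → ℝ} {C : ℝ} {w : ℝ → ℝ}

/-- The smoothness bound of the kernel over `B(z, ρ)`, as a function of the other variable. -/
noncomputable def smoothBound {X : Type*} [MeasurableSpace X] (d : X → X → ℝ) (μ : Measure X)
    (C : ℝ) (w : ℝ → ℝ) (z : X) (ρ : ℝ) (x : X) : ℝ≥0∞ :=
  ENNReal.ofReal (C * w (ρ / d z x)) * (μ (qball d z (d z x)))⁻¹

theorem DoublingBalls.measurable_dist (h : DoublingBalls d μ c D Cd) (z : X) :
    Measurable (d z) := measurable_of_Iio fun r => h.measurableSet_ball z r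

theorem IsCZKernelWith.lintegral_smoothBound_le (hK : IsCZKernelWith d μ K C w)
    (h : DoublingBalls d μ c D Cd) [IsFiniteMeasure μ] {z : X} {ρ : ℝ} (hρ : 0 < ρ) :
    ∫⁻ x in (qball d z (farConst c C * ρ))ᶜ, smoothBound d μ C w z ρ x ∂μ ≤
      ENNReal.ofReal C * diniSum w * Cd := by
  have h1 := hK.lintegral_smooth_le h (x := z) hρ (u := smoothBound d μ C w z ρ)
    (φ := fun _ => 1) aemeasurable_const (m := 1) (fun k y _ hk => ?_) (fun s _ => by simp)
  · simpa using h1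
  · have hpos : 0 < d z y := lt_of_lt_of_le (by positivity) hk
    have hw : w (ρ / d z y) ≤ w ((1 / 2) ^ (k + 1)) := by
      refine hK.dini.mono (mem_Ioi.2 (by positivity)) (mem_Ioi.2 (by positivity)) ?_
      rw [div_le_iff₀ hpos, one_div, inv_pow, ← div_eq_inv_mul, le_div_iff₀ (by positivity)]
      linarith
    rw [← ENNReal.ofReal_mul hK.pos.le]
    have hCc := hK.pos
    unfold smoothBound
    gcongr
    exact qball_mono d z hk

theorem IsCZKernelWith.aemeasurable_smoothBound (hK : IsCZKernelWith d μ K C w)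
    (h : DoublingBalls d μ c D Cd) {z : X} {ρ : ℝ} (hρ : 0 < ρ) :
    AEMeasurable (smoothBound d μ C w z ρ) (μ.restrict (qball d z (farConst c C * ρ))ᶜ) := by
  have hd := h.measurable_dist z
  have hW : Monotone fun t : ℝ => if 0 < t then w t else 0 := by
    intro s t hst
    by_cases hs : 0 < s
    · simp only [hs, hs.trans_le hst, if_true]
      exact hK.dini.mono hs (hs.trans_le hst) hst
    · by_cases ht : 0 < t
      · simpa [hs, ht] using (hK.dini.pos t ht).le
      · simp [hs, ht]
  have hB : Monotone fun s : ℝ => μ (qball d z s) := fun s t hst => measure_mono (qball_mono d z hst)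
  have hm : Measurable fun x => ENNReal.ofReal
      (C * (if 0 < ρ / d z x then w (ρ / d z x) else 0)) * (μ (qball d z (d z x)))⁻¹ :=
    ((hW.measurable.comp (hd.const_div ρ)).const_mul C).ennreal_ofReal.mul
      (hB.measurable.comp hd).inv
  refine ⟨_, hm, (ae_restrict_iff' (h.measurableSet_ball _ _).compl).2 (ae_of_all _ fun x hx => ?_)⟩
  obtain ⟨-, -, hL⟩ := hK.two_le_farConst h
  have hx : farConst c C * ρ ≤ d z x := not_lt.1 hx
  have : 0 < d z x := lt_of_lt_of_le (by positivity) hx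
  simp [smoothBound, div_pos hρ this]

theorem IsCZKernelWith.le_dist_of_far (hK : IsCZKernelWith d μ K C w)
    (h : DoublingBalls d μ c D Cd) {x y z : X} {ρ : ℝ} (hy : y ∈ qball d z ρ)
    (hx : x ∉ qball d z (farConst c C * ρ)) : ρ ≤ c * d x y := by
  obtain ⟨hL, -, -⟩ := hK.two_le_farConst h
  have hρ := h.pos_of_mem hy
  have hc := h.cpos
  have h1 : farConst c C * ρ ≤ d z x := not_lt.1 hx
  have h2 := h.triangle z x y
  have h3 := h.symm y x
  have hy : d z y < ρ := hy
  have h4 : 2 * c * ρ ≤ farConst c C * ρ := by gcongr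
  have h5 : c * (ρ + ρ) ≤ c * (ρ + c * d x y) := by
    calc c * (ρ + ρ) ≤ d z x := by linarith
      _ ≤ c * (d z y + d y x) := h2
      _ ≤ _ := by gcongr
  have h6 := le_of_mul_le_mul_left h5 hc
  linarith

/-- The principal value of the bad part of a Calderón–Zygmund decomposition exists at every density
point of the complement of `Ω` which lies far from all the pieces: the pieces met by the boundary
of the truncation occupy a small proportion of a ball. -/
theorem IsCZKernelWith.pv_bad (hK : IsCZKernelWith d μ K C w)
    (h : DoublingBalls d μ c D Cd) [IsFiniteMeasure μ] [NullSingletonClass μ]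
    {φ : X → ℝ≥0∞} {α C₂ : ℝ≥0∞} {Ω : Set X} {u : Set (X × ℝ)} {Q : X × ℝ → Set X}
    (hQ : IsCZCover d μ c φ α C₂ Ω u Q) {β : X → ℝ} (hβ : Integrable β μ)
    (hβΩ : ∀ x ∉ Ω, β x = 0) (hβ0 : ∀ B ∈ u, ∫ y in Q B, β y ∂μ = 0) {A : ℝ≥0∞} (hA : A ≠ ∞)
    (hβA : ∀ B ∈ u, ∫⁻ y in Q B, ‖β y‖ₑ ∂μ ≤ A * μ (qball d B.1 B.2)) {x : X}
    (hx : ∀ B ∈ u, x ∉ qball d B.1 (farConst c C * (engulfConst c 2 * B.2)))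
    (hdens : ∀ ε : ℝ≥0∞, 0 < ε → ∀ᶠ r in 𝓝[>] (0:ℝ), μ (Ω ∩ qball d x r) ≤ ε * μ (qball d x r))
    (hS : ∑' B : u, smoothBound d μ C w B.1.1 (engulfConst c 2 * B.1.2) x *
      ∫⁻ y in Q B, ‖β y‖ₑ ∂μ < ∞) :
    PVExistsAt d μ K β x ∧ ‖pvOperator d μ K β x‖ₑ ≤
      ∑' B : u, smoothBound d μ C w B.1.1 (engulfConst c 2 * B.1.2) x *
        ∫⁻ y in Q B, ‖β y‖ₑ ∂μ := by
  classical
  have := hQ.countable.to_subtype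
  set κ := engulfConst c 2 with hκdef
  have hκ : 2 < κ := h.two_lt_engulfConst
  have hc := h.cpos
  have hρ : ∀ B ∈ u, 0 < κ * B.2 := fun B hB => mul_pos (by linarith) (hQ.pos B hB)
  have hfar : ∀ B ∈ u, ∀ y ∈ Q B, κ * B.2 / c ≤ d x y := fun B hB y hy => by
    rw [div_le_iff₀' hc]
    exact hK.le_dist_of_far h (hQ.subset_ball B hB hy) (hx B hB)
  have hΩm := hQ.measurableSet_union
  set I : u → ℝ := fun B => ∫ y in Q B, K x y * β y ∂μ with hI
  have hKint : ∀ B : u, IntegrableOn (fun y => K x y * β y) (Q B) μ := fun B =>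
    hK.integrableOn h hβ (div_pos (hρ B B.2) hc) (hQ.measurableSet B B.2) (hfar B B.2)
  have hIle : ∀ B : u, ‖I B‖ₑ ≤ smoothBound d μ C w B.1.1 (κ * B.1.2) x *
      ∫⁻ y in Q B, ‖β y‖ₑ ∂μ := by
    intro B
    have h1 : I B = ∫ y in Q B, (K x y - K x B.1.1) * β y ∂μ := by
      simp only [sub_mul]
      rw [integral_sub (hKint B) (hβ.integrableOn.const_mul _), integral_const_mul, hβ0 B B.2]
      simp [hI]
    rw [h1, ← lintegral_const_mul'' _ hβ.1.enorm.restrict]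
    refine (enorm_integral_le_lintegral_enorm _).trans ?_
    refine setLIntegral_mono' (hQ.measurableSet B B.2) fun y hy => ?_
    rw [enorm_mul]
    gcongr
    exact le_add_self.trans (hK.enorm_sub_add_le h (hQ.subset_ball B B.2 hy)
      (not_lt.1 (hx B B.2)))
  have hIsum : ∑' B, ‖I B‖ₑ ≠ ∞ := ne_top_of_le_ne_top hS.ne (ENNReal.tsum_le_tsum hIle)
  have hIsum' : Summable fun B => ‖I B‖ :=
    tsum_enorm_ne_top_iff_summable_norm.1 hIsum
  -- the contribution of the pieces which the truncation leaves intact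
  set F : ℝ → u → ℝ := fun η B => if Disjoint (Q B) (qball d x η) then I B else 0 with hF
  set T : ℝ → u → ℝ := fun η B => ∫ y in Q B ∩ (qball d x η)ᶜ, K x y * β y ∂μ with hT
  have hT_sum : ∀ η, 0 < η → HasSum (T η) (truncated d μ K β η x) := by
    intro η hη
    have hi := hK.integrableOn_compl h hβ x hη
    have hsub : (⋃ B : u, Q B ∩ (qball d x η)ᶜ) = Ω ∩ (qball d x η)ᶜ := by
      rw [← iUnion_inter, ← hQ.iUnion_eq, biUnion_eq_iUnion]
    have hm : ∀ B : u, MeasurableSet (Q B ∩ (qball d x η)ᶜ) := fun B =>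
      (hQ.measurableSet B B.2).inter (h.measurableSet_ball _ _).compl
    have h1 := hasSum_integral_iUnion hm (fun B B' hne => (hQ.disjoint B.2 B'.2
      (fun e => hne (Subtype.ext e))).mono inter_subset_left inter_subset_left)
      (hi.mono_set (hsub ▸ inter_subset_right))
    rw [hsub] at h1
    have h2 : truncated d μ K β η x = ∫ y in Ω ∩ (qball d x η)ᶜ, K x y * β y ∂μ := by
      refine setIntegral_eq_of_subset_of_forall_sdiff_eq_zero (h.measurableSet_ball _ _).compl
        inter_subset_right fun y hy => ?_
      rw [hβΩ y fun hyΩ => hy.2 ⟨hyΩ, hy.1⟩, mul_zero]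
    rw [h2]
    exact h1
  have hFlim : Tendsto (fun η => ∑' B, F η B) (𝓝[>] 0) (𝓝 (∑' B, I B)) := by
    refine tendsto_tsum_of_dominated_convergence hIsum' (fun B => ?_)
      (Eventually.of_forall fun η B => ?_)
    · refine tendsto_const_nhds.congr' ?_
      filter_upwards [eventually_small_radius (div_pos (hρ B B.2) hc)] with η hη
      have : Disjoint (Q B) (qball d x η) := Set.disjoint_left.2 fun y hy hlt => by
        have h1 := hfar B B.2 y hy
        have h2 : d x y < η := hlt
        linarith [hη.2]
      simp [hF, this]
    · simp only [hF]
      split_ifs <;> simp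
  -- the contribution of the pieces cut by the truncation
  have hRlim : Tendsto (fun η => truncated d μ K β η x - ∑' B, F η B) (𝓝[>] 0) (𝓝 0) := by
    set C₃ := engulfConst c c with hC₃
    have hC₃pos : 0 < C₃ := lt_of_lt_of_le one_pos (h.one_le_engulfConst hc.le)
    have hle : ∀ η, 0 < η → ‖truncated d μ K β η x - ∑' B, F η B‖ₑ ≤
        ENNReal.ofReal C * (μ (qball d x η))⁻¹ * (A * μ (Ω ∩ qball d x (C₃ * η))) := by
      intro η hη
      have hFs : Summable (F η) := Summable.of_norm_bounded hIsum' fun B => by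
        simp only [hF]
        split_ifs <;> simp
      have h1 : truncated d μ K β η x - ∑' B, F η B = ∑' B, (T η B - F η B) := by
        rw [(hT_sum η hη).summable.tsum_sub hFs, (hT_sum η hη).tsum_eq]
      rw [h1]
      have hterm : ∀ B : u, ‖T η B - F η B‖ₑ ≤ ENNReal.ofReal C * (μ (qball d x η))⁻¹ *
          (A * ∫⁻ y in Q B, (qball d x (C₃ * η)).indicator 1 y ∂μ) := by
        intro B
        by_cases hd1 : Disjoint (Q B) (qball d x η)
        · have : Q B ∩ (qball d x η)ᶜ = Q B :=
            inter_eq_left.2 (subset_compl_iff_disjoint_right.2 hd1)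
          simp [hF, hT, hd1, this, hI]
        · obtain ⟨y, hyQ, hyη⟩ := Set.not_disjoint_iff.1 hd1
          have hyB := hQ.subset_ball B B.2 hyQ
          have hργ : κ * B.1.2 ≤ c * η := (hK.le_dist_of_far h hyB (hx B B.2)).trans
            (by gcongr; exact le_of_lt hyη)
          have hsub : Q B ⊆ qball d x (C₃ * η) := (hQ.subset_ball B B.2).trans
            (h.ball_subset_of_inter hργ ⟨y, hyη, hyB⟩)
          have h2 : ∫⁻ y in Q B, (qball d x (C₃ * η)).indicator 1 y ∂μ = μ (Q B) := by
            rw [← setLIntegral_one]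
            exact setLIntegral_congr_fun (hQ.measurableSet B B.2) fun y hy => by simp [hsub hy]
          rw [h2]
          simp only [hF, hd1, if_false, sub_zero, hT]
          refine (hK.enorm_setIntegral_le h hβ.1 hη ((hQ.measurableSet B B.2).inter
            (h.measurableSet_ball _ _).compl) fun y hy => not_lt.1 hy.2).trans ?_
          gcongr
          refine (lintegral_mono_set inter_subset_left).trans ((hβA B B.2).trans ?_)
          gcongr
          exact hQ.ball_subset B B.2
      calc ‖∑' B, (T η B - F η B)‖ₑ ≤ ∑' B, ‖T η B - F η B‖ₑ :=
            enorm_tsum_le_tsum_enorm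
        _ ≤ _ := ENNReal.tsum_le_tsum hterm
        _ = _ := by
            rw [ENNReal.tsum_mul_left, ENNReal.tsum_mul_left,
              hQ.tsum_lintegral ((qball d x (C₃ * η)).indicator 1),
              lintegral_indicator_one (h.measurableSet_ball _ _),
              Measure.restrict_apply (h.measurableSet_ball _ _), inter_comm]
    refine tendsto_iff_edist_tendsto_0.2 ?_
    simp only [edist_zero_right]
    set M : ℝ≥0∞ := ENNReal.ofReal C * A * (Cd ^ ⌈C₃⌉₊ : ℝ≥0) with hM
    have hMtop : M ≠ ∞ := by finiteness
    have hscale : Tendsto (fun η : ℝ => C₃ * η) (𝓝[>] 0) (𝓝[>] 0) := by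
      refine tendsto_nhdsWithin_iff.2 ⟨?_, ?_⟩
      · have : Tendsto (fun η : ℝ => C₃ * η) (𝓝 0) (𝓝 (C₃ * 0)) :=
          (continuous_const.mul continuous_id).tendsto 0
        rw [mul_zero] at this
        exact this.mono_left nhdsWithin_le_nhds
      · filter_upwards [self_mem_nhdsWithin] with η hη using mul_pos hC₃pos hη
    have hev : ∀ ε : ℝ≥0∞, 0 < ε → ∀ᶠ η in 𝓝[>] (0:ℝ),
        ‖truncated d μ K β η x - ∑' B, F η B‖ₑ ≤ M * ε := by
      intro ε hε
      filter_upwards [hscale.eventually (hdens ε hε), self_mem_nhdsWithin] with η hη1 hη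
      have hη : 0 < η := hη
      have hpos := h.measure_ball_pos x η hη
      calc _ ≤ _ := hle η hη
        _ ≤ ENNReal.ofReal C * (μ (qball d x η))⁻¹ *
            (A * (ε * ((Cd ^ ⌈C₃⌉₊ : ℝ≥0) * μ (qball d x η)))) := by
            gcongr
            refine hη1.trans ?_
            gcongr
            exact h.measure_dilate_le _ _ hη
        _ = ENNReal.ofReal C * A * (Cd ^ ⌈C₃⌉₊ : ℝ≥0) * ε *
            ((μ (qball d x η))⁻¹ * μ (qball d x η)) := by ring
        _ = M * ε := by rw [ENNReal.inv_mul_cancel hpos.ne' (measure_ne_top _ _), mul_one]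
    refine ENNReal.tendsto_nhds_zero.2 fun δ hδ => ?_
    have hlim : Tendsto (fun ε : ℝ≥0∞ => M * ε) (𝓝 0) (𝓝 (M * 0)) :=
      ENNReal.Tendsto.const_mul tendsto_id (Or.inr hMtop)
    rw [mul_zero] at hlim
    have hlim2 := (hlim.mono_left (nhdsWithin_le_nhds (s := Ioi 0))).eventually (gt_mem_nhds hδ)
    obtain ⟨ε, hε, hε0⟩ := (hlim2.and self_mem_nhdsWithin).exists
    exact (hev ε hε0).mono fun η hη => hη.trans hε.le
  have hlim : Tendsto (fun η => truncated d μ K β η x) (𝓝[>] 0) (𝓝 (∑' B, I B)) := by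
    have := hRlim.add hFlim
    simpa using this
  obtain ⟨h1, h2⟩ := pvExistsAt_of_tendsto (fun η hη => hK.integrableOn_compl h hβ x hη) hlim
  refine ⟨h1, ?_⟩
  rw [h2]
  exact (enorm_tsum_le_tsum_enorm).trans (ENNReal.tsum_le_tsum hIle)

end GrandMorrey

namespace GrandMorrey

/-! ### The weak type `(1,1)` inequality and the existence of principal values -/

variable {X : Type*} [MeasurableSpace X] {d : X → X → ℝ} {μ ν : Measure X} {c D : ℝ} {Cd : ℝ≥0}
  {𝒢 : Set (X × ℝ)} {Λ : ℝ} {K : X → X → ℝ} {C : ℝ} {w : ℝ → ℝ}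

theorem IsCZOperator.exists_kernelWith (hT : IsCZOperator d μ K) :
    ∃ C w, IsCZKernelWith d μ K C w := by
  obtain ⟨C, w, hC, hw, h1, h2⟩ := hT.kernel.bounds
  exact ⟨C, w, hT.kernel.measurable, hC, hw, h1, h2⟩

theorem eLpNorm_two_sq (f : X → ℝ) : eLpNorm f 2 μ ^ (2:ℝ) = ∫⁻ x, ‖f x‖ₑ ^ (2:ℝ) ∂μ := by
  rw [eLpNorm_eq_lintegral_rpow_enorm_toReal (by simp) (by simp)]
  rw [← ENNReal.rpow_mul]
  simp

/-- Outside an exceptional set `E` of measure at most `C' ‖f‖₁ / α`, the principal value of `f`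
exists and is at most `α`. -/
theorem IsCZOperator.exists_exceptional [TopologicalSpace X] (hX : IsHomogeneousType d μ)
    (h : DoublingBalls d μ c D Cd) [IsFiniteMeasure μ] [NullSingletonClass μ]
    (hT : IsCZOperator d μ K) : ∃ C' : ℝ≥0, ∀ f : X → ℝ, Integrable f μ → ∀ α : ℝ≥0, 0 < α →
      ∫⁻ x, ‖f x‖ₑ ∂μ < α * μ univ → ∃ E : Set X, α * μ E ≤ C' * ∫⁻ x, ‖f x‖ₑ ∂μ ∧
        ∀ᵐ x ∂μ, x ∉ E → PVExistsAt d μ K f x ∧ ‖pvOperator d μ K f x‖ₑ ≤ α := by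
  obtain ⟨C, w, hK⟩ := hT.exists_kernelWith
  obtain ⟨C₀, hC₀⟩ := hT.bounded
  obtain ⟨𝒢, Λ, -, h𝒢⟩ := h.exists_ballBasis
  set κ := engulfConst c 2 with hκdef
  have hκ : 2 < κ := h.two_lt_engulfConst
  set L := farConst c C with hL
  obtain ⟨-, -, hL2⟩ := hK.two_le_farConst h
  set C₂ : ℝ≥0 := compConst c Cd Λ * compConst c Cd 2 with hC₂
  set A₀ : ℝ≥0∞ := ENNReal.ofReal C * diniSum w * Cd with hA₀
  have hA₀top : A₀ ≠ ∞ := by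
    have := hK.dini.diniSum_lt_top.ne
    finiteness
  refine ⟨Cd ^ ⌈L * κ⌉₊ * compConst c Cd 2 + 4 * C₀ ^ 2 * C₂ + 4 * A₀.toNNReal, ?_⟩
  intro f hf α hα hαX
  set φ : X → ℝ≥0∞ := fun x => ‖f x‖ₑ with hφ
  set N := ∫⁻ x, φ x ∂μ with hN
  obtain ⟨u, Q, hQ⟩ := h.exists_czCover h𝒢 hαX
  set Ω := {x | (α:ℝ≥0∞) < maxFn d 𝒢 μ φ x} with hΩ
  obtain ⟨g, hgi, hgf, hgQ, hgle, hgb, hgN⟩ := hQ.exists_good hX h h𝒢 hf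
  have huc := hQ.countable.to_subtype
  have hgb' : ∀ᵐ x ∂μ, ‖g x‖ₑ ≤ C₂ * α := by
    simpa [hC₂] using hgb
  -- the good part
  have hg2 : MemLp g 2 μ := by
    refine MemLp.of_bound hgi.1 ((C₂ * α : ℝ≥0) : ℝ) ?_
    filter_upwards [hgb'] with x hx
    rw [← coe_nnnorm, NNReal.coe_le_coe]
    have : (‖g x‖₊ : ℝ≥0∞) ≤ ((C₂ * α : ℝ≥0) : ℝ≥0∞) := by
      rw [← enorm_eq_nnnorm]; simpa using hx
    exact_mod_cast this
  have hgpv := hT.pv_exists g hg2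
  have hgsq : ∫⁻ x, ‖g x‖ₑ ^ (2:ℝ) ∂μ ≤ C₂ * α * N := by
    calc ∫⁻ x, ‖g x‖ₑ ^ (2:ℝ) ∂μ ≤ ∫⁻ x, C₂ * α * ‖g x‖ₑ ∂μ := by
          refine lintegral_mono_ae ?_
          filter_upwards [hgb'] with x hx
          rw [ENNReal.rpow_two, sq]
          gcongr
      _ = C₂ * α * ∫⁻ x, ‖g x‖ₑ ∂μ := lintegral_const_mul' _ _ (by finiteness)
      _ ≤ _ := by gcongr
  have hαne : (α : ℝ≥0∞) ≠ 0 := by simpa using hα.ne'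
  set E₂ := {x | (α / 2 : ℝ≥0∞) ≤ ‖pvOperator d μ K g x‖ₑ} with hE₂
  have hE₂le : α * μ E₂ ≤ 4 * C₀ ^ 2 * C₂ * N := by
    have h1 := mul_meas_ge_le_pow_eLpNorm' μ (p := 2) (by simp) (by simp) (hC₀ g hg2).1.1
      (α / 2 : ℝ≥0∞)
    have h2 : (α / 2 : ℝ≥0∞) ^ (2:ℝ) * μ E₂ ≤ C₀ ^ 2 * (C₂ * α * N) := by
      calc (α / 2 : ℝ≥0∞) ^ (2:ℝ) * μ E₂ ≤ eLpNorm (pvOperator d μ K g) 2 μ ^ (2:ℝ) := by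
            simpa using h1
        _ ≤ (C₀ * eLpNorm g 2 μ) ^ (2:ℝ) := by gcongr; exact (hC₀ g hg2).2
        _ = C₀ ^ 2 * ∫⁻ x, ‖g x‖ₑ ^ (2:ℝ) ∂μ := by
            rw [ENNReal.mul_rpow_of_nonneg _ _ zero_le_two, eLpNorm_two_sq, ENNReal.rpow_two]
        _ ≤ _ := by gcongr
    have h3 : (α / 2 : ℝ≥0∞) ^ (2:ℝ) = α * (α / 4) := by
      rw [ENNReal.rpow_two, sq, ENNReal.div_eq_inv_mul, ENNReal.div_eq_inv_mul,
        show (4 : ℝ≥0∞) = 2 * 2 by norm_num, ENNReal.mul_inv (by simp) (by simp)]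
      ring
    rw [h3] at h2
    have h4 : α * (α / 4 * μ E₂) ≤ α * (C₀ ^ 2 * C₂ * N) := by
      calc _ = α * (α / 4) * μ E₂ := by ring
        _ ≤ _ := h2
        _ = _ := by ring
    have h5 : (α / 4 : ℝ≥0∞) * μ E₂ ≤ C₀ ^ 2 * C₂ * N :=
      (ENNReal.mul_le_mul_iff_right hαne ENNReal.coe_ne_top).1 h4
    calc α * μ E₂ = 4 * (α / 4 * μ E₂) := by
          rw [← mul_assoc, ENNReal.mul_div_cancel (by simp) (by simp)]
      _ ≤ 4 * (C₀ ^ 2 * C₂ * N) := by gcongr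
      _ = _ := by ring
  -- the bad part
  set β : X → ℝ := fun x => f x - g x with hβdef
  have hβ : Integrable β μ := hf.sub hgi
  have hβΩ : ∀ x ∉ Ω, β x = 0 := fun x hx => by
    simp [hβdef, hgf x (not_lt.1 hx)]
  have hβ0 : ∀ B ∈ u, ∫ y in Q B, β y ∂μ = 0 := fun B hB => by
    simp only [hβdef]
    rw [integral_sub hf.integrableOn hgi.integrableOn, hgQ B hB, sub_self]
  have hβQ : ∀ B ∈ u, ∫⁻ y in Q B, ‖β y‖ₑ ∂μ ≤ 2 * ∫⁻ y in Q B, φ y ∂μ := fun B hB => by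
    calc ∫⁻ y in Q B, ‖β y‖ₑ ∂μ ≤ ∫⁻ y in Q B, (φ y + ‖g y‖ₑ) ∂μ :=
          lintegral_mono fun y => enorm_sub_le
      _ = ∫⁻ y in Q B, φ y ∂μ + ∫⁻ y in Q B, ‖g y‖ₑ ∂μ := lintegral_add_left' hf.1.enorm.restrict _
      _ ≤ ∫⁻ y in Q B, φ y ∂μ + ∫⁻ y in Q B, φ y ∂μ := add_le_add le_rfl (hgle B hB)
      _ = _ := by ring
  have hβA : ∀ B ∈ u, ∫⁻ y in Q B, ‖β y‖ₑ ∂μ ≤ (2 * (C₂ * α)) * μ (qball d B.1 B.2) := by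
    intro B hB
    refine (hβQ B hB).trans ?_
    rw [mul_assoc]
    gcongr
    refine (lintegral_mono_set (hQ.subset_ball B hB)).trans ((hQ.lintegral_le B hB).trans ?_)
    simp [hC₂]
  set E₁ := ⋃ B ∈ u, qball d B.1 (L * (κ * B.2)) with hE₁
  have hE₁m : MeasurableSet E₁ :=
    MeasurableSet.biUnion hQ.countable fun _ _ => h.measurableSet_ball _ _
  have hE₁le : α * μ E₁ ≤ Cd ^ ⌈L * κ⌉₊ * compConst c Cd 2 * N := by
    calc α * μ E₁ ≤ α * ∑' B : u, μ (qball d B.1.1 (L * (κ * B.1.2))) := by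
          gcongr
          rw [hE₁, biUnion_eq_iUnion]
          exact measure_iUnion_le _
      _ ≤ α * ∑' B : u, (Cd ^ ⌈L * κ⌉₊ : ℝ≥0) * μ (qball d B.1.1 B.1.2) := by
          gcongr with B
          rw [← mul_assoc]
          exact h.measure_dilate_le _ _ (hQ.pos B B.2)
      _ ≤ (Cd ^ ⌈L * κ⌉₊ : ℝ≥0) * (α * μ Ω) := by
          rw [ENNReal.tsum_mul_left, mul_left_comm]
          gcongr
          exact hQ.tsum_measure_le
      _ ≤ (Cd ^ ⌈L * κ⌉₊ : ℝ≥0) * (compConst c Cd 2 * N) := by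
          gcongr 1
          exact h.mul_measure_lt_maxFn_le' h𝒢 φ α
      _ = _ := by push_cast; ring
  set S : X → ℝ≥0∞ := fun x => ∑' B : u, smoothBound d μ C w B.1.1 (κ * B.1.2) x *
      ∫⁻ y in Q B, ‖β y‖ₑ ∂μ with hS
  have hρ : ∀ B ∈ u, 0 < κ * B.2 := fun B hB => mul_pos (by linarith) (hQ.pos B hB)
  have hE₁sub : ∀ B ∈ u, E₁ᶜ ⊆ (qball d B.1 (L * (κ * B.2)))ᶜ := fun B hB =>
    compl_subset_compl.2 (subset_biUnion_of_mem (u := fun B : X × ℝ => qball d B.1 (L * (κ * B.2)))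
      hB)
  have hSm : ∀ B : u, AEMeasurable (fun x => smoothBound d μ C w B.1.1 (κ * B.1.2) x *
      ∫⁻ y in Q B, ‖β y‖ₑ ∂μ) (μ.restrict E₁ᶜ) := fun B =>
    ((hK.aemeasurable_smoothBound h (hρ B B.2)).mono_measure
      (Measure.restrict_mono (hE₁sub B B.2) le_rfl)).mul_const _
  have hSint : ∫⁻ x in E₁ᶜ, S x ∂μ ≤ 2 * A₀ * N := by
    calc ∫⁻ x in E₁ᶜ, S x ∂μ = ∑' B : u, ∫⁻ x in E₁ᶜ,
          smoothBound d μ C w B.1.1 (κ * B.1.2) x * ∫⁻ y in Q B, ‖β y‖ₑ ∂μ ∂μ :=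
          lintegral_tsum hSm
      _ ≤ ∑' B : u, A₀ * (2 * ∫⁻ y in Q B, φ y ∂μ) := by
          refine ENNReal.tsum_le_tsum fun B => ?_
          rw [lintegral_mul_const'' _ ((hK.aemeasurable_smoothBound h (hρ B B.2)).mono_measure
            (Measure.restrict_mono (hE₁sub B B.2) le_rfl))]
          gcongr
          · exact (lintegral_mono_set (hE₁sub B B.2)).trans
              (hK.lintegral_smoothBound_le h (hρ B B.2))
          · exact hβQ B B.2
      _ = A₀ * (2 * ∫⁻ y in Ω, φ y ∂μ) := by
          rw [ENNReal.tsum_mul_left, ENNReal.tsum_mul_left, hQ.tsum_lintegral]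
      _ ≤ A₀ * (2 * N) := by gcongr; exact setLIntegral_le_lintegral _ _
      _ = _ := by ring
  -- Chebyshev's inequality for the majorant of the bad part
  set E₃ := {x | (α / 2 : ℝ≥0∞) ≤ S x} ∩ E₁ᶜ with hE₃
  have hE₃le : α * μ E₃ ≤ 4 * A₀ * N := by
    have hSm' : AEMeasurable S (μ.restrict E₁ᶜ) := AEMeasurable.tsum hSm
    have h1 := mul_meas_ge_le_lintegral₀ hSm' (α / 2 : ℝ≥0∞)
    rw [Measure.restrict_apply' hE₁m.compl] at h1
    calc α * μ E₃ = 2 * (α / 2 * μ E₃) := by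
          rw [← mul_assoc, ENNReal.mul_div_cancel (by simp) (by simp)]
      _ ≤ 2 * (2 * A₀ * N) := by
          gcongr 1
          exact h1.trans hSint
      _ = _ := by ring
  refine ⟨E₁ ∪ E₂ ∪ E₃, ?_, ?_⟩
  · calc α * μ (E₁ ∪ E₂ ∪ E₃) ≤ α * (μ E₁ + μ E₂ + μ E₃) := by
          gcongr
          exact (measure_union_le _ _).trans (by gcongr; exact measure_union_le _ _)
      _ ≤ Cd ^ ⌈L * κ⌉₊ * compConst c Cd 2 * N + 4 * C₀ ^ 2 * C₂ * N + 4 * A₀ * N := by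
          rw [mul_add, mul_add]
          gcongr
      _ = _ := by
          push_cast
          rw [ENNReal.coe_toNNReal hA₀top]
          ring
  -- off the three exceptional sets, each of the two parts is at most `α / 2`
  · filter_upwards [hgpv, hX.ae_density_point h hQ.measurableSet_union] with x hxg hxd hxE
    simp only [mem_union, not_or] at hxE
    obtain ⟨⟨hx1, hx2⟩, hx3⟩ := hxE
    have hxB : ∀ B ∈ u, x ∉ qball d B.1 (L * (κ * B.2)) := fun B hB hxB =>
      hx1 (mem_biUnion hB hxB)
    have hxΩ : x ∉ Ω := by
      rw [← hQ.iUnion_eq]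
      simp only [mem_iUnion, not_exists]
      intro B hB hxQ
      refine hxB B hB (qball_mono d _ ?_ (hQ.subset_ball B hB hxQ))
      exact le_mul_of_one_le_left (hρ B hB).le (by linarith)
    have hSx : S x < α / 2 := by
      by_contra hcon
      exact hx3 ⟨not_lt.1 hcon, hx1⟩
    obtain ⟨h1, h2⟩ := hK.pv_bad h hQ hβ hβΩ hβ0 (by finiteness) hβA hxB (hxd hxΩ)
      (hSx.trans_le le_top)
    have h3 := hxg.add h1
    have h4 : (fun y => g y + β y) = f := by funext y; simp [hβdef]
    rw [h4] at h3
    refine ⟨h3.1, ?_⟩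
    rw [h3.2]
    calc ‖pvOperator d μ K g x + pvOperator d μ K β x‖ₑ
        ≤ ‖pvOperator d μ K g x‖ₑ + ‖pvOperator d μ K β x‖ₑ := enorm_add_le _ _
      _ ≤ α / 2 + α / 2 := add_le_add (le_of_lt (not_le.1 hx2)) (h2.trans hSx.le)
      _ = α := ENNReal.add_halves _

/-- Weak type `(1,1)`, and existence almost everywhere of the principal values of integrable
functions. -/
theorem IsCZOperator.exists_weakType [TopologicalSpace X] (hX : IsHomogeneousType d μ)
    (h : DoublingBalls d μ c D Cd) [IsFiniteMeasure μ] [NullSingletonClass μ]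
    (hT : IsCZOperator d μ K) : ∃ C' : ℝ≥0, ∀ f : X → ℝ, Integrable f μ →
      (∀ᵐ x ∂μ, PVExistsAt d μ K f x) ∧ ∀ α : ℝ≥0,
        α * μ {x | α < ‖pvOperator d μ K f x‖ₑ} ≤ C' * ∫⁻ x, ‖f x‖ₑ ∂μ := by
  obtain ⟨C', hC'⟩ := hT.exists_exceptional hX h
  refine ⟨C' + 1, fun f hf => ⟨?_, fun α => ?_⟩⟩
  · by_cases hμ : μ univ = 0
    · rw [Measure.measure_univ_eq_zero.1 hμ]; simp
    set N := ∫⁻ x, ‖f x‖ₑ ∂μ with hN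
    have hNtop : N ≠ ∞ := hf.2.ne
    obtain ⟨n₀, hn₀⟩ := ENNReal.exists_nat_mul_gt hμ hNtop
    rw [ae_iff]
    by_contra hne
    obtain ⟨n₁, hn₁⟩ := ENNReal.exists_nat_mul_gt hne
      (ENNReal.mul_ne_top (ENNReal.coe_ne_top (r := C')) hNtop)
    set n : ℝ≥0 := (n₀ + n₁ + 1 : ℝ≥0) with hn
    have hnpos : 0 < n := by positivity
    have h1 : N < n * μ univ := hn₀.trans_le (by
      gcongr
      simp only [hn]; push_cast
      rw [add_assoc]; exact le_self_add)
    obtain ⟨E, hE, hEx⟩ := hC' f hf n hnpos h1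
    have h2 : μ {x | ¬ PVExistsAt d μ K f x} ≤ μ E := by
      refine measure_mono_ae ?_
      filter_upwards [hEx] with x hx hx2
      by_contra hxE
      exact hx2 (hx hxE).1
    refine absurd hn₁ (not_lt.2 ?_)
    calc (n₁ : ℝ≥0∞) * μ {x | ¬ PVExistsAt d μ K f x} ≤ n * μ E := by
          gcongr
          simp only [hn]; push_cast
          rw [add_right_comm]; exact le_add_self
      _ ≤ _ := hE
  · rcases eq_or_lt_of_le (show 0 ≤ α from zero_le) with h0 | hα
    · simp [← h0]
    rcases lt_or_ge (∫⁻ x, ‖f x‖ₑ ∂μ) (α * μ univ) with hlt | hge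
    · obtain ⟨E, hE, hEx⟩ := hC' f hf α hα hlt
      calc α * μ {x | α < ‖pvOperator d μ K f x‖ₑ} ≤ α * μ E := by
            gcongr 1
            refine measure_mono_ae ?_
            filter_upwards [hEx] with x hx hx2
            by_contra hxE
            exact absurd hx2 (not_lt.2 (hx hxE).2)
        _ ≤ _ := hE
        _ ≤ _ := by gcongr; simp
    · calc α * μ {x | α < ‖pvOperator d μ K f x‖ₑ} ≤ α * μ univ := by
            gcongr; exact subset_univ _
        _ ≤ _ := hge
        _ ≤ _ := le_mul_of_one_le_left zero_le (by simp)

end GrandMorrey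

namespace GrandMorrey

variable {X : Type*} [MeasurableSpace X] {d : X → X → ℝ} {μ ν : Measure X} {c D : ℝ} {Cd : ℝ≥0}
  {𝒢 : Set (X × ℝ)} {Λ : ℝ} {K : X → X → ℝ} {C : ℝ} {w : ℝ → ℝ}

/-- The weak type `(1,1)` property, together with the existence of principal values. -/
def IsWeakType {X : Type*} [MeasurableSpace X] (d : X → X → ℝ) (μ : Measure X)
    (K : X → X → ℝ) (C' : ℝ≥0) : Prop :=
  ∀ f : X → ℝ, Integrable f μ → (∀ᵐ x ∂μ, PVExistsAt d μ K f x) ∧ ∀ α : ℝ≥0,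
    α * μ {x | α < ‖pvOperator d μ K f x‖ₑ} ≤ C' * ∫⁻ x, ‖f x‖ₑ ∂μ

theorem IsWeakType.ae_sub {C' : ℝ≥0} (hW : IsWeakType d μ K C') {f g : X → ℝ}
    (hf : Integrable f μ) (hg : Integrable g μ) : ∀ᵐ x ∂μ,
      pvOperator d μ K (fun y => f y - g y) x = pvOperator d μ K f x - pvOperator d μ K g x := by
  filter_upwards [(hW f hf).1, (hW g hg).1] with x h1 h2 using (h1.sub h2).2

/-- The weak type inequality turns convergence in `L¹` into convergence in measure of the principal
values, hence into convergence almost everywhere along a subsequence. -/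
theorem IsWeakType.exists_subseq_tendsto {C' : ℝ≥0} (hW : IsWeakType d μ K C') {f : X → ℝ}
    {fs : ℕ → X → ℝ} (hf : Integrable f μ) (hfs : ∀ n, Integrable (fs n) μ)
    (hlim : Tendsto (fun n => ∫⁻ x, ‖fs n x - f x‖ₑ ∂μ) atTop (𝓝 0)) :
    ∃ ns : ℕ → ℕ, StrictMono ns ∧ ∀ᵐ x ∂μ,
      Tendsto (fun k => pvOperator d μ K (fs (ns k)) x) atTop (𝓝 (pvOperator d μ K f x)) := by
  have h1 : ∀ k : ℕ, ∀ᶠ n in atTop, ∫⁻ x, ‖fs n x - f x‖ₑ ∂μ ≤ ((1 / 4) ^ k : ℝ≥0) := fun k =>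
    (hlim.eventually (gt_mem_nhds (ENNReal.coe_pos.2 (by positivity)))).mono fun n hn => le_of_lt hn
  obtain ⟨ns, hns, hle⟩ := extraction_forall_of_eventually h1
  refine ⟨ns, hns, ?_⟩
  set s : ℕ → Set X := fun k => {x | (((1 / 2) ^ k : ℝ≥0) : ℝ≥0∞) <
    ‖pvOperator d μ K (fun y => fs (ns k) y - f y) x‖ₑ} with hs
  have hsle : ∀ k, μ (s k) ≤ C' * (((1 / 2) ^ k : ℝ≥0) : ℝ≥0∞) := by
    intro k
    have h2 := (hW _ ((hfs (ns k)).sub hf)).2 ((1 / 2) ^ k)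
    have h3 : (((1 / 4) ^ k : ℝ≥0) : ℝ≥0∞) =
        (((1 / 2) ^ k : ℝ≥0) : ℝ≥0∞) * (((1 / 2) ^ k : ℝ≥0) : ℝ≥0∞) := by
      rw [← ENNReal.coe_mul, ← mul_pow]; norm_num
    refine (ENNReal.mul_le_mul_iff_right (a := (((1 / 2) ^ k : ℝ≥0) : ℝ≥0∞)) ?_
      ENNReal.coe_ne_top).1 ?_
    · simp
    · calc _ ≤ _ := h2
        _ ≤ C' * (((1 / 4) ^ k : ℝ≥0) : ℝ≥0∞) := by gcongr; exact hle k
        _ = _ := by rw [h3]; ring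
  have hsum : ∑' k, μ (s k) ≠ ∞ := by
    refine ne_top_of_le_ne_top ?_ (ENNReal.tsum_le_tsum hsle)
    rw [ENNReal.tsum_mul_left]
    refine ENNReal.mul_ne_top ENNReal.coe_ne_top ?_
    have : Summable fun k : ℕ => ((1 / 2) ^ k : ℝ≥0) :=
      NNReal.summable_geometric (by rw [div_lt_one two_pos]; exact one_lt_two)
    exact ENNReal.tsum_coe_ne_top_iff_summable.2 this
  have hae : ∀ᵐ x ∂μ, ∀ k, pvOperator d μ K (fun y => fs (ns k) y - f y) x =
      pvOperator d μ K (fs (ns k)) x - pvOperator d μ K f x :=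
    ae_all_iff.2 fun k => hW.ae_sub (hfs _) hf
  filter_upwards [ae_eventually_notMem hsum, hae] with x hx1 hx2
  rw [tendsto_iff_edist_tendsto_0]
  have hg : Tendsto (fun k : ℕ => (((1 / 2) ^ k : ℝ≥0) : ℝ≥0∞)) atTop (𝓝 0) := by
    rw [← ENNReal.coe_zero]
    exact ENNReal.tendsto_coe.2 (NNReal.tendsto_pow_atTop_nhds_zero_of_lt_one
      (by rw [div_lt_one two_pos]; exact one_lt_two))
  refine tendsto_of_tendsto_of_tendsto_of_le_of_le' tendsto_const_nhds hg
    (Eventually.of_forall fun k => zero_le) ?_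
  filter_upwards [hx1] with k hk
  rw [edist_eq_enorm_sub, ← hx2 k]
  exact not_lt.1 hk

/-- Truncating `f` at height `n` gives functions in `L²`, for which measurability is part of the
hypothesis on the operator. -/
theorem IsCZOperator.aestronglyMeasurable_pv [IsFiniteMeasure μ] (hT : IsCZOperator d μ K)
    {C' : ℝ≥0} (hW : IsWeakType d μ K C') {f : X → ℝ} (hf : Integrable f μ) :
    AEStronglyMeasurable (pvOperator d μ K f) μ := by
  obtain ⟨f', hf'm, hff'⟩ := hf.1
  have hf' : Integrable f' μ := hf.congr hff'
  set fs : ℕ → X → ℝ := fun n => {x | ‖f' x‖ ≤ n}.indicator f' with hfs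
  have hms : ∀ n : ℕ, MeasurableSet {x | ‖f' x‖ ≤ n} := fun n =>
    measurableSet_le hf'm.measurable.norm measurable_const
  have hfs1 : ∀ (n : ℕ) x, ‖f' x‖ ≤ n → fs n x = f' x := fun n x hx =>
    indicator_of_mem (show x ∈ {x | ‖f' x‖ ≤ n} from hx) f'
  have hfs0 : ∀ (n : ℕ) x, ¬ ‖f' x‖ ≤ n → fs n x = 0 := fun n x hx =>
    indicator_of_notMem (show x ∉ {x | ‖f' x‖ ≤ n} from hx) f'
  have hlim : Tendsto (fun n => ∫⁻ x, ‖fs n x - f' x‖ₑ ∂μ) atTop (𝓝 0) := by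
    have h0 : ∫⁻ _ : X, (0:ℝ≥0∞) ∂μ = 0 := by simp
    rw [← h0]
    refine tendsto_lintegral_of_dominated_convergence' (fun x => ‖f' x‖ₑ)
      (fun n => ((hf'.1.indicator (hms n)).sub hf'.1).enorm) (fun n => ae_of_all _ fun x => ?_)
      hf'.2.ne (ae_of_all _ fun x => ?_)
    · by_cases hx : ‖f' x‖ ≤ n
      · simp [hfs1 n x hx]
      · simp [hfs0 n x hx]
    · refine tendsto_const_nhds.congr' ?_
      obtain ⟨n, hn⟩ := exists_nat_ge ‖f' x‖
      filter_upwards [eventually_ge_atTop n] with m hm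
      simp [hfs1 m x (hn.trans (by exact_mod_cast hm))]
  obtain ⟨ns, -, hns⟩ := hW.exists_subseq_tendsto hf' (fun n => hf'.indicator (hms n)) hlim
  have h2 : ∀ n, MemLp (fs n) 2 μ := fun n =>
    MemLp.of_bound (hf'.1.indicator (hms n)) n (ae_of_all _ fun x => by
      by_cases hx : ‖f' x‖ ≤ n
      · rwa [hfs1 n x hx]
      · simp [hfs0 n x hx])
  have h3 : AEStronglyMeasurable (pvOperator d μ K f') μ := by
    obtain ⟨C₀, hC₀⟩ := hT.bounded
    exact aestronglyMeasurable_of_tendsto_ae atTop (fun k => (hC₀ _ (h2 (ns k))).1.1) hns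
  refine h3.congr ?_
  filter_upwards [(hW f hf).1] with x hx using (hx.congr_ae hff').2

/-! ### The good-`λ` inequality for Calderón–Zygmund operators -/

/-- The supremum of the truncated integrals over the balls of a basis which contain the point. -/
noncomputable def truncSup {X : Type*} [MeasurableSpace X] (d : X → X → ℝ) (𝒢 : Set (X × ℝ))
    (μ : Measure X) (K : X → X → ℝ) (L : ℝ) (f : X → ℝ) (x : X) : ℝ≥0∞ :=
  ⨆ B ∈ 𝒢, (qball d B.1 B.2).indicator (fun _ => ‖truncated d μ K f (L * B.2) B.1‖ₑ) x

theorem lt_truncSup_iff {L : ℝ} {f : X → ℝ} {x : X} {a : ℝ≥0∞} : a < truncSup d 𝒢 μ K L f x ↔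
    ∃ B ∈ 𝒢, x ∈ qball d B.1 B.2 ∧ a < ‖truncated d μ K f (L * B.2) B.1‖ₑ := by
  simp only [truncSup, lt_iSup_iff, exists_prop]
  refine exists_congr fun B => and_congr_right fun _ => ?_
  by_cases hx : x ∈ qball d B.1 B.2 <;> simp [hx]

theorem measurable_truncSup (h : DoublingBalls d μ c D Cd) (h𝒢 : IsBallBasis d 𝒢 Λ) (L : ℝ)
    (f : X → ℝ) : Measurable (truncSup d 𝒢 μ K L f) :=
  Measurable.biSup _ h𝒢.countable fun _ _ =>
    measurable_const.indicator (h.measurableSet_ball _ _)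

theorem le_truncSup {L : ℝ} {f : X → ℝ} {x : X} {B : X × ℝ} (hB : B ∈ 𝒢)
    (hx : x ∈ qball d B.1 B.2) :
    ‖truncated d μ K f (L * B.2) B.1‖ₑ ≤ truncSup d 𝒢 μ K L f x := by
  refine le_trans ?_ (le_biSup _ hB)
  simp [hx]

/-- The constant in the comparison of truncations over balls of radii `r' ≤ r ≤ t * r'`. -/
noncomputable def truncConst (c : ℝ) (Cd : ℝ≥0) (C : ℝ) (w : ℝ → ℝ) (Λ t : ℝ) : ℝ≥0∞ :=
  2 * (ENNReal.ofReal C * compConst c Cd (engulfConst c 1 * t) + ENNReal.ofReal C * diniSum w * Cd)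
    * compConst c Cd Λ

theorem IsCZKernelWith.truncConst_ne_top (hK : IsCZKernelWith d μ K C w) (t : ℝ) :
    truncConst c Cd C w Λ t ≠ ∞ := by
  have := hK.dini.diniSum_lt_top.ne
  unfold truncConst
  finiteness

/-- Truncations over two balls of comparable radii which share a point `v` differ by at most a
multiple of the maximal function at `v`. -/
theorem IsCZKernelWith.enorm_truncated_sub_le' (hK : IsCZKernelWith d μ K C w)
    (h : DoublingBalls d μ c D Cd) [IsFiniteMeasure μ] [NullSingletonClass μ]
    (h𝒢 : IsBallBasis d 𝒢 Λ) {f : X → ℝ} (hf : Integrable f μ) {x x' v : X} {r r' t : ℝ}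
    (hv : v ∈ qball d x r) (hv' : v ∈ qball d x' r') (hr : r' ≤ r) (ht : 1 ≤ t)
    (hrt : r ≤ t * r') :
    ‖truncated d μ K f (farConst c C * r') x' - truncated d μ K f (farConst c C * r) x‖ₑ ≤
      truncConst c Cd C w Λ t * maxFn d 𝒢 μ (fun y => ‖f y‖ₑ) v := by
  obtain ⟨-, -, hL2⟩ := hK.two_le_farConst h
  set L := farConst c C with hL
  set N := engulfConst c 1 with hN
  have hN1 : 1 ≤ N := h.one_le_engulfConst zero_le_one
  have hc1 := h.one_le
  have hr0 := h.pos_of_mem hv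
  have hr'0 := h.pos_of_mem hv'
  set m : ℝ≥0∞ := compConst c Cd Λ * maxFn d 𝒢 μ (fun y => ‖f y‖ₑ) v with hm
  have hrN : r ≤ N * r := le_mul_of_one_le_left hr0.le hN1
  have hmav : ∀ ρ, N * r ≤ ρ → ∫⁻ y in qball d x ρ, ‖f y‖ₑ ∂μ ≤ m * μ (qball d x ρ) :=
    fun ρ hρ => h.lintegral_ball_le h𝒢 _ (qball_mono d x (hrN.trans hρ) hv)
  -- both truncations are compared with the one at the larger scale `N * r`
  have key : ∀ x₁ r₁, v ∈ qball d x₁ r₁ → r₁ ≤ r → r ≤ t * r₁ →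
      ‖truncated d μ K f (L * r₁) x₁ - truncated d μ K f (L * (N * r)) x‖ₑ ≤
        (ENNReal.ofReal C * compConst c Cd (N * t) + ENNReal.ofReal C * diniSum w * Cd) * m := by
    intro x₁ r₁ hv₁ hr₁ hrt₁
    have hr₁0 := h.pos_of_mem hv₁
    have hmemL : v ∈ qball d x₁ (L * r₁) := qball_mono d _ (by nlinarith) hv₁
    have hmemL' : v ∈ qball d x (L * r) := qball_mono d _ (by nlinarith) hv
    have hx₁ : x₁ ∈ qball d x (N * r) := by
      have h1 := h.triangle x x₁ v
      have h2 := h.symm v x₁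
      have h3 : d x v < r := hv
      have h4 : d x₁ v < r₁ := hv₁
      have h5 : d v x₁ ≤ c * r := h2.trans (by gcongr; linarith)
      change d x x₁ < N * r
      have hc2 : c ≤ c ^ 2 := by nlinarith
      calc d x x₁ ≤ c * (d x v + d v x₁) := h1
        _ < c * (r + c * r) := mul_lt_mul_of_pos_left (by linarith) h.cpos
        _ ≤ c * (r + 2 * c ^ 2 * r) := by gcongr; nlinarith
        _ = N * r := by rw [hN, engulfConst]; ring
    have hsub : qball d x₁ (L * r₁) ⊆ qball d x (L * (N * r)) := by
      have := h.ball_subset_of_inter (x := x) (y := x₁) (r := L * r) (s := L * r₁) (t := 1)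
        (by rw [one_mul]; gcongr) ⟨v, hmemL', hmemL⟩
      rwa [← hN, mul_left_comm] at this
    have h1 := hK.enorm_truncated_sub_le h hf hx₁ (by positivity) hsub hmav
    refine h1.trans ?_
    have hpos := h.measure_ball_pos x₁ (L * r₁) (by positivity)
    have h2 : μ (qball d x (L * (N * r))) ≤
        compConst c Cd (N * t) * μ (qball d x₁ (L * r₁)) := by
      refine h.measure_le_of_inter ?_ (by positivity) ⟨v, hmemL, ?_⟩
      · calc L * (N * r) ≤ L * (N * (t * r₁)) := by gcongr
          _ = _ := by ring
      · exact qball_mono d _ (by gcongr) hmemL'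
    rw [add_mul]
    refine add_le_add ?_ le_rfl
    calc ENNReal.ofReal C * (μ (qball d x₁ (L * r₁)))⁻¹ * (m * μ (qball d x (L * (N * r))))
        ≤ ENNReal.ofReal C * (μ (qball d x₁ (L * r₁)))⁻¹ *
          (m * (compConst c Cd (N * t) * μ (qball d x₁ (L * r₁)))) := by gcongr
      _ = ENNReal.ofReal C * compConst c Cd (N * t) * m *
          ((μ (qball d x₁ (L * r₁)))⁻¹ * μ (qball d x₁ (L * r₁))) := by ring
      _ = _ := by rw [ENNReal.inv_mul_cancel hpos.ne' (measure_ne_top _ _), mul_one]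
  have e1 := key x' r' hv' hr hrt
  have e2 := key x r hv le_rfl (le_mul_of_one_le_left hr0.le ht)
  calc ‖truncated d μ K f (L * r') x' - truncated d μ K f (L * r) x‖ₑ
      = ‖(truncated d μ K f (L * r') x' - truncated d μ K f (L * (N * r)) x) -
        (truncated d μ K f (L * r) x - truncated d μ K f (L * (N * r)) x)‖ₑ := by congr 1; ring
    _ ≤ _ := enorm_sub_le
    _ ≤ _ := add_le_add e1 e2
    _ = _ := by rw [truncConst, hm]; ring

/-- The principal value is a limit of truncations, each of which is close to a truncation over a
ball of the basis. -/
theorem IsCZKernelWith.enorm_pv_le (hK : IsCZKernelWith d μ K C w)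
    (h : DoublingBalls d μ c D Cd) [IsFiniteMeasure μ] [NullSingletonClass μ] (hΛ : 1 ≤ Λ)
    (h𝒢 : IsBallBasis d 𝒢 Λ) {f : X → ℝ} (hf : Integrable f μ) {x : X}
    (hpv : PVExistsAt d μ K f x) :
    ‖pvOperator d μ K f x‖ₑ ≤ truncSup d 𝒢 μ K (farConst c C) f x +
      truncConst c Cd C w Λ Λ * maxFn d 𝒢 μ (fun y => ‖f y‖ₑ) x := by
  obtain ⟨-, -, hL2⟩ := hK.two_le_farConst h
  have hlim : Tendsto (fun η => ‖truncated d μ K f η x‖ₑ) (𝓝[>] 0)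
      (𝓝 ‖pvOperator d μ K f x‖ₑ) := (continuous_enorm.tendsto _).comp hpv.tendsto
  refine le_of_tendsto hlim ?_
  filter_upwards [self_mem_nhdsWithin] with η hη
  have hη' : 0 < η / farConst c C := div_pos hη (by linarith)
  obtain ⟨B, hB, hsub, h1, h2⟩ := h𝒢.exists_superset x _ hη'
  have hxη := h.mem_ball_self x hη'
  have h3 := hK.enorm_truncated_sub_le' h h𝒢 hf (hsub hxη) hxη h1 hΛ h2
  rw [mul_div_cancel₀ _ (by linarith : farConst c C ≠ 0)] at h3
  calc ‖truncated d μ K f η x‖ₑ = ‖truncated d μ K f (farConst c C * B.2) B.1 +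
        (truncated d μ K f η x - truncated d μ K f (farConst c C * B.2) B.1)‖ₑ := by congr 1; ring
    _ ≤ _ := enorm_add_le _ _
    _ ≤ _ := add_le_add (le_truncSup hB (hsub hxη)) h3

theorem IsCZKernelWith.enorm_pv_sub_le (hK : IsCZKernelWith d μ K C w)
    (h : DoublingBalls d μ c D Cd) [IsFiniteMeasure μ] [NullSingletonClass μ]
    (h𝒢 : IsBallBasis d 𝒢 Λ) {f : X → ℝ} (hf : Integrable f μ) {x y v : X} {r : ℝ}
    (hy : y ∈ qball d x r) (hv : v ∈ qball d x r) (hpv : PVExistsAt d μ K f y) :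
    ‖pvOperator d μ K f y - truncated d μ K f (farConst c C * r) x‖ₑ ≤
      ‖pvOperator d μ K ((qball d x (farConst c C * r)).indicator f) y‖ₑ +
      ENNReal.ofReal C * diniSum w * Cd * compConst c Cd Λ *
        maxFn d 𝒢 μ (fun y => ‖f y‖ₑ) v := by
  rw [(hK.pv_split h hf hy hpv).2, add_sub_assoc, mul_assoc (ENNReal.ofReal C * diniSum w * Cd)]
  refine (enorm_add_le _ _).trans (add_le_add le_rfl ?_)
  exact hK.enorm_far_sub_le h hf hy fun ρ hρ =>
    h.lintegral_ball_le h𝒢 _ (qball_mono d x hρ hv)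

end GrandMorrey

namespace GrandMorrey

variable {X : Type*} [MeasurableSpace X] {d : X → X → ℝ} {μ ν : Measure X} {c D : ℝ} {Cd : ℝ≥0}
  {𝒢 : Set (X × ℝ)} {Λ : ℝ} {K : X → X → ℝ} {C : ℝ} {w : ℝ → ℝ}

/-- Where `Mf` is small, `T f` cannot be large on most of a ball near which the truncations at
larger scales are small. Only the unweighted measure enters here. -/
theorem IsWeakType.exists_local_goodLambda {C' : ℝ≥0} (hW : IsWeakType d μ K C')
    (hK : IsCZKernelWith d μ K C w) (h : DoublingBalls d μ c D Cd) [IsFiniteMeasure μ]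
    [NullSingletonClass μ] (hΛ : 1 ≤ Λ) (h𝒢 : IsBallBasis d 𝒢 Λ) :
    ∃ Q : ℝ≥0, ∀ f : X → ℝ, Integrable f μ → ∀ (t : ℝ) (γ : ℝ≥0), 0 < t → Q * γ ≤ 1 →
      ∀ (z x₀ : X) (r : ℝ), x₀ ∈ qball d z r →
      (∀ B ∈ 𝒢, x₀ ∈ qball d B.1 B.2 →
        ENNReal.ofReal t < ‖truncated d μ K f (farConst c C * B.2) B.1‖ₑ → B.2 ≤ 2 * r) →
      μ ({x | ENNReal.ofReal (3 * t) < truncSup d 𝒢 μ K (farConst c C) f x ∧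
          maxFn d 𝒢 μ (fun y => ‖f y‖ₑ) x ≤ γ * ENNReal.ofReal t} ∩
        qball d z (engulfConst c 2 * r)) ≤
        Q * γ * μ (qball d z (engulfConst c 2 * r)) := by
  obtain ⟨-, -, hL2⟩ := hK.two_le_farConst h
  set L := farConst c C with hL
  set κ := engulfConst c 2 with hκ
  set N := engulfConst c 1 with hN
  have hN2 : 2 * 1 ≤ N := h.le_engulfConst zero_le_one
  have hκ4 : 2 * 2 ≤ κ := h.le_engulfConst zero_le_two
  set T1 := truncConst c Cd C w Λ (Λ * N) with hT1
  have hT1top : T1 ≠ ∞ := hK.truncConst_ne_top _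
  set c2 : ℝ≥0∞ := ENNReal.ofReal C * diniSum w * Cd * compConst c Cd Λ with hc2
  have hc2top : c2 ≠ ∞ := by
    have := hK.dini.diniSum_lt_top.ne
    finiteness
  set a0 : ℝ≥0∞ := C' * (compConst c Cd Λ * (Cd ^ ⌈L⌉₊ : ℝ≥0)) with ha0
  set a1 : ℝ≥0∞ := 4 * compConst c Cd 2 * (a0 * compConst c Cd (Λ * N)) with ha1
  have ha0top : a0 ≠ ∞ := by finiteness
  have ha1top : a1 ≠ ∞ := by finiteness
  have hQtop : T1 + 4 * c2 + 4 * a0 + a1 ≠ ∞ := by finiteness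
  refine ⟨(T1 + 4 * c2 + 4 * a0 + a1).toNNReal, fun f hf t γ ht hQγ z x₀ r hx₀ hmax => ?_⟩
  have hQ' : (T1 + 4 * c2 + 4 * a0 + a1) * γ ≤ 1 := by
    rw [← ENNReal.coe_toNNReal hQtop]; exact_mod_cast hQγ
  rw [ENNReal.coe_toNNReal hQtop]
  set Q := T1 + 4 * c2 + 4 * a0 + a1 with hQ
  have hr0 := h.pos_of_mem hx₀
  set τ : ℝ≥0∞ := ENNReal.ofReal t with hτ
  have hτ0 : τ ≠ 0 := by simpa [hτ] using ht
  have hτtop : τ ≠ ∞ := by simp [hτ]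
  have h3τ : ENNReal.ofReal (3 * t) = 3 * τ := by
    rw [ENNReal.ofReal_mul (by norm_num)]; simp [hτ]
  rw [h3τ]
  have hT1γ : T1 * γ ≤ 1 := le_trans (by gcongr; rw [hQ, add_assoc, add_assoc]; exact le_self_add) hQ'
  have hc2γ : 4 * c2 * γ ≤ 1 := le_trans (by
    gcongr; rw [hQ, add_assoc, add_comm T1, add_assoc]; exact le_self_add) hQ'
  have ha0γ : 4 * a0 * γ ≤ 1 := le_trans (by
    gcongr; rw [hQ, add_assoc, add_comm (T1 + 4 * c2), add_assoc]; exact le_self_add) hQ'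
  set S := {x | 3 * τ < truncSup d 𝒢 μ K L f x ∧
          maxFn d 𝒢 μ (fun y => ‖f y‖ₑ) x ≤ γ * τ} with hS
  -- if the set is nonempty, one of its points has small `Mf`, so all averages at the scale of the
  -- ball are small
  rcases (S ∩ qball d z (κ * r)).eq_empty_or_nonempty with he | ⟨v₀, hv₀S, hv₀⟩
  · rw [he]; simp
  set R := N * (κ * r) with hR
  have hκr : 0 < κ * r := by positivity
  have hR0 : 0 < R := by rw [hR]; positivity
  have hκR : κ * r ≤ R := by rw [hR]; nlinarith
  have h2r : 2 * r < R := by nlinarith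
  -- a ball around `x₀` too large to be among those with large truncations
  obtain ⟨Bt, hBt, hBtsub, hBt1, hBt2⟩ := h𝒢.exists_superset z R hR0
  have hx₀t : x₀ ∈ qball d Bt.1 Bt.2 := hBtsub (qball_mono d z (by linarith) hx₀)
  have hv₀t : v₀ ∈ qball d Bt.1 Bt.2 := hBtsub (qball_mono d z hκR hv₀)
  have hBt0 : 0 < Bt.2 := by linarith
  have hcBt : ‖truncated d μ K f (L * Bt.2) Bt.1‖ₑ ≤ τ := by
    by_contra! hlt
    have := hmax Bt hBt hx₀t hlt
    linarith
  -- the local part of `f` at a ball containing a point where `Mf` is small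
  have hweak : ∀ (x v : X) (ρ : ℝ) (α : ℝ≥0), v ∈ qball d x ρ →
      maxFn d 𝒢 μ (fun y => ‖f y‖ₑ) v ≤ γ * τ →
      α * μ {y | α < ‖pvOperator d μ K ((qball d x (L * ρ)).indicator f) y‖ₑ} ≤
        a0 * γ * τ * μ (qball d x ρ) := by
    intro x v ρ α hv hM
    have hρ := h.pos_of_mem hv
    refine ((hW _ (hf.indicator (h.measurableSet_ball x (L * ρ)))).2 α).trans ?_
    have e1 : ∫⁻ y, ‖(qball d x (L * ρ)).indicator f y‖ₑ ∂μ =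
        ∫⁻ y in qball d x (L * ρ), ‖f y‖ₑ ∂μ := by
      rw [← lintegral_indicator (h.measurableSet_ball _ _)]
      simp only [enorm_indicator_eq_indicator_enorm]
    rw [e1]
    have e2 := h.lintegral_ball_le h𝒢 (fun y => ‖f y‖ₑ)
      (qball_mono d x (by nlinarith : ρ ≤ L * ρ) hv)
    calc (C' : ℝ≥0∞) * ∫⁻ y in qball d x (L * ρ), ‖f y‖ₑ ∂μ
        ≤ C' * (compConst c Cd Λ * (γ * τ) * ((Cd ^ ⌈L⌉₊ : ℝ≥0) * μ (qball d x ρ))) := by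
          refine mul_le_mul' le_rfl (e2.trans (mul_le_mul' (mul_le_mul' le_rfl hM) ?_))
          exact h.measure_dilate_le L x hρ
      _ = _ := by rw [ha0]; ring
  set E₀ := {y | τ < ‖pvOperator d μ K ((qball d Bt.1 (L * Bt.2)).indicator f) y‖ₑ} with hE₀
  set E := toMeasurable μ E₀ with hE
  have hEm : MeasurableSet E := measurableSet_toMeasurable _ _
  have hEle : μ E ≤ a0 * γ * μ (qball d Bt.1 Bt.2) := by
    have := hweak Bt.1 v₀ Bt.2 t.toNNReal hv₀t hv₀S.2
    rw [measure_toMeasurable]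
    change τ * μ E₀ ≤ _ at this
    have e : a0 * γ * τ * μ (qball d Bt.1 Bt.2) = τ * (a0 * γ * μ (qball d Bt.1 Bt.2)) := by ring
    rw [e] at this
    exact (ENNReal.mul_le_mul_iff_right hτ0 hτtop).1 this
  have hsub : S ∩ qball d z (κ * r) ⊆ {x | 4⁻¹ < maxFn d 𝒢 μ (E.indicator 1) x} := by
    rintro v ⟨⟨hv1, hvM⟩, hvκ⟩
    obtain ⟨⟨z', r'⟩, hB', hvB', hlt⟩ := lt_truncSup_iff.1 hv1
    simp only at hvB' hlt
    have hr'0 := h.pos_of_mem hvB'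
    rcases le_or_gt (κ * r) r' with hcase | hcase
    · exfalso
      have hNr' : 0 < N * r' := by positivity
      obtain ⟨B2, hB2, hsub2, hB21, hB22⟩ := h𝒢.exists_superset z' (N * r') hNr'
      have hsub3 : qball d z (κ * r) ⊆ qball d z' (N * r') :=
        h.ball_subset_of_inter (by linarith) ⟨v, hvB', hvκ⟩
      have hx2 : x₀ ∈ qball d B2.1 B2.2 :=
        hsub2 (hsub3 (qball_mono d z (by nlinarith) hx₀))
      have hle : ‖truncated d μ K f (L * B2.2) B2.1‖ₑ ≤ τ := by
        by_contra! hgt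
        have := hmax B2 hB2 hx2 hgt
        nlinarith
      have hcmp := hK.enorm_truncated_sub_le' h h𝒢 hf (hsub2 (hsub3 hvκ)) hvB'
        (by nlinarith : r' ≤ B2.2) (by nlinarith : 1 ≤ Λ * N) (by linarith)
      have : ‖truncated d μ K f (L * r') z'‖ₑ ≤ τ + τ := by
        calc ‖truncated d μ K f (L * r') z'‖ₑ = ‖truncated d μ K f (L * B2.2) B2.1 +
              (truncated d μ K f (L * r') z' - truncated d μ K f (L * B2.2) B2.1)‖ₑ := by
              congr 1; ring
          _ ≤ _ := enorm_add_le _ _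
          _ ≤ τ + T1 * (γ * τ) := add_le_add hle (hcmp.trans (by gcongr))
          _ ≤ τ + 1 * τ := by rw [← mul_assoc]; gcongr
          _ = τ + τ := by rw [one_mul]
      have h3 : 3 * τ < τ + τ := hlt.trans_le this
      have : τ + τ ≤ 3 * τ := by rw [← two_mul]; gcongr; norm_num
      exact absurd h3 (not_lt.2 this)
    · have hB'sub : qball d z' r' ⊆ qball d Bt.1 Bt.2 :=
        (h.ball_subset_of_inter (t := 1) (by linarith) ⟨v, hvκ, hvB'⟩).trans hBtsub
      have hvt := hB'sub hvB'
      set E1 := {y | ((t / 2).toNNReal : ℝ≥0∞) <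
        ‖pvOperator d μ K ((qball d z' (L * r')).indicator f) y‖ₑ} with hE1
      have hhalf : ((t / 2).toNNReal : ℝ≥0∞) = 2⁻¹ * τ := by
        change ENNReal.ofReal (t / 2) = _
        rw [div_eq_inv_mul, ENNReal.ofReal_mul (by norm_num), ENNReal.ofReal_inv_of_pos two_pos]
        simp [hτ]
      have hE1le : μ E1 ≤ 2⁻¹ * μ (qball d z' r') := by
        have := hweak z' v r' (t / 2).toNNReal hvB' hvM
        rw [hhalf] at this
        have e : 2⁻¹ * τ * μ E1 ≤ 2⁻¹ * τ * (2⁻¹ * μ (qball d z' r')) := by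
          rw [← hhalf, hE1, hhalf]
          refine this.trans ?_
          calc a0 * γ * τ * μ (qball d z' r')
              = 4⁻¹ * (4 * a0 * γ) * τ * μ (qball d z' r') := by
                rw [mul_assoc 4, ← mul_assoc, ENNReal.inv_mul_cancel (by norm_num) (by norm_num),
                  one_mul]
            _ ≤ 4⁻¹ * 1 * τ * μ (qball d z' r') := by gcongr
            _ = 2⁻¹ * τ * (2⁻¹ * μ (qball d z' r')) := by
                rw [show (4 : ℝ≥0∞) = 2 * 2 by norm_num, ENNReal.mul_inv (by simp) (by simp)]; ring
        exact (ENNReal.mul_le_mul_iff_right (by simp [hτ0]) (by finiteness)).1 e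
      have hae : ∀ᵐ y ∂μ, y ∈ qball d z' r' → y ∈ E1 ∪ E := by
        filter_upwards [(hW f hf).1] with y hy hyB
        by_contra hnot
        have h1 : ‖pvOperator d μ K ((qball d z' (L * r')).indicator f) y‖ₑ ≤ 2⁻¹ * τ := by
          rw [← hhalf]
          exact not_lt.1 fun hlt => hnot (Or.inl hlt)
        have h2 : ‖pvOperator d μ K ((qball d Bt.1 (L * Bt.2)).indicator f) y‖ₑ ≤ τ :=
          not_lt.1 fun hlt => hnot (Or.inr (subset_toMeasurable _ _ hlt))
        have e1 := hK.enorm_pv_sub_le h h𝒢 hf hyB hvB' hy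
        have e2 := hK.enorm_pv_sub_le h h𝒢 hf (hB'sub hyB) hvt hy
        rw [← hc2, ← hL] at e1 e2
        have h3 : ‖truncated d μ K f (L * r') z'‖ₑ ≤ 3 * τ := by
          calc ‖truncated d μ K f (L * r') z'‖ₑ
              = ‖(truncated d μ K f (L * Bt.2) Bt.1 +
                (pvOperator d μ K f y - truncated d μ K f (L * Bt.2) Bt.1)) -
                (pvOperator d μ K f y - truncated d μ K f (L * r') z')‖ₑ := by congr 1; ring
            _ ≤ _ := enorm_sub_le
            _ ≤ _ := add_le_add (enorm_add_le _ _) le_rfl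
            _ ≤ (τ + (τ + c2 * (γ * τ))) + (2⁻¹ * τ + c2 * (γ * τ)) :=
                add_le_add (add_le_add hcBt (e2.trans (add_le_add h2 (by gcongr))))
                  (e1.trans (add_le_add h1 (by gcongr)))
            _ = (2 + 2⁻¹ + 2⁻¹ * (4 * c2 * γ)) * τ := by
                have : (2⁻¹ : ℝ≥0∞) * 4 = 2 := by
                  rw [show (4 : ℝ≥0∞) = 2 * 2 by norm_num, ← mul_assoc,
                    ENNReal.inv_mul_cancel (by simp) (by simp), one_mul]
                rw [mul_assoc 4, ← mul_assoc 2⁻¹, this]; ring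
            _ ≤ (2 + 2⁻¹ + 2⁻¹ * 1) * τ := by gcongr
            _ = 3 * τ := by rw [mul_one, add_assoc, ENNReal.inv_two_add_inv_two]; norm_num
        exact absurd hlt (not_lt.2 h3)
      have hBpos := h.measure_ball_pos z' r' hr'0
      have hBtop := measure_ne_top μ (qball d z' r')
      have hle : 2⁻¹ * μ (qball d z' r') ≤ μ (qball d z' r' ∩ E) := by
        have h1 : μ (qball d z' r') ≤ 2⁻¹ * μ (qball d z' r') + μ (qball d z' r' ∩ E) := by
          calc μ (qball d z' r') ≤ μ (E1 ∪ (qball d z' r' ∩ E)) := by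
                refine measure_mono_ae ?_
                filter_upwards [hae] with y hy hyB
                exact (hy hyB).imp id fun hyE => ⟨hyB, hyE⟩
            _ ≤ _ := (measure_union_le _ _).trans (add_le_add hE1le le_rfl)
        have h2 : μ (qball d z' r') = 2⁻¹ * μ (qball d z' r') + 2⁻¹ * μ (qball d z' r') := by
          rw [← add_mul, ENNReal.inv_two_add_inv_two, one_mul]
        refine (ENNReal.add_le_add_iff_left (a := 2⁻¹ * μ (qball d z' r')) (by finiteness)).1 ?_
        rwa [← h2]
      change 4⁻¹ < maxFn d 𝒢 μ (E.indicator 1) v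
      refine lt_of_lt_of_le ?_ (average_le_maxFn hB' hvB')
      have e1 : ∫⁻ y in qball d z' r', E.indicator 1 y ∂μ = μ (qball d z' r' ∩ E) := by
        rw [setLIntegral_indicator hEm]
        simp [inter_comm]
      simp only [e1]
      calc (4⁻¹ : ℝ≥0∞) < 2⁻¹ := by rw [ENNReal.inv_lt_inv]; norm_num
        _ = (μ (qball d z' r'))⁻¹ * (2⁻¹ * μ (qball d z' r')) := by
            rw [mul_left_comm, ENNReal.inv_mul_cancel hBpos.ne' hBtop, mul_one]
        _ ≤ _ := by gcongr
  have hBtle : μ (qball d Bt.1 Bt.2) ≤ compConst c Cd (Λ * N) * μ (qball d z (κ * r)) :=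
    h.measure_le_of_inter (by rw [hR] at hBt2; linarith) hκr ⟨v₀, hv₀, hv₀t⟩
  have hfin := h.mul_measure_lt_maxFn_le' h𝒢 (E.indicator 1) (4⁻¹ : ℝ≥0∞)
  rw [lintegral_indicator hEm] at hfin
  simp only [Pi.one_apply, lintegral_one, Measure.restrict_apply MeasurableSet.univ, univ_inter]
    at hfin
  calc μ (S ∩ qball d z (κ * r)) ≤ μ {x | 4⁻¹ < maxFn d 𝒢 μ (E.indicator 1) x} := measure_mono hsub
    _ = 4 * (4⁻¹ * μ {x | 4⁻¹ < maxFn d 𝒢 μ (E.indicator 1) x}) := by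
        rw [← mul_assoc, ENNReal.mul_inv_cancel (by norm_num) (by norm_num), one_mul]
    _ ≤ 4 * (compConst c Cd 2 * (a0 * γ * (compConst c Cd (Λ * N) * μ (qball d z (κ * r))))) := by
        refine mul_le_mul' le_rfl (hfin.trans (mul_le_mul' le_rfl (hEle.trans ?_)))
        gcongr
    _ = a1 * γ * μ (qball d z (κ * r)) := by rw [ha1]; ring
    _ ≤ Q * γ * μ (qball d z (κ * r)) := by gcongr; exact le_add_self

end GrandMorrey

namespace GrandMorrey

/-! ### Weighted norm inequalities for Calderón–Zygmund operators -/

/-- A measure which satisfies, with constant `Cν`, the `A_∞` condition with exponent `1/2` and the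
`A_r` condition of Muckenhoupt with respect to `μ`. -/
structure IsWeight {X : Type*} [MeasurableSpace X] (d : X → X → ℝ) (μ : Measure X) (r : ℝ)
    (Cν : ℝ≥0) (ν : Measure X) : Prop where
  ac : ν ≪ μ
  ac' : μ ≪ ν
  ainfty : ∀ x ρ E, 0 < ρ → MeasurableSet E → E ⊆ qball d x ρ →
    ν E ≤ Cν * (μ E / μ (qball d x ρ)) ^ (1 / 2 : ℝ) * ν (qball d x ρ)
  muckenhoupt : ∀ x ρ (φ : X → ℝ≥0∞), 0 < ρ → AEMeasurable φ μ →
    (∫⁻ y in qball d x ρ, φ y ∂μ) ^ r * ν (qball d x ρ) ≤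
      Cν * μ (qball d x ρ) ^ r * ∫⁻ y in qball d x ρ, φ y ^ r ∂ν

variable {X : Type*} [MeasurableSpace X] {d : X → X → ℝ} {μ ν : Measure X} {c D : ℝ} {Cd : ℝ≥0}
  {𝒢 : Set (X × ℝ)} {Λ : ℝ} {K : X → X → ℝ} {C : ℝ} {w : ℝ → ℝ} {r : ℝ} {Cν : ℝ≥0}

/-- The doubling constant of a weight, for dilation by the factor of the covering lemma. -/
noncomputable def weightDoubling (c : ℝ) (Cd : ℝ≥0) (r : ℝ) (Cν : ℝ≥0) : ℝ≥0 :=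
  max 1 (Cν * compConst c Cd 2 ^ r)

/-- The doubling property of a weight: the `A_r` condition for the indicator of a ball. -/
theorem IsWeight.measure_engulf_le (hν : IsWeight d μ r Cν ν) (hr : 0 < r)
    (h : DoublingBalls d μ c D Cd) [IsFiniteMeasure μ] (x : X) {ρ : ℝ} (hρ : 0 < ρ) :
    ν (qball d x (engulfConst c 2 * ρ)) ≤ weightDoubling c Cd r Cν * ν (qball d x ρ) := by
  have hκ : 1 ≤ engulfConst c 2 := h.one_le_engulfConst zero_le_two
  set κ := engulfConst c 2 with hκdef
  have hBm := h.measurableSet_ball x ρ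
  have hsub : qball d x ρ ⊆ qball d x (κ * ρ) := qball_mono d x (by nlinarith)
  have h1 := hν.muckenhoupt x (κ * ρ) ((qball d x ρ).indicator 1) (by positivity)
    (measurable_one.indicator hBm).aemeasurable
  have e1 : ∫⁻ y in qball d x (κ * ρ), (qball d x ρ).indicator 1 y ∂μ = μ (qball d x ρ) := by
    rw [setLIntegral_indicator hBm]; simp [inter_eq_left.2 hsub]
  have e2 : ∫⁻ y in qball d x (κ * ρ), ((qball d x ρ).indicator 1 y : ℝ≥0∞) ^ r ∂ν =
      ν (qball d x ρ) := by
    have : ∀ y, ((qball d x ρ).indicator 1 y : ℝ≥0∞) ^ r = (qball d x ρ).indicator 1 y := by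
      intro y
      by_cases hy : y ∈ qball d x ρ <;> simp [hy, hr]
    simp only [this]
    rw [setLIntegral_indicator hBm]; simp [inter_eq_left.2 hsub]
  rw [e1, e2] at h1
  have hpos := h.measure_ball_pos x ρ hρ
  have htop := measure_ne_top μ (qball d x ρ)
  have hpr : μ (qball d x ρ) ^ r ≠ 0 := by simp [hpos.ne']
  have hpt : μ (qball d x ρ) ^ r ≠ ∞ := ENNReal.rpow_ne_top_of_nonneg hr.le htop
  refine (ENNReal.mul_le_mul_iff_right hpr hpt).1 (h1.trans ?_)
  calc (Cν : ℝ≥0∞) * μ (qball d x (κ * ρ)) ^ r * ν (qball d x ρ)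
      ≤ Cν * (compConst c Cd 2 * μ (qball d x ρ)) ^ r * ν (qball d x ρ) := by
        gcongr; exact h.measure_engulf_le 2 x hρ
    _ = μ (qball d x ρ) ^ r * (((Cν * compConst c Cd 2 ^ r : ℝ≥0) : ℝ≥0∞) * ν (qball d x ρ)) := by
        rw [ENNReal.mul_rpow_of_nonneg _ _ hr.le, ENNReal.coe_mul,
          ENNReal.coe_rpow_of_nonneg _ hr.le]
        ring
    _ ≤ _ := by gcongr; exact le_max_right _ _

/-- The good-`λ` inequality for weights. -/
theorem IsWeight.exists_goodLambda {C' : ℝ≥0} (hW : IsWeakType d μ K C')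
    (hK : IsCZKernelWith d μ K C w) (h : DoublingBalls d μ c D Cd) [IsFiniteMeasure μ]
    [NullSingletonClass μ] (hΛ : 1 ≤ Λ) (h𝒢 : IsBallBasis d 𝒢 Λ) :
    ∃ Q : ℝ≥0, ∀ (r : ℝ) (Cν : ℝ≥0) (ν : Measure X), 0 < r → IsWeight d μ r Cν ν →
      ∀ f : X → ℝ, Integrable f μ → ∀ (t : ℝ) (γ : ℝ≥0), 0 < t → Q * γ ≤ 1 →
      ν {x | ENNReal.ofReal (3 * t) < truncSup d 𝒢 μ K (farConst c C) f x ∧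
          maxFn d 𝒢 μ (fun y => ‖f y‖ₑ) x ≤ γ * ENNReal.ofReal t} ≤
        Cν * (Q * γ : ℝ≥0∞) ^ (1 / 2 : ℝ) * weightDoubling c Cd r Cν *
          ν {x | ENNReal.ofReal t < truncSup d 𝒢 μ K (farConst c C) f x} := by
  obtain ⟨-, -, hL2⟩ := hK.two_le_farConst h
  obtain ⟨Q, hQ⟩ := hW.exists_local_goodLambda hK h hΛ h𝒢
  refine ⟨Q, fun r Cν ν hr hν f hf t γ ht hQγ => ?_⟩
  set L := farConst c C with hL
  set G := truncSup d 𝒢 μ K L f with hG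
  have hGm : Measurable G := measurable_truncSup h h𝒢 L f
  set S := {x | ENNReal.ofReal (3 * t) < G x ∧
    maxFn d 𝒢 μ (fun y => ‖f y‖ₑ) x ≤ γ * ENNReal.ofReal t} with hS
  have hSm : MeasurableSet S := (measurableSet_lt measurable_const hGm).inter
    (measurableSet_le (measurable_maxFn h h𝒢 _) measurable_const)
  -- the balls which witness that the supremum of truncations exceeds `t`; their radii are bounded
  -- by `D` because a truncation over the whole space vanishes
  set T : Set (X × ℝ) := {B | B ∈ 𝒢 ∧
    ENNReal.ofReal t < ‖truncated d μ K f (L * B.2) B.1‖ₑ} with hT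
  have hTpos : ∀ B ∈ T, 0 < B.2 := fun B hB => h𝒢.pos B hB.1
  have hTD : ∀ B ∈ T, B.2 ≤ D := by
    intro B hB
    by_contra! hlt
    have hpos := hTpos B hB
    have h0 : truncated d μ K f (L * B.2) B.1 = 0 := by
      rw [truncated, h.ball_eq_univ B.1 (by nlinarith : D ≤ L * B.2)]; simp
    have := hB.2
    rw [h0] at this
    simp at this
  obtain ⟨u, huT, hud, hcov, hmax⟩ := h.exists_covering T hTpos D hTD
  have huc : u.Countable := h𝒢.countable.mono fun B hB => (huT hB).1
  have hcT : ∀ x, ENNReal.ofReal t < G x → x ∈ ⋃ B ∈ T, qball d B.1 B.2 := by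
    intro x hx
    obtain ⟨B, hB, hxB, hlt⟩ := lt_truncSup_iff.1 hx
    exact mem_biUnion (show B ∈ T from ⟨hB, hlt⟩) hxB
  have hSsub : S ⊆ ⋃ B ∈ u, S ∩ qball d B.1 (engulfConst c 2 * B.2) := by
    intro x hx
    have := hcov (hcT x (lt_of_le_of_lt (ENNReal.ofReal_le_ofReal (by linarith)) hx.1))
    simp only [mem_iUnion, exists_prop] at this ⊢
    obtain ⟨B, hB, hxB⟩ := this
    exact ⟨B, hB, hx, hxB⟩
  have hκ : 2 * 2 ≤ engulfConst c 2 := h.le_engulfConst zero_le_two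
  have hloc : ∀ B ∈ u, ν (S ∩ qball d B.1 (engulfConst c 2 * B.2)) ≤
      Cν * (Q * γ : ℝ≥0∞) ^ (1 / 2 : ℝ) * weightDoubling c Cd r Cν * ν (qball d B.1 B.2) := by
    intro B hB
    have hB0 := hTpos B (huT hB)
    obtain ⟨x₀, hx₀, hx₀max⟩ := hmax B hB
    have h1 := hQ f hf t γ ht hQγ B.1 x₀ B.2 hx₀
      (fun B' hB' hx' hlt => hx₀max B' ⟨hB', hlt⟩ hx')
    refine (hν.ainfty B.1 (engulfConst c 2 * B.2) _ (by positivity)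
      (hSm.inter (h.measurableSet_ball _ _)) inter_subset_right).trans ?_
    have h2 : μ (S ∩ qball d B.1 (engulfConst c 2 * B.2)) /
        μ (qball d B.1 (engulfConst c 2 * B.2)) ≤ Q * γ := ENNReal.div_le_of_le_mul h1
    calc _ ≤ Cν * (Q * γ : ℝ≥0∞) ^ (1 / 2 : ℝ) *
        (weightDoubling c Cd r Cν * ν (qball d B.1 B.2)) :=
          mul_le_mul' (mul_le_mul' le_rfl (ENNReal.rpow_le_rpow h2 (by norm_num)))
            (hν.measure_engulf_le hr h B.1 hB0)
      _ = _ := by ring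
  calc ν S ≤ ν (⋃ B ∈ u, S ∩ qball d B.1 (engulfConst c 2 * B.2)) := measure_mono hSsub
    _ ≤ ∑' B : u, ν (S ∩ qball d B.1.1 (engulfConst c 2 * B.1.2)) := measure_biUnion_le ν huc _
    _ ≤ ∑' B : u, Cν * (Q * γ : ℝ≥0∞) ^ (1 / 2 : ℝ) * weightDoubling c Cd r Cν *
        ν (qball d B.1.1 B.1.2) := ENNReal.tsum_le_tsum fun B => hloc B.1 B.2
    _ = Cν * (Q * γ : ℝ≥0∞) ^ (1 / 2 : ℝ) * weightDoubling c Cd r Cν *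
        ν (⋃ B ∈ u, qball d B.1 B.2) := by
        rw [ENNReal.tsum_mul_left, measure_biUnion huc hud fun B _ => h.measurableSet_ball _ _]
    _ ≤ _ := by
        gcongr
        intro x hx
        simp only [mem_iUnion, exists_prop] at hx
        obtain ⟨B, hB, hxB⟩ := hx
        exact lt_truncSup_iff.2 ⟨B, (huT hB).1, hxB, (huT hB).2⟩

theorem IsWeight.maxFn_rpow_le (hν : IsWeight d μ r Cν ν) (hr : 0 < r)
    (h : DoublingBalls d μ c D Cd) [IsFiniteMeasure μ] [IsFiniteMeasure ν]
    (h𝒢 : IsBallBasis d 𝒢 Λ) {φ : X → ℝ≥0∞} (hφ : AEMeasurable φ μ) (x : X) :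
    maxFn d 𝒢 μ φ x ^ r ≤ Cν * maxFn d 𝒢 ν (fun y => φ y ^ r) x := by
  rw [← ENNReal.le_rpow_inv_iff hr]
  refine le_of_forall_lt fun a ha => ?_
  obtain ⟨B, hB, hx, hlt⟩ := lt_maxFn_iff.1 ha
  refine hlt.trans_le ?_
  rw [ENNReal.le_rpow_inv_iff hr]
  have hB0 := h𝒢.pos B hB
  have hpos := h.measure_ball_pos B.1 B.2 hB0
  have htop := measure_ne_top μ (qball d B.1 B.2)
  have hνpos : ν (qball d B.1 B.2) ≠ 0 := fun h0 => hpos.ne' (hν.ac' h0)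
  have hνtop := measure_ne_top ν (qball d B.1 B.2)
  have h1 := hν.muckenhoupt B.1 B.2 φ hB0 hφ
  have h2 : (∫⁻ y in qball d B.1 B.2, φ y ∂μ) ^ r ≤
      Cν * μ (qball d B.1 B.2) ^ r * ((ν (qball d B.1 B.2))⁻¹ *
        ∫⁻ y in qball d B.1 B.2, φ y ^ r ∂ν) := by
    rw [← mul_assoc, mul_right_comm, ← div_eq_mul_inv]
    exact (ENNReal.le_div_iff_mul_le (Or.inl hνpos) (Or.inl hνtop)).2 h1
  calc ((μ (qball d B.1 B.2))⁻¹ * ∫⁻ y in qball d B.1 B.2, φ y ∂μ) ^ r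
      ≤ ((μ (qball d B.1 B.2)) ^ r)⁻¹ * (Cν * μ (qball d B.1 B.2) ^ r *
        maxFn d 𝒢 ν (fun y => φ y ^ r) x) := by
        rw [ENNReal.mul_rpow_of_nonneg _ _ hr.le, ENNReal.inv_rpow]
        gcongr
        exact h2.trans (mul_le_mul' le_rfl (average_le_maxFn hB hx))
    _ = ((μ (qball d B.1 B.2)) ^ r)⁻¹ * μ (qball d B.1 B.2) ^ r *
        (Cν * maxFn d 𝒢 ν (fun y => φ y ^ r) x) := by ring
    _ = _ := by
        rw [ENNReal.inv_mul_cancel (by simp [hpos.ne'])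
          (ENNReal.rpow_ne_top_of_nonneg hr.le htop), one_mul]

/-- Muckenhoupt's theorem, with a bound uniform in the exponent. -/
theorem IsWeight.lintegral_maxFn_rpow_le (hν : IsWeight d μ r Cν ν) (hr : 0 < r)
    (h : DoublingBalls d μ c D Cd) [IsFiniteMeasure μ] [IsFiniteMeasure ν]
    (h𝒢 : IsBallBasis d 𝒢 Λ) {φ : X → ℝ≥0∞} (hφ : AEMeasurable φ μ) {q : ℝ} (hq : r < q) :
    ∫⁻ x, maxFn d 𝒢 μ φ x ^ q ∂ν ≤ Cν ^ (q / r) *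
      (ENNReal.ofReal (q / r / (q / r - 1) * 2 ^ (q / r)) * weightDoubling c Cd r Cν) *
        ∫⁻ x, φ x ^ q ∂ν := by
  have hqr : 1 < q / r := by rwa [one_lt_div hr]
  have hq0 : 0 ≤ q / r := by linarith
  have key := h.lintegral_maxFn_rpow_le (ν := ν) h𝒢 (le_max_left 1 _ : 1 ≤ weightDoubling c Cd r Cν)
    (fun x ρ hρ => hν.measure_engulf_le hr h x hρ)
    (hφ.mono_ac hν.ac |>.pow_const r) hqr
  have hmulr : ∀ a : ℝ≥0∞, (a ^ r) ^ (q / r) = a ^ q := fun a => by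
    rw [← ENNReal.rpow_mul, mul_div_cancel₀ _ hr.ne']
  simp only [hmulr] at key
  calc ∫⁻ x, maxFn d 𝒢 μ φ x ^ q ∂ν
      ≤ ∫⁻ x, Cν ^ (q / r) * maxFn d 𝒢 ν (fun y => φ y ^ r) x ^ (q / r) ∂ν := by
        refine lintegral_mono fun x => ?_
        rw [← hmulr, ← ENNReal.mul_rpow_of_nonneg _ _ hq0]
        exact ENNReal.rpow_le_rpow (hν.maxFn_rpow_le hr h h𝒢 hφ x) hq0
    _ = Cν ^ (q / r) * ∫⁻ x, maxFn d 𝒢 ν (fun y => φ y ^ r) x ^ (q / r) ∂ν :=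
        lintegral_const_mul' _ _ (by finiteness)
    _ ≤ _ := by rw [mul_assoc]; exact mul_le_mul' le_rfl key

/-- Calderón–Zygmund operators are bounded on `L^q(ν)`, uniformly for weights `ν` with given
constants and for exponents `q` in a compact interval. -/
theorem IsWeakType.exists_weighted_bound {C' : ℝ≥0} (hW : IsWeakType d μ K C')
    (hK : IsCZKernelWith d μ K C w) (h : DoublingBalls d μ c D Cd) [IsFiniteMeasure μ]
    [NullSingletonClass μ] {q₀ q₁ : ℝ} (hr : 0 < r) (hq₀ : r < q₀) (Cν : ℝ≥0) :
    ∃ C₁ : ℝ≥0, ∀ ν : Measure X, IsFiniteMeasure ν → IsWeight d μ r Cν ν →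
      ∀ q, q₀ ≤ q → q ≤ q₁ → ∀ f : X → ℝ, Integrable f μ →
        ∫⁻ x, ‖pvOperator d μ K f x‖ₑ ^ q ∂ν ≤ C₁ * ∫⁻ x, ‖f x‖ₑ ^ q ∂ν := by
  obtain ⟨𝒢, Λ, hΛ, h𝒢⟩ := h.exists_ballBasis
  obtain ⟨Q, hQ⟩ := IsWeight.exists_goodLambda hW hK h hΛ h𝒢
  set W := weightDoubling c Cd r Cν with hWd
  set A : ℝ≥0 := 3 ^ q₁ * (Cν * W) with hA
  -- the parameter which makes the good-`λ` inequality absorbable for all exponents up to `q₁`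
  set γ : ℝ≥0 := (1 / (2 * A + 2)) ^ 2 / (Q + 1) with hγ
  have hγ0 : 0 < γ := by positivity
  have hs1 : 1 / (2 * A + 2) ≤ 1 := by
    rw [div_le_one (by positivity)]
    exact le_trans (by norm_num) (le_add_of_nonneg_left zero_le : (2 : ℝ≥0) ≤ 2 * A + 2)
  have hQγs : Q * γ ≤ (1 / (2 * A + 2)) ^ 2 := by
    rw [hγ, mul_div_assoc']
    refine div_le_of_le_mul₀ zero_le zero_le ?_
    rw [mul_comm]; gcongr; exact le_self_add
  have hQγ : Q * γ ≤ 1 := hQγs.trans (pow_le_one₀ zero_le hs1)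
  have hγ1 : (γ : ℝ) ≤ 1 := by
    have : γ ≤ 1 := div_le_of_le_mul₀ zero_le zero_le (by
      rw [one_mul]; exact (pow_le_one₀ zero_le hs1).trans (le_add_of_nonneg_left zero_le))
    exact_mod_cast this
  have hroot : (Q * γ : ℝ≥0∞) ^ (1 / 2 : ℝ) ≤ ((1 / (2 * A + 2) : ℝ≥0) : ℝ≥0∞) := by
    have : ((Q * γ : ℝ≥0) : ℝ≥0∞) ≤ (((1 / (2 * A + 2)) ^ 2 : ℝ≥0) : ℝ≥0∞) := by exact_mod_cast hQγs
    rw [ENNReal.coe_mul] at this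
    refine (ENNReal.rpow_le_rpow this (by norm_num)).trans ?_
    rw [ENNReal.coe_pow, ← ENNReal.rpow_natCast, ← ENNReal.rpow_mul]
    norm_num
  have habs : (A : ℝ≥0∞) * ((1 / (2 * A + 2) : ℝ≥0) : ℝ≥0∞) ≤ 2⁻¹ := by
    have : A * (1 / (2 * A + 2)) ≤ 2⁻¹ := by
      rw [mul_one_div]
      refine div_le_of_le_mul₀ zero_le zero_le ?_
      rw [mul_add, ← mul_assoc, inv_mul_cancel₀ two_ne_zero, one_mul]
      exact le_self_add
    calc (A : ℝ≥0∞) * ((1 / (2 * A + 2) : ℝ≥0) : ℝ≥0∞) = ((A * (1 / (2 * A + 2)) : ℝ≥0) : ℝ≥0∞) := by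
          exact (ENNReal.coe_mul _ _).symm
      _ ≤ ((2⁻¹ : ℝ≥0) : ℝ≥0∞) := by exact_mod_cast this
      _ = 2⁻¹ := by rw [ENNReal.coe_inv two_ne_zero]; rfl
  set T := truncConst c Cd C w Λ Λ with hT
  have hTtop : T ≠ ∞ := hK.truncConst_ne_top _
  set M₀ : ℝ≥0∞ := (max 1 Cν : ℝ≥0) ^ (q₁ / r) *
    (ENNReal.ofReal (q₁ / (q₀ - r) * 2 ^ (q₁ / r)) * W) with hM₀
  have hmax1 : (max 1 Cν : ℝ≥0) ≠ 0 := (lt_of_lt_of_le one_pos (le_max_left _ _)).ne'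
  have hM₀top : M₀ ≠ ∞ := by
    have : ((max 1 Cν : ℝ≥0) : ℝ≥0∞) ^ (q₁ / r) ≠ ∞ :=
      ENNReal.rpow_ne_top_of_ne_zero (by exact_mod_cast hmax1) ENNReal.coe_ne_top
    finiteness
  set C₁ : ℝ≥0∞ := 2 ^ q₁ * (2 * ENNReal.ofReal ((3 / γ) ^ q₁) + (max 1 T) ^ q₁) * M₀ with hC₁
  have hC₁top : C₁ ≠ ∞ := by
    have h1 : (max 1 T) ^ q₁ ≠ ∞ :=
      ENNReal.rpow_ne_top_of_ne_zero (lt_of_lt_of_le one_pos (le_max_left _ _)).ne'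
        (by simp [hTtop])
    finiteness
  refine ⟨C₁.toNNReal, fun ν hνf hν q hq hq' f hf => ?_⟩
  rw [ENNReal.coe_toNNReal hC₁top]
  have hq0 : 0 < q := by linarith
  set φ : X → ℝ≥0∞ := fun y => ‖f y‖ₑ with hφ
  have hφm : AEMeasurable φ μ := hf.1.enorm
  set G := truncSup d 𝒢 μ K (farConst c C) f with hG
  have hGm : Measurable G := measurable_truncSup h h𝒢 _ f
  have hFm : Measurable (maxFn d 𝒢 μ φ) := measurable_maxFn h h𝒢 φ
  have hMle : ∫⁻ x, maxFn d 𝒢 μ φ x ^ q ∂ν ≤ M₀ * ∫⁻ x, φ x ^ q ∂ν := by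
    refine (hν.lintegral_maxFn_rpow_le hr h h𝒢 hφm (by linarith)).trans ?_
    have hqr : q / r ≤ q₁ / r := by gcongr
    have e1 : (Cν : ℝ≥0∞) ^ (q / r) ≤ ((max 1 Cν : ℝ≥0) : ℝ≥0∞) ^ (q₁ / r) := by
      refine (ENNReal.rpow_le_rpow (ENNReal.coe_le_coe.2 (le_max_right 1 Cν)) (by positivity)).trans
        (ENNReal.rpow_le_rpow_of_exponent_le ?_ hqr)
      exact_mod_cast le_max_left 1 Cν
    have e2 : q / r / (q / r - 1) ≤ q₁ / (q₀ - r) := by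
      have : q / r / (q / r - 1) = q / (q - r) := by
        have h1 : q - r ≠ 0 := by linarith
        have h2 : q / r - 1 = (q - r) / r := by field_simp
        rw [h2]; field_simp
      rw [this]
      exact div_le_div₀ (by linarith) hq' (by linarith) (by linarith)
    have e3 : (2 : ℝ) ^ (q / r) ≤ 2 ^ (q₁ / r) :=
      Real.rpow_le_rpow_of_exponent_le one_le_two hqr
    refine mul_le_mul' (mul_le_mul' e1 (mul_le_mul' (ENNReal.ofReal_le_ofReal ?_) le_rfl)) le_rfl
    have : 0 < q₀ - r := by linarith
    have : 0 < q₁ := by linarith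
    exact mul_le_mul e2 e3 (by positivity) (by positivity)
  have hGle : ∫⁻ x, G x ^ q ∂ν ≤ 2 * ENNReal.ofReal ((3 / γ) ^ q) *
      ∫⁻ x, maxFn d 𝒢 μ φ x ^ q ∂ν := by
    refine lintegral_rpow_le_of_goodLambda hGm hFm hγ0 hq0
      (ε := Cν * (Q * γ : ℝ≥0∞) ^ (1 / 2 : ℝ) * W) ?_ fun t ht => ?_
    · have e1 : ENNReal.ofReal (3 ^ q) ≤ ((3 ^ q₁ : ℝ≥0) : ℝ≥0∞) := by
        rw [show ((3 ^ q₁ : ℝ≥0) : ℝ≥0∞) = ENNReal.ofReal (3 ^ q₁) by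
          rw [ENNReal.ofReal, ENNReal.coe_inj, Real.toNNReal_rpow_of_nonneg (by norm_num)]
          norm_num]
        exact ENNReal.ofReal_le_ofReal (Real.rpow_le_rpow_of_exponent_le (by norm_num) hq')
      calc ENNReal.ofReal (3 ^ q) * (Cν * (Q * γ : ℝ≥0∞) ^ (1 / 2 : ℝ) * W)
          ≤ ((3 ^ q₁ : ℝ≥0) : ℝ≥0∞) * (Cν * ((1 / (2 * A + 2) : ℝ≥0) : ℝ≥0∞) * W) := by gcongr
        _ = A * ((1 / (2 * A + 2) : ℝ≥0) : ℝ≥0∞) := by rw [hA]; push_cast; ring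
        _ ≤ _ := habs
    · have := hQ r Cν ν hr hν f hf t γ ht hQγ
      rwa [show (γ : ℝ≥0∞) * ENNReal.ofReal t = ENNReal.ofReal (γ * t) by
        rw [ENNReal.ofReal_mul (NNReal.coe_nonneg γ), ENNReal.ofReal_coe_nnreal]] at this
  have hpt : ∀ᵐ x ∂ν, ‖pvOperator d μ K f x‖ₑ ^ q ≤
      2 ^ q₁ * (G x ^ q + (max 1 T) ^ q₁ * maxFn d 𝒢 μ φ x ^ q) := by
    filter_upwards [hν.ac ((hW f hf).1)] with x hx
    have h1 := hK.enorm_pv_le h hΛ h𝒢 hf hx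
    rw [← hT, ← hG, ← hφ] at h1
    set a := G x
    set b := maxFn d 𝒢 μ φ x
    calc ‖pvOperator d μ K f x‖ₑ ^ q ≤ (2 * max a (T * b)) ^ q := by
          refine ENNReal.rpow_le_rpow (h1.trans ?_) hq0.le
          rw [two_mul]; exact add_le_add (le_max_left _ _) (le_max_right _ _)
      _ = 2 ^ q * max a (T * b) ^ q := ENNReal.mul_rpow_of_nonneg _ _ hq0.le
      _ ≤ 2 ^ q₁ * (a ^ q + (max 1 T) ^ q₁ * b ^ q) := by
          refine mul_le_mul' (ENNReal.rpow_le_rpow_of_exponent_le one_le_two hq') ?_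
          have h2 : (T * b) ^ q ≤ (max 1 T) ^ q₁ * b ^ q := by
            rw [ENNReal.mul_rpow_of_nonneg _ _ hq0.le]
            gcongr
            exact (ENNReal.rpow_le_rpow (le_max_right 1 T) hq0.le).trans
              (ENNReal.rpow_le_rpow_of_exponent_le (le_max_left 1 T) hq')
          rcases max_choice a (T * b) with hm | hm <;> rw [hm]
          · exact le_self_add
          · exact h2.trans le_add_self
  calc ∫⁻ x, ‖pvOperator d μ K f x‖ₑ ^ q ∂ν
      ≤ ∫⁻ x, 2 ^ q₁ * (G x ^ q + (max 1 T) ^ q₁ * maxFn d 𝒢 μ φ x ^ q) ∂ν := lintegral_mono_ae hpt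
    _ = 2 ^ q₁ * (∫⁻ x, G x ^ q ∂ν + (max 1 T) ^ q₁ * ∫⁻ x, maxFn d 𝒢 μ φ x ^ q ∂ν) := by
        rw [lintegral_const_mul _ (by fun_prop), lintegral_add_left (by fun_prop),
          lintegral_const_mul _ (by fun_prop)]
    _ ≤ 2 ^ q₁ * (2 * ENNReal.ofReal ((3 / γ) ^ q₁) * (M₀ * ∫⁻ x, φ x ^ q ∂ν) +
        (max 1 T) ^ q₁ * (M₀ * ∫⁻ x, φ x ^ q ∂ν)) := by
        have hγ3 : 1 ≤ 3 / (γ : ℝ) := by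
          rw [one_le_div (by exact_mod_cast hγ0)]; linarith
        refine mul_le_mul' le_rfl (add_le_add (hGle.trans (mul_le_mul' (mul_le_mul' le_rfl ?_) hMle))
          (mul_le_mul' le_rfl hMle))
        exact ENNReal.ofReal_le_ofReal (Real.rpow_le_rpow_of_exponent_le hγ3 hq')
    _ = C₁ * ∫⁻ x, φ x ^ q ∂ν := by rw [hC₁]; ring

end GrandMorrey

namespace GrandMorrey

/-! ### The John–Nirenberg inequality -/

variable {X : Type*} [MeasurableSpace X] {d : X → X → ℝ} {μ ν : Measure X} {c D : ℝ} {Cd : ℝ≥0}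
  {𝒢 : Set (X × ℝ)} {Λ : ℝ} {b : X → ℝ} {Cb : ℝ≥0}

/-- The average of `b` over the ball `B(x, r)`. -/
noncomputable def ballAvg {X : Type*} [MeasurableSpace X] (d : X → X → ℝ) (μ : Measure X)
    (b : X → ℝ) (x : X) (r : ℝ) : ℝ := ⨍ z in qball d x r, b z ∂μ

/-- The mean oscillation of `b` over balls of *all* radii is at most `Cb`. -/
def HasBoundedOscillation {X : Type*} [MeasurableSpace X] (d : X → X → ℝ) (μ : Measure X)
    (b : X → ℝ) (Cb : ℝ≥0) : Prop :=
  ∀ x r, 0 < r → ∫⁻ y in qball d x r, ‖b y - ballAvg d μ b x r‖ₑ ∂μ ≤ Cb * μ (qball d x r)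

theorem DoublingBalls.enorm_ballAvg_sub_mul_le (h : DoublingBalls d μ c D Cd) [IsFiniteMeasure μ]
    (hb : Integrable b μ) (a : ℝ) (x : X) {r : ℝ} (hr : 0 < r) :
    ‖ballAvg d μ b x r - a‖ₑ * μ (qball d x r) ≤ ∫⁻ y in qball d x r, ‖b y - a‖ₑ ∂μ := by
  have hpos := h.measure_ball_pos x r hr
  have hreal : μ.real (qball d x r) ≠ 0 := by
    simp [Measure.real, ENNReal.toReal_eq_zero_iff, hpos.ne']
  have h1 : ∫ y in qball d x r, (b y - a) ∂μ =
      (ballAvg d μ b x r - a) * μ.real (qball d x r) := by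
    rw [integral_sub hb.integrableOn (integrable_const a), ballAvg, setAverage_eq]
    simp only [integral_const, smul_eq_mul, measureReal_restrict_apply_univ]
    field_simp
  calc ‖ballAvg d μ b x r - a‖ₑ * μ (qball d x r)
      = ‖∫ y in qball d x r, (b y - a) ∂μ‖ₑ := by
        rw [h1, enorm_mul, Real.enorm_of_nonneg measureReal_nonneg, ofReal_measureReal]
    _ ≤ _ := enorm_integral_le_lintegral_enorm _

/-- The averages over concentric balls of comparable radii differ by a bounded amount. -/
theorem HasBoundedOscillation.lintegral_dilate_le (hosc : HasBoundedOscillation d μ b Cb)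
    (h : DoublingBalls d μ c D Cd) [IsFiniteMeasure μ] (hb : Integrable b μ) {t : ℝ} (ht : 1 ≤ t)
    (x : X) {r : ℝ} (hr : 0 < r) :
    ‖ballAvg d μ b x (t * r) - ballAvg d μ b x r‖ₑ ≤ Cb * (Cd ^ ⌈t⌉₊ : ℝ≥0) ∧
    ∫⁻ y in qball d x (t * r), ‖b y - ballAvg d μ b x r‖ₑ ∂μ ≤
      Cb * (1 + (Cd ^ ⌈t⌉₊ : ℝ≥0)) * μ (qball d x (t * r)) := by
  have hpos := h.measure_ball_pos x r hr
  have htop := measure_ne_top μ (qball d x r)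
  have hsub : qball d x r ⊆ qball d x (t * r) := qball_mono d x (by nlinarith)
  have h0 := hosc x (t * r) (by positivity)
  set m' := ballAvg d μ b x (t * r)
  set m := ballAvg d μ b x r with hm
  have h1 : ‖m' - m‖ₑ ≤ Cb * (Cd ^ ⌈t⌉₊ : ℝ≥0) := by
    have e1 := h.enorm_ballAvg_sub_mul_le hb m' x hr
    rw [← hm] at e1
    have e2 : ‖m' - m‖ₑ * μ (qball d x r) ≤ Cb * (Cd ^ ⌈t⌉₊ : ℝ≥0) * μ (qball d x r) := by
      rw [← enorm_neg, neg_sub]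
      calc _ ≤ _ := e1
        _ ≤ ∫⁻ y in qball d x (t * r), ‖b y - m'‖ₑ ∂μ := lintegral_mono_set hsub
        _ ≤ Cb * μ (qball d x (t * r)) := h0
        _ ≤ Cb * ((Cd ^ ⌈t⌉₊ : ℝ≥0) * μ (qball d x r)) := by
            gcongr; exact h.measure_dilate_le t x hr
        _ = _ := by ring
    exact (ENNReal.mul_le_mul_iff_left hpos.ne' htop).1 e2
  refine ⟨h1, ?_⟩
  calc ∫⁻ y in qball d x (t * r), ‖b y - m‖ₑ ∂μ
      ≤ ∫⁻ y in qball d x (t * r), (‖b y - m'‖ₑ + ‖m' - m‖ₑ) ∂μ := by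
        refine lintegral_mono fun y => ?_
        calc ‖b y - m‖ₑ = ‖(b y - m') + (m' - m)‖ₑ := by congr 1; ring
          _ ≤ _ := enorm_add_le _ _
    _ = ∫⁻ y in qball d x (t * r), ‖b y - m'‖ₑ ∂μ + ‖m' - m‖ₑ * μ (qball d x (t * r)) := by
        rw [lintegral_add_right _ measurable_const, lintegral_const,
          Measure.restrict_apply MeasurableSet.univ, univ_inter]
    _ ≤ Cb * μ (qball d x (t * r)) + Cb * (Cd ^ ⌈t⌉₊ : ℝ≥0) * μ (qball d x (t * r)) := by gcongr
    _ = _ := by ring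

/-- The distribution of the oscillation over a ball decays exponentially. -/
theorem HasBoundedOscillation.exists_measure_le [TopologicalSpace X]
    (hX : IsHomogeneousType d μ) (hosc : HasBoundedOscillation d μ b Cb)
    (h : DoublingBalls d μ c D Cd) [IsFiniteMeasure μ] (hb : Integrable b μ) (hCb : 1 ≤ Cb) :
    ∃ A : ℝ≥0, 0 < A ∧ ∀ (k : ℕ) (x : X) (r : ℝ), 0 < r →
      μ {y | y ∈ qball d x r ∧ k * A < ‖b y - ballAvg d μ b x r‖ₑ} ≤
        2⁻¹ ^ k * μ (qball d x r) := by
  obtain ⟨𝒢, Λ, hΛ, h𝒢⟩ := h.exists_ballBasis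
  set κ := engulfConst c 2 with hκ
  have hκ4 : 2 * 2 ≤ κ := h.le_engulfConst zero_le_two
  set N := engulfConst c κ with hN
  have hN1 : 1 ≤ N := h.one_le_engulfConst (by linarith)
  set c' : ℝ≥0 := Cd ^ ⌈N⌉₊ with hc'
  set C₀ : ℝ≥0 := Cb * (1 + c') * c' with hC₀
  have hcomp : ∀ t, 1 ≤ compConst c Cd t := fun t => one_le_pow₀ h.one_le_doubling
  have hc'1 : 1 ≤ c' := one_le_pow₀ h.one_le_doubling
  have hC₀pos : 0 < C₀ := by positivity
  set α : ℝ≥0 := 2 * compConst c Cd 2 * C₀ + C₀ * compConst c Cd 1 with hα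
  have hαpos : 0 < α := by
    have := one_pos.trans_le (hcomp 2)
    positivity
  refine ⟨α * compConst c Cd Λ, mul_pos hαpos (one_pos.trans_le (hcomp Λ)), fun k => ?_⟩
  set A := α * compConst c Cd Λ with hA
  induction k with
  | zero => intro x r _; simp only [pow_zero, one_mul]; exact measure_mono fun y hy => hy.1
  | succ k ih =>
  intro x r hr
  set m := ballAvg d μ b x r with hm
  set Bs := qball d x (N * r) with hBs
  have hBsm : MeasurableSet Bs := h.measurableSet_ball _ _
  have hBsub : qball d x r ⊆ Bs := qball_mono d x (by nlinarith)
  set f : X → ℝ := Bs.indicator (fun y => b y - m) with hf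
  have hfi : Integrable f μ := (hb.sub (integrable_const m)).indicator hBsm
  set φ : X → ℝ≥0∞ := fun y => ‖f y‖ₑ with hφ
  have hφs : ∀ y ∈ Bs, φ y = ‖b y - m‖ₑ := fun y hy => by simp [hφ, hf, hy]
  have hφint : ∫⁻ y, φ y ∂μ ≤ C₀ * μ (qball d x r) := by
    have e1 : ∫⁻ y, φ y ∂μ = ∫⁻ y in Bs, ‖b y - m‖ₑ ∂μ := by
      rw [← lintegral_indicator hBsm]
      simp only [hφ, hf, enorm_indicator_eq_indicator_enorm]
    rw [e1]
    refine ((hosc.lintegral_dilate_le h hb hN1 x hr).2).trans ?_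
    calc (Cb : ℝ≥0∞) * (1 + (Cd ^ ⌈N⌉₊ : ℝ≥0)) * μ (qball d x (N * r))
        ≤ Cb * (1 + (Cd ^ ⌈N⌉₊ : ℝ≥0)) * ((Cd ^ ⌈N⌉₊ : ℝ≥0) * μ (qball d x r)) := by
          gcongr; exact h.measure_dilate_le N x hr
      _ = _ := by rw [hC₀, hc']; push_cast; ring
  set T : Set (X × ℝ) := {B | B ∈ 𝒢 ∧ (qball d x r ∩ qball d B.1 B.2).Nonempty ∧
    α * μ (qball d B.1 B.2) < ∫⁻ y in qball d B.1 B.2, φ y ∂μ} with hT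
  have hTpos : ∀ B ∈ T, 0 < B.2 := fun B hB => h𝒢.pos B hB.1
  have hTr : ∀ B ∈ T, B.2 ≤ r := by
    intro B hB
    by_contra! hlt
    have h1 : μ (qball d x r) ≤ compConst c Cd 1 * μ (qball d B.1 B.2) :=
      h.measure_le_of_inter (by linarith) (hTpos B hB) (by rw [inter_comm]; exact hB.2.1)
    have h2 : ∫⁻ y in qball d B.1 B.2, φ y ∂μ ≤ α * μ (qball d B.1 B.2) := by
      calc _ ≤ ∫⁻ y, φ y ∂μ := setLIntegral_le_lintegral _ _
        _ ≤ C₀ * (compConst c Cd 1 * μ (qball d B.1 B.2)) := hφint.trans (by gcongr)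
        _ = ((C₀ * compConst c Cd 1 : ℝ≥0) : ℝ≥0∞) * μ (qball d B.1 B.2) := by push_cast; ring
        _ ≤ _ := by gcongr; exact le_add_self
    exact absurd hB.2.2 (not_lt.2 h2)
  obtain ⟨u, huT, hud, hcov, hmax⟩ := h.exists_covering T hTpos r hTr
  have huc : u.Countable := h𝒢.countable.mono fun B hB => (huT hB).1
  -- almost every point of the ball with large oscillation lies in a selected ball
  have hae : ∀ᵐ y ∂μ, (y ∈ qball d x r ∧ ((k + 1 : ℕ) : ℝ≥0∞) * A < ‖b y - m‖ₑ) →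
      y ∈ ⋃ B ∈ u, {y | y ∈ qball d B.1 (κ * B.2) ∧
        k * A < ‖b y - ballAvg d μ b B.1 (κ * B.2)‖ₑ} := by
    filter_upwards [hX.ae_enorm_le_of_average_le h hfi] with y hy ⟨hyB, hlt⟩
    have hyT : y ∈ ⋃ B ∈ T, qball d B.1 B.2 := by
      by_contra hnot
      simp only [mem_iUnion, exists_prop, not_exists, not_and] at hnot
      have h1 : ‖f y‖ₑ ≤ A := by
        refine hy A ⟨1, one_pos, fun ρ hρ _ => ?_⟩
        obtain ⟨B, hB, hsub, h1, h2⟩ := h𝒢.exists_superset y ρ hρ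
        have hyB' := hsub (h.mem_ball_self y hρ)
        have hle : ∫⁻ z in qball d B.1 B.2, φ z ∂μ ≤ α * μ (qball d B.1 B.2) := by
          by_contra! hgt
          exact hnot B ⟨hB, ⟨y, hyB, hyB'⟩, hgt⟩ hyB'
        calc ∫⁻ z in qball d y ρ, ‖f z‖ₑ ∂μ ≤ ∫⁻ z in qball d B.1 B.2, φ z ∂μ :=
              lintegral_mono_set hsub
          _ ≤ α * (compConst c Cd Λ * μ (qball d y ρ)) := by
              refine hle.trans ?_
              gcongr
              exact h.measure_le_of_inter h2 hρ ⟨y, h.mem_ball_self y hρ, hyB'⟩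
          _ = A * μ (qball d y ρ) := by rw [hA]; push_cast; ring
      have h2 : ‖f y‖ₑ = ‖b y - m‖ₑ := hφs y (hBsub hyB)
      rw [h2] at h1
      refine absurd hlt (not_lt.2 (h1.trans ?_))
      push_cast
      exact le_mul_of_one_le_left zero_le le_add_self
    have hyu := hcov hyT
    simp only [mem_iUnion, exists_prop] at hyu ⊢
    obtain ⟨B, hB, hyB'⟩ := hyu
    have hB0 := hTpos B (huT hB)
    refine ⟨B, hB, hyB', ?_⟩
    obtain ⟨x₁, hx₁, hx₁max⟩ := hmax B hB
    obtain ⟨B2, hB2, hsub2, h21, h22⟩ := h𝒢.exists_superset B.1 (κ * B.2) (by positivity)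
    have hBκ : qball d B.1 B.2 ⊆ qball d B.1 (κ * B.2) := qball_mono d _ (by nlinarith)
    have hBκs : qball d B.1 (κ * B.2) ⊆ Bs := by
      refine h.ball_subset_of_inter (t := κ) ?_ ((huT hB).2.1.mono
        (inter_subset_inter_right _ hBκ))
      have := hTr B (huT hB)
      gcongr
    have hle2 : ∫⁻ z in qball d B2.1 B2.2, φ z ∂μ ≤ α * μ (qball d B2.1 B2.2) := by
      by_contra! hgt
      have := hx₁max B2 ⟨hB2, (huT hB).2.1.mono
        (inter_subset_inter_right _ (hBκ.trans hsub2)), hgt⟩ (hsub2 (hBκ hx₁))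
      nlinarith
    have hκpos := h.measure_ball_pos B.1 (κ * B.2) (by positivity)
    have hmm : ‖ballAvg d μ b B.1 (κ * B.2) - m‖ₑ ≤ A := by
      have e1 := h.enorm_ballAvg_sub_mul_le hb m B.1 (r := κ * B.2) (by positivity)
      have e2 : ‖ballAvg d μ b B.1 (κ * B.2) - m‖ₑ * μ (qball d B.1 (κ * B.2)) ≤
          A * μ (qball d B.1 (κ * B.2)) := by
        calc _ ≤ _ := e1
          _ = ∫⁻ z in qball d B.1 (κ * B.2), φ z ∂μ :=
              (setLIntegral_congr_fun (h.measurableSet_ball _ _) fun z hz => hφs z (hBκs hz)).symm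
          _ ≤ ∫⁻ z in qball d B2.1 B2.2, φ z ∂μ := lintegral_mono_set hsub2
          _ ≤ α * (compConst c Cd Λ * μ (qball d B.1 (κ * B.2))) := by
              refine hle2.trans ?_
              gcongr
              exact h.measure_le_of_inter h22 (by positivity)
                ⟨x₁, hBκ hx₁, hsub2 (hBκ hx₁)⟩
          _ = _ := by rw [hA]; push_cast; ring
      exact (ENNReal.mul_le_mul_iff_left hκpos.ne' (measure_ne_top _ _)).1 e2
    by_contra! hle
    refine absurd hlt (not_lt.2 ?_)
    calc ‖b y - m‖ₑ = ‖(b y - ballAvg d μ b B.1 (κ * B.2)) +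
          (ballAvg d μ b B.1 (κ * B.2) - m)‖ₑ := by congr 1; ring
      _ ≤ _ := enorm_add_le _ _
      _ ≤ k * A + A := add_le_add hle hmm
      _ = _ := by push_cast; ring
  have hsum : ∑' B : u, μ (qball d B.1.1 (κ * B.1.2)) ≤ 2⁻¹ * μ (qball d x r) := by
    have h1 : ∑' B : u, α * μ (qball d B.1.1 (κ * B.1.2)) ≤
        α * (2⁻¹ * μ (qball d x r)) := by
      calc ∑' B : u, α * μ (qball d B.1.1 (κ * B.1.2))
          ≤ ∑' B : u, compConst c Cd 2 * ∫⁻ y in qball d B.1.1 B.1.2, φ y ∂μ := by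
            refine ENNReal.tsum_le_tsum fun B => ?_
            calc α * μ (qball d B.1.1 (κ * B.1.2))
                ≤ α * (compConst c Cd 2 * μ (qball d B.1.1 B.1.2)) := by
                  gcongr; exact h.measure_engulf_le 2 _ (hTpos _ (huT B.2))
              _ = compConst c Cd 2 * (α * μ (qball d B.1.1 B.1.2)) := by ring
              _ ≤ _ := by gcongr; exact (huT B.2).2.2.le
        _ ≤ compConst c Cd 2 * ∫⁻ y, φ y ∂μ := by
            rw [ENNReal.tsum_mul_left]
            gcongr
            exact sum_lintegral_le_of_disjoint h huc hud φ
        _ ≤ compConst c Cd 2 * (C₀ * μ (qball d x r)) := by gcongr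
        _ = 2⁻¹ * ((2 * compConst c Cd 2 * C₀ : ℝ≥0) : ℝ≥0∞) * μ (qball d x r) := by
            push_cast
            rw [mul_assoc 2, ← mul_assoc 2⁻¹, ENNReal.inv_mul_cancel (by simp) (by simp)]
            ring
        _ ≤ 2⁻¹ * α * μ (qball d x r) := by gcongr; exact le_self_add
        _ = _ := by ring
    rw [ENNReal.tsum_mul_left] at h1
    exact (ENNReal.mul_le_mul_iff_right (by exact_mod_cast hαpos.ne') ENNReal.coe_ne_top).1 h1
  calc μ {y | y ∈ qball d x r ∧ ((k + 1 : ℕ) : ℝ≥0∞) * A < ‖b y - m‖ₑ}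
      ≤ μ (⋃ B ∈ u, {y | y ∈ qball d B.1 (κ * B.2) ∧
        k * A < ‖b y - ballAvg d μ b B.1 (κ * B.2)‖ₑ}) := measure_mono_ae hae
    _ ≤ ∑' B : u, μ {y | y ∈ qball d B.1.1 (κ * B.1.2) ∧
        k * A < ‖b y - ballAvg d μ b B.1.1 (κ * B.1.2)‖ₑ} := measure_biUnion_le μ huc _
    _ ≤ ∑' B : u, 2⁻¹ ^ k * μ (qball d B.1.1 (κ * B.1.2)) := by
        refine ENNReal.tsum_le_tsum fun B => ih _ _ ?_
        have := hTpos _ (huT B.2)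
        positivity
    _ ≤ 2⁻¹ ^ k * (2⁻¹ * μ (qball d x r)) := by rw [ENNReal.tsum_mul_left]; gcongr
    _ = _ := by rw [pow_succ]; ring

/-- The oscillation `|b - m_B|` over every ball `B` is exponentially integrable. -/
def HasExpBound {X : Type*} [MeasurableSpace X] (d : X → X → ℝ) (μ : Measure X) (b : X → ℝ)
    (m : X → ℝ → ℝ) (c₀ : ℝ) (C₁ : ℝ≥0) : Prop :=
  ∀ x r, 0 < r → ∫⁻ y in qball d x r, ENNReal.ofReal (Real.exp (c₀ * |b y - m x r|)) ∂μ ≤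
    C₁ * μ (qball d x r)

/-- The John–Nirenberg inequality in integrated form. -/
theorem HasBoundedOscillation.exists_expBound [TopologicalSpace X]
    (hX : IsHomogeneousType d μ) (hosc : HasBoundedOscillation d μ b Cb)
    (h : DoublingBalls d μ c D Cd) [IsFiniteMeasure μ] (hb : Integrable b μ) (hCb : 1 ≤ Cb) :
    ∃ c₀ > 0, ∃ C₁, HasExpBound d μ b (ballAvg d μ b) c₀ C₁ := by
  obtain ⟨A, hA, hdist⟩ := hosc.exists_measure_le hX h hb hCb
  have hA' : (0 : ℝ) < A := hA
  set c₀ := Real.log (3 / 2) / A with hc₀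
  have hlog : 0 < Real.log (3 / 2) := Real.log_pos (by norm_num)
  refine ⟨c₀, div_pos hlog hA', 8, fun x r hr => ?_⟩
  set m := ballAvg d μ b x r
  set S : ℕ → Set X := fun k => {y | y ∈ qball d x r ∧ k * A < ‖b y - m‖ₑ} with hS
  set ρ : ℝ≥0∞ := 3 / 2 with hρ
  have hexp : ∀ n : ℕ, Real.exp (c₀ * (n * A)) = (3 / 2) ^ n := fun n => by
    rw [hc₀, show Real.log (3 / 2) / A * (n * A) = n * Real.log (3 / 2) by field_simp,
      Real.exp_nat_mul, Real.exp_log (by norm_num)]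
  have hofρ : ∀ n : ℕ, ENNReal.ofReal ((3 / 2) ^ n) = ρ ^ n := fun n => by
    rw [ENNReal.ofReal_pow (by norm_num), ENNReal.ofReal_div_of_pos two_pos]
    simp [hρ]
  have hpt : ∀ y ∈ qball d x r, ENNReal.ofReal (Real.exp (c₀ * |b y - m|)) ≤
      1 + ∑' k : ℕ, ρ ^ (k + 1) * (toMeasurable μ (S k)).indicator 1 y := by
    intro y hy
    rcases (abs_nonneg (b y - m)).eq_or_lt with h0 | h0
    · rw [← h0]; simp
    obtain ⟨n, hn⟩ : ∃ n : ℕ, n + 1 = ⌈|b y - m| / A⌉₊ :=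
      ⟨⌈|b y - m| / A⌉₊ - 1, Nat.sub_add_cancel (Nat.ceil_pos.2 (by positivity))⟩
    have h1 : |b y - m| ≤ ((n + 1 : ℕ) : ℝ) * A := by
      rw [hn, ← div_le_iff₀ hA']; exact Nat.le_ceil _
    have h2 : (n : ℝ) * A < |b y - m| := by
      rw [← lt_div_iff₀ hA']
      exact Nat.lt_ceil.1 (by omega)
    have hyS : y ∈ S n := by
      refine ⟨hy, ?_⟩
      rw [Real.enorm_eq_ofReal_abs]
      calc (n : ℝ≥0∞) * A = ENNReal.ofReal (n * A) := by
            rw [ENNReal.ofReal_mul (by positivity)]; simp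
        _ < _ := (ENNReal.ofReal_lt_ofReal_iff h0).2 h2
    calc ENNReal.ofReal (Real.exp (c₀ * |b y - m|))
        ≤ ENNReal.ofReal (Real.exp (c₀ * ((n + 1 : ℕ) * A))) := by
          have : 0 < c₀ := div_pos hlog hA'
          gcongr
      _ = ρ ^ (n + 1) * (toMeasurable μ (S n)).indicator 1 y := by
          rw [hexp, hofρ, indicator_of_mem (subset_toMeasurable μ _ hyS)]; simp
      _ ≤ ∑' k : ℕ, ρ ^ (k + 1) * (toMeasurable μ (S k)).indicator 1 y :=
          ENNReal.le_tsum (f := fun k => ρ ^ (k + 1) * (toMeasurable μ (S k)).indicator 1 y) n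
      _ ≤ _ := le_add_self
  have hSle : ∀ k, μ (S k) ≤ 2⁻¹ ^ k * μ (qball d x r) := fun k => hdist k x r hr
  calc ∫⁻ y in qball d x r, ENNReal.ofReal (Real.exp (c₀ * |b y - m|)) ∂μ
      ≤ ∫⁻ y in qball d x r, (1 + ∑' k : ℕ, ρ ^ (k + 1) *
          (toMeasurable μ (S k)).indicator 1 y) ∂μ :=
        setLIntegral_mono' (h.measurableSet_ball _ _) hpt
    _ = μ (qball d x r) + ∑' k : ℕ, ρ ^ (k + 1) *
          ∫⁻ y in qball d x r, (toMeasurable μ (S k)).indicator 1 y ∂μ := by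
        have hm : ∀ k, Measurable ((toMeasurable μ (S k)).indicator (1 : X → ℝ≥0∞)) := fun k =>
          measurable_one.indicator (measurableSet_toMeasurable _ _)
        rw [lintegral_add_left measurable_const, lintegral_tsum fun k =>
          ((hm k).const_mul _).aemeasurable]
        simp_rw [lintegral_const_mul _ (hm _)]
        simp
    _ ≤ μ (qball d x r) + ∑' k : ℕ, ρ ^ (k + 1) * (2⁻¹ ^ k * μ (qball d x r)) := by
        gcongr with k
        refine (setLIntegral_le_lintegral _ _).trans ?_
        rw [lintegral_indicator (measurableSet_toMeasurable _ _)]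
        simp only [Pi.one_apply, lintegral_one, Measure.restrict_apply MeasurableSet.univ,
          univ_inter, measure_toMeasurable]
        exact hSle k
    _ = μ (qball d x r) + ρ * (∑' k : ℕ, (3 / 4 : ℝ≥0∞) ^ k) * μ (qball d x r) := by
        rw [← ENNReal.tsum_mul_left, ← ENNReal.tsum_mul_right]
        congr 2
        funext k
        have : (3 / 4 : ℝ≥0∞) = ρ * 2⁻¹ := by
          rw [hρ, div_eq_mul_inv, div_eq_mul_inv, show (4 : ℝ≥0∞) = 2 * 2 by norm_num,
            ENNReal.mul_inv (by simp) (by simp)]; ring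
        rw [this, mul_pow, pow_succ]; ring
    _ ≤ (8 : ℝ≥0) * μ (qball d x r) := by
        have h34 : (1 - 3 / 4 : ℝ≥0∞)⁻¹ = 4 := by
          have : (1 - 3 / 4 : ℝ≥0∞) = 4⁻¹ := by
            refine ENNReal.sub_eq_of_eq_add (by finiteness) ?_
            rw [div_eq_mul_inv, show (4⁻¹ : ℝ≥0∞) + 3 * 4⁻¹ = 4 * 4⁻¹ by ring,
              ENNReal.mul_inv_cancel (by norm_num) (by norm_num)]
          rw [this, inv_inv]
        rw [ENNReal.tsum_geometric, h34]
        nth_rw 1 [← one_mul (μ (qball d x r))]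
        rw [← add_mul]
        gcongr
        have : ρ * 4 = 6 := by
          rw [hρ, show (4 : ℝ≥0∞) = 2 * 2 by norm_num, ← mul_assoc,
            ENNReal.div_mul_cancel (by simp) (by simp)]
          norm_num
        rw [this]
        norm_num

end GrandMorrey

namespace GrandMorrey

/-! ### Exponentials of functions of bounded mean oscillation are weights -/

/-- The exponential function with values in `[0, ∞]`. -/
noncomputable def eexp (t : ℝ) : ℝ≥0∞ := ENNReal.ofReal (Real.exp t)

theorem eexp_add (s t : ℝ) : eexp (s + t) = eexp s * eexp t := by
  rw [eexp, Real.exp_add, ENNReal.ofReal_mul (Real.exp_pos _).le]; rfl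

theorem eexp_ne_zero (t : ℝ) : eexp t ≠ 0 := by simp [eexp, Real.exp_pos]

theorem eexp_ne_top (t : ℝ) : eexp t ≠ ∞ := ENNReal.ofReal_ne_top

theorem eexp_rpow (t p : ℝ) : eexp t ^ p = eexp (p * t) := by
  rw [eexp, ENNReal.ofReal_rpow_of_pos (Real.exp_pos _), ← Real.exp_mul, mul_comm]; rfl

theorem eexp_mono {s t : ℝ} (h : s ≤ t) : eexp s ≤ eexp t :=
  ENNReal.ofReal_le_ofReal (Real.exp_le_exp.2 h)

@[fun_prop]
theorem measurable_eexp : Measurable eexp := by unfold eexp; fun_prop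

variable {X : Type*} [MeasurableSpace X] {d : X → X → ℝ} {μ ν : Measure X} {c D : ℝ} {Cd : ℝ≥0}
  {g : X → ℝ} {m : X → ℝ → ℝ} {c₀ : ℝ} {C₁ : ℝ≥0} {r s : ℝ}

theorem HasExpBound.lintegral_eexp_le (H : HasExpBound d μ g m c₀ C₁)
    (x : X) {ρ t : ℝ} (hρ : 0 < ρ) (ht : |t| ≤ c₀) :
    ∫⁻ y in qball d x ρ, eexp (t * (g y - m x ρ)) ∂μ ≤ C₁ * μ (qball d x ρ) := by
  refine le_trans (lintegral_mono fun y => eexp_mono ?_) (H x ρ hρ)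
  calc t * (g y - m x ρ) ≤ |t * (g y - m x ρ)| := le_abs_self _
    _ ≤ _ := by rw [abs_mul]; gcongr

/-- The measure with density `exp (s * g)`. -/
noncomputable def expWeight {X : Type*} [MeasurableSpace X] (μ : Measure X) (g : X → ℝ) (s : ℝ) :
    Measure X := μ.withDensity fun y => eexp (s * g y)

theorem HasExpBound.isFiniteMeasure_expWeight (h : DoublingBalls d μ c D Cd) [IsFiniteMeasure μ]
    (H : HasExpBound d μ g m c₀ C₁) (hs : |s| ≤ c₀) : IsFiniteMeasure (expWeight μ g s) := by
  rcases isEmpty_or_nonempty X with hX | ⟨⟨x⟩⟩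
  · infer_instance
  refine isFiniteMeasure_withDensity ?_
  have hD := h.pos_diam x
  have h1 := H.lintegral_eexp_le x hD hs
  rw [h.ball_eq_univ x le_rfl, setLIntegral_univ] at h1
  have h2 : ∀ y, eexp (s * g y) = eexp (s * m x D) * eexp (s * (g y - m x D)) := fun y => by
    rw [← eexp_add]; ring_nf
  simp_rw [h2]
  rw [lintegral_const_mul' _ _ (eexp_ne_top _)]
  exact ENNReal.mul_ne_top (eexp_ne_top _) (h1.trans_lt (by finiteness)).ne

/-- Exponentials of small multiples of `g` are weights. Both conditions follow from Hölder's
inequality, since the factor `exp (s * m x ρ)` cancels and `exp |s (g - m x ρ)|`, raised to the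
powers that occur, has average at most `C₁` over the ball. -/
theorem HasExpBound.isWeight (h : DoublingBalls d μ c D Cd) [IsFiniteMeasure μ]
    (hg : Measurable g) (H : HasExpBound d μ g m c₀ C₁) (hC₁ : 1 ≤ C₁) (hr : 1 < r) (hr2 : r ≤ 2)
    (hs : |s| ≤ c₀ / 2) (hs' : |s| ≤ c₀ * (r - 1)) :
    IsWeight d μ r (C₁ ^ 2) (expWeight μ g s) := by
  have hC₁' : (1 : ℝ≥0∞) ≤ C₁ := by exact_mod_cast hC₁
  have hs0 : |s| ≤ c₀ := by have := abs_nonneg s; linarith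
  have hem : ∀ t : ℝ, Measurable fun y => eexp (t * g y) := fun t => by fun_prop
  -- factoring out the value of the weight at the reference constant of a ball
  have hfac : ∀ (a : ℝ) (E : Set X) (φ : X → ℝ≥0∞), MeasurableSet E → AEMeasurable φ μ →
      ∫⁻ y in E, φ y ∂(expWeight μ g s) =
        eexp (s * a) * ∫⁻ y in E, eexp (s * (g y - a)) * φ y ∂μ := by
    intro a E φ hE hφ
    rw [expWeight, restrict_withDensity hE, lintegral_withDensity_eq_lintegral_mul₀
      (hem s).aemeasurable hφ.restrict, ← lintegral_const_mul' _ _ (eexp_ne_top _)]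
    refine lintegral_congr fun y => ?_
    rw [Pi.mul_apply, ← mul_assoc, ← eexp_add]
    ring_nf
  have hmeas : ∀ (a : ℝ) (E : Set X), MeasurableSet E →
      expWeight μ g s E = eexp (s * a) * ∫⁻ y in E, eexp (s * (g y - a)) ∂μ := by
    intro a E hE
    have := hfac a E (fun _ => 1) hE aemeasurable_const
    simpa using this
  refine ⟨withDensity_absolutelyContinuous _ _, withDensity_absolutelyContinuous'
    (hem s).aemeasurable (ae_of_all _ fun _ => eexp_ne_zero _), ?_, ?_⟩
  · intro x ρ E hρ hE hEB
    set B := qball d x ρ with hB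
    have hBm : MeasurableSet B := h.measurableSet_ball x ρ
    have hpos : 0 < μ B := h.measure_ball_pos x ρ hρ
    have htop := measure_ne_top μ B
    set a := m x ρ
    set I := ∫⁻ y in B, eexp (s * (g y - a)) ∂μ with hI
    rw [hmeas a E hE, hmeas a B hBm, ← hI]
    have h1 : ∫⁻ y in E, eexp (s * (g y - a)) ∂μ ≤
        μ E ^ (1 / 2 : ℝ) * (C₁ * μ B) ^ (1 / 2 : ℝ) := by
      have e := ENNReal.lintegral_mul_norm_pow_le (μ := μ.restrict E) (f := fun _ => 1)
        (g := fun y => eexp (2 * s * (g y - a))) aemeasurable_const (by fun_prop)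
        (p := 1 / 2) (q := 1 / 2) (by norm_num) (by norm_num) (by norm_num)
      simp only [ENNReal.one_rpow, one_mul, eexp_rpow, lintegral_one,
        Measure.restrict_apply MeasurableSet.univ, univ_inter] at e
      calc ∫⁻ y in E, eexp (s * (g y - a)) ∂μ
          = ∫⁻ y in E, eexp (1 / 2 * (2 * s * (g y - a))) ∂μ := by
            refine lintegral_congr fun y => ?_; ring_nf
        _ ≤ _ := e
        _ ≤ _ := by
            gcongr
            refine (lintegral_mono_set hEB).trans (H.lintegral_eexp_le x hρ ?_)
            rw [abs_mul]; norm_num; linarith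
    have h2 : μ B ≤ C₁ * I := by
      have e := ENNReal.lintegral_mul_norm_pow_le (μ := μ.restrict B)
        (f := fun y => eexp (s * (g y - a)))
        (g := fun y => eexp (-s * (g y - a))) (by fun_prop) (by fun_prop)
        (p := 1 / 2) (q := 1 / 2) (by norm_num) (by norm_num) (by norm_num)
      have e1 : ∀ y, eexp (s * (g y - a)) ^ (1 / 2 : ℝ) * eexp (-s * (g y - a)) ^ (1 / 2 : ℝ) = 1 := by
        intro y
        rw [eexp_rpow, eexp_rpow, ← eexp_add]
        have : 1 / 2 * (s * (g y - a)) + 1 / 2 * (-s * (g y - a)) = 0 := by ring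
        rw [this]; simp [eexp]
      simp only [e1, lintegral_one, Measure.restrict_apply MeasurableSet.univ, univ_inter] at e
      rw [← hI, ← ENNReal.mul_rpow_of_nonneg _ _ (by norm_num)] at e
      have e2 : ∫⁻ y in B, eexp (-s * (g y - a)) ∂μ ≤ C₁ * μ B :=
        H.lintegral_eexp_le x hρ (by rwa [abs_neg])
      have e3 : μ B ^ (2 : ℝ) ≤ I * (C₁ * μ B) := by
        calc μ B ^ (2 : ℝ) ≤ ((I * ∫⁻ y in B, eexp (-s * (g y - a)) ∂μ) ^ (1 / 2 : ℝ)) ^ (2 : ℝ) :=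
              ENNReal.rpow_le_rpow e (by norm_num)
          _ = I * ∫⁻ y in B, eexp (-s * (g y - a)) ∂μ := by rw [← ENNReal.rpow_mul]; norm_num
          _ ≤ _ := by gcongr
      have e4 : μ B * μ B ≤ (C₁ * I) * μ B := by
        calc μ B * μ B = μ B ^ (2 : ℝ) := by
              rw [← sq, ← ENNReal.rpow_natCast]; norm_num
          _ ≤ _ := e3
          _ = _ := by ring
      exact (ENNReal.mul_le_mul_iff_left hpos.ne' htop).1 e4
    have hroot : (C₁ : ℝ≥0∞) ^ (1 / 2 : ℝ) ≤ C₁ := by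
      calc (C₁ : ℝ≥0∞) ^ (1 / 2 : ℝ) ≤ (C₁ : ℝ≥0∞) ^ (1 : ℝ) :=
            ENNReal.rpow_le_rpow_of_exponent_le hC₁' (by norm_num)
        _ = _ := ENNReal.rpow_one _
    calc eexp (s * a) * ∫⁻ y in E, eexp (s * (g y - a)) ∂μ
        ≤ eexp (s * a) * (μ E ^ (1 / 2 : ℝ) * (C₁ * μ B ^ (1 / 2 : ℝ))) := by
          gcongr
          refine h1.trans ?_
          rw [ENNReal.mul_rpow_of_nonneg _ _ (by norm_num)]
          gcongr
      _ = C₁ * (μ E / μ B) ^ (1 / 2 : ℝ) * (eexp (s * a) * μ B) := by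
          have : μ E ^ (1 / 2 : ℝ) * μ B ^ (1 / 2 : ℝ) = (μ E / μ B) ^ (1 / 2 : ℝ) * μ B := by
            have e5 : μ B ^ (1 / 2 : ℝ) * μ B ^ (1 / 2 : ℝ) = μ B := by
              rw [← ENNReal.rpow_add _ _ hpos.ne' htop]; norm_num
            have e6 : (μ E / μ B) ^ (1 / 2 : ℝ) * μ B ^ (1 / 2 : ℝ) = μ E ^ (1 / 2 : ℝ) := by
              rw [← ENNReal.mul_rpow_of_nonneg _ _ (by norm_num),
                ENNReal.div_mul_cancel hpos.ne' htop]
            rw [← e6, mul_assoc, e5]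
          calc eexp (s * a) * (μ E ^ (1 / 2 : ℝ) * (C₁ * μ B ^ (1 / 2 : ℝ)))
              = eexp (s * a) * C₁ * (μ E ^ (1 / 2 : ℝ) * μ B ^ (1 / 2 : ℝ)) := by ring
            _ = _ := by rw [this]; ring
      _ ≤ C₁ * (μ E / μ B) ^ (1 / 2 : ℝ) * (eexp (s * a) * (C₁ * I)) := by gcongr
      _ = _ := by push_cast; ring
  · intro x ρ φ hρ hφ
    set B := qball d x ρ with hB
    have hBm : MeasurableSet B := h.measurableSet_ball x ρ
    set a := m x ρ
    have hr0 : 0 < r := by linarith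
    rw [hmeas a B hBm, hfac a B _ hBm (hφ.pow_const r)]
    set J := ∫⁻ y in B, eexp (s * (g y - a)) * φ y ^ r ∂μ with hJ
    have e := ENNReal.lintegral_mul_norm_pow_le (μ := μ.restrict B)
      (f := fun y => eexp (s * (g y - a)) * φ y ^ r)
      (g := fun y => eexp (-s / (r - 1) * (g y - a)))
      (by have := hφ.restrict (s := B); fun_prop) (by fun_prop)
      (p := 1 / r) (q := 1 - 1 / r) (by positivity)
      (by rw [sub_nonneg, div_le_one hr0]; exact hr.le) (by ring)
    have e1 : ∀ y, (eexp (s * (g y - a)) * φ y ^ r) ^ (1 / r) *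
        eexp (-s / (r - 1) * (g y - a)) ^ (1 - 1 / r) = φ y := by
      intro y
      have hr1 : r - 1 ≠ 0 := by linarith
      rw [ENNReal.mul_rpow_of_nonneg _ _ (by positivity), eexp_rpow, eexp_rpow,
        ← ENNReal.rpow_mul, mul_one_div_cancel hr0.ne', ENNReal.rpow_one, mul_right_comm,
        ← eexp_add]
      have : 1 / r * (s * (g y - a)) + (1 - 1 / r) * (-s / (r - 1) * (g y - a)) = 0 := by
        field_simp; ring
      rw [this]; simp [eexp]
    simp only [e1, ← hJ] at e
    have e2 : ∫⁻ y in B, eexp (-s / (r - 1) * (g y - a)) ∂μ ≤ C₁ * μ B := by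
      refine H.lintegral_eexp_le x hρ ?_
      rw [abs_div, abs_neg, abs_of_pos (by linarith : 0 < r - 1), div_le_iff₀ (by linarith)]
      exact hs'
    have e3 : (∫⁻ y in B, φ y ∂μ) ^ r ≤ J * (C₁ * μ B) ^ (r - 1) := by
      calc _ ≤ (J ^ (1 / r) * (∫⁻ y in B, eexp (-s / (r - 1) * (g y - a)) ∂μ) ^ (1 - 1 / r)) ^ r :=
            ENNReal.rpow_le_rpow e hr0.le
        _ = J * (∫⁻ y in B, eexp (-s / (r - 1) * (g y - a)) ∂μ) ^ (r - 1) := by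
            rw [ENNReal.mul_rpow_of_nonneg _ _ hr0.le, ← ENNReal.rpow_mul, ← ENNReal.rpow_mul,
              one_div_mul_cancel hr0.ne', ENNReal.rpow_one, sub_mul, one_mul,
              one_div_mul_cancel hr0.ne']
        _ ≤ _ := by gcongr
    have e4 : ∫⁻ y in B, eexp (s * (g y - a)) ∂μ ≤ C₁ * μ B := H.lintegral_eexp_le x hρ hs0
    have e5 : (C₁ * μ B) ^ (r - 1) * (C₁ * μ B) = C₁ ^ r * μ B ^ r := by
      rw [← ENNReal.mul_rpow_of_nonneg _ _ hr0.le]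
      nth_rw 2 [← ENNReal.rpow_one (C₁ * μ B)]
      rw [← ENNReal.rpow_add_of_nonneg _ _ (by linarith) zero_le_one]
      norm_num
    calc (∫⁻ y in B, φ y ∂μ) ^ r * (eexp (s * a) * ∫⁻ y in B, eexp (s * (g y - a)) ∂μ)
        ≤ (J * (C₁ * μ B) ^ (r - 1)) * (eexp (s * a) * (C₁ * μ B)) := by gcongr
      _ = ((C₁ * μ B) ^ (r - 1) * (C₁ * μ B)) * (eexp (s * a) * J) := by ring
      _ = C₁ ^ r * μ B ^ r * (eexp (s * a) * J) := by rw [e5]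
      _ ≤ _ := by
          gcongr
          rw [ENNReal.coe_pow, ← ENNReal.rpow_natCast]
          exact ENNReal.rpow_le_rpow_of_exponent_le hC₁' (by exact_mod_cast hr2)

/-! ### The commutator as a contour integral -/

/-- Cauchy's formula for the derivative at `0` of `z ↦ exp (a z)`, on the unit circle. -/
theorem integral_exp_circle (a : ℂ) :
    ∫ φ in (0 : ℝ)..2 * Real.pi, Complex.exp (a * Complex.exp (φ * Complex.I)) *
      Complex.exp (-(φ * Complex.I)) = 2 * Real.pi * a := by
  have hd : DiffContOnCl ℂ (fun z => Complex.exp (a * z)) (Metric.ball 0 1) :=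
    (by fun_prop : Differentiable ℂ fun z => Complex.exp (a * z)).diffContOnCl
  have h1 := hd.deriv_eq_smul_circleIntegral one_pos
  have h2 : deriv (fun z => Complex.exp (a * z)) 0 = a := by
    simp [deriv_cexp (by fun_prop : DifferentiableAt ℂ (fun z => a * z) 0)]
  have h3 : (∮ z in C(0, 1), (1 / (z - 0) ^ 2) • Complex.exp (a * z)) = Complex.I *
      ∫ φ in (0 : ℝ)..2 * Real.pi, Complex.exp (a * Complex.exp (φ * Complex.I)) *
      Complex.exp (-(φ * Complex.I)) := by
    rw [circleIntegral, ← intervalIntegral.integral_const_mul]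
    refine intervalIntegral.integral_congr fun φ _ => ?_
    have hne := Complex.exp_ne_zero (φ * Complex.I)
    simp only [deriv_circleMap, circleMap, Complex.ofReal_one, one_mul, zero_add, sub_zero,
      smul_eq_mul, Complex.exp_neg]
    field_simp
  rw [h3, h2, smul_eq_mul, mul_right_comm, mul_comm _ Complex.I] at h1
  exact mul_left_cancel₀ Complex.I_ne_zero h1

/-- A linear combination with coefficients `y - v` is dominated by exponential ones. -/
theorem abs_sum_sub_mul_le (F : Finset ℝ) (T : ℝ → ℝ) (y : ℝ) {τ : ℝ} (hτ : 0 < τ) :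
    ENNReal.ofReal (2 * Real.pi * τ) * ‖∑ v ∈ F, (y - v) * T v‖ₑ ≤
      ∫⁻ φ in Ioc 0 (2 * Real.pi), eexp (τ * Real.cos φ * y) *
        (‖∑ v ∈ F, (Complex.exp (-(τ * v * Complex.exp (φ * Complex.I)))).re * T v‖ₑ +
          ‖∑ v ∈ F, (Complex.exp (-(τ * v * Complex.exp (φ * Complex.I)))).im * T v‖ₑ) := by
  have h2π : 0 ≤ 2 * Real.pi := by positivity
  have h1 : ((2 * Real.pi * τ * ∑ v ∈ F, (y - v) * T v : ℝ) : ℂ) =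
      ∫ φ in (0 : ℝ)..2 * Real.pi, ∑ v ∈ F, (T v : ℂ) *
        (Complex.exp ((τ * (y - v) : ℂ) * Complex.exp (φ * Complex.I)) *
          Complex.exp (-(φ * Complex.I))) := by
    rw [intervalIntegral.integral_finsetSum fun v _ =>
      Continuous.intervalIntegrable (by fun_prop) _ _]
    simp_rw [intervalIntegral.integral_const_mul, integral_exp_circle]
    push_cast
    rw [Finset.mul_sum]
    refine Finset.sum_congr rfl fun v _ => ?_
    ring
  have h3 : ENNReal.ofReal (2 * Real.pi * τ) * ‖∑ v ∈ F, (y - v) * T v‖ₑ =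
      ‖((2 * Real.pi * τ * ∑ v ∈ F, (y - v) * T v : ℝ) : ℂ)‖ₑ := by
    rw [← ofReal_norm (_ : ℂ), Complex.norm_real, ofReal_norm, enorm_mul,
      Real.enorm_of_nonneg (by positivity : 0 ≤ 2 * Real.pi * τ)]
  rw [h3, h1, intervalIntegral.integral_of_le h2π]
  refine (enorm_integral_le_lintegral_enorm _).trans (lintegral_mono fun φ => ?_)
  set Z := Complex.exp (φ * Complex.I) with hZ
  have h4 : ∑ v ∈ F, (T v : ℂ) * (Complex.exp ((τ * (y - v) : ℂ) * Z) *
      Complex.exp (-(φ * Complex.I))) = Complex.exp (τ * y * Z) * Complex.exp (-(φ * Complex.I)) *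
        ∑ v ∈ F, Complex.exp (-(τ * v * Z)) * T v := by
    rw [Finset.mul_sum]
    refine Finset.sum_congr rfl fun v _ => ?_
    rw [show (τ * (y - v) : ℂ) * Z = τ * y * Z + -(τ * v * Z) by ring, Complex.exp_add]
    ring
  have hZre : Z.re = Real.cos φ := by rw [hZ, Complex.exp_ofReal_mul_I_re]
  rw [h4, enorm_mul, enorm_mul]
  have h5 : ‖Complex.exp (τ * y * Z)‖ₑ = eexp (τ * Real.cos φ * y) := by
    rw [← ofReal_norm, Complex.norm_exp, eexp]
    have : (τ * y * Z : ℂ).re = τ * Real.cos φ * y := by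
      rw [← Complex.ofReal_mul, Complex.re_ofReal_mul, hZre]; ring
    rw [this]
  have h6 : ‖Complex.exp (-(φ * Complex.I))‖ₑ = 1 := by
    rw [← ofReal_norm, Complex.norm_exp]; simp
  rw [h5, h6, mul_one]
  gcongr
  set S := ∑ v ∈ F, Complex.exp (-(τ * v * Z)) * T v with hS
  have hre : S.re = ∑ v ∈ F, (Complex.exp (-(τ * v * Z))).re * T v := by
    rw [hS, Complex.re_sum]
    exact Finset.sum_congr rfl fun v _ => by rw [Complex.re_mul_ofReal]
  have him : S.im = ∑ v ∈ F, (Complex.exp (-(τ * v * Z))).im * T v := by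
    rw [hS, Complex.im_sum]
    exact Finset.sum_congr rfl fun v _ => by rw [Complex.im_mul_ofReal]
  rw [← hre, ← him, ← ofReal_norm, ← ofReal_norm, ← ofReal_norm,
    ← ENNReal.ofReal_add (norm_nonneg _) (norm_nonneg _)]
  exact ENNReal.ofReal_le_ofReal (Complex.norm_le_abs_re_add_abs_im S)

end GrandMorrey

namespace GrandMorrey

/-! ### The commutator on Lebesgue spaces -/

variable {X : Type*} [MeasurableSpace X] {d : X → X → ℝ} {μ ν : Measure X} {c D : ℝ} {Cd : ℝ≥0}
  {K : X → X → ℝ} {C : ℝ} {w : ℝ → ℝ} {g : X → ℝ} {m : X → ℝ → ℝ} {c₀ : ℝ} {C₁ : ℝ≥0}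

theorem PVExistsAt.finset_sum {ι : Type*} (F : Finset ι) {fs : ι → X → ℝ} {x : X}
    (hfs : ∀ i ∈ F, PVExistsAt d μ K (fs i) x) :
    PVExistsAt d μ K (fun y => ∑ i ∈ F, fs i y) x ∧
      pvOperator d μ K (fun y => ∑ i ∈ F, fs i y) x = ∑ i ∈ F, pvOperator d μ K (fs i) x := by
  classical
  induction F using Finset.induction_on with
  | empty =>
    refine pvExistsAt_of_tendsto (fun η _ => ?_) ?_
    · simp
    · simp [truncated]
  | insert i F hi ih =>
    obtain ⟨h1, h2⟩ := ih fun j hj => hfs j (Finset.mem_insert_of_mem hj)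
    have h3 := (hfs i (Finset.mem_insert_self i F)).add h1
    simp only [Finset.sum_insert hi]
    rw [← h2]
    exact h3

/-- Multiplying `f` by a function of `g`, where `g` has finite range, amounts to a linear
combination of the pieces of `f` on the level sets of `g`. -/
theorem pv_comp_mul {F : Finset ℝ} (hF : ∀ y, g y ∈ F) {f : X → ℝ} {x : X}
    (hx : ∀ v ∈ F, PVExistsAt d μ K ((g ⁻¹' {v}).indicator f) x) (α : ℝ → ℝ) :
    PVExistsAt d μ K (fun y => α (g y) * f y) x ∧ pvOperator d μ K (fun y => α (g y) * f y) x =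
      ∑ v ∈ F, α v * pvOperator d μ K ((g ⁻¹' {v}).indicator f) x := by
  have e : (fun y => α (g y) * f y) = fun y => ∑ v ∈ F, α v * (g ⁻¹' {v}).indicator f y := by
    funext y
    rw [Finset.sum_eq_single (g y)]
    · simp
    · intro v _ hv
      have : y ∉ g ⁻¹' {v} := fun h => hv h.symm
      simp [this]
    · intro h; exact absurd (hF y) h
  rw [e]
  have h1 := PVExistsAt.finset_sum F fun v hv => ((hx v hv).const_mul (α v)).1
  refine ⟨h1.1, h1.2.trans (Finset.sum_congr rfl fun v hv => ((hx v hv).const_mul (α v)).2)⟩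

/-- Jensen's inequality for powers, for a measure which need not be normalized. -/
theorem lintegral_rpow_le_measure_mul {α : Type*} [MeasurableSpace α] {ρ : Measure α}
    {F : α → ℝ≥0∞} (hF : AEMeasurable F ρ) {q : ℝ} (hq : 1 ≤ q) :
    (∫⁻ a, F a ∂ρ) ^ q ≤ ρ univ ^ (q - 1) * ∫⁻ a, F a ^ q ∂ρ := by
  have hq0 : 0 < q := by linarith
  have e := ENNReal.lintegral_mul_norm_pow_le (μ := ρ) (f := fun a => F a ^ q)
    (g := fun _ => 1) (hF.pow_const q) aemeasurable_const (p := 1 / q) (q := 1 - 1 / q)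
    (by positivity) (by rw [sub_nonneg, div_le_one hq0]; exact hq) (by ring)
  simp only [← ENNReal.rpow_mul, mul_one_div_cancel hq0.ne', ENNReal.rpow_one, ENNReal.one_rpow,
    mul_one, lintegral_one] at e
  calc (∫⁻ a, F a ∂ρ) ^ q ≤ ((∫⁻ a, F a ^ q ∂ρ) ^ (1 / q) * ρ univ ^ (1 - 1 / q)) ^ q :=
        ENNReal.rpow_le_rpow e hq0.le
    _ = _ := by
        rw [ENNReal.mul_rpow_of_nonneg _ _ hq0.le, ← ENNReal.rpow_mul, ← ENNReal.rpow_mul,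
          one_div_mul_cancel hq0.ne', ENNReal.rpow_one, sub_mul, one_mul,
          one_div_mul_cancel hq0.ne', mul_comm]

/-- The coefficient `exp(-τ v e^{iφ})` of the value `v` in the conjugated operators. -/
noncomputable def conjCoeff (τ φ v : ℝ) : ℂ := Complex.exp (-(τ * v * Complex.exp (φ * Complex.I)))

theorem norm_conjCoeff (τ φ v : ℝ) : ‖conjCoeff τ φ v‖ = Real.exp (-(τ * Real.cos φ) * v) := by
  rw [conjCoeff, Complex.norm_exp, Complex.neg_re, ← Complex.ofReal_mul, Complex.re_ofReal_mul,
    Complex.exp_ofReal_mul_I_re]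
  ring_nf

theorem measurable_conjCoeff_re (τ v : ℝ) : Measurable fun φ => (conjCoeff τ φ v).re := by
  simp only [conjCoeff]; fun_prop

theorem measurable_conjCoeff_im (τ v : ℝ) : Measurable fun φ => (conjCoeff τ φ v).im := by
  simp only [conjCoeff]; fun_prop

/-- The contour integral bound for `∑ (y - v) T v`, raised to the power `q`. With `y = g x` and `T
v` the value at `x` of the operator on the piece of `f` where `g = v`, the sum is the commutator and
the integrands are the conjugated operators. -/
theorem enorm_sum_sub_mul_rpow_le (F : Finset ℝ) (T : ℝ → ℝ) (y : ℝ) {τ : ℝ} (hτ0 : 0 < τ)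
    {q : ℝ} (hq1 : 1 ≤ q) :
    ‖∑ v ∈ F, (y - v) * T v‖ₑ ^ q ≤
      ENNReal.ofReal (2 * Real.pi)⁻¹ * ENNReal.ofReal (2 / τ) ^ q *
        ∫⁻ φ in Ioc 0 (2 * Real.pi),
          (eexp (q * (τ * Real.cos φ) * y) * ‖∑ v ∈ F, (conjCoeff τ φ v).re * T v‖ₑ ^ q +
            eexp (q * (τ * Real.cos φ) * y) * ‖∑ v ∈ F, (conjCoeff τ φ v).im * T v‖ₑ ^ q) := by
  have hq0 : 0 < q := by linarith
  set S := ‖∑ v ∈ F, (y - v) * T v‖ₑ with hS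
  set R : ℝ → ℝ≥0∞ := fun φ => ‖∑ v ∈ F, (conjCoeff τ φ v).re * T v‖ₑ with hR
  set R' : ℝ → ℝ≥0∞ := fun φ => ‖∑ v ∈ F, (conjCoeff τ φ v).im * T v‖ₑ with hR'
  have hRm : Measurable R := by simp only [hR, conjCoeff]; fun_prop
  have hRm' : Measurable R' := by simp only [hR', conjCoeff]; fun_prop
  have e1 : ENNReal.ofReal (2 * Real.pi * τ) * S ≤
      ∫⁻ φ in Ioc 0 (2 * Real.pi), eexp (τ * Real.cos φ * y) * (R φ + R' φ) :=
    abs_sum_sub_mul_le F T y hτ0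
  have e2 := ENNReal.rpow_le_rpow e1 hq0.le
  have e3 : (∫⁻ φ in Ioc 0 (2 * Real.pi), eexp (τ * Real.cos φ * y) * (R φ + R' φ)) ^ q ≤
      ENNReal.ofReal (2 * Real.pi) ^ (q - 1) *
        (2 ^ q * ∫⁻ φ in Ioc 0 (2 * Real.pi), (eexp (q * (τ * Real.cos φ) * y) * R φ ^ q +
          eexp (q * (τ * Real.cos φ) * y) * R' φ ^ q)) := by
    refine (lintegral_rpow_le_measure_mul (by fun_prop) hq1).trans ?_
    rw [Measure.restrict_apply MeasurableSet.univ, univ_inter, Real.volume_Ioc, sub_zero,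
      ← lintegral_const_mul' (2 ^ q) _ (by finiteness)]
    refine mul_le_mul' le_rfl (lintegral_mono fun φ => ?_)
    rw [ENNReal.mul_rpow_of_nonneg _ _ hq0.le, eexp_rpow]
    have e4 : (R φ + R' φ) ^ q ≤ 2 ^ q * (R φ ^ q + R' φ ^ q) := by
      calc (R φ + R' φ) ^ q ≤ (2 * max (R φ) (R' φ)) ^ q := by
            gcongr; rw [two_mul]; exact add_le_add (le_max_left _ _) (le_max_right _ _)
        _ = 2 ^ q * max (R φ) (R' φ) ^ q := ENNReal.mul_rpow_of_nonneg _ _ hq0.le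
        _ ≤ _ := by
            gcongr
            rcases max_choice (R φ) (R' φ) with hm | hm <;> rw [hm]
            · exact le_self_add
            · exact le_add_self
    calc eexp (q * (τ * Real.cos φ * y)) * (R φ + R' φ) ^ q
        ≤ eexp (q * (τ * Real.cos φ * y)) * (2 ^ q * (R φ ^ q + R' φ ^ q)) := by gcongr
      _ = _ := by
          rw [← mul_assoc q]
          ring
  have hpi := Real.pi_pos
  rw [ENNReal.mul_rpow_of_nonneg _ _ hq0.le] at e2
  have hne : ENNReal.ofReal (2 * Real.pi * τ) ^ q ≠ 0 := by
    have : 0 < 2 * Real.pi * τ := by positivity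
    simp [ENNReal.rpow_eq_zero_iff, hpi, hτ0, hq0.not_gt]
  refine (ENNReal.mul_le_mul_iff_right hne (by finiteness)).1 ((e2.trans e3).trans (le_of_eq ?_))
  have e5 : ENNReal.ofReal (2 * Real.pi) ^ (q - 1) * 2 ^ q =
      ENNReal.ofReal (2 * Real.pi * τ) ^ q *
        (ENNReal.ofReal (2 * Real.pi)⁻¹ * ENNReal.ofReal (2 / τ) ^ q) := by
    rw [show (2 : ℝ≥0∞) = ENNReal.ofReal 2 by simp,
      ENNReal.ofReal_rpow_of_pos (by positivity), ENNReal.ofReal_rpow_of_pos (by positivity),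
      ENNReal.ofReal_rpow_of_pos (by positivity), ENNReal.ofReal_rpow_of_pos (by positivity),
      ← ENNReal.ofReal_mul (by positivity), ← ENNReal.ofReal_mul (by positivity),
      ← ENNReal.ofReal_mul (by positivity)]
    congr 1
    rw [Real.rpow_sub_one (by positivity), Real.mul_rpow (by positivity) hτ0.le,
      Real.div_rpow (by positivity) hτ0.le]
    have : τ ^ q ≠ 0 := (Real.rpow_pos_of_pos hτ0 q).ne'
    field_simp
  rw [← mul_assoc, e5, mul_assoc]

/-- The commutator with a function of finite range, by the Coifman–Rochberg–Weiss conjugation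
method: it is a contour integral of the conjugated operators `exp(z g) T exp(-z g)`, which are
bounded because the `exp(s g)` are weights. The bound does not depend on the range. -/
theorem IsWeakType.exists_commutator_bound_of_finite [IsFiniteMeasure μ] [NullSingletonClass μ]
    {C' : ℝ≥0} (hW : IsWeakType d μ K C') (hT : IsCZOperator d μ K)
    (hK : IsCZKernelWith d μ K C w) (h : DoublingBalls d μ c D Cd) {q₀ q₁ : ℝ} (hq₀ : 1 < q₀)
    (hq₁ : q₀ ≤ q₁) (hc₀ : 0 < c₀) (hC₁ : 1 ≤ C₁) :
    ∃ C₂ : ℝ≥0, ∀ (g : X → ℝ) (F : Finset ℝ) (m : X → ℝ → ℝ), Measurable g → (∀ y, g y ∈ F) →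
      HasExpBound d μ g m c₀ C₁ → ∀ q, q₀ ≤ q → q ≤ q₁ → ∀ f : X → ℝ, Integrable f μ →
        ∫⁻ x, ‖commutator g (pvOperator d μ K) f x‖ₑ ^ q ∂μ ≤ C₂ * ∫⁻ x, ‖f x‖ₑ ^ q ∂μ := by
  set r : ℝ := min 2 ((1 + q₀) / 2) with hr
  have hr1 : 1 < r := lt_min one_lt_two (by linarith)
  have hr2 : r ≤ 2 := min_le_left _ _
  have hrq : r < q₀ := (min_le_right _ _).trans_lt (by linarith)
  obtain ⟨Cw, hCw⟩ := hW.exists_weighted_bound hK h (q₀ := q₀) (q₁ := q₁) (by linarith) hrq (C₁ ^ 2)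
  -- the range of exponents `s` for which `exp (s g)` is a weight
  set s₀ := min (c₀ / 2) (c₀ * (r - 1)) with hs₀
  have hs₀pos : 0 < s₀ := lt_min (by linarith) (mul_pos hc₀ (by linarith))
  have hq₁0 : 0 < q₁ := by linarith
  set τ := s₀ / q₁ with hτ
  have hτ0 : 0 < τ := div_pos hs₀pos hq₁0
  set C₂ : ℝ≥0∞ := ENNReal.ofReal (max 1 (2 / τ)) ^ q₁ * (2 * Cw) with hC₂
  have hC₂top : C₂ ≠ ∞ := by finiteness
  refine ⟨C₂.toNNReal, fun g F m hg hF H q hq hq' f hf => ?_⟩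
  rw [ENNReal.coe_toNNReal hC₂top]
  have hq1 : 1 ≤ q := by linarith
  have hq0 : 0 < q := by linarith
  set T : ℝ → X → ℝ := fun v => pvOperator d μ K ((g ⁻¹' {v}).indicator f) with hTdef
  have hfv : ∀ v, Integrable ((g ⁻¹' {v}).indicator f) μ := fun v =>
    hf.indicator (hg (measurableSet_singleton v))
  have hTm : ∀ v, AEMeasurable (T v) μ := fun v => (hT.aestronglyMeasurable_pv hW (hfv v)).aemeasurable
  have hpv : ∀ᵐ x ∂μ, ∀ v ∈ F, PVExistsAt d μ K ((g ⁻¹' {v}).indicator f) x :=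
    (ae_ball_iff F.countable_toSet).2 fun v _ => (hW _ (hfv v)).1
  have hint : ∀ α : ℝ → ℝ, Integrable (fun y => α (g y) * f y) μ := by
    intro α
    have e : (fun y => α (g y) * f y) = fun y => ∑ v ∈ F, α v * (g ⁻¹' {v}).indicator f y := by
      funext y
      rw [Finset.sum_eq_single (g y)]
      · simp
      · intro v _ hv
        have : y ∉ g ⁻¹' {v} := fun h => hv h.symm
        simp [this]
      · intro h; exact absurd (hF y) h
    rw [e]
    exact integrable_finsetSum _ fun v _ => (hfv v).const_mul _
  -- the conjugated operators are bounded on `L^q`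
  have hconj : ∀ (φ : ℝ) (α : ℝ → ℝ), (∀ v, |α v| ≤ ‖conjCoeff τ φ v‖) →
      ∫⁻ x, eexp (q * (τ * Real.cos φ) * g x) * ‖∑ v ∈ F, α v * T v x‖ₑ ^ q ∂μ ≤
        Cw * ∫⁻ x, ‖f x‖ₑ ^ q ∂μ := by
    intro φ α hα
    set s := q * (τ * Real.cos φ) with hs
    have hsle : |s| ≤ s₀ := by
      rw [hs, abs_mul, abs_mul, abs_of_pos hq0, abs_of_pos hτ0]
      calc q * (τ * |Real.cos φ|) ≤ q₁ * (τ * 1) := by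
            gcongr; exact Real.abs_cos_le_one φ
        _ = s₀ := by rw [hτ]; field_simp
    have hwt := H.isWeight h hg hC₁ hr1 hr2 (hsle.trans (min_le_left _ _))
      (hsle.trans (min_le_right _ _))
    have hfin := H.isFiniteMeasure_expWeight h (s := s)
      ((hsle.trans (min_le_left _ _)).trans (by linarith))
    have hem : AEMeasurable (fun y => eexp (s * g y)) μ := by fun_prop
    have e1 := hCw _ hfin hwt q hq hq' _ (hint α)
    have hpvm : AEMeasurable (fun x => ‖pvOperator d μ K (fun y => α (g y) * f y) x‖ₑ ^ q) μ :=
      (hT.aestronglyMeasurable_pv hW (hint α)).enorm.pow_const q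
    have hαm : AEMeasurable (fun x => ‖α (g x) * f x‖ₑ ^ q) μ := (hint α).1.enorm.pow_const q
    rw [expWeight, lintegral_withDensity_eq_lintegral_mul₀ hem hpvm,
      lintegral_withDensity_eq_lintegral_mul₀ hem hαm] at e1
    simp only [Pi.mul_apply] at e1
    calc ∫⁻ x, eexp (s * g x) * ‖∑ v ∈ F, α v * T v x‖ₑ ^ q ∂μ
        = ∫⁻ x, eexp (s * g x) * ‖pvOperator d μ K (fun y => α (g y) * f y) x‖ₑ ^ q ∂μ := by
          refine lintegral_congr_ae ?_
          filter_upwards [hpv] with x hx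
          simp only [(pv_comp_mul hF hx α).2, hTdef]
      _ ≤ _ := e1
      _ ≤ Cw * ∫⁻ x, ‖f x‖ₑ ^ q ∂μ := by
          gcongr with x
          have e2 : ‖α (g x)‖ₑ ≤ eexp (-(τ * Real.cos φ) * g x) := by
            rw [Real.enorm_eq_ofReal_abs, eexp, ← norm_conjCoeff]
            exact ENNReal.ofReal_le_ofReal (hα _)
          calc eexp (s * g x) * ‖α (g x) * f x‖ₑ ^ q
              ≤ eexp (s * g x) * (eexp (-(τ * Real.cos φ) * g x) * ‖f x‖ₑ) ^ q := by
                rw [enorm_mul]; gcongr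
            _ = ‖f x‖ₑ ^ q := by
                rw [ENNReal.mul_rpow_of_nonneg _ _ hq0.le, eexp_rpow, ← mul_assoc, ← eexp_add]
                have : s * g x + q * (-(τ * Real.cos φ) * g x) = 0 := by rw [hs]; ring
                rw [this]; simp [eexp]
  set P : ℝ → X → ℝ≥0∞ := fun φ x => eexp (q * (τ * Real.cos φ) * g x) *
    ‖∑ v ∈ F, (conjCoeff τ φ v).re * T v x‖ₑ ^ q with hP
  set P' : ℝ → X → ℝ≥0∞ := fun φ x => eexp (q * (τ * Real.cos φ) * g x) *
    ‖∑ v ∈ F, (conjCoeff τ φ v).im * T v x‖ₑ ^ q with hP'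
  set ρ : Measure ℝ := volume.restrict (Ioc 0 (2 * Real.pi)) with hρ
  have hρuniv : ρ univ = ENNReal.ofReal (2 * Real.pi) := by simp [hρ]
  have hjoint : ∀ β : ℝ → ℝ → ℝ, (∀ v, Measurable fun φ => β φ v) →
      AEMeasurable (Function.uncurry fun (x : X) (φ : ℝ) => eexp (q * (τ * Real.cos φ) * g x) *
        ‖∑ v ∈ F, β φ v * T v x‖ₑ ^ q) (μ.prod ρ) := by
    intro β hβ
    have h1 : ∀ v, AEMeasurable (fun z : X × ℝ => T v z.1) (μ.prod ρ) := fun v => (hTm v).comp_fst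
    have h2 : ∀ v, Measurable fun z : X × ℝ => β z.2 v := fun v => (hβ v).comp measurable_snd
    have h3 : AEMeasurable (fun z : X × ℝ => ∑ v ∈ F, β z.2 v * T v z.1) (μ.prod ρ) :=
      Finset.aemeasurable_fun_sum _ fun v _ => (h2 v).aemeasurable.mul (h1 v)
    have h4 : Measurable fun z : X × ℝ => eexp (q * (τ * Real.cos z.2) * g z.1) := by fun_prop
    exact h4.aemeasurable.mul (h3.enorm.pow_const q)
  have hpt : ∀ᵐ x ∂μ, ‖commutator g (pvOperator d μ K) f x‖ₑ ^ q ≤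
      ENNReal.ofReal (2 * Real.pi)⁻¹ * ENNReal.ofReal (2 / τ) ^ q * ∫⁻ φ, (P φ x + P' φ x) ∂ρ := by
    filter_upwards [hpv] with x hx
    have e0 : commutator g (pvOperator d μ K) f x = ∑ v ∈ F, (g x - v) * T v x := by
      have h1 := (pv_comp_mul hF hx (fun v => v)).2
      have h2 := (pv_comp_mul hF hx (fun _ => 1)).2
      simp only [one_mul] at h2
      rw [commutator, h1, show pvOperator d μ K f x = _ from h2, Finset.mul_sum,
        ← Finset.sum_sub_distrib]
      exact Finset.sum_congr rfl fun v _ => by simp only [hTdef]; ring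
    rw [e0]
    exact enorm_sum_sub_mul_rpow_le F (fun v => T v x) (g x) hτ0 hq1
  calc ∫⁻ x, ‖commutator g (pvOperator d μ K) f x‖ₑ ^ q ∂μ
      ≤ ∫⁻ x, ENNReal.ofReal (2 * Real.pi)⁻¹ * ENNReal.ofReal (2 / τ) ^ q *
        ∫⁻ φ, (P φ x + P' φ x) ∂ρ ∂μ := lintegral_mono_ae hpt
    _ = ENNReal.ofReal (2 * Real.pi)⁻¹ * ENNReal.ofReal (2 / τ) ^ q *
        ∫⁻ φ, ∫⁻ x, (P φ x + P' φ x) ∂μ ∂ρ := by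
        rw [lintegral_const_mul' _ _ (by finiteness), lintegral_lintegral_swap]
        exact (hjoint (fun φ v => (conjCoeff τ φ v).re) (measurable_conjCoeff_re τ)).add
          (hjoint (fun φ v => (conjCoeff τ φ v).im) (measurable_conjCoeff_im τ))
    _ ≤ ENNReal.ofReal (2 * Real.pi)⁻¹ * ENNReal.ofReal (2 / τ) ^ q *
        ∫⁻ _, 2 * (Cw * ∫⁻ x, ‖f x‖ₑ ^ q ∂μ) ∂ρ := by
        gcongr with φ
        have hPm : AEMeasurable (P φ) μ := by
          have h3 : AEMeasurable (fun x => ∑ v ∈ F, (conjCoeff τ φ v).re * T v x) μ :=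
            Finset.aemeasurable_fun_sum _ fun v _ => (hTm v).const_mul _
          exact (by fun_prop : Measurable fun x => eexp (q * (τ * Real.cos φ) * g x)).aemeasurable.mul
            (h3.enorm.pow_const q)
        rw [lintegral_add_left' hPm, two_mul]
        exact add_le_add (hconj φ (fun v => (conjCoeff τ φ v).re) fun v => Complex.abs_re_le_norm _)
          (hconj φ (fun v => (conjCoeff τ φ v).im) fun v => Complex.abs_im_le_norm _)
    _ = ENNReal.ofReal (2 / τ) ^ q * (2 * Cw) * ∫⁻ x, ‖f x‖ₑ ^ q ∂μ := by
        rw [lintegral_const, hρuniv]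
        have : ENNReal.ofReal (2 * Real.pi)⁻¹ * ENNReal.ofReal (2 * Real.pi) = 1 := by
          have := Real.pi_pos
          rw [← ENNReal.ofReal_mul (by positivity), inv_mul_cancel₀ (by positivity),
            ENNReal.ofReal_one]
        calc _ = (ENNReal.ofReal (2 * Real.pi)⁻¹ * ENNReal.ofReal (2 * Real.pi)) *
              (ENNReal.ofReal (2 / τ) ^ q * (2 * Cw) * ∫⁻ x, ‖f x‖ₑ ^ q ∂μ) := by ring
          _ = _ := by rw [this, one_mul]
    _ ≤ C₂ * ∫⁻ x, ‖f x‖ₑ ^ q ∂μ := by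
        rw [hC₂]
        gcongr ?_ * _ * _
        refine (ENNReal.rpow_le_rpow (ENNReal.ofReal_le_ofReal (le_max_right 1 _)) hq0.le).trans
          (ENNReal.rpow_le_rpow_of_exponent_le ?_ hq')
        rw [ENNReal.one_le_ofReal]
        exact le_max_left _ _

end GrandMorrey

namespace GrandMorrey

variable {X : Type*} [MeasurableSpace X] {d : X → X → ℝ} {μ ν : Measure X} {c D : ℝ} {Cd : ℝ≥0}
  {K : X → X → ℝ} {C : ℝ} {w : ℝ → ℝ} {b : X → ℝ} {m : X → ℝ → ℝ} {c₀ : ℝ} {C₁ : ℝ≥0}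

/-- Truncation of `s` at height `n`, rounded down to a multiple of `1 / (n + 1)`. -/
noncomputable def quantize (n : ℕ) (s : ℝ) : ℝ :=
  ⌊((n : ℝ) + 1) * max (-(n : ℝ)) (min s n)⌋ / ((n : ℝ) + 1)

theorem measurable_quantize (n : ℕ) : Measurable (quantize n) := by
  unfold quantize; fun_prop

theorem exists_finset_quantize (n : ℕ) : ∃ F : Finset ℝ, ∀ s, quantize n s ∈ F := by
  refine ⟨(Finset.Icc (-((n + 1 : ℤ) * n)) ((n + 1 : ℤ) * n)).image
    fun k : ℤ => (k : ℝ) / ((n : ℝ) + 1), fun s => Finset.mem_image.2 ⟨_, ?_, rfl⟩⟩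
  have hn : (0 : ℝ) ≤ n := n.cast_nonneg
  rw [Finset.mem_Icc]
  constructor
  · rw [Int.le_floor]
    push_cast
    rw [← mul_neg]
    gcongr
    exact le_max_left _ _
  · have h1 : (⌊((n : ℝ) + 1) * max (-(n : ℝ)) (min s n)⌋ : ℝ) ≤ ((n : ℝ) + 1) * n := by
      refine (Int.floor_le _).trans ?_
      gcongr
      exact max_le (by linarith) (min_le_right _ _)
    exact_mod_cast h1

theorem abs_quantize_sub_le (n : ℕ) (s t : ℝ) : |quantize n s - quantize n t| ≤ |s - t| + 1 := by
  have hn : (0 : ℝ) ≤ n := n.cast_nonneg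
  set s' := max (-(n : ℝ)) (min s n) with hs
  set t' := max (-(n : ℝ)) (min t n) with ht
  have h1 : |s' - t'| ≤ |s - t| := by
    rw [hs, ht, max_comm, max_comm (-(n : ℝ))]
    refine (abs_max_sub_max_le_abs _ _ _).trans ?_
    exact abs_min_sub_min_le_max s n t n |>.trans (by simp)
  have h2 := abs_le.1 h1
  have e1 := Int.floor_le (((n : ℝ) + 1) * s')
  have e2 := Int.lt_floor_add_one (((n : ℝ) + 1) * s')
  have e3 := Int.floor_le (((n : ℝ) + 1) * t')
  have e4 := Int.lt_floor_add_one (((n : ℝ) + 1) * t')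
  rw [quantize, quantize, ← hs, ← ht, ← sub_div, abs_div, abs_of_pos (by linarith : (0:ℝ) < n + 1),
    div_le_iff₀ (by linarith), abs_le]
  constructor <;> nlinarith

theorem quantize_zero (n : ℕ) : quantize n 0 = 0 := by simp [quantize]

theorem tendsto_quantize (s : ℝ) : Tendsto (fun n => quantize n s) atTop (𝓝 s) := by
  have h1 : Tendsto (fun n : ℕ => s - 1 / ((n : ℝ) + 1)) atTop (𝓝 s) := by
    simpa using tendsto_one_div_add_atTop_nhds_zero_nat.const_sub s
  have hev : ∀ᶠ n : ℕ in atTop, |s| ≤ n := by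
    obtain ⟨N, hN⟩ := exists_nat_ge |s|
    filter_upwards [eventually_ge_atTop N] with n hn
    exact hN.trans (by exact_mod_cast hn)
  have hq : ∀ n : ℕ, |s| ≤ n → quantize n s = ⌊((n : ℝ) + 1) * s⌋ / ((n : ℝ) + 1) := fun n hn => by
    rw [quantize, min_eq_left (abs_le.1 hn).2, max_eq_right (abs_le.1 hn).1]
  refine tendsto_of_tendsto_of_tendsto_of_le_of_le' h1 tendsto_const_nhds ?_ ?_
  · filter_upwards [hev] with n hn
    have : (0 : ℝ) < n + 1 := by positivity
    rw [hq n hn, le_div_iff₀ this, sub_mul, one_div_mul_cancel this.ne']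
    have := Int.lt_floor_add_one (((n : ℝ) + 1) * s)
    linarith
  · filter_upwards [hev] with n hn
    have : (0 : ℝ) < n + 1 := by positivity
    rw [hq n hn, div_le_iff₀ this]
    have := Int.floor_le (((n : ℝ) + 1) * s)
    linarith

theorem HasExpBound.congr_ae {b' : X → ℝ} (H : HasExpBound d μ b m c₀ C₁) (hb : b =ᵐ[μ] b') :
    HasExpBound d μ b' m c₀ C₁ := by
  intro x r hr
  refine le_trans (le_of_eq (lintegral_congr_ae ?_)) (H x r hr)
  filter_upwards [ae_restrict_of_ae hb] with y hy
  rw [hy]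

/-- Quantization moves differences by at most `1`, so it preserves exponential bounds. -/
theorem HasExpBound.quantize (H : HasExpBound d μ b m c₀ C₁) (hc₀ : 0 ≤ c₀) (n : ℕ) :
    HasExpBound d μ (fun y => GrandMorrey.quantize n (b y))
      (fun x r => GrandMorrey.quantize n (m x r)) c₀ (max 1 ((Real.exp c₀).toNNReal * C₁)) := by
  intro x r hr
  calc _ ≤ ∫⁻ y in qball d x r, ENNReal.ofReal (Real.exp c₀) *
        ENNReal.ofReal (Real.exp (c₀ * |b y - m x r|)) ∂μ := by
        refine lintegral_mono fun y => ?_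
        rw [← ENNReal.ofReal_mul (Real.exp_pos _).le, ← Real.exp_add]
        refine ENNReal.ofReal_le_ofReal (Real.exp_le_exp.2 ?_)
        have := abs_quantize_sub_le n (b y) (m x r)
        nlinarith
    _ = ENNReal.ofReal (Real.exp c₀) *
        ∫⁻ y in qball d x r, ENNReal.ofReal (Real.exp (c₀ * |b y - m x r|)) ∂μ :=
        lintegral_const_mul' _ _ (by finiteness)
    _ ≤ ENNReal.ofReal (Real.exp c₀) * (C₁ * μ (qball d x r)) := by gcongr; exact H x r hr
    _ = (((Real.exp c₀).toNNReal * C₁ : ℝ≥0) : ℝ≥0∞) * μ (qball d x r) := by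
        rw [ENNReal.coe_mul, mul_assoc]; rfl
    _ ≤ _ := by gcongr; exact le_max_right _ _

/-- The bound for finite range passes to `b` through the functions `quantize n ∘ b` and Fatou's
lemma. -/
theorem IsWeakType.exists_commutator_bound [IsFiniteMeasure μ] [NullSingletonClass μ]
    {C' : ℝ≥0} (hW : IsWeakType d μ K C') (hT : IsCZOperator d μ K)
    (hK : IsCZKernelWith d μ K C w) (h : DoublingBalls d μ c D Cd) {q₀ q₁ : ℝ} (hq₀ : 1 < q₀)
    (hq₁ : q₀ ≤ q₁) (hc₀ : 0 < c₀) (hb : AEStronglyMeasurable b μ)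
    (H : HasExpBound d μ b m c₀ C₁) :
    ∃ C₂ : ℝ≥0, ∀ q, q₀ ≤ q → q ≤ q₁ → ∀ f : X → ℝ, Integrable f μ →
      Integrable (fun y => b y * f y) μ →
        ∫⁻ x, ‖commutator b (pvOperator d μ K) f x‖ₑ ^ q ∂μ ≤ C₂ * ∫⁻ x, ‖f x‖ₑ ^ q ∂μ := by
  obtain ⟨b', hb'm, hbb'⟩ := hb
  have H' := H.congr_ae hbb'
  obtain ⟨C₂, hC₂⟩ := hW.exists_commutator_bound_of_finite hT hK h hq₀ hq₁ hc₀
    (le_max_left 1 ((Real.exp c₀).toNNReal * C₁))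
  refine ⟨C₂, fun q hq hq' f hf hbf => ?_⟩
  have hq0 : 0 < q := by linarith
  set bn : ℕ → X → ℝ := fun n y => quantize n (b' y) with hbn
  have hbnm : ∀ n, Measurable (bn n) := fun n => (measurable_quantize n).comp hb'm.measurable
  have hbnb : ∀ n y, |bn n y| ≤ |b' y| + 1 := fun n y => by
    have := abs_quantize_sub_le n (b' y) 0
    simpa [quantize_zero, hbn] using this
  have hbf' : Integrable (fun y => b' y * f y) μ := by
    refine hbf.congr ?_
    filter_upwards [hbb'] with y hy
    rw [hy]
  set G : X → ℝ := fun y => 2 * |b' y * f y| + |f y| with hG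
  have hGi : Integrable G μ := (hbf'.abs.const_mul 2).add hf.abs
  have hfs : ∀ n, Integrable (fun y => bn n y * f y) μ := by
    intro n
    refine hGi.mono' ((hbnm n).aestronglyMeasurable.mul hf.1) (ae_of_all _ fun y => ?_)
    have h1 := hbnb n y
    have h2 := abs_nonneg (f y)
    have h3 := abs_nonneg (b' y)
    rw [Real.norm_eq_abs, abs_mul]
    change _ ≤ 2 * |b' y * f y| + |f y|
    rw [abs_mul]
    nlinarith
  have hlim : Tendsto (fun n => ∫⁻ x, ‖bn n x * f x - b x * f x‖ₑ ∂μ) atTop (𝓝 0) := by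
    have h0 : ∫⁻ _ : X, (0 : ℝ≥0∞) ∂μ = 0 := by simp
    rw [← h0]
    refine tendsto_lintegral_of_dominated_convergence' (fun x => ‖G x‖ₑ)
      (fun n => ((hfs n).sub hbf).1.enorm) (fun n => ?_) hGi.2.ne ?_
    · filter_upwards [hbb'] with y hy
      rw [hy]
      refine enorm_le_iff_norm_le.2 ?_
      have h1 := hbnb n y
      have h2 := abs_nonneg (f y)
      have h3 := abs_nonneg (b' y)
      have h4 : 0 ≤ G y := by positivity
      rw [Real.norm_of_nonneg h4, Real.norm_eq_abs, ← sub_mul, abs_mul]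
      change _ ≤ 2 * |b' y * f y| + |f y|
      rw [abs_mul]
      have h5 := abs_sub (bn n y) (b' y)
      nlinarith
    · filter_upwards [hbb'] with y hy
      have h1 : Tendsto (fun n => bn n y * f y - b y * f y) atTop (𝓝 (b' y * f y - b y * f y)) :=
        ((tendsto_quantize (b' y)).mul_const _).sub_const _
      rw [hy, sub_self] at h1
      simpa [hy] using h1.enorm
  obtain ⟨ns, hns, hae⟩ := hW.exists_subseq_tendsto hbf hfs hlim
  have hTfm := (hT.aestronglyMeasurable_pv hW hf).aemeasurable
  have hcm : ∀ n, AEMeasurable (fun x => ‖commutator (bn n) (pvOperator d μ K) f x‖ₑ ^ q) μ :=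
    fun n => (((hbnm n).aemeasurable.mul hTfm).sub
      (hT.aestronglyMeasurable_pv hW (hfs n)).aemeasurable).enorm.pow_const q
  calc ∫⁻ x, ‖commutator b (pvOperator d μ K) f x‖ₑ ^ q ∂μ
      = ∫⁻ x, liminf (fun k => ‖commutator (bn (ns k)) (pvOperator d μ K) f x‖ₑ ^ q) atTop ∂μ := by
        refine lintegral_congr_ae ?_
        filter_upwards [hae, hbb'] with x hx hbx
        have h1 : Tendsto (fun k => bn (ns k) x * pvOperator d μ K f x) atTop
            (𝓝 (b x * pvOperator d μ K f x)) := by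
          rw [hbx]
          exact ((tendsto_quantize (b' x)).comp hns.tendsto_atTop).mul_const _
        have h2 := (ENNReal.continuous_rpow_const (y := q)).tendsto _ |>.comp (h1.sub hx).enorm
        exact h2.liminf_eq.symm
    _ ≤ liminf (fun k => ∫⁻ x, ‖commutator (bn (ns k)) (pvOperator d μ K) f x‖ₑ ^ q ∂μ) atTop :=
        lintegral_liminf_le' fun k => hcm (ns k)
    _ ≤ C₂ * ∫⁻ x, ‖f x‖ₑ ^ q ∂μ := by
        refine liminf_le_of_le (by isBoundedDefault) fun a ha => ?_
        obtain ⟨k, hk⟩ := ha.exists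
        refine hk.trans ?_
        obtain ⟨F, hF⟩ := exists_finset_quantize (ns k)
        exact hC₂ _ F _ (hbnm _) (fun y => hF _) (H'.quantize hc₀.le _) q hq hq' f hf

end GrandMorrey

namespace GrandMorrey

/-! ### The commutator on Morrey spaces -/

variable {X : Type*} [MeasurableSpace X] {d : X → X → ℝ} {μ ν : Measure X} {c D : ℝ} {Cd : ℝ≥0}
  {K : X → X → ℝ} {C : ℝ} {w : ℝ → ℝ} {b : X → ℝ} {m : X → ℝ → ℝ} {c₀ : ℝ} {C₁ Cb : ℝ≥0}

/-- The oscillation has moments of all orders, uniformly for bounded orders. -/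
theorem HasExpBound.exists_moment_bound (H : HasExpBound d μ b m c₀ C₁) (hc₀ : 0 < c₀) (n : ℕ) :
    ∃ C₈ : ℝ≥0, 1 ≤ C₈ ∧ ∀ p : ℝ, 0 ≤ p → p ≤ n → ∀ x r, 0 < r →
      ∫⁻ y in qball d x r, (1 + ‖b y - m x r‖ₑ) ^ p ∂μ ≤ C₈ * μ (qball d x r) := by
  set A : ℝ := n.factorial / c₀ ^ n * Real.exp c₀ with hA
  refine ⟨max 1 (A.toNNReal * C₁), le_max_left _ _, fun p hp hpn x r hr => ?_⟩
  calc ∫⁻ y in qball d x r, (1 + ‖b y - m x r‖ₑ) ^ p ∂μ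
      ≤ ∫⁻ y in qball d x r, ENNReal.ofReal A *
          ENNReal.ofReal (Real.exp (c₀ * |b y - m x r|)) ∂μ := by
        refine lintegral_mono fun y => ?_
        have h0 := abs_nonneg (b y - m x r)
        have h1 : (1 : ℝ≥0∞) + ‖b y - m x r‖ₑ = ENNReal.ofReal (1 + |b y - m x r|) := by
          rw [ENNReal.ofReal_add zero_le_one h0, Real.enorm_eq_ofReal_abs, ENNReal.ofReal_one]
        calc (1 + ‖b y - m x r‖ₑ) ^ p ≤ (1 + ‖b y - m x r‖ₑ) ^ (n : ℝ) :=
              ENNReal.rpow_le_rpow_of_exponent_le le_self_add hpn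
          _ = ENNReal.ofReal ((1 + |b y - m x r|) ^ n) := by
              rw [h1, ENNReal.rpow_natCast, ENNReal.ofReal_pow (by linarith)]
          _ ≤ ENNReal.ofReal (A * Real.exp (c₀ * |b y - m x r|)) := by
              refine ENNReal.ofReal_le_ofReal ?_
              have h2 := Real.pow_div_factorial_le_exp _
                (by positivity : 0 ≤ c₀ * (1 + |b y - m x r|)) n
              rw [div_le_iff₀ (by positivity), mul_pow, mul_add, mul_one, Real.exp_add] at h2
              rw [hA, div_mul_eq_mul_div, div_mul_eq_mul_div, le_div_iff₀ (by positivity)]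
              linarith
          _ = _ := ENNReal.ofReal_mul (by positivity)
    _ = ENNReal.ofReal A * ∫⁻ y in qball d x r,
          ENNReal.ofReal (Real.exp (c₀ * |b y - m x r|)) ∂μ :=
        lintegral_const_mul' _ _ (by finiteness)
    _ ≤ ENNReal.ofReal A * (C₁ * μ (qball d x r)) := by gcongr; exact H x r hr
    _ = ((A.toNNReal * C₁ : ℝ≥0) : ℝ≥0∞) * μ (qball d x r) := by
        rw [ENNReal.coe_mul, mul_assoc]; rfl
    _ ≤ _ := by gcongr; exact le_max_right _ _

theorem HasBoundedOscillation.enorm_avg_two_pow_sub_le (hosc : HasBoundedOscillation d μ b Cb)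
    (h : DoublingBalls d μ c D Cd) [IsFiniteMeasure μ] (hb : Integrable b μ) (x : X) {r : ℝ}
    (hr : 0 < r) (k : ℕ) :
    ‖ballAvg d μ b x (2 ^ k * r) - ballAvg d μ b x r‖ₑ ≤ k * (Cb * Cd ^ 2 : ℝ≥0) := by
  induction k with
  | zero => simp
  | succ k ih =>
    have h1 := (hosc.lintegral_dilate_le h hb one_le_two x (r := 2 ^ k * r) (by positivity)).1
    rw [← mul_assoc, ← pow_succ', Nat.ceil_ofNat] at h1
    calc ‖ballAvg d μ b x (2 ^ (k + 1) * r) - ballAvg d μ b x r‖ₑ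
        = ‖(ballAvg d μ b x (2 ^ (k + 1) * r) - ballAvg d μ b x (2 ^ k * r)) +
          (ballAvg d μ b x (2 ^ k * r) - ballAvg d μ b x r)‖ₑ := by congr 1; ring
      _ ≤ _ := enorm_add_le _ _
      _ ≤ Cb * (Cd ^ 2 : ℝ≥0) + k * (Cb * Cd ^ 2 : ℝ≥0) := add_le_add h1 ih
      _ = _ := by push_cast; ring

theorem HasBoundedOscillation.enorm_avg_sub_le_of_mem (hosc : HasBoundedOscillation d μ b Cb)
    (h : DoublingBalls d μ c D Cd) [IsFiniteMeasure μ] (hb : Integrable b μ) {x z : X} {r : ℝ}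
    (hx : x ∈ qball d z r) :
    ‖ballAvg d μ b z r - ballAvg d μ b x r‖ₑ ≤
      2 * (Cb * (compConst c Cd 1 * compConst c Cd 1) : ℝ≥0) := by
  have hr := h.pos_of_mem hx
  set N := engulfConst c 1 with hN
  have hN1 : 1 ≤ N := h.one_le_engulfConst zero_le_one
  set B := qball d z (N * r) with hB
  set M := ballAvg d μ b z (N * r) with hM
  have key : ∀ x', (qball d z r ∩ qball d x' r).Nonempty →
      ‖ballAvg d μ b x' r - M‖ₑ ≤ (Cb * (compConst c Cd 1 * compConst c Cd 1) : ℝ≥0) := by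
    intro x' hne
    have hpos := h.measure_ball_pos x' r hr
    have h1 : qball d x' r ⊆ B := h.ball_subset_of_inter (by simp) hne
    have h2 : μ B ≤ (compConst c Cd 1 * compConst c Cd 1 : ℝ≥0) * μ (qball d x' r) := by
      refine (h.measure_engulf_le 1 z hr).trans ?_
      rw [ENNReal.coe_mul, mul_assoc]
      gcongr
      exact h.measure_le_of_inter (by simp) hr (by rwa [inter_comm])
    have h3 := h.enorm_ballAvg_sub_mul_le hb M x' hr
    have h4 : ‖ballAvg d μ b x' r - M‖ₑ * μ (qball d x' r) ≤
        (Cb * (compConst c Cd 1 * compConst c Cd 1) : ℝ≥0) * μ (qball d x' r) := by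
      calc _ ≤ _ := h3
        _ ≤ ∫⁻ y in B, ‖b y - M‖ₑ ∂μ := lintegral_mono_set h1
        _ ≤ Cb * μ B := hosc z (N * r) (by positivity)
        _ ≤ _ := by rw [ENNReal.coe_mul, mul_assoc]; gcongr
    exact (ENNReal.mul_le_mul_iff_left hpos.ne' (measure_ne_top _ _)).1 h4
  have e1 := key z (by rw [inter_self]; exact ⟨x, hx⟩)
  have e2 := key x ⟨x, hx, h.mem_ball_self x hr⟩
  calc ‖ballAvg d μ b z r - ballAvg d μ b x r‖ₑ
      = ‖(ballAvg d μ b z r - M) - (ballAvg d μ b x r - M)‖ₑ := by congr 1; ring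
    _ ≤ _ := enorm_sub_le
    _ ≤ _ := by rw [two_mul]; exact add_le_add e1 e2

/-- Hölder's inequality for a function of Morrey type against the oscillation of `b`. -/
theorem lintegral_mul_le_of_morrey [IsFiniteMeasure μ] {φ ψ : X → ℝ≥0∞} (hφ : AEMeasurable φ μ)
    (hψ : AEMeasurable ψ μ) {B : Set X} (hB : 0 < μ B) {q κ : ℝ} (hq : 1 < q) {M : ℝ≥0∞} {C₈ : ℝ≥0}
    (hC₈ : 1 ≤ C₈) (hM : ∫⁻ y in B, φ y ^ q ∂μ ≤ M * μ B ^ κ)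
    (hψB : ∫⁻ y in B, ψ y ^ (q / (q - 1)) ∂μ ≤ C₈ * μ B) :
    ∫⁻ y in B, ψ y * φ y ∂μ ≤ C₈ * M ^ (1 / q) * (μ B ^ ((1 - κ) / q))⁻¹ * μ B := by
  have hq0 : 0 < q := by linarith
  have htop := measure_ne_top μ B
  have hq1 : q - 1 ≠ 0 := by linarith
  have hq1' : 0 ≤ 1 - 1 / q := by rw [sub_nonneg, div_le_one hq0]; exact hq.le
  have e := ENNReal.lintegral_mul_norm_pow_le (μ := μ.restrict B) (f := fun a => φ a ^ q)
    (g := fun a => ψ a ^ (q / (q - 1))) (hφ.restrict.pow_const q) (hψ.restrict.pow_const _)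
    (p := 1 / q) (q := 1 - 1 / q)
    (by positivity) hq1' (by ring)
  have hex : q / (q - 1) * (1 - 1 / q) = 1 := by field_simp
  simp only [← ENNReal.rpow_mul, mul_one_div_cancel hq0.ne', ENNReal.rpow_one, hex] at e
  calc ∫⁻ y in B, ψ y * φ y ∂μ = ∫⁻ y in B, φ y * ψ y ∂μ := by simp_rw [mul_comm]
    _ ≤ _ := e
    _ ≤ (M * μ B ^ κ) ^ (1 / q) * (C₈ * μ B) ^ (1 - 1 / q) := by gcongr
    _ = (C₈ : ℝ≥0∞) ^ (1 - 1 / q) * M ^ (1 / q) * (μ B ^ (κ / q) * μ B ^ (1 - 1 / q)) := by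
        rw [ENNReal.mul_rpow_of_nonneg _ _ (by positivity), ENNReal.mul_rpow_of_nonneg _ _ hq1',
          ← ENNReal.rpow_mul, mul_one_div]
        ring
    _ ≤ C₈ * M ^ (1 / q) * ((μ B ^ ((1 - κ) / q))⁻¹ * μ B) := by
        refine mul_le_mul' (mul_le_mul' ?_ le_rfl) (le_of_eq ?_)
        · calc (C₈ : ℝ≥0∞) ^ (1 - 1 / q) ≤ (C₈ : ℝ≥0∞) ^ (1 : ℝ) :=
                ENNReal.rpow_le_rpow_of_exponent_le (by exact_mod_cast hC₈) (by
                  have : 0 < 1 / q := by positivity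
                  linarith)
            _ = C₈ := ENNReal.rpow_one _
        · rw [← ENNReal.rpow_add _ _ hB.ne' htop, ← ENNReal.rpow_neg]
          nth_rw 3 [← ENNReal.rpow_one (μ B)]
          rw [← ENNReal.rpow_add _ _ hB.ne' htop]
          congr 1
          field_simp
          ring
    _ = _ := by ring

/-- The measures of the dyadic dilates of a ball grow geometrically as long as the radii stay below
the diameter. -/
def HasReverseDoubling {X : Type*} [MeasurableSpace X] (d : X → X → ℝ) (μ : Measure X) (D : ℝ)
    (C₅ ρ : ℝ≥0) : Prop :=
  ∀ x r (k : ℕ), 0 < r → 2 ^ k * r < D →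
    μ (qball d x r) ≤ C₅ * ρ ^ k * μ (qball d x (2 ^ k * r))

theorem inv_le_mul_inv_of_le_mul {a b t : ℝ≥0∞} (ha : a ≠ 0) (ha' : a ≠ ∞) (hab : a ≤ t * b) :
    b⁻¹ ≤ t * a⁻¹ := by
  calc b⁻¹ = b⁻¹ * (a * a⁻¹) := by rw [ENNReal.mul_inv_cancel ha ha', mul_one]
    _ ≤ b⁻¹ * (t * b * a⁻¹) := by gcongr
    _ = (b * b⁻¹) * (t * a⁻¹) := by ring
    _ ≤ 1 * (t * a⁻¹) := by gcongr; exact ENNReal.mul_inv_le_one b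
    _ = _ := one_mul _

theorem tsum_succ_mul_pow_ne_top {ρ : ℝ≥0} (hρ : ρ < 1) :
    ∑' k : ℕ, ((k : ℝ≥0∞) + 1) * (ρ : ℝ≥0∞) ^ k ≠ ∞ := by
  have h1 : Summable fun k : ℕ => ((k : ℝ) + 1) * (ρ : ℝ) ^ k := by
    have hn : ‖(ρ : ℝ)‖ < 1 := by simpa using hρ
    have e1 := summable_pow_mul_geometric_of_norm_lt_one 1 hn
    have e2 := summable_geometric_of_norm_lt_one hn
    simpa [add_mul] using e1.add e2
  have h2 : Summable fun k : ℕ => ((k : ℝ≥0) + 1) * ρ ^ k := by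
    rw [← NNReal.summable_coe]; push_cast; exact h1
  have h3 := ENNReal.tsum_coe_ne_top_iff_summable.2 h2
  push_cast at h3
  exact h3

/-- The part of the commutator away from a ball, at a point of the ball. -/
theorem IsCZKernelWith.exists_far_bound (hK : IsCZKernelWith d μ K C w)
    (h : DoublingBalls d μ c D Cd) [IsFiniteMeasure μ] {C₅ ρ : ℝ≥0}
    (hrev : HasReverseDoubling d μ D C₅ ρ) (hC₅ : 1 ≤ C₅) (hρ : ρ < 1)
    (hosc : HasBoundedOscillation d μ b Cb) (hb : Integrable b μ) (hc₀ : 0 < c₀)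
    (H : HasExpBound d μ b (ballAvg d μ b) c₀ C₁) {q₀ q₁ lam : ℝ} (hq₀ : 1 < q₀)
    (hq₁ : q₀ ≤ q₁) (hlam : lam < 1) :
    ∃ C₇ : ℝ≥0, ∀ q κ : ℝ, q₀ ≤ q → q ≤ q₁ → 0 ≤ κ → κ ≤ lam → ∀ (f : X → ℝ) (M : ℝ≥0∞),
      AEStronglyMeasurable f μ →
      (∀ x r, 0 < r → ∫⁻ y in qball d x r, ‖f y‖ₑ ^ q ∂μ ≤ M * μ (qball d x r) ^ κ) →
      ∀ (x z : X) (r : ℝ), x ∈ qball d z r →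
        ∫⁻ y in (qball d x r)ᶜ, ‖K x y‖ₑ * ‖(b x - b y) * f y‖ₑ ∂μ ≤
          C₇ * M ^ (1 / q) * (μ (qball d z r) ^ ((1 - κ) / q))⁻¹ *
            (1 + ‖b x - ballAvg d μ b z r‖ₑ) := by
  obtain ⟨C₈, hC₈, hmom⟩ := H.exists_moment_bound hc₀ ⌈q₀ / (q₀ - 1)⌉₊
  -- the least value of `(1 - κ) / q`, which makes the geometric ratio `ρ ^ s₀` uniform
  set s₀ : ℝ := (1 - lam) / q₁ with hs₀
  set ρ' : ℝ≥0 := ρ ^ s₀ with hρ'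
  have hρ'1 : ρ' < 1 :=
    NNReal.rpow_lt_one hρ (div_pos (by linarith) (by linarith))
  set e1 : ℝ≥0 := 2 * (Cb * (compConst c Cd 1 * compConst c Cd 1)) with he1
  set e2 : ℝ≥0 := Cb * Cd ^ 2 with he2
  set E : ℝ≥0∞ := 1 + e1 + e2 with hE
  set S : ℝ≥0∞ := ∑' k : ℕ, ((k : ℝ≥0∞) + 1) * (ρ' : ℝ≥0∞) ^ k with hS
  have hStop : S ≠ ∞ := tsum_succ_mul_pow_ne_top hρ'1
  set C₇ : ℝ≥0∞ := ENNReal.ofReal C * (E * C₈ * Cd * C₅ * compConst c Cd 1) * S with hC₇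
  have hC₇top : C₇ ≠ ∞ := by finiteness
  refine ⟨C₇.toNNReal, fun q κ hq hq' hκ hκ' f M hf hM x z r hx => ?_⟩
  rw [ENNReal.coe_toNNReal hC₇top]
  have hr := h.pos_of_mem hx
  have hq0 : 0 < q := by linarith
  have hq₁0 : 0 < q₁ := by linarith
  set s : ℝ := (1 - κ) / q with hs
  have hs0 : 0 ≤ s := div_nonneg (by linarith) hq0.le
  have hs1 : s ≤ 1 := by rw [hs, div_le_one hq0]; linarith
  have hss : s₀ ≤ s := div_le_div₀ (by linarith) (by linarith) hq0 hq'
  set β := ‖b x - ballAvg d μ b z r‖ₑ with hβ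
  have hdiam : ∀ k : ℕ, (2 : ℝ) ^ (k + 1) * (r / 2) = 2 ^ k * r := fun k => by
    rw [pow_succ]; ring
  have hdiam' : ∀ k : ℕ, (2 : ℝ) ^ (k + 2) * (r / 2) = 2 ^ (k + 1) * r := fun k => by
    rw [pow_succ _ (k + 1)]; ring
  -- annuli of inner radius at least `D` are empty
  set a : ℕ → ℝ≥0∞ := fun k => if 2 ^ k * r < D then ENNReal.ofReal C else 0 with ha
  set mm : ℕ → ℝ≥0∞ := fun k => E * (k + 1) * (1 + β) * (C₈ * M ^ (1 / q) *
    (μ (qball d x (2 ^ (k + 1) * r)) ^ s)⁻¹ * Cd) with hmm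
  have hφm : AEMeasurable (fun y => ‖(b x - b y) * f y‖ₑ) μ :=
    ((aestronglyMeasurable_const.sub hb.1).mul hf).enorm
  have hann := h.lintegral_annuli_le (z := x) (r := r / 2) (by positivity)
    (u := fun y => ‖K x y‖ₑ) hφm (a := a) (m := mm) ?_ ?_
  · rw [mul_div_cancel₀ _ two_ne_zero] at hann
    refine hann.trans ?_
    have hterm : ∀ k, a k * mm k ≤ ENNReal.ofReal C * (E * C₈ * Cd * C₅ * compConst c Cd 1) *
        (((k : ℝ≥0∞) + 1) * (ρ' : ℝ≥0∞) ^ k) * (M ^ (1 / q) * (μ (qball d z r) ^ s)⁻¹ *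
          (1 + β)) := by
      intro k
      by_cases hk : 2 ^ k * r < D
      swap
      · simp [ha, hk]
      have hpx := h.measure_ball_pos x r hr
      have hpz := h.measure_ball_pos z r hr
      have i1 : (μ (qball d x (2 ^ (k + 1) * r)) ^ s)⁻¹ ≤ (μ (qball d x (2 ^ k * r)) ^ s)⁻¹ := by
        gcongr
        refine qball_mono d x ?_
        rw [pow_succ]
        have : (0 : ℝ) < 2 ^ k * r := by positivity
        linarith
      have i2 : (μ (qball d x (2 ^ k * r)) ^ s)⁻¹ ≤
          C₅ * ρ' ^ k * (μ (qball d x r) ^ s)⁻¹ := by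
        refine inv_le_mul_inv_of_le_mul (by simp [hpx.ne', hs0.not_gt])
          (ENNReal.rpow_ne_top_of_nonneg hs0 (measure_ne_top _ _)) ?_
        calc μ (qball d x r) ^ s ≤ (C₅ * ρ ^ k * μ (qball d x (2 ^ k * r))) ^ s := by
              gcongr; exact hrev x r k hr hk
          _ = (C₅ : ℝ≥0∞) ^ s * ((ρ : ℝ≥0∞) ^ k) ^ s * μ (qball d x (2 ^ k * r)) ^ s := by
              rw [ENNReal.mul_rpow_of_nonneg _ _ hs0, ENNReal.mul_rpow_of_nonneg _ _ hs0]
          _ ≤ _ := by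
              refine mul_le_mul' (mul_le_mul' ?_ ?_) le_rfl
              · calc (C₅ : ℝ≥0∞) ^ s ≤ (C₅ : ℝ≥0∞) ^ (1 : ℝ) :=
                      ENNReal.rpow_le_rpow_of_exponent_le (by exact_mod_cast hC₅) hs1
                  _ = C₅ := ENNReal.rpow_one _
              · have : (ρ' : ℝ≥0∞) = (ρ : ℝ≥0∞) ^ s₀ := by
                  rw [hρ', ENNReal.coe_rpow_of_nonneg]
                  exact div_nonneg (by linarith) hq₁0.le
                rw [this, ← ENNReal.rpow_natCast, ← ENNReal.rpow_natCast, ← ENNReal.rpow_mul,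
                  mul_comm, ENNReal.rpow_mul]
                gcongr ?_ ^ _
                exact ENNReal.rpow_le_rpow_of_exponent_ge (by exact_mod_cast hρ.le) hss
      have i3 : (μ (qball d x r) ^ s)⁻¹ ≤ compConst c Cd 1 * (μ (qball d z r) ^ s)⁻¹ := by
        refine inv_le_mul_inv_of_le_mul (by simp [hpz.ne', hs0.not_gt])
          (ENNReal.rpow_ne_top_of_nonneg hs0 (measure_ne_top _ _)) ?_
        have hcmp1 : (1 : ℝ≥0∞) ≤ compConst c Cd 1 := by
          exact_mod_cast (one_le_pow₀ h.one_le_doubling : 1 ≤ compConst c Cd 1)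
        calc μ (qball d z r) ^ s ≤ (compConst c Cd 1 * μ (qball d x r)) ^ s := by
              gcongr
              exact h.measure_le_of_inter (by simp) hr ⟨x, h.mem_ball_self x hr, hx⟩
          _ = (compConst c Cd 1 : ℝ≥0∞) ^ s * μ (qball d x r) ^ s :=
              ENNReal.mul_rpow_of_nonneg _ _ hs0
          _ ≤ (compConst c Cd 1 : ℝ≥0∞) ^ (1 : ℝ) * μ (qball d x r) ^ s := by
              gcongr
          _ = _ := by rw [ENNReal.rpow_one]
      have hak : a k = ENNReal.ofReal C := if_pos hk
      rw [hak]
      calc ENNReal.ofReal C * mm k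
          ≤ ENNReal.ofReal C * (E * (k + 1) * (1 + β) * (C₈ * M ^ (1 / q) *
              (C₅ * ρ' ^ k * (compConst c Cd 1 * (μ (qball d z r) ^ s)⁻¹)) * Cd)) := by
            refine mul_le_mul' le_rfl (mul_le_mul' le_rfl (mul_le_mul' (mul_le_mul' le_rfl ?_)
              le_rfl))
            exact i1.trans (i2.trans (mul_le_mul' le_rfl i3))
        _ = _ := by ring
    calc ∑' k, a k * mm k ≤ _ := ENNReal.tsum_le_tsum hterm
      _ = C₇ * (M ^ (1 / q) * (μ (qball d z r) ^ s)⁻¹ * (1 + β)) := by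
          rw [ENNReal.tsum_mul_right, ENNReal.tsum_mul_left]
      _ = _ := by ring
  · intro k y hy
    rw [hdiam] at hy ⊢
    have hk : 2 ^ k * r < D := hy.trans_lt (h.lt_diam x y)
    simp only [ha, if_pos hk]
    exact hK.enorm_le h (by positivity) hy
  · intro k
    rw [hdiam', hdiam]
    set R : ℝ := 2 ^ (k + 1) * r with hR
    have hR0 : 0 < R := by positivity
    set t : X → ℝ≥0∞ := fun y => 1 + ‖b y - ballAvg d μ b x R‖ₑ with ht
    have htm : AEMeasurable t μ :=
      aemeasurable_const.add (hb.1.sub aestronglyMeasurable_const).enorm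
    -- `b x - b y` is split at the averages over `B(z, r)`, `B(x, r)` and `B(x, R)`; the last two
    -- differ by a multiple of `k + 1`
    have hpt : ∀ y, ‖(b x - b y) * f y‖ₑ ≤ E * (k + 1) * (1 + β) * (t y * ‖f y‖ₑ) := by
      intro y
      have j1 := hosc.enorm_avg_sub_le_of_mem h hb hx
      have j2 := hosc.enorm_avg_two_pow_sub_le h hb x hr (k + 1)
      rw [← hR, ← enorm_neg, neg_sub] at j2
      have j3 : ‖b x - b y‖ₑ ≤ β + e1 + (k + 1) * e2 + ‖b y - ballAvg d μ b x R‖ₑ := by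
        calc ‖b x - b y‖ₑ = ‖(((b x - ballAvg d μ b z r) + (ballAvg d μ b z r - ballAvg d μ b x r)) +
              (ballAvg d μ b x r - ballAvg d μ b x R)) - (b y - ballAvg d μ b x R)‖ₑ := by
              congr 1; ring
          _ ≤ _ := enorm_sub_le
          _ ≤ _ := by
              refine add_le_add ((enorm_add_le _ _).trans (add_le_add ((enorm_add_le _ _).trans
                (add_le_add le_rfl ?_)) ?_)) le_rfl
              · rw [he1]; exact_mod_cast j1
              · exact_mod_cast j2
      rw [enorm_mul, ← mul_assoc]
      gcongr
      refine j3.trans ?_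
      set τ := ‖b y - ballAvg d μ b x R‖ₑ
      change _ ≤ E * (k + 1) * (1 + β) * (1 + τ)
      have hk1 : (1 : ℝ≥0∞) ≤ (k : ℝ≥0∞) + 1 := le_add_self
      have hE1 : (1 : ℝ≥0∞) ≤ E := by rw [hE, add_assoc]; exact le_self_add
      have j4 : (e1 : ℝ≥0∞) + (k + 1) * e2 ≤ E * (k + 1) := by
        rw [show E * (k + 1) = 1 * (k + 1) + e1 * (k + 1) + (k + 1) * e2 by rw [hE]; ring]
        refine add_le_add ?_ le_rfl
        calc (e1 : ℝ≥0∞) = e1 * 1 := (mul_one _).symm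
          _ ≤ e1 * (k + 1) := mul_le_mul' le_rfl hk1
          _ ≤ 1 * (k + 1) + e1 * (k + 1) := le_add_self
      have j5 : (1 : ℝ≥0∞) ≤ E * (k + 1) := one_le_mul hE1 hk1
      calc β + e1 + (k + 1) * e2 + τ = (e1 + (k + 1) * e2) + (β + τ) := by ring
        _ ≤ E * (k + 1) + E * (k + 1) * (β + τ + β * τ) := by
            refine add_le_add j4 ?_
            calc β + τ ≤ 1 * (β + τ + β * τ) := by rw [one_mul]; exact le_self_add
              _ ≤ _ := by gcongr
        _ = _ := by ring
    have hqq : q / (q - 1) ≤ (⌈q₀ / (q₀ - 1)⌉₊ : ℝ) := by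
      refine le_trans ?_ (Nat.le_ceil _)
      rw [div_le_div_iff₀ (by linarith) (by linarith)]
      nlinarith
    have hhol := lintegral_mul_le_of_morrey hf.enorm htm (h.measure_ball_pos x R hR0)
      (by linarith : 1 < q) hC₈ (hM x R hR0)
      (hmom _ (div_nonneg hq0.le (by linarith)) hqq x R hR0)
    calc ∫⁻ y in qball d x R, ‖(b x - b y) * f y‖ₑ ∂μ
        ≤ ∫⁻ y in qball d x R, E * (k + 1) * (1 + β) * (t y * ‖f y‖ₑ) ∂μ :=
          lintegral_mono fun y => hpt y
      _ = E * (k + 1) * (1 + β) * ∫⁻ y in qball d x R, t y * ‖f y‖ₑ ∂μ :=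
          lintegral_const_mul'' _ (htm.mul hf.enorm).restrict
      _ ≤ E * (k + 1) * (1 + β) * (C₈ * M ^ (1 / q) * (μ (qball d x R) ^ s)⁻¹ *
            (Cd * μ (qball d x (2 ^ k * r)))) := by
          refine mul_le_mul' le_rfl (hhol.trans (mul_le_mul' le_rfl ?_))
          rw [hR, pow_succ', mul_assoc]
          exact h.doubling x _ (by positivity)
      _ = _ := by rw [hmm]; ring

end GrandMorrey

namespace GrandMorrey

variable {X : Type*} [MeasurableSpace X] {d : X → X → ℝ} {μ ν : Measure X} {c D : ℝ} {Cd : ℝ≥0}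
  {K : X → X → ℝ} {C : ℝ} {w : ℝ → ℝ} {b : X → ℝ} {m : X → ℝ → ℝ} {c₀ : ℝ} {C₁ Cb : ℝ≥0}

/-- Functions of Morrey type are integrable even after multiplication by `b`, by Hölder's inequality
and the moments of `b`. -/
theorem HasExpBound.integrable_of_morrey (h : DoublingBalls d μ c D Cd) [IsFiniteMeasure μ]
    (hb : Integrable b μ) (hc₀ : 0 < c₀) (H : HasExpBound d μ b m c₀ C₁) {q κ : ℝ} (hq : 1 < q)
    (hκ : κ ≤ 1) {f : X → ℝ} (hf : AEStronglyMeasurable f μ) {M : ℝ≥0∞} (hMtop : M ≠ ∞)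
    (hM : ∀ x r, 0 < r → ∫⁻ y in qball d x r, ‖f y‖ₑ ^ q ∂μ ≤ M * μ (qball d x r) ^ κ) :
    Integrable f μ ∧ Integrable (fun y => b y * f y) μ := by
  rcases isEmpty_or_nonempty X with hX | ⟨⟨x⟩⟩
  · rw [Measure.eq_zero_of_isEmpty μ]
    exact ⟨integrable_zero_measure, integrable_zero_measure⟩
  have hq0 : 0 < q := by linarith
  have hD := h.pos_diam x
  have hpos := h.measure_ball_pos x D hD
  obtain ⟨C₈, hC₈, hmom⟩ := H.exists_moment_bound hc₀ ⌈q / (q - 1)⌉₊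
  set a := m x D
  set t : X → ℝ≥0∞ := fun y => 1 + ‖b y - a‖ₑ with ht
  have htm : AEMeasurable t μ :=
    aemeasurable_const.add (hb.1.sub aestronglyMeasurable_const).enorm
  have hhol := lintegral_mul_le_of_morrey hf.enorm htm hpos hq hC₈ (hM x D hD)
    (hmom _ (div_nonneg hq0.le (by linarith)) (Nat.le_ceil _) x D hD)
  rw [h.ball_eq_univ x le_rfl] at hhol hpos
  rw [setLIntegral_univ] at hhol
  have hs0 : 0 ≤ (1 - κ) / q := div_nonneg (by linarith) hq0.le
  have hlt : ∫⁻ y, t y * ‖f y‖ₑ ∂μ < ∞ := by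
    refine hhol.trans_lt ?_
    have h1 : (μ univ ^ ((1 - κ) / q))⁻¹ ≠ ∞ := by
      simp [hpos.ne', hs0.not_gt]
    have h2 : M ^ (1 / q) ≠ ∞ := ENNReal.rpow_ne_top_of_nonneg (by positivity) hMtop
    finiteness
  refine ⟨⟨hf, lt_of_le_of_lt (lintegral_mono fun y => ?_) hlt⟩, ⟨hb.1.mul hf, ?_⟩⟩
  · exact le_mul_of_one_le_left zero_le le_self_add
  · calc ∫⁻ y, ‖b y * f y‖ₑ ∂μ ≤ ∫⁻ y, (1 + ‖a‖ₑ) * (t y * ‖f y‖ₑ) ∂μ := by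
          refine lintegral_mono fun y => ?_
          rw [enorm_mul, ← mul_assoc]
          gcongr
          calc ‖b y‖ₑ = ‖(b y - a) + a‖ₑ := by congr 1; ring
            _ ≤ ‖b y - a‖ₑ + ‖a‖ₑ := enorm_add_le _ _
            _ ≤ (‖b y - a‖ₑ + ‖a‖ₑ) + (1 + ‖a‖ₑ * ‖b y - a‖ₑ) := le_self_add
            _ = (1 + ‖a‖ₑ) * t y := by rw [ht]; ring
      _ = (1 + ‖a‖ₑ) * ∫⁻ y, t y * ‖f y‖ₑ ∂μ := lintegral_const_mul' _ _ (by finiteness)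
      _ < ∞ := ENNReal.mul_lt_top (by finiteness) hlt

/-- At a point of a ball, the commutator splits into a local part and an absolutely convergent
far part. -/
theorem IsCZKernelWith.enorm_commutator_le (hK : IsCZKernelWith d μ K C w)
    (h : DoublingBalls d μ c D Cd) [IsFiniteMeasure μ] [NullSingletonClass μ] {f : X → ℝ}
    (hf : Integrable f μ) (hbf : Integrable (fun y => b y * f y) μ) {x z : X} {r : ℝ}
    (hx : x ∈ qball d z r) (h1 : PVExistsAt d μ K f x)
    (h2 : PVExistsAt d μ K (fun y => b y * f y) x) :
    ‖commutator b (pvOperator d μ K) f x‖ₑ ≤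
      ‖commutator b (pvOperator d μ K) ((qball d z (farConst c C * r)).indicator f) x‖ₑ +
        ∫⁻ y in (qball d x r)ᶜ, ‖K x y‖ₑ * ‖(b x - b y) * f y‖ₑ ∂μ := by
  have hr := h.pos_of_mem hx
  set Bs := qball d z (farConst c C * r) with hBs
  have hBsm : MeasurableSet Bsᶜ := (h.measurableSet_ball _ _).compl
  have hsub : Bsᶜ ⊆ (qball d x r)ᶜ := compl_subset_compl.2 (hK.ball_subset_far h hx)
  have hfar : ∀ y ∈ Bsᶜ, r ≤ d x y := fun y hy => not_lt.1 (hsub hy)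
  have e1 := (hK.pv_split h hf hx h1).2
  have e2 := (hK.pv_split h hbf hx h2).2
  have e3 : Bs.indicator (fun y => b y * f y) = fun y => b y * Bs.indicator f y := by
    funext y
    by_cases hy : y ∈ Bs <;> simp [hy]
  rw [← hBs] at e1 e2
  rw [e3] at e2
  have i1 := hK.integrableOn h hf hr hBsm hfar
  have i2 := hK.integrableOn h hbf hr hBsm hfar
  have e4 : b x * ∫ y in Bsᶜ, K x y * f y ∂μ - ∫ y in Bsᶜ, K x y * (b y * f y) ∂μ =
      ∫ y in Bsᶜ, K x y * ((b x - b y) * f y) ∂μ := by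
    rw [← integral_const_mul, ← integral_sub (i1.const_mul _) i2]
    refine integral_congr_ae (ae_of_all _ fun y => ?_)
    ring
  have e5 : commutator b (pvOperator d μ K) f x =
      commutator b (pvOperator d μ K) (Bs.indicator f) x +
        ∫ y in Bsᶜ, K x y * ((b x - b y) * f y) ∂μ := by
    rw [← e4, commutator, commutator, e1, e2]
    ring
  rw [e5]
  refine (enorm_add_le _ _).trans (add_le_add le_rfl ?_)
  refine (enorm_integral_le_lintegral_enorm _).trans ?_
  simp_rw [enorm_mul (K x _)]
  exact lintegral_mono_set hsub

/-- The commutator satisfies Morrey estimates, uniformly in both parameters. -/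
theorem IsWeakType.exists_morrey_bound [IsFiniteMeasure μ] [NullSingletonClass μ]
    {C' : ℝ≥0} (hW : IsWeakType d μ K C') (hT : IsCZOperator d μ K)
    (hK : IsCZKernelWith d μ K C w) (h : DoublingBalls d μ c D Cd) {C₅ ρ : ℝ≥0}
    (hrev : HasReverseDoubling d μ D C₅ ρ) (hC₅ : 1 ≤ C₅) (hρ : ρ < 1)
    (hosc : HasBoundedOscillation d μ b Cb) (hb : Integrable b μ) (hc₀ : 0 < c₀)
    (H : HasExpBound d μ b (ballAvg d μ b) c₀ C₁) {q₀ q₁ lam : ℝ} (hq₀ : 1 < q₀)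
    (hq₁ : q₀ ≤ q₁) (hlam : lam < 1) :
    ∃ C₉ : ℝ≥0, ∀ q κ : ℝ, q₀ ≤ q → q ≤ q₁ → 0 ≤ κ → κ ≤ lam → ∀ (f : X → ℝ) (M : ℝ≥0∞),
      AEStronglyMeasurable f μ → M ≠ ∞ →
      (∀ x r, 0 < r → ∫⁻ y in qball d x r, ‖f y‖ₑ ^ q ∂μ ≤ M * μ (qball d x r) ^ κ) →
      ∀ (z : X) (r : ℝ), 0 < r →
        ∫⁻ y in qball d z r, ‖commutator b (pvOperator d μ K) f y‖ₑ ^ q ∂μ ≤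
          C₉ * M * μ (qball d z r) ^ κ := by
  obtain ⟨C₂, hC₂⟩ := hW.exists_commutator_bound hT hK h hq₀ hq₁ hc₀ hb.1 H
  obtain ⟨C₇, hC₇⟩ := hK.exists_far_bound h hrev hC₅ hρ hosc hb hc₀ H hq₀ hq₁ hlam
  obtain ⟨C₈, hC₈, hmom⟩ := H.exists_moment_bound hc₀ ⌈q₁⌉₊
  set L := farConst c C with hL
  have hq₁0 : 0 ≤ q₁ := by linarith
  set C₉ : ℝ≥0∞ := 2 ^ q₁ * (C₂ * (Cd ^ ⌈L⌉₊ : ℝ≥0) + (max 1 C₇ : ℝ≥0) ^ q₁ * C₈) with hC₉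
  have hC₉top : C₉ ≠ ∞ := by finiteness
  refine ⟨C₉.toNNReal, fun q κ hq hq' hκ hκ' f M hf hMtop hM z r hr => ?_⟩
  rw [ENNReal.coe_toNNReal hC₉top]
  have hq0 : 0 < q := by linarith
  obtain ⟨hfi, hbfi⟩ := H.integrable_of_morrey h hb hc₀ (by linarith : 1 < q) (by linarith) hf
    hMtop hM
  obtain ⟨-, -, hL2⟩ := hK.two_le_farConst h
  set B := qball d z r with hB
  have hBm : MeasurableSet B := h.measurableSet_ball _ _
  have hpos : 0 < μ B := h.measure_ball_pos z r hr
  have htop := measure_ne_top μ B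
  set Bs := qball d z (L * r) with hBs
  have hBsm : MeasurableSet Bs := h.measurableSet_ball _ _
  set f₁ := Bs.indicator f with hf₁
  have hf₁i : Integrable f₁ μ := hfi.indicator hBsm
  have hbf₁i : Integrable (fun y => b y * f₁ y) μ := by
    refine (hbfi.indicator hBsm).congr (ae_of_all _ fun y => ?_)
    by_cases hy : y ∈ Bs <;> simp [hf₁, hy]
  set β : X → ℝ≥0∞ := fun y => 1 + ‖b y - ballAvg d μ b z r‖ₑ with hβ
  have hpt : ∀ᵐ x ∂(μ.restrict B), ‖commutator b (pvOperator d μ K) f x‖ₑ ^ q ≤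
      2 ^ q * (‖commutator b (pvOperator d μ K) f₁ x‖ₑ ^ q +
        C₇ ^ q * M * (μ B ^ (1 - κ))⁻¹ * β x ^ q) := by
    filter_upwards [ae_restrict_of_ae (hW f hfi).1, ae_restrict_of_ae (hW _ hbfi).1,
      ae_restrict_mem hBm] with x hx1 hx2 hxB
    have e1 := hK.enorm_commutator_le h hfi hbfi hxB hx1 hx2
    have e2 := hC₇ q κ hq hq' hκ hκ' f M hf hM x z r hxB
    have e3 := e1.trans (add_le_add le_rfl e2)
    set u := ‖commutator b (pvOperator d μ K) f₁ x‖ₑ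
    have e4 : (C₇ * M ^ (1 / q) * (μ B ^ ((1 - κ) / q))⁻¹ * β x) ^ q =
        C₇ ^ q * M * (μ B ^ (1 - κ))⁻¹ * β x ^ q := by
      rw [ENNReal.mul_rpow_of_nonneg _ _ hq0.le, ENNReal.mul_rpow_of_nonneg _ _ hq0.le,
        ENNReal.mul_rpow_of_nonneg _ _ hq0.le, ← ENNReal.inv_rpow, ← ENNReal.rpow_mul,
        ← ENNReal.rpow_mul, one_div_mul_cancel hq0.ne', ENNReal.rpow_one,
        div_mul_cancel₀ _ hq0.ne', ENNReal.inv_rpow]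
    rw [← e4]
    set v := C₇ * M ^ (1 / q) * (μ B ^ ((1 - κ) / q))⁻¹ * β x
    calc ‖commutator b (pvOperator d μ K) f x‖ₑ ^ q ≤ (2 * max u v) ^ q := by
          refine ENNReal.rpow_le_rpow (e3.trans ?_) hq0.le
          rw [two_mul]; exact add_le_add (le_max_left _ _) (le_max_right _ _)
      _ = 2 ^ q * max u v ^ q := ENNReal.mul_rpow_of_nonneg _ _ hq0.le
      _ ≤ _ := by
          gcongr
          rcases max_choice u v with hm | hm <;> rw [hm]
          · exact le_self_add
          · exact le_add_self
  have hcm : AEMeasurable (fun x => ‖commutator b (pvOperator d μ K) f₁ x‖ₑ ^ q) μ :=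
    ((hb.1.mul (hT.aestronglyMeasurable_pv hW hf₁i)).sub
      (hT.aestronglyMeasurable_pv hW hbf₁i)).enorm.pow_const q
  have hloc : ∫⁻ x in B, ‖commutator b (pvOperator d μ K) f₁ x‖ₑ ^ q ∂μ ≤
      C₂ * (Cd ^ ⌈L⌉₊ : ℝ≥0) * M * μ B ^ κ := by
    calc ∫⁻ x in B, ‖commutator b (pvOperator d μ K) f₁ x‖ₑ ^ q ∂μ
        ≤ ∫⁻ x, ‖commutator b (pvOperator d μ K) f₁ x‖ₑ ^ q ∂μ := setLIntegral_le_lintegral _ _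
      _ ≤ C₂ * ∫⁻ x, ‖f₁ x‖ₑ ^ q ∂μ := hC₂ q hq hq' f₁ hf₁i hbf₁i
      _ = C₂ * ∫⁻ x in Bs, ‖f x‖ₑ ^ q ∂μ := by
          rw [← lintegral_indicator hBsm]
          congr 2
          funext x
          by_cases hx : x ∈ Bs <;> simp [hf₁, hx, hq0]
      _ ≤ C₂ * (M * μ Bs ^ κ) := by gcongr; exact hM z (L * r) (by nlinarith)
      _ ≤ C₂ * (M * ((Cd ^ ⌈L⌉₊ : ℝ≥0) * μ B ^ κ)) := by
          gcongr
          have hcd : (1 : ℝ≥0∞) ≤ (Cd ^ ⌈L⌉₊ : ℝ≥0) := by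
            exact_mod_cast one_le_pow₀ h.one_le_doubling
          calc μ Bs ^ κ ≤ ((Cd ^ ⌈L⌉₊ : ℝ≥0) * μ B) ^ κ := by
                gcongr; exact h.measure_dilate_le L z hr
            _ = ((Cd ^ ⌈L⌉₊ : ℝ≥0) : ℝ≥0∞) ^ κ * μ B ^ κ := ENNReal.mul_rpow_of_nonneg _ _ hκ
            _ ≤ ((Cd ^ ⌈L⌉₊ : ℝ≥0) : ℝ≥0∞) ^ (1 : ℝ) * μ B ^ κ :=
                mul_le_mul' (ENNReal.rpow_le_rpow_of_exponent_le hcd (by linarith)) le_rfl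
            _ = _ := by rw [ENNReal.rpow_one]
      _ = _ := by ring
  have hfar : ∫⁻ x in B, C₇ ^ q * M * (μ B ^ (1 - κ))⁻¹ * β x ^ q ∂μ ≤
      (max 1 C₇ : ℝ≥0) ^ q₁ * C₈ * M * μ B ^ κ := by
    have hβm : AEMeasurable β μ :=
      aemeasurable_const.add (hb.1.sub aestronglyMeasurable_const).enorm
    rw [lintegral_const_mul'' _ (hβm.pow_const q).restrict]
    have e1 : (C₇ : ℝ≥0∞) ^ q ≤ ((max 1 C₇ : ℝ≥0) : ℝ≥0∞) ^ q₁ :=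
      (ENNReal.rpow_le_rpow (ENNReal.coe_le_coe.2 (le_max_right 1 C₇)) hq0.le).trans
        (ENNReal.rpow_le_rpow_of_exponent_le (by exact_mod_cast le_max_left 1 C₇) hq')
    have e2 : (μ B ^ (1 - κ))⁻¹ * μ B = μ B ^ κ := by
      rw [← ENNReal.rpow_neg]
      nth_rw 2 [← ENNReal.rpow_one (μ B)]
      rw [← ENNReal.rpow_add _ _ hpos.ne' htop]
      congr 1
      ring
    calc C₇ ^ q * M * (μ B ^ (1 - κ))⁻¹ * ∫⁻ x in B, β x ^ q ∂μ
        ≤ ((max 1 C₇ : ℝ≥0) : ℝ≥0∞) ^ q₁ * M * (μ B ^ (1 - κ))⁻¹ * (C₈ * μ B) := by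
          gcongr
          exact hmom q hq0.le (hq'.trans (Nat.le_ceil _)) z r hr
      _ = ((max 1 C₇ : ℝ≥0) : ℝ≥0∞) ^ q₁ * C₈ * M * ((μ B ^ (1 - κ))⁻¹ * μ B) := by ring
      _ = _ := by rw [e2]
  calc ∫⁻ y in B, ‖commutator b (pvOperator d μ K) f y‖ₑ ^ q ∂μ
      ≤ ∫⁻ x in B, 2 ^ q * (‖commutator b (pvOperator d μ K) f₁ x‖ₑ ^ q +
        C₇ ^ q * M * (μ B ^ (1 - κ))⁻¹ * β x ^ q) ∂μ := lintegral_mono_ae hpt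
    _ = 2 ^ q * (∫⁻ x in B, ‖commutator b (pvOperator d μ K) f₁ x‖ₑ ^ q ∂μ +
        ∫⁻ x in B, C₇ ^ q * M * (μ B ^ (1 - κ))⁻¹ * β x ^ q ∂μ) := by
        rw [lintegral_const_mul' _ _ (by finiteness), lintegral_add_left' hcm.restrict]
    _ ≤ 2 ^ q₁ * (C₂ * (Cd ^ ⌈L⌉₊ : ℝ≥0) * M * μ B ^ κ +
        (max 1 C₇ : ℝ≥0) ^ q₁ * C₈ * M * μ B ^ κ) :=
        mul_le_mul' (ENNReal.rpow_le_rpow_of_exponent_le one_le_two hq') (add_le_add hloc hfar)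
    _ = C₉ * M * μ B ^ κ := by rw [hC₉]; ring

end GrandMorrey

namespace GrandMorrey

/-! ### Bounded upper regular spaces of homogeneous type -/

variable {X : Type*} [MeasurableSpace X] {d : X → X → ℝ} {μ : Measure X} {c D : ℝ} {Cd : ℝ≥0}
  {γ : ℝ} {b : X → ℝ}

theorem le_toReal_qdiam {X : Type*} {d : X → X → ℝ} (hd : qdiam d ≠ ∞) (x y : X) :
    d x y ≤ (qdiam d).toReal := by
  rw [← ENNReal.ofReal_le_iff_le_toReal hd]
  exact le_iSup₂ (f := fun x y => ENNReal.ofReal (d x y)) x y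

theorem IsUpperAhlforsRegular.measure_eq_zero (hreg : IsUpperAhlforsRegular d μ γ) (hγ : 0 < γ)
    {x : X} {s : Set X} (hs : ∀ r, 0 < r → s ⊆ qball d x r) : μ s = 0 := by
  obtain ⟨c, -, hc⟩ := hreg
  have hlim : Tendsto (fun r : ℝ => ENNReal.ofReal (c * r ^ γ)) (𝓝[>] 0) (𝓝 0) := by
    have h1 : Tendsto (fun r : ℝ => c * r ^ γ) (𝓝 0) (𝓝 (c * 0 ^ γ)) :=
      (Real.continuousAt_rpow_const 0 γ (Or.inr hγ.le)).tendsto.const_mul c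
    rw [Real.zero_rpow hγ.ne', mul_zero] at h1
    simpa using ENNReal.tendsto_ofReal (h1.mono_left nhdsWithin_le_nhds)
  refine le_antisymm (ge_of_tendsto hlim ?_) zero_le
  filter_upwards [self_mem_nhdsWithin] with r hr using (measure_mono (hs r hr)).trans (hc x r hr)

theorem IsUpperAhlforsRegular.nullSingletonClass [TopologicalSpace X]
    (hreg : IsUpperAhlforsRegular d μ γ) (hγ : 0 < γ) (hX : IsHomogeneousType d μ) :
    NullSingletonClass μ where
  measure_singleton x := hreg.measure_eq_zero hγ (x := x) fun r hr => by
    rw [singleton_subset_iff]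
    show d x x < r
    rwa [(hX.quasimetric.eq_zero_iff x x).2 rfl]

/-- A space of diameter zero is a point, and upper regularity makes this point a null set. -/
theorem IsUpperAhlforsRegular.eq_zero_of_qdiam_eq_zero (hreg : IsUpperAhlforsRegular d μ γ)
    (hγ : 0 < γ) (hd : qdiam d = 0) : μ = 0 := by
  rcases isEmpty_or_nonempty X with hX | ⟨⟨x⟩⟩
  · exact Measure.eq_zero_of_isEmpty μ
  rw [← Measure.measure_univ_eq_zero]
  refine hreg.measure_eq_zero hγ (x := x) fun r hr y _ => ?_
  have := le_toReal_qdiam (d := d) (by simp [hd]) x y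
  rw [hd, ENNReal.toReal_zero] at this
  exact this.trans_lt hr

/-- The doubling condition extends to radii beyond the diameter. -/
theorem IsHomogeneousType.exists_doublingBalls [TopologicalSpace X] (hX : IsHomogeneousType d μ)
    (hd : qdiam d ≠ ∞) (hd0 : qdiam d ≠ 0) :
    ∃ c Cd, DoublingBalls d μ c (2 * (qdiam d).toReal) Cd := by
  obtain ⟨Ct, -, ht⟩ := hX.quasimetric.quasi_triangle
  obtain ⟨Cs, -, hs⟩ := hX.quasimetric.quasi_symm
  obtain ⟨Cd, hCd, hdbl⟩ := hX.doubling
  have hD : 0 < (qdiam d).toReal := ENNReal.toReal_pos hd0 hd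
  set D := (qdiam d).toReal with hDdef
  have hlt : ∀ r, r < D → ENNReal.ofReal r < qdiam d := fun r hr => by
    rw [← ENNReal.ofReal_toReal hd, ENNReal.ofReal_lt_ofReal_iff hD]
    exact hr
  have hnn := hX.quasimetric.nonneg
  refine ⟨max 1 (max Ct Cs), Cd, le_max_left _ _, hCd.le, hnn, hX.quasimetric.eq_zero_iff,
    fun x y z => (ht x y z).trans (mul_le_mul_of_nonneg_right
      ((le_max_left _ _).trans (le_max_right _ _)) (add_nonneg (hnn _ _) (hnn _ _))),
    fun x y => (hs x y).trans (mul_le_mul_of_nonneg_right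
      ((le_max_right _ _).trans (le_max_right _ _)) (hnn _ _)),
    fun x y => (le_toReal_qdiam hd x y).trans_lt (by linarith), hX.measurableSet_ball,
    fun x r hr => ?_, fun x r hr => ?_⟩
  · have hR : 0 < min r D / 2 := by positivity
    have hRr : min r D / 2 ≤ r := by linarith [min_le_left r D]
    have hRD : min r D / 2 < D := by linarith [min_le_right r D]
    exact (hX.annulus_pos x (min r D / 2 / 2) (min r D / 2) (by linarith) (by linarith)
      (hlt _ hRD)).trans_le (measure_mono (sdiff_subset.trans (qball_mono d x hRr)))
  · by_cases h : r < D
    · exact hdbl x r hr (hlt r h)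
    · -- a ball of radius `D` need not be the whole space, but one of radius `3 D / 2` is
      have h1 : qball d x (2 * r) ⊆ qball d x (2 * (3 / 4 * D)) := fun y _ =>
        (le_toReal_qdiam hd x y).trans_lt (by linarith)
      have h2 : qball d x (3 / 4 * D) ⊆ qball d x r := qball_mono d x (by linarith)
      calc μ (qball d x (2 * r)) ≤ μ (qball d x (2 * (3 / 4 * D))) := measure_mono h1
        _ ≤ Cd * μ (qball d x (3 / 4 * D)) := hdbl x _ (by linarith) (hlt _ (by linarith))
        _ ≤ _ := by gcongr

theorem IsHomogeneousType.isFiniteMeasure [TopologicalSpace X] (hX : IsHomogeneousType d μ)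
    (hd : qdiam d ≠ ∞) : IsFiniteMeasure μ := by
  rcases isEmpty_or_nonempty X with h | ⟨⟨x⟩⟩
  · rw [Measure.eq_zero_of_isEmpty μ]; infer_instance
  refine ⟨(measure_mono fun y _ => ?_).trans_lt
    (hX.measure_ball_lt_top x ((qdiam d).toReal + 1) (by positivity))⟩
  exact (le_toReal_qdiam hd x y).trans_lt (by linarith)

/-- An annulus around `x` contains a ball which is disjoint from a given ball around `x` and whose
measure is comparable with that of a dilate, so this dilate is substantially larger than the
ball. -/
theorem IsHomogeneousType.exists_reverseDoubling_step [TopologicalSpace X]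
    (hX : IsHomogeneousType d μ) (hd : qdiam d ≠ ∞) (h : DoublingBalls d μ c D Cd) :
    ∃ (n : ℕ) (σ : ℝ≥0), 0 < n ∧ 0 < σ ∧ σ < 1 ∧ ∀ x r, 0 < r →
      2 ^ n * r < (qdiam d).toReal → μ (qball d x r) ≤ σ * μ (qball d x (2 ^ n * r)) := by
  have hc := h.one_le
  -- `2 ^ m` makes the ball around a point of the annulus disjoint from the inner one, and `2 ^ n`
  -- makes it fit into the outer one
  obtain ⟨m, hm⟩ := pow_unbounded_of_one_lt (2 * c ^ 2) (one_lt_two (α := ℝ))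
  obtain ⟨n, hn⟩ := pow_unbounded_of_one_lt (c * (2 ^ m + 1)) (one_lt_two (α := ℝ))
  have hm0 : (0 : ℝ) < 2 ^ m := by positivity
  have hmn : (2 : ℝ) ^ m < 2 ^ n := by nlinarith
  have hn0 : 0 < n := by
    rcases Nat.eq_zero_or_pos n with rfl | h0
    · nlinarith
    · exact h0
  set C₆ : ℝ≥0 := compConst c Cd (2 ^ n) with hC₆
  have hC₆pos : 0 < C₆ := pow_pos (one_pos.trans_le h.one_le_doubling) _
  refine ⟨n, C₆ / (C₆ + 1), hn0, by positivity, by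
    rw [div_lt_one (by positivity)]; exact lt_add_one _, fun x r hr hlt => ?_⟩
  have hlt' : ENNReal.ofReal (2 ^ m * r) < qdiam d := by
    rw [← ENNReal.ofReal_toReal hd, ENNReal.ofReal_lt_ofReal_iff (by
      refine lt_trans ?_ hlt; positivity)]
    nlinarith
  obtain ⟨y, hy, hy'⟩ := nonempty_of_measure_ne_zero
    (hX.annulus_pos x (2 * c ^ 2 * r) (2 ^ m * r) (by positivity) (by gcongr) hlt').ne'
  replace hy : d x y < 2 ^ m * r := hy
  replace hy' : 2 * c ^ 2 * r ≤ d x y := not_lt.1 hy'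
  have hdisj : Disjoint (qball d x r) (qball d y r) := by
    refine Set.disjoint_left.2 fun z (hz : d x z < r) (hz' : d y z < r) => ?_
    have h1 := h.triangle x y z
    have h2 := h.symm z y
    have h3 : d x z + d z y < r + c * r := by nlinarith
    have h4 : c * (d x z + d z y) < c * (r + c * r) := mul_lt_mul_of_pos_left h3 h.cpos
    have h5 : c ≤ c ^ 2 := by nlinarith
    have h6 : c * r ≤ c ^ 2 * r := by gcongr
    nlinarith
  have hsub : qball d y r ⊆ qball d x (2 ^ n * r) := fun z (hz : d y z < r) => by
    have h1 := h.triangle x z y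
    have h2 : c * (d x y + d y z) < c * (2 ^ m * r + r) :=
      mul_lt_mul_of_pos_left (by linarith) h.cpos
    show d x z < 2 ^ n * r
    nlinarith
  have hsub' : qball d x r ⊆ qball d x (2 ^ n * r) :=
    qball_mono d x (le_mul_of_one_le_left hr.le (one_le_pow₀ one_le_two))
  set V := μ (qball d x (2 ^ n * r))
  have e1 : μ (qball d x r) + μ (qball d y r) ≤ V := by
    rw [← measure_union hdisj (h.measurableSet_ball _ _)]
    exact measure_mono (union_subset hsub' hsub)
  have e2 : V ≤ C₆ * μ (qball d y r) := h.measure_le_of_inter le_rfl hr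
    ⟨y, h.mem_ball_self y hr, hsub (h.mem_ball_self y hr)⟩
  have e3 : ((C₆ + 1 : ℝ≥0) : ℝ≥0∞) * μ (qball d x r) ≤ C₆ * V := by
    calc ((C₆ + 1 : ℝ≥0) : ℝ≥0∞) * μ (qball d x r)
        = C₆ * μ (qball d x r) + μ (qball d x r) := by push_cast; ring
      _ ≤ C₆ * μ (qball d x r) + C₆ * μ (qball d y r) := by
          gcongr
          exact (measure_mono hsub').trans e2
      _ = C₆ * (μ (qball d x r) + μ (qball d y r)) := by ring
      _ ≤ _ := by gcongr
  rw [ENNReal.coe_div (by positivity), div_eq_mul_inv, mul_right_comm, ← div_eq_mul_inv,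
    ENNReal.le_div_iff_mul_le (Or.inl (by simp)) (Or.inl (by simp)), mul_comm]
  exact e3

/-- Iterating the growth of measures by a fixed factor over `n` dyadic scales gives growth by its
`n`-th root over each of them. -/
theorem IsHomogeneousType.exists_reverseDoubling [TopologicalSpace X]
    (hX : IsHomogeneousType d μ) (hd : qdiam d ≠ ∞) (h : DoublingBalls d μ c D Cd) :
    ∃ C₅ ρ : ℝ≥0, 1 ≤ C₅ ∧ ρ < 1 ∧ HasReverseDoubling d μ (2 * (qdiam d).toReal) C₅ ρ := by
  obtain ⟨n, σ, hn, hσ, hσ1, hstep⟩ := hX.exists_reverseDoubling_step hd h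
  have hρn : (σ ^ (n⁻¹ : ℝ)) ^ n = σ := NNReal.rpow_inv_natCast_pow σ hn.ne'
  set ρ := σ ^ (n⁻¹ : ℝ) with hρ
  have hρ1 : ρ < 1 := NNReal.rpow_lt_one hσ1 (by positivity)
  refine ⟨σ⁻¹, ρ, (one_le_inv₀ hσ).2 hσ1.le, hρ1, fun x r k => ?_⟩
  induction k using Nat.strong_induction_on generalizing r with
  | _ k ih =>
  intro hr hlt
  rcases le_or_gt k n with hk | hk
  · have h1 : (1 : ℝ≥0∞) ≤ (σ⁻¹ : ℝ≥0) * ρ ^ k := by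
      have : 1 ≤ σ⁻¹ * ρ ^ k := by
        calc (1 : ℝ≥0) = σ⁻¹ * ρ ^ n := by rw [hρn, inv_mul_cancel₀ hσ.ne']
          _ ≤ _ := mul_le_mul' le_rfl (pow_le_pow_of_le_one zero_le hρ1.le hk)
      exact_mod_cast this
    calc μ (qball d x r) ≤ μ (qball d x (2 ^ k * r)) :=
          measure_mono (qball_mono d x (le_mul_of_one_le_left hr.le (one_le_pow₀ one_le_two)))
      _ ≤ _ := le_mul_of_one_le_left zero_le h1
  · have e : (2 : ℝ) ^ k = 2 ^ (k - n) * 2 ^ n := by rw [← pow_add]; congr 1; omega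
    have h1 : (2 : ℝ) ≤ 2 ^ (k - n) := by
      calc (2 : ℝ) = 2 ^ 1 := by norm_num
        _ ≤ _ := pow_le_pow_right₀ one_le_two (by omega)
    have hr' : 0 < 2 ^ n * r := by positivity
    have h2 := hstep x r hr (by rw [e] at hlt; nlinarith)
    have h3 := ih (k - n) (by omega) (2 ^ n * r) hr' (by rwa [← mul_assoc, ← e])
    rw [← mul_assoc, ← e] at h3
    have e' : (ρ : ℝ≥0∞) ^ k = σ * ρ ^ (k - n) := by
      rw [← hρn]; push_cast; rw [← pow_add]; congr 1; omega
    calc μ (qball d x r) ≤ σ * μ (qball d x (2 ^ n * r)) := h2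
      _ ≤ σ * ((σ⁻¹ : ℝ≥0) * ρ ^ (k - n) * μ (qball d x (2 ^ k * r))) := by gcongr
      _ = _ := by rw [e']; ring

theorem DoublingBalls.measure_univ_le (h : DoublingBalls d μ c D Cd) (x : X) {r : ℝ} (hr : 0 < r) :
    μ univ ≤ (Cd ^ ⌈D / r⌉₊ : ℝ≥0) * μ (qball d x r) := by
  have := h.measure_dilate_le (D / r) x hr
  rwa [div_mul_cancel₀ _ hr.ne', h.ball_eq_univ x le_rfl] at this

/-- The balls of a maximal disjoint family have measure bounded below, so they are finitely many. -/
theorem DoublingBalls.exists_finite_cover (h : DoublingBalls d μ c D Cd) [IsFiniteMeasure μ]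
    {r : ℝ} (hr : 0 < r) : ∃ u : Finset X, ∀ x, ∃ z ∈ u, x ∈ qball d z r := by
  have hL : 0 < engulfConst c 1 := one_pos.trans_le (h.one_le_engulfConst zero_le_one)
  set s := r / engulfConst c 1 with hs
  have hs0 : 0 < s := by positivity
  obtain ⟨u, -, hdis, hcov⟩ := h.exists_net hs0
  have hfin : u.Finite := by
    have hne : (Cd ^ ⌈D / s⌉₊ : ℝ≥0) ≠ 0 := (pow_pos (one_pos.trans_le h.one_le_doubling) _).ne'
    rcases isEmpty_or_nonempty X with hX | ⟨⟨x₀⟩⟩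
    · exact Set.toFinite u
    have hpos : 0 < μ univ := (h.measure_ball_pos x₀ 1 one_pos).trans_le (measure_mono (subset_univ _))
    have := Measure.finite_const_le_meas_of_disjoint_iUnion μ
      (ε := μ univ / (Cd ^ ⌈D / s⌉₊ : ℝ≥0)) (ENNReal.div_pos hpos.ne' ENNReal.coe_ne_top)
      (As := fun x : u => qball d (x : X) s) (fun x => h.measurableSet_ball _ _)
      (fun a b hab => hdis a.2 b.2 (fun e => hab (Subtype.ext e))) (measure_ne_top _ _)
    have h2 : {i : u | μ univ / (Cd ^ ⌈D / s⌉₊ : ℝ≥0) ≤ μ (qball d (i : X) s)} = univ :=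
      eq_univ_of_forall fun i => ENNReal.div_le_of_le_mul' (h.measure_univ_le _ hs0)
    rw [h2] at this
    have := finite_univ_iff.1 this
    exact Set.toFinite u
  refine ⟨hfin.toFinset, fun x => ?_⟩
  obtain ⟨z, hz, hsub⟩ := hcov x
  refine ⟨z, hfin.mem_toFinset.2 hz, ?_⟩
  have := hsub (h.mem_ball_self x hs0)
  rwa [hs, mul_div_cancel₀ _ hL.ne'] at this

theorem MemBMO.integrable (hb : MemBMO d μ b) (h : DoublingBalls d μ c D Cd) :
    Integrable b μ := by
  rcases isEmpty_or_nonempty X with hX | ⟨⟨x⟩⟩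
  · rw [Measure.eq_zero_of_isEmpty μ]; exact integrable_zero_measure
  have := hb.1 x D (h.pos_diam x)
  rwa [h.ball_eq_univ x le_rfl, integrableOn_univ] at this

/-- The `BMO` seminorm only involves radii less than the diameter; for the others, the oscillation
is at most twice the integral of `|b|`, and the measure of the ball is bounded below. -/
theorem MemBMO.exists_hasBoundedOscillation (hb : MemBMO d μ b)
    (h : DoublingBalls d μ c D Cd) [IsFiniteMeasure μ] (hd : qdiam d ≠ ∞) (hd0 : qdiam d ≠ 0) :
    ∃ Cb : ℝ≥0, 1 ≤ Cb ∧ HasBoundedOscillation d μ b Cb := by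
  rcases isEmpty_or_nonempty X with hX | ⟨⟨x₀⟩⟩
  · exact ⟨1, le_rfl, fun x => (hX.false x).elim⟩
  have hbi := hb.integrable h
  have hD : 0 < (qdiam d).toReal := ENNReal.toReal_pos hd0 hd
  have hpos : 0 < μ univ := (h.measure_ball_pos x₀ 1 one_pos).trans_le (measure_mono (subset_univ _))
  set I := ∫⁻ y, ‖b y‖ₑ ∂μ with hI
  have hItop : I ≠ ∞ := hbi.2.ne
  set E : ℝ≥0 := Cd ^ ⌈D / (qdiam d).toReal⌉₊
  set N := bmoNorm d μ b with hN
  have hNtop : N ≠ ∞ := hb.2.ne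
  have hTop : 1 + N + 2 * I / μ univ * E ≠ ∞ := by
    have : 2 * I / μ univ ≠ ∞ := ENNReal.div_ne_top (by finiteness) hpos.ne'
    finiteness
  refine ⟨(1 + N + 2 * I / μ univ * E).toNNReal, ?_, fun x r hr => ?_⟩
  · rw [← ENNReal.coe_le_coe, ENNReal.coe_toNNReal hTop, ENNReal.coe_one, add_assoc]
    exact le_self_add
  rw [ENNReal.coe_toNNReal hTop]
  have hB := h.measure_ball_pos x r hr
  by_cases hr' : ENNReal.ofReal r < qdiam d
  · have h1 : (μ (qball d x r))⁻¹ * ∫⁻ y in qball d x r, ‖b y - ballAvg d μ b x r‖ₑ ∂μ ≤ N :=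
      le_iSup_of_le x <| le_iSup_of_le r <| le_iSup_of_le hr <| le_iSup_of_le hr' le_rfl
    rw [ENNReal.inv_mul_le_iff hB.ne' (measure_ne_top _ _), mul_comm] at h1
    refine h1.trans ?_
    gcongr
    rw [add_comm 1 N, add_assoc]
    exact le_self_add
  · have hr2 : (qdiam d).toReal ≤ r := ENNReal.toReal_le_of_le_ofReal hr.le (not_lt.1 hr')
    have h1 := h.enorm_ballAvg_sub_mul_le hbi 0 x hr
    simp only [sub_zero] at h1
    calc ∫⁻ y in qball d x r, ‖b y - ballAvg d μ b x r‖ₑ ∂μ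
        ≤ ∫⁻ y in qball d x r, (‖b y‖ₑ + ‖ballAvg d μ b x r‖ₑ) ∂μ :=
          lintegral_mono fun y => enorm_sub_le
      _ = ∫⁻ y in qball d x r, ‖b y‖ₑ ∂μ + ‖ballAvg d μ b x r‖ₑ * μ (qball d x r) := by
          rw [lintegral_add_right _ measurable_const, lintegral_const,
            Measure.restrict_apply MeasurableSet.univ, univ_inter]
      _ ≤ I + I := add_le_add (setLIntegral_le_lintegral _ _)
          (h1.trans (setLIntegral_le_lintegral _ _))
      _ = 2 * I / μ univ * μ univ := by
          rw [ENNReal.div_mul_cancel hpos.ne' (measure_ne_top _ _), two_mul]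
      _ ≤ 2 * I / μ univ * (E * μ (qball d x r)) := by
          gcongr
          refine (h.measure_univ_le x hD).trans ?_
          gcongr
          exact qball_mono d x hr2
      _ = 2 * I / μ univ * E * μ (qball d x r) := by ring
      _ ≤ _ := by gcongr; exact le_add_self

/-- The Morrey norm involves the balls of radius less than the diameter only. On the larger ones the
integral is controlled by finitely many balls of half that radius. -/
theorem DoublingBalls.exists_lintegral_le_morreyNorm (h : DoublingBalls d μ c D Cd)
    [IsFiniteMeasure μ] (hd : qdiam d ≠ ∞) (hd0 : qdiam d ≠ 0) :
    ∃ C : ℝ≥0, ∀ (q κ : ℝ) (f : X → ℝ), 0 < q → 0 ≤ κ → κ ≤ 1 → ∀ x r, 0 < r →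
      ∫⁻ y in qball d x r, ‖f y‖ₑ ^ q ∂μ ≤
        C * morreyNorm d μ q κ f ^ q * μ (qball d x r) ^ κ := by
  have hD : 0 < (qdiam d).toReal := ENNReal.toReal_pos hd0 hd
  obtain ⟨u, hu⟩ := h.exists_finite_cover (half_pos hD)
  set E : ℝ≥0 := Cd ^ ⌈D / (qdiam d).toReal⌉₊ with hE
  have hE1 : 1 ≤ E := one_le_pow₀ h.one_le_doubling
  refine ⟨1 + u.card * E, fun q κ f hq hκ hκ' x r hr => ?_⟩
  set N := morreyNorm d μ q κ f with hN
  have hsmall : ∀ x r, 0 < r → ENNReal.ofReal r < qdiam d →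
      ∫⁻ y in qball d x r, ‖f y‖ₑ ^ q ∂μ ≤ N ^ q * μ (qball d x r) ^ κ := by
    intro x r hr hr'
    have h1 : ((μ (qball d x r) ^ κ)⁻¹ * ∫⁻ y in qball d x r, ‖f y‖ₑ ^ q ∂μ) ^ (1 / q) ≤ N :=
      le_iSup_of_le x <| le_iSup_of_le r <| le_iSup_of_le hr <| le_iSup_of_le hr' le_rfl
    rw [one_div, ENNReal.rpow_inv_le_iff hq, ENNReal.inv_mul_le_iff] at h1
    · rwa [mul_comm]
    · exact (ENNReal.rpow_pos (h.measure_ball_pos x r hr) (measure_ne_top _ _)).ne'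
    · exact ENNReal.rpow_ne_top_of_nonneg hκ (measure_ne_top _ _)
  by_cases hr' : ENNReal.ofReal r < qdiam d
  · refine (hsmall x r hr hr').trans ?_
    rw [mul_assoc]
    refine le_mul_of_one_le_left zero_le ?_
    exact_mod_cast (le_self_add : (1 : ℝ≥0) ≤ 1 + u.card * E)
  have hr2 : (qdiam d).toReal ≤ r := ENNReal.toReal_le_of_le_ofReal hr.le (not_lt.1 hr')
  have hhalf : ENNReal.ofReal ((qdiam d).toReal / 2) < qdiam d := by
    conv_rhs => rw [← ENNReal.ofReal_toReal hd]
    exact (ENNReal.ofReal_lt_ofReal_iff hD).2 (half_lt_self hD)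
  have hV : μ univ ^ κ ≤ E * μ (qball d x r) ^ κ := by
    calc μ univ ^ κ ≤ (E * μ (qball d x r)) ^ κ := by
          gcongr
          refine (h.measure_univ_le x hD).trans ?_
          gcongr
          exact qball_mono d x hr2
      _ = (E : ℝ≥0∞) ^ κ * μ (qball d x r) ^ κ := ENNReal.mul_rpow_of_nonneg _ _ hκ
      _ ≤ (E : ℝ≥0∞) ^ (1 : ℝ) * μ (qball d x r) ^ κ :=
          mul_le_mul' (ENNReal.rpow_le_rpow_of_exponent_le (by exact_mod_cast hE1) hκ') le_rfl
      _ = _ := by rw [ENNReal.rpow_one]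
  calc ∫⁻ y in qball d x r, ‖f y‖ₑ ^ q ∂μ
      ≤ ∫⁻ y in ⋃ z : u, qball d (z : X) ((qdiam d).toReal / 2), ‖f y‖ₑ ^ q ∂μ :=
        lintegral_mono_set fun y _ => by
          obtain ⟨z, hz, hyz⟩ := hu y
          exact mem_iUnion.2 ⟨⟨z, hz⟩, hyz⟩
    _ ≤ ∑ z ∈ u, ∫⁻ y in qball d z ((qdiam d).toReal / 2), ‖f y‖ₑ ^ q ∂μ :=
        (lintegral_iUnion_le _ _).trans_eq (Finset.tsum_subtype u
          fun z => ∫⁻ y in qball d z ((qdiam d).toReal / 2), ‖f y‖ₑ ^ q ∂μ)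
    _ ≤ ∑ _z ∈ u, N ^ q * μ univ ^ κ := by
        refine Finset.sum_le_sum fun z _ => (hsmall z _ (half_pos hD) hhalf).trans ?_
        gcongr
        exact subset_univ _
    _ = u.card * (N ^ q * μ univ ^ κ) := by rw [Finset.sum_const, nsmul_eq_mul]
    _ ≤ u.card * (N ^ q * (E * μ (qball d x r) ^ κ)) := by gcongr
    _ = u.card * E * N ^ q * μ (qball d x r) ^ κ := by ring
    _ ≤ _ := by push_cast; gcongr; exact le_add_self

end GrandMorrey

namespace GrandMorrey

/-! ### Grand Morrey spaces -/

variable {X : Type*} [MeasurableSpace X] {d : X → X → ℝ} {μ : Measure X} {p lam : ℝ} {A : ℝ → ℝ}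

theorem mem_Ioo_of_lt_sMax {ε : ℝ} (hA : IsAdmissible p A) (hε : 0 < ε) (hε' : ε < sMax p lam A) :
    ε ∈ Ioo 0 (p - 1) ∧ 0 ≤ A ε ∧ A ε ≤ lam := by
  have hne : {ε | ε ∈ Ioo 0 (p - 1) ∧ A ε ≤ lam}.Nonempty := by
    by_contra h
    rw [not_nonempty_iff_eq_empty] at h
    rw [sMax, h, Real.sSup_empty] at hε'
    linarith
  obtain ⟨δ, ⟨hδ, hδ'⟩, hlt⟩ := exists_lt_of_lt_csSup hne hε'
  have hεm : ε ∈ Ioo 0 (p - 1) := ⟨hε, hlt.trans hδ.2⟩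
  exact ⟨hεm, hA.nonneg ε hεm, (hA.mono hεm hδ hlt.le).trans hδ'⟩

theorem sMax_pos (hA : IsAdmissible p A) (hp : 1 < p) (hlam : 0 < lam) : 0 < sMax p lam A := by
  have h1 : ∀ᶠ ε in 𝓝[>] (0 : ℝ), A ε < lam := hA.tendsto_zero.eventually (gt_mem_nhds hlam)
  have h2 : ∀ᶠ ε in 𝓝[>] (0 : ℝ), ε ∈ Ioo 0 (p - 1) := Ioo_mem_nhdsGT (by linarith)
  obtain ⟨ε, h3, h4⟩ := (h1.and h2).exists
  exact h4.1.trans_le (le_csSup ⟨p - 1, fun x hx => hx.1.2.le⟩ ⟨h4, h3.le⟩)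

theorem le_grandMorreyNorm {φ : ℝ → ℝ} {f : X → ℝ} {ε : ℝ} (hε : 0 < ε)
    (hε' : ε < sMax p lam A) :
    ENNReal.ofReal (φ ε ^ (1 / (p - ε))) * morreyNorm d μ (p - ε) (lam - A ε) f ≤
      grandMorreyNorm d μ p lam φ A f :=
  le_iSup_of_le ε <| le_iSup_of_le hε <| le_iSup_of_le hε' le_rfl

theorem morreyNorm_le_of_lintegral_le {q κ : ℝ} (hq : 0 < q) {g : X → ℝ} {N : ℝ≥0∞}
    (hg : ∀ x r, 0 < r → ∫⁻ y in qball d x r, ‖g y‖ₑ ^ q ∂μ ≤ N ^ q * μ (qball d x r) ^ κ) :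
    morreyNorm d μ q κ g ≤ N := by
  refine iSup_le fun x => iSup_le fun r => iSup_le fun hr => iSup_le fun _ => ?_
  rw [one_div, ENNReal.rpow_inv_le_iff hq]
  calc (μ (qball d x r) ^ κ)⁻¹ * ∫⁻ y in qball d x r, ‖g y‖ₑ ^ q ∂μ
      ≤ (μ (qball d x r) ^ κ)⁻¹ * (N ^ q * μ (qball d x r) ^ κ) := by gcongr; exact hg x r hr
    _ = N ^ q * ((μ (qball d x r) ^ κ)⁻¹ * μ (qball d x r) ^ κ) := by ring
    _ ≤ N ^ q * 1 := by gcongr; exact ENNReal.inv_mul_le_one _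
    _ = _ := mul_one _

/-- On a bounded space of finite measure the Morrey norms increase with both exponents, up to a
constant. -/
theorem DoublingBalls.morreyNorm_mono {c D : ℝ} {Cd : ℝ≥0} (h : DoublingBalls d μ c D Cd)
    [IsFiniteMeasure μ] {q q' κ κ' : ℝ} (hq : 1 ≤ q) (hqq : q ≤ q') (hκκ : κ ≤ κ') (hκ : 0 ≤ κ)
    (hκ' : κ' ≤ 1) {g : X → ℝ} (hgm : AEStronglyMeasurable g μ) {N : ℝ≥0∞}
    (hg : ∀ x r, 0 < r → ∫⁻ y in qball d x r, ‖g y‖ₑ ^ q' ∂μ ≤ N ^ q' * μ (qball d x r) ^ κ') :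
    morreyNorm d μ q κ g ≤ max 1 (μ univ) * N := by
  have hq0 : 0 < q := by linarith
  have hq'0 : 0 < q' := by linarith
  have ht1 : q / q' ≤ 1 := (div_le_one hq'0).2 hqq
  have ht0 : 0 ≤ q / q' := by positivity
  refine morreyNorm_le_of_lintegral_le hq0 fun x r hr => ?_
  have hpos := h.measure_ball_pos x r hr
  have htop := measure_ne_top μ (qball d x r)
  set V := μ (qball d x r) with hV
  set e := (1 - κ) - (1 - κ') * (q / q') with he
  have he0 : 0 ≤ e := by nlinarith
  have he1 : e ≤ 1 := by nlinarith
  have h1 := ENNReal.lintegral_mul_norm_pow_le (μ := μ.restrict (qball d x r))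
    (f := fun y => ‖g y‖ₑ ^ q') (g := fun _ => 1) (hgm.enorm.pow_const q').restrict
    aemeasurable_const ht0 (sub_nonneg.2 ht1) (by ring)
  simp only [ENNReal.one_rpow, mul_one, lintegral_const, one_mul,
    Measure.restrict_apply MeasurableSet.univ, univ_inter, ← ENNReal.rpow_mul,
    mul_div_cancel₀ _ hq'0.ne'] at h1
  calc ∫⁻ y in qball d x r, ‖g y‖ₑ ^ q ∂μ
      ≤ (∫⁻ y in qball d x r, ‖g y‖ₑ ^ q' ∂μ) ^ (q / q') * V ^ (1 - q / q') := h1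
    _ ≤ (N ^ q' * V ^ κ') ^ (q / q') * V ^ (1 - q / q') := by gcongr; exact hg x r hr
    _ = N ^ q * V ^ (κ' * (q / q')) * V ^ (1 - q / q') := by
        rw [ENNReal.mul_rpow_of_nonneg _ _ ht0, ← ENNReal.rpow_mul, ← ENNReal.rpow_mul,
          mul_div_cancel₀ _ hq'0.ne']
    _ = N ^ q * (V ^ e * V ^ κ) := by
        rw [mul_assoc, ← ENNReal.rpow_add _ _ hpos.ne' htop, ← ENNReal.rpow_add _ _ hpos.ne' htop]
        congr 2
        rw [he]; ring
    _ ≤ N ^ q * (max 1 (μ univ) ^ q * V ^ κ) := by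
        gcongr
        calc V ^ e ≤ max 1 (μ univ) ^ e := by
              gcongr; exact (measure_mono (subset_univ _)).trans (le_max_right _ _)
          _ ≤ max 1 (μ univ) ^ q :=
              ENNReal.rpow_le_rpow_of_exponent_le (le_max_left _ _) (he1.trans hq)
    _ = (max 1 (μ univ) * N) ^ q * V ^ κ := by
        rw [ENNReal.mul_rpow_of_nonneg _ _ hq0.le]; ring

/-- An operator `U` is bounded on the grand Morrey space if it is bounded on the Morrey spaces,
uniformly for `q` in compact subintervals of `(1, ∞)` and `κ ≤ lam`. The norms with `ε` close to
`s_max` are dominated by the one with `ε = s_max / 2`, which keeps the exponents `p - ε` away from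
`1`. The predicate `P` stands for a property of all functions of Morrey type, on which the
measurability of `U f` may depend. -/
theorem DoublingBalls.grandMorreyNorm_le {c D : ℝ} {Cd : ℝ≥0} (h : DoublingBalls d μ c D Cd)
    [IsFiniteMeasure μ] (hd : qdiam d ≠ ∞) (hd0 : qdiam d ≠ 0) {θ : ℝ} (hθ : 0 < θ) (hp : 1 < p)
    (hlam0 : 0 < lam) (hlam1 : lam < 1) (hA : IsAdmissible p A) {U : (X → ℝ) → X → ℝ}
    {P : (X → ℝ) → Prop}
    (hP : ∀ (f : X → ℝ) (q κ : ℝ) (M : ℝ≥0∞), 1 < q → κ ≤ 1 → AEStronglyMeasurable f μ → M ≠ ∞ →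
      (∀ x r, 0 < r → ∫⁻ y in qball d x r, ‖f y‖ₑ ^ q ∂μ ≤ M * μ (qball d x r) ^ κ) → P f)
    (hUm : ∀ f, P f → AEStronglyMeasurable (U f) μ)
    (hU : ∀ q₀ q₁ : ℝ, 1 < q₀ → q₀ ≤ q₁ → ∃ C₉ : ℝ≥0, ∀ q κ : ℝ, q₀ ≤ q → q ≤ q₁ → 0 ≤ κ →
      κ ≤ lam → ∀ (f : X → ℝ) (M : ℝ≥0∞), AEStronglyMeasurable f μ → M ≠ ∞ →
      (∀ x r, 0 < r → ∫⁻ y in qball d x r, ‖f y‖ₑ ^ q ∂μ ≤ M * μ (qball d x r) ^ κ) →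
      ∀ (z : X) (r : ℝ), 0 < r →
        ∫⁻ y in qball d z r, ‖U f y‖ₑ ^ q ∂μ ≤ C₉ * M * μ (qball d z r) ^ κ) :
    ∃ C : ℝ≥0, ∀ f : X → ℝ, MemGrandMorrey d μ p lam (fun ε => ε ^ θ) A f →
      P f ∧ MemGrandMorrey d μ p lam (fun ε => ε ^ θ) A (U f) ∧
        grandMorreyNorm d μ p lam (fun ε => ε ^ θ) A (U f) ≤
          C * grandMorreyNorm d μ p lam (fun ε => ε ^ θ) A f := by
  have hs := sMax_pos hA hp hlam0
  set s := sMax p lam A with hsdef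
  -- below `σ` the exponents `p - ε` stay in `[p - σ, p]`; above `σ` the norms are compared with the
  -- one at `σ`
  set σ := s / 2 with hσ
  have hσ0 : 0 < σ := half_pos hs
  have hσs : σ < s := half_lt_self hs
  obtain ⟨⟨-, hσp⟩, hAσ0, hAσ⟩ := mem_Ioo_of_lt_sMax hA hσ0 hσs
  obtain ⟨C₉, hC₉⟩ := hU (p - σ) p (by linarith) (by linarith)
  obtain ⟨Cx, hext⟩ := h.exists_lintegral_le_morreyNorm hd hd0
  set C₁ : ℝ≥0 := max 1 (C₉ * Cx) with hC₁
  set v : ℝ → ℝ≥0∞ := fun ε => ENNReal.ofReal ((ε ^ θ) ^ (1 / (p - ε))) with hv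
  have hv0 : ∀ ε, 0 < ε → v ε ≠ 0 := fun ε hε => by
    simp only [hv, ne_eq, ENNReal.ofReal_eq_zero, not_le]; positivity
  have hvtop : ∀ ε, v ε ≠ ∞ := fun ε => ENNReal.ofReal_ne_top
  set C₂ : ℝ≥0∞ := ENNReal.ofReal (p ^ θ) * max 1 (μ univ) * (v σ)⁻¹ with hC₂
  have hC₂top : C₂ ≠ ∞ := by
    have : (v σ)⁻¹ ≠ ∞ := ENNReal.inv_ne_top.2 (hv0 σ hσ0)
    have h2 : max 1 (μ univ) ≠ ∞ := by simp
    finiteness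
  refine ⟨C₁ * max 1 C₂.toNNReal, fun f ⟨hfm, hfG⟩ => ?_⟩
  set G := grandMorreyNorm d μ p lam (fun ε => ε ^ θ) A f with hG
  have hle : ∀ ε, 0 < ε → ε < s → v ε * morreyNorm d μ (p - ε) (lam - A ε) f ≤ G :=
    fun ε hε hε' => le_grandMorreyNorm (φ := fun ε => ε ^ θ) hε hε'
  have htop : ∀ ε, 0 < ε → ε < s → morreyNorm d μ (p - ε) (lam - A ε) f ≠ ∞ := by
    intro ε hε hε' he
    have := hle ε hε hε'
    rw [he, ENNReal.mul_top (hv0 ε hε)] at this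
    exact absurd hfG (not_lt.2 this)
  have hPf : P f := hP f (p - σ) (lam - A σ) _ (by linarith) (by linarith) hfm
    (ENNReal.mul_ne_top ENNReal.coe_ne_top (ENNReal.rpow_ne_top_of_nonneg (by linarith)
      (htop σ hσ0 hσs))) (hext (p - σ) (lam - A σ) f (by linarith) (by linarith) (by linarith))
  have hgm := hUm f hPf
  have key : ∀ ε, 0 < ε → ε ≤ σ → ∀ x r, 0 < r → ∫⁻ y in qball d x r, ‖U f y‖ₑ ^ (p - ε) ∂μ ≤
      (C₁ * morreyNorm d μ (p - ε) (lam - A ε) f) ^ (p - ε) *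
        μ (qball d x r) ^ (lam - A ε) := by
    intro ε hε hε' x r hr
    obtain ⟨⟨-, hεp⟩, hAε0, hAε⟩ := mem_Ioo_of_lt_sMax hA hε (hε'.trans_lt hσs)
    refine (hC₉ (p - ε) (lam - A ε) (by linarith) (by linarith) (by linarith) (by linarith) f _ hfm
      (ENNReal.mul_ne_top ENNReal.coe_ne_top (ENNReal.rpow_ne_top_of_nonneg (by linarith)
        (htop ε hε (hε'.trans_lt hσs))))
      (hext (p - ε) (lam - A ε) f (by linarith) (by linarith) (by linarith)) x r hr).trans ?_
    rw [ENNReal.mul_rpow_of_nonneg _ _ (by linarith), ← mul_assoc (C₉ : ℝ≥0∞)]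
    gcongr
    calc (C₉ : ℝ≥0∞) * Cx ≤ C₁ := by exact_mod_cast le_max_right 1 (C₉ * Cx)
      _ = (C₁ : ℝ≥0∞) ^ (1 : ℝ) := (ENNReal.rpow_one _).symm
      _ ≤ _ := ENNReal.rpow_le_rpow_of_exponent_le
          (by exact_mod_cast le_max_left 1 (C₉ * Cx)) (by linarith)
  have hbd : grandMorreyNorm d μ p lam (fun ε => ε ^ θ) A (U f) ≤
      (C₁ * max 1 C₂.toNNReal : ℝ≥0) * G := by
    refine iSup_le fun ε => iSup_le fun hε => iSup_le fun hε' => ?_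
    obtain ⟨⟨-, hεp⟩, hAε0, hAε⟩ := mem_Ioo_of_lt_sMax hA hε hε'
    rw [ENNReal.coe_mul, ENNReal.coe_max 1 C₂.toNNReal, ENNReal.coe_toNNReal hC₂top, ENNReal.coe_one]
    rcases le_or_gt ε σ with hεσ | hεσ
    · calc v ε * morreyNorm d μ (p - ε) (lam - A ε) (U f)
          ≤ v ε * (C₁ * morreyNorm d μ (p - ε) (lam - A ε) f) := by
            gcongr
            exact morreyNorm_le_of_lintegral_le (by linarith) (key ε hε hεσ)
        _ = C₁ * 1 * (v ε * morreyNorm d μ (p - ε) (lam - A ε) f) := by ring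
        _ ≤ C₁ * max 1 C₂ * G :=
            mul_le_mul' (mul_le_mul' le_rfl (le_max_left _ _)) (hle ε hε hε')
    · have hvε : v ε ≤ ENNReal.ofReal (p ^ θ) := by
        refine ENNReal.ofReal_le_ofReal ?_
        have h1 : ε ^ θ ≤ p ^ θ := Real.rpow_le_rpow hε.le (by linarith) hθ.le
        have h2 : 1 / (p - ε) ≤ 1 := (div_le_one (by linarith)).2 (by linarith)
        have h3 : 0 ≤ 1 / (p - ε) := one_div_nonneg.2 (by linarith)
        calc (ε ^ θ) ^ (1 / (p - ε)) ≤ (p ^ θ) ^ (1 / (p - ε)) :=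
              Real.rpow_le_rpow (by positivity) h1 h3
          _ ≤ (p ^ θ) ^ (1 : ℝ) :=
              Real.rpow_le_rpow_of_exponent_le (Real.one_le_rpow hp.le hθ.le) h2
          _ = _ := Real.rpow_one _
      have hAm : A σ ≤ A ε := hA.mono ⟨hσ0, hσp⟩ ⟨hε, hεp⟩ hεσ.le
      calc v ε * morreyNorm d μ (p - ε) (lam - A ε) (U f)
          ≤ ENNReal.ofReal (p ^ θ) * (max 1 (μ univ) *
            (C₁ * morreyNorm d μ (p - σ) (lam - A σ) f)) := by
            refine mul_le_mul' hvε (h.morreyNorm_mono (by linarith) (by linarith) (by linarith)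
              (by linarith) (by linarith) hgm (key σ hσ0 le_rfl))
        _ = C₁ * (ENNReal.ofReal (p ^ θ) * max 1 (μ univ) * ((v σ)⁻¹ * v σ)) *
            morreyNorm d μ (p - σ) (lam - A σ) f := by
            rw [ENNReal.inv_mul_cancel (hv0 σ hσ0) (hvtop σ)]; ring
        _ = C₁ * C₂ * (v σ * morreyNorm d μ (p - σ) (lam - A σ) f) := by rw [hC₂]; ring
        _ ≤ C₁ * max 1 C₂ * G :=
            mul_le_mul' (mul_le_mul' le_rfl (le_max_right _ _)) (hle σ hσ0 hσs)
  exact ⟨hPf, ⟨hgm, hbd.trans_lt (ENNReal.mul_lt_top ENNReal.coe_lt_top hfG)⟩, hbd⟩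

end GrandMorrey

theorem mainTheorem1 {X : Type*} [TopologicalSpace X] [MeasurableSpace X]
    (d : X → X → ℝ) (μ : Measure X)
    (hX : GrandMorrey.IsHomogeneousType d μ)
    (hdiam : GrandMorrey.qdiam d < ∞)
    (γ : ℝ) (hγ : 0 < γ) (hreg : GrandMorrey.IsUpperAhlforsRegular d μ γ)
    (p θ lam : ℝ) (hp : 1 < p) (hθ : 0 < θ) (hlam0 : 0 < lam) (hlam1 : lam < 1)
    (A : ℝ → ℝ) (hA : GrandMorrey.IsAdmissible p A)
    (K : X → X → ℝ) (hK : GrandMorrey.IsCZOperator d μ K)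
    (b : X → ℝ) (hb : GrandMorrey.MemBMO d μ b) :
    ∃ C : ℝ≥0, ∀ f : X → ℝ,
      GrandMorrey.MemGrandMorrey d μ p lam (fun ε => ε ^ θ) A f →
        (∀ᵐ x ∂μ, GrandMorrey.PVExistsAt d μ K f x) ∧
        (∀ᵐ x ∂μ, GrandMorrey.PVExistsAt d μ K (fun y => b y * f y) x) ∧
        GrandMorrey.MemGrandMorrey d μ p lam (fun ε => ε ^ θ) A
          (GrandMorrey.commutator b (GrandMorrey.pvOperator d μ K) f) ∧
        GrandMorrey.grandMorreyNorm d μ p lam (fun ε => ε ^ θ) A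
            (GrandMorrey.commutator b (GrandMorrey.pvOperator d μ K) f) ≤
          C * GrandMorrey.grandMorreyNorm d μ p lam (fun ε => ε ^ θ) A f := by
  by_cases hd0 : GrandMorrey.qdiam d = 0
  · -- the space is a null point, and the suprema defining the norms are empty
    have hμ := hreg.eq_zero_of_qdiam_eq_zero hγ hd0
    have hG : ∀ g, GrandMorrey.grandMorreyNorm d μ p lam (fun ε => ε ^ θ) A g = 0 := fun g => by
      simp [GrandMorrey.grandMorreyNorm, GrandMorrey.morreyNorm, hd0]
    refine ⟨0, fun f _ => ?_⟩
    rw [GrandMorrey.MemGrandMorrey, hG, hG]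
    simp [hμ]
  have hd := hdiam.ne
  have := hX.isFiniteMeasure hd
  have := hreg.nullSingletonClass hγ hX
  obtain ⟨c, Cd, h⟩ := hX.exists_doublingBalls hd hd0
  obtain ⟨C₅, ρ, hC₅, hρ, hrev⟩ := hX.exists_reverseDoubling hd h
  have hbi := hb.integrable h
  obtain ⟨Cb, hCb, hosc⟩ := hb.exists_hasBoundedOscillation h hd hd0
  obtain ⟨c₀, hc₀, C₁, H⟩ := hosc.exists_expBound hX h hbi hCb
  obtain ⟨C, w, hKw⟩ := hK.exists_kernelWith
  obtain ⟨C', hW⟩ : ∃ C', GrandMorrey.IsWeakType d μ K C' := hK.exists_weakType hX h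
  obtain ⟨C₀, hC₀⟩ := h.grandMorreyNorm_le hd hd0 hθ hp hlam0 hlam1 hA
    (U := GrandMorrey.commutator b (GrandMorrey.pvOperator d μ K))
    (P := fun f => Integrable f μ ∧ Integrable (fun y => b y * f y) μ)
    (fun f q κ M hq hκ hf hM hfM => H.integrable_of_morrey h hbi hc₀ hq hκ hf hM hfM)
    (fun f hf => (hbi.1.mul (hK.aestronglyMeasurable_pv hW hf.1)).sub
      (hK.aestronglyMeasurable_pv hW hf.2))
    (fun q₀ q₁ hq₀ hq₁ =>
      hW.exists_morrey_bound hK hKw h hrev hC₅ hρ hosc hbi hc₀ H hq₀ hq₁ hlam1)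
  exact ⟨C₀, fun f hf => ⟨(hW f (hC₀ f hf).1.1).1, (hW _ (hC₀ f hf).1.2).1, (hC₀ f hf).2⟩⟩
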